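/- Let $k$ be a commutative artinian ring and let $R$ be an artin $k$-algebra, i.e. a $k$-algebra that is finitely generated as a $k$-module. Modules are right modules unless otherwise stated, $\mathrm{mod}\,R$ denotes the finitely generated $R$-modules, and $D=\mathrm{Hom}_k(-,E(k/\mathrm{rad}\,k))$ is the usual duality, where $E(k/\mathrm{rad}\,k)$ is the injective hull. For a module $T$, $\mathrm{add}\,T$ is the class of direct summands of finite direct sums of copies of $T$. A module $T\in\mathrm{mod}\,R$ is *tilting* if it has finite projective dimension, $\mathrm{Ext}_R^i(T,T)=0$ for all $i>0$, and there is an exact sequence $0\to R\to T_0\to\cdots\to T_n\to 0$ with all $T_i\in\mathrm{add}\,T$. It is *cotilting* if it has finite injective dimension, $\mathrm{Ext}_R^i(T,T)=0$ for all $i>0$, and there is an exact sequence $0\to T_n\to\cdots\to T_0\to DR\to 0$ with all $T_i\in\mathrm{add}\,T$. Let $T\in\mathrm{mod}\,R$ and $S=\mathrm{End}(T_R)$. The module $T$ is *Wakamatsu-tilting* if the canonical map from $R$ to the endomorphism ring of ${}_ST$ (right multiplication) is bijective and $\mathrm{Ext}_R^i(T,T)=0=\mathrm{Ext}_S^i(T,T)$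 for all $i>0$. A pair $(\mathcal B,\mathcal A)$ of subcategories of $\mathrm{mod}\,R$ is a *cotorsion pair* if $\mathcal B=\{X\in\mathrm{mod}\,R:\mathrm{Ext}^1_R(X,A)=0\ \forall A\in\mathcal A\}$ and $\mathcal A=\{Y\in\mathrm{mod}\,R:\mathrm{Ext}^1_R(B,Y)=0\ \forall B\in\mathcal B\}$; it is *hereditary* if $\mathcal B$ is resolving (contains the finitely generated projectives and is closed under extensions, kernels of epimorphisms and direct summands), and *complete* if for each $X\in\mathrm{mod}\,R$ there are exact sequences $0\to X\to A\to B\to 0$ and $0\to A'\to B'\to X\to 0$ with $A,A'\in\mathcal A$ and $B,B'\in\mathcal B$. A Wakamatsu-tilting module $T$ is *good* if there are complete hereditary cotorsion pairs $(\mathcal B,\mathcal A)$ in $\mathrm{mod}\,R$ and $(\mathcal G,\mathcal K)$ in $\mathrm{mod}\,S$ such that $\mathrm{Hom}_R(T,-):\mathcal A\rightleftarrows\mathcal G:-\otimes_ST$ and $\mathrm{Hom}_S(DT,-):\mathcal K\rightleftarrows\mathcal B:-\otimes_RDT$ are equivalences. The *repetitive category* of $R$ is the stable category (morphisms modulo those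 that factor through a projective object) of the category of finitely generated modules over the repetitive algebra $\widehat R$. The latter category has as objects the families $(X_i,\delta_i)_{i\in\mathbb Z}$ with $X_i\in\mathrm{mod}\,R$, almost all $X_i=0$, and $R$-linear maps $\delta_i:X_i\to\mathrm{Hom}_R(DR,X_{i-1})$ such that the composite $\mathrm{Hom}_R(DR,\delta_{i-1})\circ\delta_i : X_i\to\mathrm{Hom}_R(DR,\mathrm{Hom}_R(DR,X_{i-2}))$ is zero for all $i$, and as morphisms the families of $R$-linear maps $X_i\to Y_i$ compatible with the $\delta_i$. Two artin $k$-algebras are *repetitive equivalent* if their repetitive categories are equivalent. **Theorem.** Let $T_R$ be a tilting module (of finite projective dimension) or a cotilting module (of finite injective dimension), and let $S=\mathrm{End}(T_R)$. Then $T$ is a good Wakamatsu-tilting module, and $R$ and $S$ are repetitive equivalent. -/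

import Mathlib

open CategoryTheory

universe u

/-! Right modules over `R` are modules over `Rᵐᵒᵖ`; an `S`-`R`-bimodule is an abelian group with
commuting structures of `S`-module and `Rᵐᵒᵖ`-module. -/

section InjectiveHull

/-- `ι : N → E` is an injective hull: `E` is injective, `ι` is injective and its image is an
essential submodule of `E`. -/
structure IsInjectiveHull {k N E : Type u} [Ring k] [AddCommGroup N] [Module k N]
    [AddCommGroup E] [Module k E] (ι : N →ₗ[k] E) : Prop where
  injective : Function.Injective ι
  injective_module : Module.Injective k E
  essential : ∀ U : Submodule k E, U ⊓ LinearMap.range ι = ⊥ → U = ⊥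

theorem exists_isInjectiveHull (k N : Type u) [Ring k] [AddCommGroup N] [Module k N] :
    ∃ (E : ModuleCat.{u} k) (ι : N →ₗ[k] E), IsInjectiveHull ι := by
  obtain ⟨I, _, j, hj⟩ : ∃ (I : ModuleCat.{u} k) (_ : Module.Injective k I) (j : N →ₗ[k] I),
      Function.Injective j := by
    obtain ⟨J, _, f, _⟩ := (EnoughInjectives.presentation (ModuleCat.of k N)).some
    exact ⟨J, Module.injective_module_of_injective_object k J, f.hom,
      (ModuleCat.mono_iff_injective f).1 inferInstance⟩
  set S := LinearMap.range j with hS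
  let Ess : Set (Submodule k I) := {U | S ≤ U ∧ ∀ W ≤ U, W ⊓ S = ⊥ → W = ⊥}
  have hSE : S ∈ Ess := ⟨le_rfl, fun W hW h => by rwa [inf_eq_left.2 hW] at h⟩
  obtain ⟨E, -, hE⟩ := zorn_le_nonempty₀ Ess (fun c hc hch U hU => by
    refine ⟨sSup c, ⟨(hc hU).1.trans (le_sSup hU), fun W hW h => ?_⟩, fun V hV => le_sSup hV⟩
    rw [eq_bot_iff]
    intro w hw
    obtain ⟨V, hV, hwV⟩ := (Submodule.mem_sSup_of_directed ⟨U, hU⟩ hch.directedOn).1 (hW hw)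
    have h1 : Submodule.span k {w} = ⊥ := (hc hV).2 _
      (by simpa using hwV)
      (by
        rw [eq_bot_iff, ← h]
        exact inf_le_inf_right _ (by simpa using hw))
    simpa using h1) S hSE
  obtain ⟨C, -, hC⟩ := zorn_le_nonempty₀ {C : Submodule k I | E ⊓ C = ⊥}
    (fun c hc hch U hU => by
      refine ⟨sSup c, ?_, fun V hV => le_sSup hV⟩
      change E ⊓ sSup c = ⊥
      rw [eq_bot_iff]
      rintro w ⟨hwE, hw⟩
      obtain ⟨V, hV, hwV⟩ := (Submodule.mem_sSup_of_directed ⟨U, hU⟩ hch.directedOn).1 hw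
      have h1 : E ⊓ V = ⊥ := hc hV
      rw [← h1]
      exact ⟨hwE, hwV⟩) ⊥ (by simp)
  have hEC : E ⊓ C = ⊥ := hC.prop
  have hgi : Function.Injective (C.mkQ ∘ₗ E.subtype) := by
    rw [← LinearMap.ker_eq_bot, eq_bot_iff]
    rintro ⟨x, hx⟩ h
    have h2 : x ∈ C := by simpa using h
    have h3 : x ∈ E ⊓ C := ⟨hx, h2⟩
    rw [hEC] at h3
    simpa using h3
  obtain ⟨h, hh⟩ := Module.Injective.extension_property k I E (I ⧸ C)
    (C.mkQ ∘ₗ E.subtype) hgi E.subtype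
  have hh' : ∀ x ∈ E, h (C.mkQ x) = x := fun x hx => LinearMap.congr_fun hh ⟨x, hx⟩
  have hEr : E ≤ LinearMap.range h := fun x hx => ⟨C.mkQ x, hh' x hx⟩
  have hmem : LinearMap.range h ∈ Ess := by
    refine ⟨hE.prop.1.trans hEr, fun W hW hWS => ?_⟩
    have hWE : W ⊓ E = ⊥ := hE.prop.2 _ inf_le_right (by
      rw [eq_bot_iff, ← hWS]
      exact inf_le_inf_right _ inf_le_left)
    have h1 : W.comap (h ∘ₗ C.mkQ) ≤ C := by
      refine hC.le_of_ge (y := W.comap (h ∘ₗ C.mkQ)) ?_ ?_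
      · change E ⊓ _ = ⊥
        rw [eq_bot_iff, ← hWE]
        rintro x ⟨hx, hx'⟩
        have h4 : h (C.mkQ x) ∈ W := hx'
        rw [hh' x hx] at h4
        exact ⟨h4, hx⟩
      · intro x hx
        have h5 : C.mkQ x = 0 := by simpa using hx
        change h (C.mkQ x) ∈ W
        rw [h5, map_zero]
        exact W.zero_mem
    rw [eq_bot_iff]
    intro w hw
    obtain ⟨y, rfl⟩ := hW hw
    obtain ⟨x, rfl⟩ := C.mkQ_surjective y
    have h6 : x ∈ C := h1 hw
    have h5 : C.mkQ x = 0 := by simpa using h6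
    simp [h5]
  have hrE : LinearMap.range h ≤ E := hE.le_of_ge hmem hEr
  have hSrange : ∀ x, j x ∈ E := fun x => hE.prop.1 ⟨x, rfl⟩
  refine ⟨ModuleCat.of k E, j.codRestrict E hSrange, ⟨?_, ⟨?_⟩, ?_⟩⟩
  · intro x y hxy
    exact hj (congrArg Subtype.val hxy)
  · intro X Y _ _ _ _ f hf g
    obtain ⟨φ, hφ⟩ := Module.Injective.extension_property k I _ _ f hf
      (E.subtype ∘ₗ g)
    refine ⟨(h ∘ₗ C.mkQ ∘ₗ φ).codRestrict E (fun y => hrE ⟨_, rfl⟩), fun x => ?_⟩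
    apply Subtype.ext
    have h7 : φ (f x) = (g x : I) := LinearMap.congr_fun hφ x
    change h (C.mkQ (φ (f x))) = (g x : I)
    rw [h7]
    exact hh' _ (g x).2
  · intro U hU
    have h8 : U.map E.subtype = ⊥ := hE.prop.2 _ (Submodule.map_subtype_le E U) (by
      rw [eq_bot_iff]
      rintro _ ⟨⟨x, hx, rfl⟩, ⟨y, hy⟩⟩
      have h9 : x ∈ U ⊓ LinearMap.range (j.codRestrict E hSrange) :=
        ⟨hx, y, Subtype.ext hy⟩
      rw [hU] at h9
      have h10 : x = 0 := by simpa using h9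
      simp [h10])
    exact Submodule.map_injective_of_injective E.injective_subtype (by rw [h8, Submodule.map_bot])

/-- The injective hull of `k / rad k`. -/
noncomputable def dualizingModule (k : Type u) [CommRing k] : ModuleCat.{u} k :=
  Classical.choose (exists_isInjectiveHull k (k ⧸ Ring.jacobson k))

end InjectiveHull

section Duality

/-- The usual duality `D = Hom_k(-, E(k / rad k))` over an artin `k`-algebra. -/
def DualModule (k M : Type u) [CommRing k] [AddCommGroup M] [Module k M] : Type u :=
  M →ₗ[k] dualizingModule k

variable {k M A : Type u} [CommRing k] [AddCommGroup M] [Module k M] [Ring A]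

noncomputable instance : AddCommGroup (DualModule k M) :=
  inferInstanceAs (AddCommGroup (M →ₗ[k] dualizingModule k))

/-- The dual of a left `A`-module is a right `A`-module: `(f a)(m) = f (a m)`. -/
noncomputable instance [Module A M] [SMulCommClass A k M] : Module Aᵐᵒᵖ (DualModule k M) where
  smul a f := LinearMap.comp (R₂ := k) f (DistribSMul.toLinearMap k M a.unop)
  one_smul := fun (f : M →ₗ[k] dualizingModule k) => LinearMap.ext fun m => congrArg f (one_smul A m)
  mul_smul a b := fun (f : M →ₗ[k] dualizingModule k) => LinearMap.ext fun m => congrArg f (mul_smul b.unop a.unop m)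
  smul_zero _ := rfl
  smul_add _ _ _ := rfl
  add_smul a b := fun (f : M →ₗ[k] dualizingModule k) => LinearMap.ext fun m =>
    (congrArg f (add_smul a.unop b.unop m)).trans (LinearMap.map_add f _ _)
  zero_smul := fun (f : M →ₗ[k] dualizingModule k) => LinearMap.ext fun m =>
    (congrArg f (zero_smul A m)).trans (LinearMap.map_zero f)

/-- The dual of a right `A`-module is a left `A`-module: `(a f)(m) = f (m a)`. -/
noncomputable instance [Module Aᵐᵒᵖ M] [SMulCommClass Aᵐᵒᵖ k M] : Module A (DualModule k M) where
  smul a f := LinearMap.comp (R₂ := k) f (DistribSMul.toLinearMap k M (MulOpposite.op a))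
  one_smul := fun (f : M →ₗ[k] dualizingModule k) => LinearMap.ext fun m => congrArg f (one_smul Aᵐᵒᵖ m)
  mul_smul a b := fun (f : M →ₗ[k] dualizingModule k) => LinearMap.ext fun m =>
    congrArg f (mul_smul (MulOpposite.op b) (MulOpposite.op a) m)
  smul_zero _ := rfl
  smul_add _ _ _ := rfl
  add_smul a b := fun (f : M →ₗ[k] dualizingModule k) => LinearMap.ext fun m =>
    (congrArg f (add_smul (MulOpposite.op a) (MulOpposite.op b) m)).trans (LinearMap.map_add f _ _)
  zero_smul := fun (f : M →ₗ[k] dualizingModule k) => LinearMap.ext fun m =>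
    (congrArg f (zero_smul Aᵐᵒᵖ m)).trans (LinearMap.map_zero f)

/-- The dual of an `S`-`R`-bimodule is an `R`-`S`-bimodule. -/
instance {S R : Type u} [Ring S] [Ring R] [Module S M] [Module Rᵐᵒᵖ M] [SMulCommClass S k M]
    [SMulCommClass Rᵐᵒᵖ k M] [SMulCommClass S Rᵐᵒᵖ M] :
    SMulCommClass R Sᵐᵒᵖ (DualModule k M) where
  smul_comm r s := fun (f : M →ₗ[k] dualizingModule k) => LinearMap.ext fun m =>
    congrArg f (smul_comm s.unop (MulOpposite.op r) m)

end Duality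

section HomTensor

variable (S R V : Type u) [Ring S] [Ring R] [AddCommGroup V] [Module S V] [Module Rᵐᵒᵖ V]
  [SMulCommClass S Rᵐᵒᵖ V]

/-- `Hom_R(V, X)` for right `R`-modules `V` and `X`. -/
def RightHom (X : Type u) [AddCommGroup X] [Module Rᵐᵒᵖ X] : Type u := V →ₗ[Rᵐᵒᵖ] X

instance (X : Type u) [AddCommGroup X] [Module Rᵐᵒᵖ X] : AddCommGroup (RightHom R V X) :=
  inferInstanceAs (AddCommGroup (V →ₗ[Rᵐᵒᵖ] X))

/-- If `V` is an `S`-`R`-bimodule, then `Hom_R(V, X)` is a right `S`-module: `(f s)(v) = f (s v)`. -/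
instance (X : Type u) [AddCommGroup X] [Module Rᵐᵒᵖ X] : Module Sᵐᵒᵖ (RightHom R V X) where
  smul s f := LinearMap.comp (R₂ := Rᵐᵒᵖ) f (DistribSMul.toLinearMap Rᵐᵒᵖ V s.unop)
  one_smul := fun (f : V →ₗ[Rᵐᵒᵖ] X) => LinearMap.ext fun v => congrArg f (one_smul S v)
  mul_smul a b := fun (f : V →ₗ[Rᵐᵒᵖ] X) => LinearMap.ext fun v => congrArg f (mul_smul b.unop a.unop v)
  smul_zero _ := rfl
  smul_add _ _ _ := rfl
  add_smul a b := fun (f : V →ₗ[Rᵐᵒᵖ] X) => LinearMap.ext fun v =>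
    (congrArg f (add_smul a.unop b.unop v)).trans (LinearMap.map_add f _ _)
  zero_smul := fun (f : V →ₗ[Rᵐᵒᵖ] X) => LinearMap.ext fun v =>
    (congrArg f (zero_smul S v)).trans (LinearMap.map_zero f)

/-- The functor `Hom_R(V, -)` from right `R`-modules to right `S`-modules. -/
def rightHomFunctor : ModuleCat.{u} Rᵐᵒᵖ ⥤ ModuleCat.{u} Sᵐᵒᵖ where
  obj X := ModuleCat.of Sᵐᵒᵖ (RightHom R V X)
  map {X Y} g := ModuleCat.ofHom (X := RightHom R V X) (Y := RightHom R V Y)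
    { toFun := fun f : RightHom R V X =>
        (LinearMap.comp (R₂ := Rᵐᵒᵖ) g.hom f : RightHom R V Y)
      map_add' := fun f f' => LinearMap.comp_add (R₂ := Rᵐᵒᵖ) f f' g.hom
      map_smul' := fun _ _ => rfl }
  map_id _ := rfl
  map_comp _ _ := rfl

open scoped TensorProduct

/-- The relations `x s ⊗ v = x ⊗ s v` in the tensor product over `ℤ`. -/
def balancedRelations (X : Type u) [AddCommGroup X] [Module Sᵐᵒᵖ X] : AddSubgroup (X ⊗[ℤ] V) :=
  AddSubgroup.closure
    {t | ∃ (x : X) (s : S) (v : V), t = (MulOpposite.op s • x) ⊗ₜ[ℤ] v - x ⊗ₜ[ℤ] (s • v)}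

/-- The tensor product `X ⊗_S V` of a right `S`-module `X` and a left `S`-module `V`. -/
def BalancedTensor (X : Type u) [AddCommGroup X] [Module Sᵐᵒᵖ X] : Type u :=
  (X ⊗[ℤ] V) ⧸ balancedRelations S V X

noncomputable instance (X : Type u) [AddCommGroup X] [Module Sᵐᵒᵖ X] :
    AddCommGroup (BalancedTensor S V X) :=
  inferInstanceAs (AddCommGroup ((X ⊗[ℤ] V) ⧸ balancedRelations S V X))

variable {S V} in
/-- The class of `x ⊗ v` in `X ⊗_S V`. -/
def BalancedTensor.tmul {X : Type u} [AddCommGroup X] [Module Sᵐᵒᵖ X] (x : X) (v : V) :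
    BalancedTensor S V X :=
  QuotientAddGroup.mk' (balancedRelations S V X) (x ⊗ₜ[ℤ] v)

variable {S V} in
theorem BalancedTensor.hom_ext {X : Type u} [AddCommGroup X] [Module Sᵐᵒᵖ X] {A : Type*}
    [AddCommGroup A] {f g : BalancedTensor S V X →+ A}
    (h : ∀ x v, f (tmul x v) = g (tmul x v)) : f = g := by
  refine QuotientAddGroup.addMonoidHom_ext _ (AddMonoidHom.ext fun t => ?_)
  induction t using TensorProduct.induction_on with
  | zero => simp
  | tmul x v => exact h x v
  | add a b ha hb => rw [map_add, map_add, ha, hb]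

variable {S V} in
/-- The map `g ⊗ h : X ⊗_S V → Y ⊗_S V`. -/
noncomputable def BalancedTensor.map {X Y : Type u} [AddCommGroup X] [Module Sᵐᵒᵖ X]
    [AddCommGroup Y] [Module Sᵐᵒᵖ Y] (g : X →ₗ[Sᵐᵒᵖ] Y) (h : V →ₗ[S] V) :
    BalancedTensor S V X →+ BalancedTensor S V Y :=
  QuotientAddGroup.map (balancedRelations S V X) (balancedRelations S V Y)
    (TensorProduct.map (g.toAddMonoidHom.toIntLinearMap)
      (h.toAddMonoidHom.toIntLinearMap)).toAddMonoidHom (by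
    rw [balancedRelations, AddSubgroup.closure_le]
    rintro _ ⟨x, s, v, rfl⟩
    refine AddSubgroup.subset_closure ⟨g x, s, h v, ?_⟩
    simp)

variable {S V} in
theorem BalancedTensor.map_tmul {X Y : Type u} [AddCommGroup X] [Module Sᵐᵒᵖ X]
    [AddCommGroup Y] [Module Sᵐᵒᵖ Y] (g : X →ₗ[Sᵐᵒᵖ] Y) (h : V →ₗ[S] V) (x : X) (v : V) :
    map g h (tmul x v) = tmul (g x) (h v) := rfl

variable {S V} in
theorem BalancedTensor.tmul_add {X : Type u} [AddCommGroup X] [Module Sᵐᵒᵖ X] (x : X) (v w : V) :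
    tmul (S := S) x (v + w) = tmul x v + tmul x w := by
  rw [tmul, TensorProduct.tmul_add, map_add]
  rfl

variable {S V} in
theorem BalancedTensor.tmul_zero {X : Type u} [AddCommGroup X] [Module Sᵐᵒᵖ X] (x : X) :
    tmul (S := S) x (0 : V) = 0 := by
  rw [tmul, TensorProduct.tmul_zero, map_zero]
  rfl

/-- Right multiplication by `r` on an `S`-`R`-bimodule, as an `S`-linear map. -/
def rightMulHom (r : Rᵐᵒᵖ) : V →ₗ[S] V where
  toFun v := r • v
  map_add' := smul_add r
  map_smul' s v := (smul_comm s r v).symm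

/-- If `V` is an `S`-`R`-bimodule, then `X ⊗_S V` is a right `R`-module: `(x ⊗ v) r = x ⊗ v r`. -/
noncomputable instance (X : Type u) [AddCommGroup X] [Module Sᵐᵒᵖ X] :
    Module Rᵐᵒᵖ (BalancedTensor S V X) where
  smul r t := BalancedTensor.map LinearMap.id (rightMulHom S R V r) t
  one_smul := DFunLike.congr_fun (f := BalancedTensor.map LinearMap.id (rightMulHom S R V 1))
    (g := AddMonoidHom.id _) (BalancedTensor.hom_ext fun x v =>
      congrArg (BalancedTensor.tmul x) (one_smul Rᵐᵒᵖ v))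
  mul_smul a b := DFunLike.congr_fun
    (f := BalancedTensor.map LinearMap.id (rightMulHom S R V (a * b)))
    (g := (BalancedTensor.map LinearMap.id (rightMulHom S R V a)).comp
      (BalancedTensor.map LinearMap.id (rightMulHom S R V b)))
    (BalancedTensor.hom_ext fun x v => congrArg (BalancedTensor.tmul x) (mul_smul a b v))
  smul_zero _ := map_zero _
  smul_add _ := map_add _
  add_smul a b := DFunLike.congr_fun
    (f := BalancedTensor.map LinearMap.id (rightMulHom S R V (a + b)))
    (g := BalancedTensor.map LinearMap.id (rightMulHom S R V a) +
      BalancedTensor.map LinearMap.id (rightMulHom S R V b))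
    (BalancedTensor.hom_ext fun x v =>
      (congrArg (BalancedTensor.tmul x) (add_smul a b v)).trans (BalancedTensor.tmul_add _ _ _))
  zero_smul := DFunLike.congr_fun
    (f := BalancedTensor.map LinearMap.id (rightMulHom S R V 0)) (g := 0)
    (BalancedTensor.hom_ext fun x v =>
      (congrArg (BalancedTensor.tmul x) (zero_smul Rᵐᵒᵖ v)).trans (BalancedTensor.tmul_zero _))

/-- The functor `- ⊗_S V` from right `S`-modules to right `R`-modules. -/
noncomputable def balancedTensorFunctor : ModuleCat.{u} Sᵐᵒᵖ ⥤ ModuleCat.{u} Rᵐᵒᵖ where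
  obj X := ModuleCat.of Rᵐᵒᵖ (BalancedTensor S V X)
  map {X Y} g := ModuleCat.ofHom (X := BalancedTensor S V X) (Y := BalancedTensor S V Y)
    { toFun := BalancedTensor.map g.hom LinearMap.id
      map_add' := map_add _
      map_smul' := fun r => DFunLike.congr_fun
        (f := (BalancedTensor.map g.hom LinearMap.id).comp
          (BalancedTensor.map LinearMap.id (rightMulHom S R V r)))
        (g := (BalancedTensor.map LinearMap.id (rightMulHom S R V r)).comp
          (BalancedTensor.map g.hom LinearMap.id))
        (BalancedTensor.hom_ext fun _ _ => rfl) }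
  map_id X := ModuleCat.hom_ext (LinearMap.ext (DFunLike.congr_fun
    (f := BalancedTensor.map (LinearMap.id : X →ₗ[Sᵐᵒᵖ] X) (LinearMap.id : V →ₗ[S] V))
    (g := AddMonoidHom.id _) (BalancedTensor.hom_ext fun _ _ => rfl)))
  map_comp f g := ModuleCat.hom_ext (LinearMap.ext (DFunLike.congr_fun
    (f := BalancedTensor.map (g.hom ∘ₗ f.hom) (LinearMap.id : V →ₗ[S] V))
    (g := (BalancedTensor.map g.hom LinearMap.id).comp (BalancedTensor.map f.hom LinearMap.id))
    (BalancedTensor.hom_ext fun _ _ => rfl)))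

/-- The functors `Hom_R(V, -)` and `- ⊗_S V` give an equivalence between the full subcategories
`𝒜` of right `R`-modules and `𝒢` of right `S`-modules. -/
def InducesEquivalence (𝒜 : ObjectProperty (ModuleCat.{u} Rᵐᵒᵖ))
    (𝒢 : ObjectProperty (ModuleCat.{u} Sᵐᵒᵖ)) : Prop :=
  ∃ e : 𝒜.FullSubcategory ≌ 𝒢.FullSubcategory,
    Nonempty (e.functor ⋙ 𝒢.ι ≅ 𝒜.ι ⋙ rightHomFunctor S R V) ∧
    Nonempty (e.inverse ⋙ 𝒜.ι ≅ 𝒢.ι ⋙ balancedTensorFunctor S R V)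

end HomTensor

section Cotorsion

variable {Λ : Type u} [Ring Λ]

/-- `(ℬ, 𝒜)` is a cotorsion pair in the category of finitely generated modules:
`ℬ = Ker Ext¹(-, 𝒜)` and `𝒜 = Ker Ext¹(ℬ, -)`. -/
def IsCotorsionPair (ℬ 𝒜 : ObjectProperty (ModuleCat.{u} Λ)) : Prop :=
  (∀ X, ℬ X ↔ Module.Finite Λ X ∧ ∀ Y, 𝒜 Y → Subsingleton (Abelian.Ext X Y 1)) ∧
  (∀ Y, 𝒜 Y ↔ Module.Finite Λ Y ∧ ∀ X, ℬ X → Subsingleton (Abelian.Ext X Y 1))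

/-- A resolving subcategory of the category of finitely generated modules: it contains the
projectives and is closed under extensions, kernels of epimorphisms and direct summands. -/
structure IsResolving (ℬ : ObjectProperty (ModuleCat.{u} Λ)) : Prop where
  finite : ∀ X, ℬ X → Module.Finite Λ X
  projective : ∀ X : ModuleCat.{u} Λ, Module.Finite Λ X → Module.Projective Λ X → ℬ X
  extension : ∀ E : ShortComplex (ModuleCat.{u} Λ), E.ShortExact → ℬ E.X₁ → ℬ E.X₃ → ℬ E.X₂
  kernel : ∀ E : ShortComplex (ModuleCat.{u} Λ), E.ShortExact → Module.Finite Λ E.X₁ →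
    ℬ E.X₂ → ℬ E.X₃ → ℬ E.X₁
  summand : ∀ X Y : ModuleCat.{u} Λ, Nonempty (Retract X Y) → ℬ Y → ℬ X

/-- For each finitely generated `X` there are exact sequences `0 → X → A → B → 0` and
`0 → A' → B' → X → 0` with `A`, `A'` in `𝒜` and `B`, `B'` in `ℬ`. -/
def IsCompletePair (ℬ 𝒜 : ObjectProperty (ModuleCat.{u} Λ)) : Prop :=
  ∀ X : ModuleCat.{u} Λ, Module.Finite Λ X →
    (∃ E : ShortComplex (ModuleCat.{u} Λ), E.ShortExact ∧ E.X₁ = X ∧ 𝒜 E.X₂ ∧ ℬ E.X₃) ∧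
    (∃ E : ShortComplex (ModuleCat.{u} Λ), E.ShortExact ∧ 𝒜 E.X₁ ∧ ℬ E.X₂ ∧ E.X₃ = X)

/-- Complete hereditary cotorsion pairs of finitely generated modules. -/
structure IsCompleteHereditaryCotorsionPair (ℬ 𝒜 : ObjectProperty (ModuleCat.{u} Λ)) : Prop where
  isCotorsionPair : IsCotorsionPair ℬ 𝒜
  hereditary : IsResolving ℬ
  complete : IsCompletePair ℬ 𝒜

end Cotorsion

section CounterEquivalence

/-- The bimodules `_S V_R` and `_R W_S` represent a counter equivalence between the pairs
`(ℬ, 𝒜)` of classes of right `R`-modules and `(𝒢, 𝒦)` of classes of right `S`-modules: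
`Hom_R(V, -) : 𝒜 ⇄ 𝒢 : - ⊗_S V` and `Hom_S(W, -) : 𝒦 ⇄ ℬ : - ⊗_R W` are equivalences. -/
def RepresentsCounterEquivalence (S R V W : Type u) [Ring S] [Ring R]
    [AddCommGroup V] [Module S V] [Module Rᵐᵒᵖ V] [SMulCommClass S Rᵐᵒᵖ V]
    [AddCommGroup W] [Module R W] [Module Sᵐᵒᵖ W] [SMulCommClass R Sᵐᵒᵖ W]
    (ℬ 𝒜 : ObjectProperty (ModuleCat.{u} Rᵐᵒᵖ)) (𝒢 𝒦 : ObjectProperty (ModuleCat.{u} Sᵐᵒᵖ)) :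
    Prop :=
  InducesEquivalence S R V 𝒜 𝒢 ∧ InducesEquivalence R S W 𝒦 ℬ

end CounterEquivalence

section Tilting

/-- `X ∈ add T`: `X` is a direct summand of a finite direct sum of copies of `T`. -/
def IsInAdd {Λ : Type u} [Ring Λ] (T X : ModuleCat.{u} Λ) : Prop :=
  ∃ (n : ℕ) (i : X →ₗ[Λ] (Fin n → T)) (p : (Fin n → T) →ₗ[Λ] X), p ∘ₗ i = LinearMap.id

/-- There is an exact sequence `0 → X → T_0 → ⋯ → T_n → 0` with all `T_i ∈ add T`
(written as a sequence indexed by `ℕ` that vanishes beyond `n`). -/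
def HasFiniteAddCoresolution {Λ : Type u} [Ring Λ] (T X : ModuleCat.{u} Λ) : Prop :=
  ∃ (n : ℕ) (C : ℕ → ModuleCat.{u} Λ) (ε : X →ₗ[Λ] C 0) (d : ∀ i, C i →ₗ[Λ] C (i + 1)),
    Function.Injective ε ∧ Function.Exact ε (d 0) ∧ (∀ i, Function.Exact (d i) (d (i + 1))) ∧
    (∀ i, IsInAdd T (C i)) ∧ ∀ i, n < i → Subsingleton (C i)

/-- There is an exact sequence `0 → T_n → ⋯ → T_0 → X → 0` with all `T_i ∈ add T`
(written as a sequence indexed by `ℕ` that vanishes beyond `n`). -/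
def HasFiniteAddResolution {Λ : Type u} [Ring Λ] (T X : ModuleCat.{u} Λ) : Prop :=
  ∃ (n : ℕ) (C : ℕ → ModuleCat.{u} Λ) (π : C 0 →ₗ[Λ] X) (d : ∀ i, C (i + 1) →ₗ[Λ] C i),
    Function.Surjective π ∧ Function.Exact (d 0) π ∧ (∀ i, Function.Exact (d (i + 1)) (d i)) ∧
    (∀ i, IsInAdd T (C i)) ∧ ∀ i, n < i → Subsingleton (C i)

/-- Tilting right modules of finite projective dimension. -/
structure IsTiltingModule (R T : Type u) [Ring R] [AddCommGroup T] [Module Rᵐᵒᵖ T] : Prop where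
  finite : Module.Finite Rᵐᵒᵖ T
  projectiveDimension : ∃ n, HasProjectiveDimensionLE (ModuleCat.of Rᵐᵒᵖ T) n
  ext_eq_zero : ∀ i : ℕ, 0 < i →
    Subsingleton (Abelian.Ext (ModuleCat.of Rᵐᵒᵖ T) (ModuleCat.of Rᵐᵒᵖ T) i)
  coresolution : HasFiniteAddCoresolution (ModuleCat.of Rᵐᵒᵖ T) (ModuleCat.of Rᵐᵒᵖ R)

/-- Cotilting right modules of finite injective dimension over the `k`-algebra `R`. -/
structure IsCotiltingModule (k R T : Type u) [CommRing k] [Ring R] [Algebra k R]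
    [AddCommGroup T] [Module Rᵐᵒᵖ T] : Prop where
  finite : Module.Finite Rᵐᵒᵖ T
  injectiveDimension : ∃ n, HasInjectiveDimensionLE (ModuleCat.of Rᵐᵒᵖ T) n
  ext_eq_zero : ∀ i : ℕ, 0 < i →
    Subsingleton (Abelian.Ext (ModuleCat.of Rᵐᵒᵖ T) (ModuleCat.of Rᵐᵒᵖ T) i)
  resolution : HasFiniteAddResolution (ModuleCat.of Rᵐᵒᵖ T) (ModuleCat.of Rᵐᵒᵖ (DualModule k R))

/-- Wakamatsu-tilting right modules: with `S = End(T_R)` acting on `T` from the left, the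
canonical map from `R` (acting from the right) to the endomorphisms of `_S T` is bijective, and
`Ext_R^i(T, T) = 0 = Ext_S^i(T, T)` for all `i > 0`. -/
structure IsWakamatsuTilting (R T : Type u) [Ring R] [AddCommGroup T] [Module Rᵐᵒᵖ T] :
    Prop where
  finite : Module.Finite Rᵐᵒᵖ T
  balanced : Function.Bijective (rightMulHom (Module.End Rᵐᵒᵖ T) R T)
  ext_right_eq_zero : ∀ i : ℕ, 0 < i →
    Subsingleton (Abelian.Ext (ModuleCat.of Rᵐᵒᵖ T) (ModuleCat.of Rᵐᵒᵖ T) i)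
  ext_left_eq_zero : ∀ i : ℕ, 0 < i →
    Subsingleton (Abelian.Ext (ModuleCat.of (Module.End Rᵐᵒᵖ T) T)
      (ModuleCat.of (Module.End Rᵐᵒᵖ T) T) i)

/-- Good Wakamatsu-tilting modules: with `S = End(T_R)`, the bimodules `_S T_R` and `_R DT_S`
represent a counter equivalence between a complete hereditary cotorsion pair `(ℬ, 𝒜)` in `mod R`
and a complete hereditary cotorsion pair `(𝒢, 𝒦)` in `mod S`. -/
def IsGoodWakamatsuTilting (k R T : Type u) [CommRing k] [Ring R] [Algebra k R]
    [AddCommGroup T] [Module k T] [Module Rᵐᵒᵖ T] [IsScalarTower k Rᵐᵒᵖ T] : Prop :=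
  IsWakamatsuTilting R T ∧
  ∃ (ℬ 𝒜 : ObjectProperty (ModuleCat.{u} Rᵐᵒᵖ))
    (𝒢 𝒦 : ObjectProperty (ModuleCat.{u} (Module.End Rᵐᵒᵖ T)ᵐᵒᵖ)),
    IsCompleteHereditaryCotorsionPair ℬ 𝒜 ∧ IsCompleteHereditaryCotorsionPair 𝒢 𝒦 ∧
    RepresentsCounterEquivalence (Module.End Rᵐᵒᵖ T) R T (DualModule k T) ℬ 𝒜 𝒢 𝒦

end Tilting

section Repetitive

variable (k R : Type u) [CommRing k] [Ring R] [Algebra k R]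

/-- A finitely generated module over the repetitive algebra of `R`, that is, a bounded sequence of
finitely generated right `R`-modules `X i` with maps `δ i : X i → Hom_R(DR, X (i - 1))` such that
consecutive ones compose to zero. -/
structure RepeComplex where
  /-- the terms -/
  X : ℤ → ModuleCat.{u} Rᵐᵒᵖ
  /-- the structure maps -/
  δ : ∀ i, X i ⟶ (rightHomFunctor R R (DualModule k R)).obj (X (i - 1))
  finite : ∀ i, Module.Finite Rᵐᵒᵖ (X i)
  bounded : {i | ¬ Subsingleton (X i)}.Finite
  δ_comp_δ : ∀ i, δ i ≫ (rightHomFunctor R R (DualModule k R)).map (δ (i - 1)) = 0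

namespace RepeComplex

variable {k R}

/-- Morphisms: families of module maps that commute with the structure maps. -/
@[ext]
structure Hom (X Y : RepeComplex k R) where
  /-- the components -/
  f : ∀ i, X.X i ⟶ Y.X i
  comm : ∀ i, X.δ i ≫ (rightHomFunctor R R (DualModule k R)).map (f (i - 1)) = f i ≫ Y.δ i

/-- The category of finitely generated modules over the repetitive algebra. -/
instance : Category (RepeComplex k R) where
  Hom := Hom
  id X := ⟨fun i => 𝟙 (X.X i), fun i => by simp⟩
  comp f g := ⟨fun i => f.f i ≫ g.f i, fun i => by
    rw [Functor.map_comp, ← Category.assoc, f.comm, Category.assoc, g.comm, Category.assoc]⟩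
  id_comp _ := Hom.ext (funext fun _ => Category.id_comp _)
  comp_id _ := Hom.ext (funext fun _ => Category.comp_id _)
  assoc _ _ _ := Hom.ext (funext fun _ => Category.assoc _ _ _)

variable (k R) in
/-- `f` and `g` are identified if `f - g` factors through a projective object. -/
def stableRel : HomRel (RepeComplex k R) := fun X Y f g =>
  ∃ (P : RepeComplex k R) (_ : Projective P) (a : X ⟶ P) (b : P ⟶ Y),
    ∀ i, Hom.f f i - Hom.f g i = Hom.f (a ≫ b) i

end RepeComplex

/-- The repetitive category: the stable category of the category of finitely generated modules
over the repetitive algebra of `R`. -/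
abbrev RepetitiveCategory := CategoryTheory.Quotient (RepeComplex.stableRel k R)

/-- Two `k`-algebras are repetitive equivalent if their repetitive categories are equivalent. -/
def RepetitiveEquivalent (S : Type u) [Ring S] [Algebra k S] : Prop :=
  Nonempty (RepetitiveCategory k R ≌ RepetitiveCategory k S)

end Repetitive

/-! Put V = T and W = DT. The bimodules V and W give two adjoint pairs, G = − ⊗_S V left adjoint to
H = Hom_R(V, −) and F = − ⊗_R W left adjoint to J = Hom_S(W, −), with H(DR) ≅ W and J(DS) ≅ V.
`BimoduleContext` records what is needed of this situation in a form symmetric in the two rings. If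
V is cotilting, H turns the given resolution of DR into one showing that W is tilting over S
(`isTilting_swap`), so only the tilting case has to be treated, together with its mirror image.

Counter equivalence. Let 𝒜 be the modules right orthogonal to V and ℬ the modules of finite
projective dimension left orthogonal to V. The coresolution of R makes every module in 𝒜 a quotient
of a power of V with kernel in 𝒜; dimension shifting and pullbacks then give approximations, so (ℬ,
𝒜) is a complete hereditary cotorsion pair. The functor F sends V to the injective module DS, hence
sends the coresolution of R to a finite injective coresolution of W. It follows that W is
self-orthogonal of finite injective dimension and cogenerates its left orthogonal class 𝒢, which
gives a second such pair (𝒢, 𝒦) over S. Units and counits are invertible on the additive closures of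
V and W, and this spreads along the approximating sequences (`isIso_counit_of_isGeneratedBy`,
`isIso_unit_of_isCogeneratedBy`); Ext vanishing is transported in the same way (`extOrth_map_right`,
`extOrth_map_left`). So H, G and J, F are inverse equivalences on the classes. Left modules over S
are reached by Matlis duality over k.

Repetitive equivalence. Since H is full and faithful on maps out of DR, Hom_R(DR, −) ≅ JH, and
likewise Hom_S(DS, −) ≅ HJ. Modules over the repetitive algebras become sequences X with maps
X_{i+1} → JH X_i and Y with maps Y_{i+1} → HJ Y_i. Write N for the composite JH or HJ. It is full
and faithful on maps out of injectives, and its values on them are projective generators, so the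
sequences with terms I_i ⊕ N I_{i−1} are projective and cover everything.

A `Triple` links X and Y through modules A_i in 𝒜. In type I, X embeds in A with cokernels in ℬ and
Y is a pushout; in type II, Y is a quotient of HA with kernels in 𝒦 and X is a pullback. Every X has
a type I triple and every Y a type II triple. Maps of X extend to triples of type I, maps of Y lift
to triples of type II, and a map of triples that is stably zero on one side is stably zero on the
other. Adding a coinduced summand converts one type into the other, so sending X to the Y of a type
I triple is a full, faithful and dense functor of stable categories
(`nonempty_stableCategory_equivalence`). -/

namespace ExtVanishing

/-! ### Dimension shifting for Ext. -/

open Abelian Limits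

universe w v

variable {C : Type u} [Category.{v} C] [Abelian C] [HasExt.{w} C]

/-- All higher extension groups from `X` to `Y` vanish. -/
def ExtOrth (X Y : C) : Prop := ∀ i : ℕ, 0 < i → Subsingleton (Ext.{w} X Y i)

section Contravariant

variable {E : ShortComplex C} (hE : E.ShortExact) {Y : C}
include hE

lemma subsingleton_ext_X₁ {i : ℕ} (h₂ : Subsingleton (Ext.{w} E.X₂ Y i))
    (h₃ : Subsingleton (Ext.{w} E.X₃ Y (i + 1))) : Subsingleton (Ext.{w} E.X₁ Y i) :=
  subsingleton_of_forall_eq 0 fun x => by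
    obtain ⟨y, rfl⟩ := Ext.contravariant_sequence_exact₁ hE Y x (add_comm 1 i)
      (Subsingleton.elim _ _)
    rw [Subsingleton.elim y 0, Ext.comp_zero]

lemma subsingleton_ext_X₂ {i : ℕ} (h₁ : Subsingleton (Ext.{w} E.X₁ Y i))
    (h₃ : Subsingleton (Ext.{w} E.X₃ Y i)) : Subsingleton (Ext.{w} E.X₂ Y i) :=
  subsingleton_of_forall_eq 0 fun x => by
    obtain ⟨y, rfl⟩ := Ext.contravariant_sequence_exact₂ hE Y x (Subsingleton.elim _ _)
    rw [Subsingleton.elim y 0, Ext.comp_zero]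

lemma subsingleton_ext_X₃ {i : ℕ} (h₁ : Subsingleton (Ext.{w} E.X₁ Y i))
    (h₂ : Subsingleton (Ext.{w} E.X₂ Y (i + 1))) : Subsingleton (Ext.{w} E.X₃ Y (i + 1)) :=
  subsingleton_of_forall_eq 0 fun x => by
    obtain ⟨y, rfl⟩ := Ext.contravariant_sequence_exact₃ hE Y x (Subsingleton.elim _ _)
      (add_comm 1 i)
    rw [Subsingleton.elim y 0, Ext.comp_zero]

lemma exists_extension (h₃ : Subsingleton (Ext.{w} E.X₃ Y 1)) (f : E.X₁ ⟶ Y) :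
    ∃ g : E.X₂ ⟶ Y, E.f ≫ g = f := by
  obtain ⟨y, hy⟩ := Ext.contravariant_sequence_exact₁ hE Y (Ext.mk₀ f) (add_zero 1)
    (Subsingleton.elim _ _)
  obtain ⟨g, rfl⟩ := Ext.homEquiv₀.symm.surjective y
  refine ⟨g, Ext.homEquiv₀.symm.injective ?_⟩
  rw [Ext.homEquiv₀_symm_apply, Ext.homEquiv₀_symm_apply, ← hy, Ext.homEquiv₀_symm_apply,
    Ext.mk₀_comp_mk₀]

/-- Every class in the group is the extension class of `E` pushed out along some map from `E.X₁`. If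
that map extends to `E.X₂`, the pushout is zero. In this way an approximation property can replace
the vanishing of an Ext group at the bottom degree. -/
lemma subsingleton_ext_one_X₃ (h₂ : Subsingleton (Ext.{w} E.X₂ Y 1))
    (h : ∀ f : E.X₁ ⟶ Y, ∃ g : E.X₂ ⟶ Y, E.f ≫ g = f) : Subsingleton (Ext.{w} E.X₃ Y 1) :=
  subsingleton_of_forall_eq 0 fun x => by
    obtain ⟨y, rfl⟩ := Ext.contravariant_sequence_exact₃ hE Y x (Subsingleton.elim _ _)
      (add_zero 1)
    obtain ⟨f, rfl⟩ := Ext.homEquiv₀.symm.surjective y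
    obtain ⟨g, rfl⟩ := h f
    rw [Ext.homEquiv₀_symm_apply, ← Ext.mk₀_comp_mk₀, ← Ext.comp_assoc_of_third_deg_zero,
      hE.extClass_comp, Ext.zero_comp]

lemma ExtOrth.X₁ (h₂ : ExtOrth.{u, w} E.X₂ Y) (h₃ : ExtOrth.{u, w} E.X₃ Y) : ExtOrth.{u, w} E.X₁ Y :=
  fun i hi => subsingleton_ext_X₁ hE (h₂ i hi) (h₃ _ i.succ_pos)

lemma ExtOrth.X₂ (h₁ : ExtOrth.{u, w} E.X₁ Y) (h₃ : ExtOrth.{u, w} E.X₃ Y) : ExtOrth.{u, w} E.X₂ Y :=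
  fun i hi => subsingleton_ext_X₂ hE (h₁ i hi) (h₃ i hi)

lemma ExtOrth.X₃ (h₁ : ExtOrth.{u, w} E.X₁ Y) (h₂ : ExtOrth.{u, w} E.X₂ Y)
    (h : ∀ f : E.X₁ ⟶ Y, ∃ g : E.X₂ ⟶ Y, E.f ≫ g = f) : ExtOrth.{u, w} E.X₃ Y := by
  rintro (_ | _ | i) hi
  · simp at hi
  · exact subsingleton_ext_one_X₃ hE (h₂ 1 one_pos) h
  · exact subsingleton_ext_X₃ hE (h₁ _ i.succ_pos) (h₂ _ (Nat.succ_pos _))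

end Contravariant

section Covariant

variable {E : ShortComplex C} (hE : E.ShortExact) {X : C}
include hE

lemma subsingleton_ext_Y₃ {i : ℕ} (h₂ : Subsingleton (Ext.{w} X E.X₂ i))
    (h₁ : Subsingleton (Ext.{w} X E.X₁ (i + 1))) : Subsingleton (Ext.{w} X E.X₃ i) :=
  subsingleton_of_forall_eq 0 fun x => by
    obtain ⟨y, rfl⟩ := Ext.covariant_sequence_exact₃ X hE x rfl (Subsingleton.elim _ _)
    rw [Subsingleton.elim y 0, Ext.zero_comp]

lemma subsingleton_ext_Y₂ {i : ℕ} (h₁ : Subsingleton (Ext.{w} X E.X₁ i))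
    (h₃ : Subsingleton (Ext.{w} X E.X₃ i)) : Subsingleton (Ext.{w} X E.X₂ i) :=
  subsingleton_of_forall_eq 0 fun x => by
    obtain ⟨y, rfl⟩ := Ext.covariant_sequence_exact₂ X hE x (Subsingleton.elim _ _)
    rw [Subsingleton.elim y 0, Ext.zero_comp]

lemma subsingleton_ext_Y₁ {i : ℕ} (h₃ : Subsingleton (Ext.{w} X E.X₃ i))
    (h₂ : Subsingleton (Ext.{w} X E.X₂ (i + 1))) : Subsingleton (Ext.{w} X E.X₁ (i + 1)) :=
  subsingleton_of_forall_eq 0 fun x => by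
    obtain ⟨y, rfl⟩ := Ext.covariant_sequence_exact₁ X hE x (Subsingleton.elim _ _) rfl
    rw [Subsingleton.elim y 0, Ext.zero_comp]

lemma exists_lifting (h₁ : Subsingleton (Ext.{w} X E.X₁ 1)) (f : X ⟶ E.X₃) :
    ∃ g : X ⟶ E.X₂, g ≫ E.g = f := by
  obtain ⟨y, hy⟩ := Ext.covariant_sequence_exact₃ X hE (Ext.mk₀ f) (zero_add 1)
    (Subsingleton.elim _ _)
  obtain ⟨g, rfl⟩ := Ext.homEquiv₀.symm.surjective y
  refine ⟨g, Ext.homEquiv₀.symm.injective ?_⟩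
  rw [Ext.homEquiv₀_symm_apply, Ext.homEquiv₀_symm_apply, ← hy, Ext.homEquiv₀_symm_apply,
    Ext.mk₀_comp_mk₀]

lemma subsingleton_ext_one_Y₁ (h₂ : Subsingleton (Ext.{w} X E.X₂ 1))
    (h : ∀ f : X ⟶ E.X₃, ∃ g : X ⟶ E.X₂, g ≫ E.g = f) : Subsingleton (Ext.{w} X E.X₁ 1) :=
  subsingleton_of_forall_eq 0 fun x => by
    obtain ⟨y, rfl⟩ := Ext.covariant_sequence_exact₁ X hE x (Subsingleton.elim _ _) (zero_add 1)
    obtain ⟨f, rfl⟩ := Ext.homEquiv₀.symm.surjective y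
    obtain ⟨g, rfl⟩ := h f
    rw [Ext.homEquiv₀_symm_apply, ← Ext.mk₀_comp_mk₀, Ext.comp_assoc_of_second_deg_zero,
      hE.comp_extClass, Ext.comp_zero]

lemma ExtOrth.Y₃ (h₁ : ExtOrth.{u, w} X E.X₁) (h₂ : ExtOrth.{u, w} X E.X₂) : ExtOrth.{u, w} X E.X₃ :=
  fun i hi => subsingleton_ext_Y₃ hE (h₂ i hi) (h₁ _ i.succ_pos)

lemma ExtOrth.Y₂ (h₁ : ExtOrth.{u, w} X E.X₁) (h₃ : ExtOrth.{u, w} X E.X₃) : ExtOrth.{u, w} X E.X₂ :=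
  fun i hi => subsingleton_ext_Y₂ hE (h₁ i hi) (h₃ i hi)

lemma ExtOrth.Y₁ (h₂ : ExtOrth.{u, w} X E.X₂) (h₃ : ExtOrth.{u, w} X E.X₃)
    (h : ∀ f : X ⟶ E.X₃, ∃ g : X ⟶ E.X₂, g ≫ E.g = f) : ExtOrth.{u, w} X E.X₁ := by
  rintro (_ | _ | i) hi
  · simp at hi
  · exact subsingleton_ext_one_Y₁ hE (h₂ 1 one_pos) h
  · exact subsingleton_ext_Y₁ hE (h₃ _ i.succ_pos) (h₂ _ (Nat.succ_pos _))

end Covariant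

lemma subsingleton_ext_of_retract {X X' Y Y' : C} (r : Retract X X') (s : Retract Y Y') {i : ℕ}
    (h : Subsingleton (Ext.{w} X' Y' i)) : Subsingleton (Ext.{w} X Y i) :=
  subsingleton_of_forall_eq 0 fun x => by
    have h1 : ((Ext.mk₀ r.r).comp (x.comp (Ext.mk₀ s.i) (add_zero i)) (zero_add i) :
      Ext.{w} X' Y' i) = 0 := Subsingleton.elim _ _
    calc x = (Ext.mk₀ r.i).comp (((Ext.mk₀ r.r).comp (x.comp (Ext.mk₀ s.i) (add_zero i))
          (zero_add i)).comp (Ext.mk₀ s.r) (add_zero i)) (zero_add i) := by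
          rw [Ext.comp_assoc_of_third_deg_zero, Ext.comp_assoc_of_third_deg_zero,
            Ext.mk₀_comp_mk₀, s.retract, Ext.comp_mk₀_id, Ext.mk₀_comp_mk₀_assoc, r.retract,
            Ext.mk₀_id_comp]
      _ = 0 := by rw [h1, Ext.zero_comp, Ext.comp_zero]

lemma ExtOrth.of_retract {X X' Y Y' : C} (h : ExtOrth.{u, w} X' Y') (r : Retract X X')
    (s : Retract Y Y') : ExtOrth.{u, w} X Y :=
  fun i hi => subsingleton_ext_of_retract r s (h i hi)

lemma ExtOrth.of_iso {X X' Y Y' : C} (h : ExtOrth.{u, w} X' Y') (r : X ≅ X') (s : Y ≅ Y') :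
    ExtOrth.{u, w} X Y :=
  h.of_retract (Retract.ofIso r) (Retract.ofIso s)

lemma extOrth_of_projective (X Y : C) [Projective X] : ExtOrth.{u, w} X Y := by
  rintro (_ | i) hi
  · simp at hi
  · exact Ext.subsingleton_of_projective X Y i

lemma extOrth_of_injective (X Y : C) [Injective Y] : ExtOrth.{u, w} X Y := by
  rintro (_ | i) hi
  · simp at hi
  · exact Ext.subsingleton_of_injective X Y i

/-- A short exact sequence with vanishing extension group makes its middle term retract onto the
outer terms. -/
lemma exists_retracts {E : ShortComplex C} (hE : E.ShortExact)
    (h : Subsingleton (Ext.{w} E.X₃ E.X₁ 1)) :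
    Nonempty (Retract E.X₁ E.X₂) ∧ Nonempty (Retract E.X₃ E.X₂) := by
  obtain ⟨g, hg⟩ := exists_extension hE h (𝟙 _)
  obtain ⟨s, hs⟩ := exists_lifting hE h (𝟙 _)
  exact ⟨⟨⟨E.f, g, hg⟩⟩, ⟨⟨s, E.g, hs⟩⟩⟩

omit [HasExt.{w} C] in
lemma shortExact_of_mono {X Y : C} (f : X ⟶ Y) [Mono f] :
    (ShortComplex.mk f (cokernel.π f) (cokernel.condition f)).ShortExact where
  exact := ShortComplex.exact_cokernel f

omit [HasExt.{w} C] in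
lemma shortExact_of_epi {X Y : C} (f : X ⟶ Y) [Epi f] :
    (ShortComplex.mk (kernel.ι f) f (kernel.condition f)).ShortExact where
  exact := ShortComplex.exact_kernel f

end ExtVanishing

/-! ### Pullbacks and pushouts of short exact sequences. -/

namespace ExtVanishing

open Abelian Limits

universe w v

section Squares

variable {C : Type u} [Category.{v} C] [Abelian C]

lemma shortExact_pullback {E : ShortComplex C} (hE : E.ShortExact) {Z : C} (h : Z ⟶ E.X₃) :
    (ShortComplex.mk (pullback.lift E.f 0 (by simp)) (pullback.snd E.g h)
      (pullback.lift_snd _ _ _)).ShortExact := by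
  have := hE.mono_f
  have := hE.epi_g
  have : Mono (pullback.lift (f := E.g) (g := h) E.f 0 (by simp)) :=
    mono_of_mono_fac (pullback.lift_fst _ _ _)
  refine ShortComplex.ShortExact.mk (ShortComplex.exact_of_f_is_kernel _ ?_)
  refine KernelFork.IsLimit.ofι _ _ (fun k hk => hE.exact.lift (k ≫ pullback.fst _ _) ?_)
    (fun k hk => ?_) (fun k hk m hm => ?_)
  · rw [Category.assoc, pullback.condition, reassoc_of% hk, zero_comp]
  · apply pullback.hom_ext
    · rw [Category.assoc, pullback.lift_fst, hE.exact.lift_f]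
    · rw [Category.assoc, pullback.lift_snd, comp_zero, hk]
  · rw [← cancel_mono E.f, hE.exact.lift_f, ← hm, Category.assoc, pullback.lift_fst]

/-- The kernel of the composite is the part of `Z` lying over `E.X₁`. Together with
`shortExact_pullback` this puts one pullback into two exact sequences, which is the exchange behind
all the approximations. -/
lemma shortExact_pullback_left {E : ShortComplex C} (hE : E.ShortExact) {Z : C} (h : Z ⟶ E.X₂)
    [Epi h] : (ShortComplex.mk (pullback.snd E.f h) (h ≫ E.g)
      (by rw [← pullback.condition_assoc, E.zero, comp_zero])).ShortExact := by
  have := hE.mono_f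
  have := hE.epi_g
  refine ShortComplex.ShortExact.mk (ShortComplex.exact_of_f_is_kernel _ ?_)
    (epi_g := epi_comp _ _)
  refine KernelFork.IsLimit.ofι _ _
    (fun k hk => pullback.lift (hE.exact.lift (k ≫ h) (by rw [Category.assoc, hk])) k
      (hE.exact.lift_f _ _))
    (fun k hk => pullback.lift_snd _ _ _) (fun k hk m hm => ?_)
  rw [← cancel_mono (pullback.snd E.f h), hm, pullback.lift_snd]

lemma shortExact_pushout {E : ShortComplex C} (hE : E.ShortExact) {Z : C} (h : E.X₁ ⟶ Z) :
    (ShortComplex.mk (pushout.inr E.f h) (pushout.desc E.g 0 (by simp))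
      (pushout.inr_desc _ _ _)).ShortExact := by
  have := hE.mono_f
  have := hE.epi_g
  have : Epi (pushout.desc (f := E.f) (g := h) E.g 0 (by simp)) :=
    epi_of_epi_fac (pushout.inl_desc _ _ _)
  refine ShortComplex.ShortExact.mk (ShortComplex.exact_of_g_is_cokernel _ ?_)
  refine CokernelCofork.IsColimit.ofπ _ _ (fun k hk => hE.exact.desc (pushout.inl _ _ ≫ k) ?_)
    (fun k hk => ?_) (fun k hk m hm => ?_)
  · rw [pushout.condition_assoc, hk, comp_zero]
  · apply pushout.hom_ext
    · rw [pushout.inl_desc_assoc, hE.exact.g_desc]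
    · rw [pushout.inr_desc_assoc, zero_comp, hk]
  · rw [← cancel_epi E.g, hE.exact.g_desc, ← hm, pushout.inl_desc_assoc]

lemma shortExact_pushout_right {E : ShortComplex C} (hE : E.ShortExact) {Z : C} (h : E.X₂ ⟶ Z)
    [Mono h] : (ShortComplex.mk (E.f ≫ h) (pushout.inr E.g h)
      (by rw [Category.assoc, ← pushout.condition, E.zero_assoc, zero_comp])).ShortExact := by
  have := hE.mono_f
  have := hE.epi_g
  refine ShortComplex.ShortExact.mk (ShortComplex.exact_of_g_is_cokernel _ ?_)
    (mono_f := mono_comp _ _)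
  refine CokernelCofork.IsColimit.ofπ _ _
    (fun k hk => pushout.desc (hE.exact.desc (h ≫ k) (by rw [← Category.assoc, hk])) k
      (hE.exact.g_desc _ _))
    (fun k hk => pushout.inr_desc _ _ _) (fun k hk m hm => ?_)
  rw [← cancel_epi (pushout.inr E.g h), hm, pushout.inr_desc]

end Squares

/-! ### Spreading invertibility of units and counits, and Ext vanishing, along generating sequences.
-/

section Adjunction

variable {C : Type u} [Category.{v} C] [Abelian C] {D : Type u} [Category.{v} D] [Abelian D]
  {L : D ⥤ C} {G : C ⥤ D} (adj : L ⊣ G)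

-- On these Hom sets `G.map` is precomposition with the counit at `A` followed by the adjunction
-- bijection.
omit [Abelian C] [Abelian D] in
lemma map_bijective_of_isIso_counit {A : C} (h : IsIso (adj.counit.app A)) (M : C) :
    Function.Bijective (G.map : (A ⟶ M) → (G.obj A ⟶ G.obj M)) := by
  have : (G.map : (A ⟶ M) → (G.obj A ⟶ G.obj M)) =
      adj.homEquiv _ _ ∘ fun f => adj.counit.app A ≫ f := by
    funext f
    simp [Adjunction.homEquiv_unit]
  rw [this]
  refine (adj.homEquiv _ _).bijective.comp ⟨fun f g hfg => ?_, fun f =>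
    ⟨inv (adj.counit.app A) ≫ f, by simp⟩⟩
  exact (cancel_epi _).1 hfg

omit [Abelian C] [Abelian D] in
lemma map_bijective_of_isIso_unit {B : D} (h : IsIso (adj.unit.app B)) (N : D) :
    Function.Bijective (L.map : (N ⟶ B) → (L.obj N ⟶ L.obj B)) := by
  have : (L.map : (N ⟶ B) → (L.obj N ⟶ L.obj B)) =
      (adj.homEquiv _ _).symm ∘ fun f => f ≫ adj.unit.app B := by
    funext f
    simp [Adjunction.homEquiv_counit]
  rw [this]
  refine (adj.homEquiv _ _).symm.bijective.comp ⟨fun f g hfg => ?_, fun f =>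
    ⟨f ≫ inv (adj.unit.app B), by simp⟩⟩
  exact (cancel_mono _).1 hfg

lemma ShortExact.map_right {E : ShortComplex C} (hE : E.ShortExact) [G.Additive]
    [PreservesFiniteLimits G] (h : Epi (G.map E.g)) : (E.map G).ShortExact := by
  have := hE.mono_f
  exact ShortComplex.ShortExact.mk (hE.exact.map_of_mono_of_preservesKernel G hE.mono_f inferInstance)
    (mono_f := inferInstanceAs (Mono (G.map E.f))) (epi_g := h)

lemma ShortExact.map_left {E : ShortComplex D} (hE : E.ShortExact) [L.Additive]
    [PreservesFiniteColimits L] (h : Mono (L.map E.f)) : (E.map L).ShortExact := by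
  have := hE.epi_g
  exact ShortComplex.ShortExact.mk (hE.exact.map_of_epi_of_preservesCokernel L hE.epi_g inferInstance)
    (epi_g := inferInstanceAs (Epi (L.map E.g))) (mono_f := h)

omit [Abelian C] [Abelian D] in
include adj in
lemma preservesFiniteLimits_of_adj : PreservesFiniteLimits G := by
  have := adj.rightAdjoint_preservesLimits.{0, 0}
  infer_instance

omit [Abelian C] [Abelian D] in
include adj in
lemma preservesFiniteColimits_of_adj : PreservesFiniteColimits L := by
  have := adj.leftAdjoint_preservesColimits.{0, 0}
  infer_instance

/-- `𝒜` is generated by objects of `𝒯` as far as the functor `G` can see. -/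
def IsGeneratedBy (G : C ⥤ D) (𝒜 𝒯 : ObjectProperty C) : Prop :=
  ∀ A, 𝒜 A → ∃ E : ShortComplex C, E.ShortExact ∧ E.X₃ = A ∧ 𝒯 E.X₂ ∧ 𝒜 E.X₁ ∧ Epi (G.map E.g)

/-- `𝒢` is cogenerated by objects of `𝒯` as far as the functor `L` can see. -/
def IsCogeneratedBy (L : D ⥤ C) (𝒢 𝒯 : ObjectProperty D) : Prop :=
  ∀ Y, 𝒢 Y → ∃ E : ShortComplex D, E.ShortExact ∧ E.X₁ = Y ∧ 𝒯 E.X₂ ∧ 𝒢 E.X₃ ∧ Mono (L.map E.f)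

/-- Naturality along a generating sequence first makes the counit epi on all of `𝒜`, in particular
at the kernel term. The inverse of the counit at the middle term then descends to the quotient; no
exactness of `L` beyond preservation of epimorphisms is used. -/
lemma isIso_counit_of_isGeneratedBy {𝒜 𝒯 : ObjectProperty C} (h : IsGeneratedBy G 𝒜 𝒯)
    (hT : ∀ T, 𝒯 T → IsIso (adj.counit.app T)) (A : C) (hA : 𝒜 A) :
    IsIso (adj.counit.app A) := by
  have hepi : ∀ A, 𝒜 A → Epi (adj.counit.app A) := by
    intro A hA
    obtain ⟨E, hE, rfl, hE2, -, -⟩ := h A hA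
    have := hT _ hE2
    have := hE.epi_g
    have h1 : Epi (L.map (G.map E.g) ≫ adj.counit.app E.X₃) := by
      have h2 := adj.counit.naturality E.g
      simp only [Functor.comp_map, Functor.id_map] at h2
      rw [h2]
      exact epi_comp _ _
    exact epi_of_epi (L.map (G.map E.g)) _
  obtain ⟨E, hE, rfl, hE2, hE1, hg⟩ := h A hA
  have := hT _ hE2
  have := hE.epi_g
  have := hepi _ hE1
  have := preservesFiniteColimits_of_adj adj
  have hLg : Epi (L.map (G.map E.g)) := inferInstance
  have nf := adj.counit.naturality E.f
  have ng := adj.counit.naturality E.g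
  simp only [Functor.comp_map, Functor.id_map] at nf ng
  -- It suffices to test after the epimorphic counit at `E.X₁`, where naturality turns the composite
  -- into the image of `E.f ≫ E.g`.
  have hz : E.f ≫ inv (adj.counit.app E.X₂) ≫ L.map (G.map E.g) = 0 := by
    rw [← cancel_epi (adj.counit.app E.X₁), ← Category.assoc, ← nf, Category.assoc,
      IsIso.hom_inv_id_assoc, ← L.map_comp, ← G.map_comp, E.zero, comp_zero]
    have hGz : G.map (0 : E.X₁ ⟶ E.X₃) = 0 := by
      have := adj.rightAdjoint_preservesLimits.{0, 0}
      exact G.map_zero _ _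
    rw [hGz]
    exact L.map_zero _ _
  have hs := hE.exact.g_desc (inv (adj.counit.app E.X₂) ≫ L.map (G.map E.g)) hz
  refine ⟨hE.exact.desc (inv (adj.counit.app E.X₂) ≫ L.map (G.map E.g)) hz, ?_, ?_⟩
  · rw [← cancel_epi (L.map (G.map E.g)), reassoc_of% ng, hs, IsIso.hom_inv_id_assoc]
    exact (Category.comp_id _).symm
  · rw [← cancel_epi E.g, reassoc_of% hs, ng, IsIso.inv_hom_id_assoc]
    exact (Category.comp_id _).symm

lemma isIso_unit_of_isCogeneratedBy {𝒢 𝒯 : ObjectProperty D} (h : IsCogeneratedBy L 𝒢 𝒯)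
    (hT : ∀ T, 𝒯 T → IsIso (adj.unit.app T)) (Y : D) (hY : 𝒢 Y) :
    IsIso (adj.unit.app Y) := by
  have hmono : ∀ Y, 𝒢 Y → Mono (adj.unit.app Y) := by
    intro Y hY
    obtain ⟨E, hE, rfl, hE2, -, -⟩ := h Y hY
    have := hT _ hE2
    have := hE.mono_f
    have h1 : Mono (adj.unit.app E.X₁ ≫ G.map (L.map E.f)) := by
      have h2 := adj.unit.naturality E.f
      simp only [Functor.comp_map, Functor.id_map] at h2
      rw [← h2]
      exact mono_comp _ _
    exact mono_of_mono _ (G.map (L.map E.f))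
  obtain ⟨E, hE, rfl, hE2, hE3, hf⟩ := h Y hY
  have := hT _ hE2
  have := hE.mono_f
  have := hmono _ hE3
  have := preservesFiniteLimits_of_adj adj
  have hLf : Mono (G.map (L.map E.f)) := inferInstance
  have nf := adj.unit.naturality E.f
  have ng := adj.unit.naturality E.g
  simp only [Functor.comp_map, Functor.id_map] at nf ng
  have hz : (G.map (L.map E.f) ≫ inv (adj.unit.app E.X₂)) ≫ E.g = 0 := by
    rw [← cancel_mono (adj.unit.app E.X₃), Category.assoc, ng, Category.assoc,
      IsIso.inv_hom_id_assoc, ← G.map_comp, ← L.map_comp, E.zero, zero_comp]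
    have hLz : L.map (0 : E.X₁ ⟶ E.X₃) = 0 := by
      have := adj.leftAdjoint_preservesColimits.{0, 0}
      exact L.map_zero _ _
    rw [hLz]
    exact G.map_zero _ _
  have hs := hE.exact.lift_f (G.map (L.map E.f) ≫ inv (adj.unit.app E.X₂)) hz
  refine ⟨hE.exact.lift (G.map (L.map E.f) ≫ inv (adj.unit.app E.X₂)) hz, ?_, ?_⟩
  · rw [← cancel_mono E.f, Category.assoc, hs, ← reassoc_of% nf, IsIso.hom_inv_id]
    exact (Category.comp_id _).trans (Category.id_comp _).symm
  · rw [← cancel_mono (G.map (L.map E.f)), Category.assoc, ← nf, reassoc_of% hs,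
      IsIso.inv_hom_id]
    exact (Category.comp_id _).trans (Category.id_comp _).symm

variable [HasExt.{w} C] [HasExt.{w} D]

-- In degree one, a map from the image of the kernel comes from a map to `I` by full faithfulness
-- and extends because `I` is injective. Higher degrees shift along the generating sequence.
omit [HasExt.{w} C] in
lemma extOrth_map_right [G.Additive] {𝒜 𝒯 : ObjectProperty C} (h : IsGeneratedBy G 𝒜 𝒯)
    (hT : ∀ T, 𝒯 T → IsIso (adj.counit.app T)) (I : C) [Injective I]
    (hTI : ∀ T, 𝒯 T → ExtOrth.{u, w} (G.obj T) (G.obj I)) (A : C) (hA : 𝒜 A) :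
    ExtOrth.{u, w} (G.obj A) (G.obj I) := by
  have := preservesFiniteLimits_of_adj adj
  suffices ∀ i : ℕ, ∀ A, 𝒜 A → Subsingleton (Ext.{w} (G.obj A) (G.obj I) (i + 1)) by
    rintro (_ | i) hi
    · simp at hi
    · exact this i A hA
  intro i
  induction i with
  | zero =>
    intro A hA
    obtain ⟨E, hE, rfl, hE2, hE1, hg⟩ := h A hA
    refine subsingleton_ext_one_X₃ (ShortExact.map_right hE hg) (hTI _ hE2 1 one_pos) fun φ => ?_
    obtain ⟨ψ, rfl⟩ := (map_bijective_of_isIso_counit adj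
      (isIso_counit_of_isGeneratedBy adj h hT _ hE1) I).2 φ
    have := hE.mono_f
    exact ⟨G.map (Injective.factorThru ψ E.f), by
      change G.map E.f ≫ _ = _
      rw [← G.map_comp, Injective.comp_factorThru]⟩
  | succ i ih =>
    intro A hA
    obtain ⟨E, hE, rfl, hE2, hE1, hg⟩ := h A hA
    exact subsingleton_ext_X₃ (ShortExact.map_right hE hg) (ih _ hE1) (hTI _ hE2 _ (by omega))

omit [HasExt.{w} D] in
lemma extOrth_map_left [L.Additive] {𝒢 𝒯 : ObjectProperty D} (h : IsCogeneratedBy L 𝒢 𝒯)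
    (hT : ∀ T, 𝒯 T → IsIso (adj.unit.app T)) (P : D) [Projective P]
    (hPT : ∀ T, 𝒯 T → ExtOrth.{u, w} (L.obj P) (L.obj T)) (Y : D) (hY : 𝒢 Y) :
    ExtOrth.{u, w} (L.obj P) (L.obj Y) := by
  have := preservesFiniteColimits_of_adj adj
  suffices ∀ i : ℕ, ∀ Y, 𝒢 Y → Subsingleton (Ext.{w} (L.obj P) (L.obj Y) (i + 1)) by
    rintro (_ | i) hi
    · simp at hi
    · exact this i Y hY
  intro i
  induction i with
  | zero =>
    intro Y hY
    obtain ⟨E, hE, rfl, hE2, hE3, hf⟩ := h Y hY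
    refine subsingleton_ext_one_Y₁ (ShortExact.map_left hE hf) (hPT _ hE2 1 one_pos) fun φ => ?_
    obtain ⟨ψ, rfl⟩ := (map_bijective_of_isIso_unit adj
      (isIso_unit_of_isCogeneratedBy adj h hT _ hE3) P).2 φ
    have := hE.epi_g
    exact ⟨L.map (Projective.factorThru ψ E.g), by
      change _ ≫ L.map E.g = _
      rw [← L.map_comp, Projective.factorThru_comp]⟩
  | succ i ih =>
    intro Y hY
    obtain ⟨E, hE, rfl, hE2, hE3, hf⟩ := h Y hY
    exact subsingleton_ext_Y₁ (ShortExact.map_left hE hf) (ih _ hE3) (hPT _ hE2 _ (by omega))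

end Adjunction

end ExtVanishing

/-! ### Finitely generated modules. -/

namespace ExtVanishing

open Abelian Limits

section FiniteModules

variable {Λ : Type u} [Ring Λ]

lemma finite_of_epi {X Y : ModuleCat.{u} Λ} (f : X ⟶ Y) [Epi f] (h : Module.Finite Λ X) :
    Module.Finite Λ Y :=
  Module.Finite.of_surjective f.hom ((ModuleCat.epi_iff_surjective f).1 inferInstance)

lemma finite_of_mono [IsNoetherianRing Λ] {X Y : ModuleCat.{u} Λ} (f : X ⟶ Y) [Mono f]
    (h : Module.Finite Λ Y) : Module.Finite Λ X :=
  Module.Finite.of_injective f.hom ((ModuleCat.mono_iff_injective f).1 inferInstance)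

lemma finite_of_retract {X Y : ModuleCat.{u} Λ} (r : Retract X Y) (h : Module.Finite Λ Y) :
    Module.Finite Λ X :=
  have : Epi r.r := (epi_of_epi_fac r.retract)
  finite_of_epi r.r h

lemma finite_X₂ [IsNoetherianRing Λ] {E : ShortComplex (ModuleCat.{u} Λ)} (hE : E.ShortExact)
    (h₁ : Module.Finite Λ E.X₁) (h₃ : Module.Finite Λ E.X₃) : Module.Finite Λ E.X₂ := by
  have h1 := (ShortComplex.ShortExact.moduleCat_exact_iff_function_exact E).1 hE.exact
  have h2 := (ModuleCat.epi_iff_surjective E.g).1 hE.epi_g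
  have : IsNoetherian Λ E.X₂ := isNoetherian_of_range_eq_ker E.f.hom E.g.hom
    (LinearMap.exact_iff.1 h1).symm
  infer_instance

lemma exists_epi_of_finite {X : ModuleCat.{u} Λ} (h : Module.Finite Λ X) :
    ∃ (n : ℕ) (f : ModuleCat.of Λ (Fin n → Λ) ⟶ X), Epi f := by
  obtain ⟨n, f, hf⟩ := Module.Finite.exists_fin' Λ X
  exact ⟨n, ModuleCat.ofHom f, (ModuleCat.epi_iff_surjective _).2 hf⟩

instance (n : ℕ) : Projective (ModuleCat.of Λ (Fin n → Λ)) :=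
  (IsProjective.iff_projective _).1 inferInstance

end FiniteModules

/-! ### Complete hereditary cotorsion pairs from tilting and cotilting classes. -/

section Tilting

variable {Λ : Type u} [Ring Λ]

/-- The finitely generated modules right orthogonal to `V`. -/
def rightPerp (V : ModuleCat.{u} Λ) : ObjectProperty (ModuleCat.{u} Λ) := fun X =>
  Module.Finite Λ X ∧ ExtOrth.{u + 1, u} V X

/-- The finitely generated modules of finite projective dimension left orthogonal to `V`. -/
def leftPerpPD (V : ModuleCat.{u} Λ) : ObjectProperty (ModuleCat.{u} Λ) := fun X =>
  Module.Finite Λ X ∧ ExtOrth.{u + 1, u} X V ∧ ∃ n, HasProjectiveDimensionLT X n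

/-- The finitely generated modules left orthogonal to `W`. -/
def leftPerp (W : ModuleCat.{u} Λ) : ObjectProperty (ModuleCat.{u} Λ) := fun X =>
  Module.Finite Λ X ∧ ExtOrth.{u + 1, u} X W

/-- The finitely generated modules of finite injective dimension right orthogonal to `W`. -/
def rightPerpID (W : ModuleCat.{u} Λ) : ObjectProperty (ModuleCat.{u} Λ) := fun X =>
  Module.Finite Λ X ∧ ExtOrth.{u + 1, u} W X ∧ ∃ n, HasInjectiveDimensionLT X n

/-- The class `𝒯` behaves like the additive closure of the self-orthogonal module `V`. -/
structure IsAdditiveClosure (V : ModuleCat.{u} Λ) (𝒯 : ObjectProperty (ModuleCat.{u} Λ)) :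
    Prop where
  self : ExtOrth.{u + 1, u} V V
  finite : ∀ T, 𝒯 T → Module.Finite Λ T
  right : ∀ T, 𝒯 T → ∀ X, ExtOrth.{u + 1, u} X V → ExtOrth.{u + 1, u} X T
  left : ∀ T, 𝒯 T → ∀ X, ExtOrth.{u + 1, u} V X → ExtOrth.{u + 1, u} T X
  projDim : ∀ n, HasProjectiveDimensionLT V n → ∀ T, 𝒯 T → HasProjectiveDimensionLT T n
  injDim : ∀ n, HasInjectiveDimensionLT V n → ∀ T, 𝒯 T → HasInjectiveDimensionLT T n
  retract : ∀ X T, Nonempty (Retract X T) → 𝒯 T → 𝒯 X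

/-- A self-orthogonal module of finite projective dimension that generates its right orthogonal
class. -/
structure IsTiltingClass (V : ModuleCat.{u} Λ) (𝒯 : ObjectProperty (ModuleCat.{u} Λ)) :
    Prop extends IsAdditiveClosure V 𝒯 where
  pd : ∃ n, HasProjectiveDimensionLT V n
  generates : ∀ A, rightPerp V A → ∃ E : ShortComplex (ModuleCat.{u} Λ),
    E.ShortExact ∧ E.X₃ = A ∧ 𝒯 E.X₂ ∧ rightPerp V E.X₁
  enoughInjectives : ∀ X : ModuleCat.{u} Λ, Module.Finite Λ X →
    ∃ (I : ModuleCat.{u} Λ) (f : X ⟶ I), Mono f ∧ Module.Finite Λ I ∧ Injective I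

/-- A self-orthogonal module of finite injective dimension that cogenerates its left orthogonal
class. -/
structure IsCotiltingClass (W : ModuleCat.{u} Λ) (𝒯 : ObjectProperty (ModuleCat.{u} Λ)) :
    Prop extends IsAdditiveClosure W 𝒯 where
  injd : ∃ n, HasInjectiveDimensionLT W n
  cogenerates : ∀ Y, leftPerp W Y → ∃ E : ShortComplex (ModuleCat.{u} Λ),
    E.ShortExact ∧ E.X₁ = Y ∧ 𝒯 E.X₂ ∧ leftPerp W E.X₃

namespace IsTiltingClass

variable {V : ModuleCat.{u} Λ} {𝒯 : ObjectProperty (ModuleCat.{u} Λ)} (h : IsTiltingClass V 𝒯)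
include h

lemma rightPerp_of_mem {T : ModuleCat.{u} Λ} (hT : 𝒯 T) : rightPerp V T :=
  ⟨h.finite T hT, h.right T hT V h.self⟩

lemma leftPerpPD_of_mem {T : ModuleCat.{u} Λ} (hT : 𝒯 T) : leftPerpPD V T :=
  ⟨h.finite T hT, h.left T hT V h.self, h.pd.imp fun n hn => h.projDim n hn T hT⟩

/-- Replacing `A` by the kernel of a cover from `𝒯` raises the degree by one and stays in the class.
After finitely many steps the degree exceeds the projective dimension of `B`. -/
lemma extOrth {B A : ModuleCat.{u} Λ} (hB : leftPerpPD V B) (hA : rightPerp V A) :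
    ExtOrth.{u + 1, u} B A := by
  obtain ⟨n, hn⟩ := hB.2.2
  suffices ∀ m A, rightPerp V A → ∀ i, 0 < i → n ≤ i + m → Subsingleton (Ext B A i) from
    fun i hi => this n A hA i hi (by omega)
  intro m
  induction m with
  | zero => exact fun A _ i _ hi => HasProjectiveDimensionLT.subsingleton B n i hi A
  | succ m ih =>
    intro A hA i hi him
    obtain ⟨E, hE, rfl, hE2, hE1⟩ := h.generates A hA
    exact subsingleton_ext_Y₃ hE (h.right _ hE2 B hB.2.1 i hi) (ih _ hE1 _ (by omega) (by omega))

omit h in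
lemma leftPerpPD_X₁ [IsNoetherianRing Λ] {E : ShortComplex (ModuleCat.{u} Λ)}
    (hE : E.ShortExact) (h₂ : leftPerpPD V E.X₂) (h₃ : leftPerpPD V E.X₃) :
    leftPerpPD V E.X₁ := by
  have := hE.mono_f
  obtain ⟨n, hn⟩ := h₂.2.2
  obtain ⟨m, hm⟩ := h₃.2.2
  exact ⟨finite_of_mono E.f h₂.1, h₂.2.1.X₁ hE h₃.2.1, max n m,
    hE.hasProjectiveDimensionLT_X₁ _ (hasProjectiveDimensionLT_of_ge _ n _ (by omega))
      (hasProjectiveDimensionLT_of_ge _ m _ (by omega))⟩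

omit h in
lemma leftPerpPD_X₂ [IsNoetherianRing Λ] {E : ShortComplex (ModuleCat.{u} Λ)}
    (hE : E.ShortExact) (h₁ : leftPerpPD V E.X₁) (h₃ : leftPerpPD V E.X₃) :
    leftPerpPD V E.X₂ := by
  obtain ⟨n, hn⟩ := h₁.2.2
  obtain ⟨m, hm⟩ := h₃.2.2
  exact ⟨finite_X₂ hE h₁.1 h₃.1, h₁.2.1.X₂ hE h₃.2.1, max n m,
    hE.hasProjectiveDimensionLT_X₂ _ (hasProjectiveDimensionLT_of_ge _ n _ (by omega))
      (hasProjectiveDimensionLT_of_ge _ m _ (by omega))⟩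

omit h in
lemma leftPerpPD_of_retract {X Y : ModuleCat.{u} Λ} (r : Retract X Y) (hY : leftPerpPD V Y) :
    leftPerpPD V X := by
  obtain ⟨n, hn⟩ := hY.2.2
  exact ⟨finite_of_retract r hY.1, hY.2.1.of_retract r (Retract.refl V), n,
    r.hasProjectiveDimensionLT n⟩

omit h in
lemma rightPerp_of_retract {X Y : ModuleCat.{u} Λ} (r : Retract X Y) (hY : rightPerp V Y) :
    rightPerp V X :=
  ⟨finite_of_retract r hY.1, hY.2.of_retract (Retract.refl V) r⟩

lemma exists_generator {A : ModuleCat.{u} Λ} (hA : rightPerp V A) :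
    ∃ (A' T : ModuleCat.{u} Λ) (f : A' ⟶ T) (g : T ⟶ A) (w : f ≫ g = 0),
      (ShortComplex.mk f g w).ShortExact ∧ 𝒯 T ∧ rightPerp V A' := by
  obtain ⟨E, hE, rfl, hE2, hE1⟩ := h.generates A hA
  exact ⟨_, _, E.f, E.g, E.zero, hE, hE2, hE1⟩

/-- Cover `E.X₂` by some `T` in `𝒯` and let P be the part of `T` over `E.X₁`. Then P maps onto
`E.X₁` with kernel in the right class, and P is the kernel of `T → E.X₃`, hence lies in the left
class. -/
lemma exists_right_approximation [IsNoetherianRing Λ] {E : ShortComplex (ModuleCat.{u} Λ)}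
    (hE : E.ShortExact) (h₂ : rightPerp V E.X₂) (h₃ : leftPerpPD V E.X₃) :
    ∃ (A B : ModuleCat.{u} Λ) (f : A ⟶ B) (g : B ⟶ E.X₁) (w : f ≫ g = 0),
      (ShortComplex.mk f g w).ShortExact ∧ rightPerp V A ∧ leftPerpPD V B := by
  obtain ⟨A', T, f, g, w, hE', hT, hA'⟩ := h.exists_generator h₂
  have : Epi g := hE'.epi_g
  refine ⟨_, _, _, _, _, shortExact_pullback hE' E.f, hA', ?_⟩
  exact leftPerpPD_of_retract (Retract.ofIso (pullbackSymmetry _ _))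
    (leftPerpPD_X₁ (shortExact_pullback_left hE g) (h.leftPerpPD_of_mem hT) h₃)

/-- Induction on the last degree in which Ext from `V` to `X` may survive. Embedding `X` in an
injective lowers this bound for the cokernel; a right approximation of the cokernel, pulled back to
the injective, has a pullback that is an extension of the injective by a module in `rightPerp V`. -/
lemma exists_left_approximation [IsNoetherianRing Λ] (m : ℕ) (X : ModuleCat.{u} Λ)
    (hX : Module.Finite Λ X) (hm : ∀ i, m < i → Subsingleton (Ext V X i)) :
    ∃ (A B : ModuleCat.{u} Λ) (f : X ⟶ A) (g : A ⟶ B) (w : f ≫ g = 0),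
      (ShortComplex.mk f g w).ShortExact ∧ rightPerp V A ∧ leftPerpPD V B := by
  induction m generalizing X with
  | zero =>
    have hz : IsZero (ModuleCat.of Λ PUnit.{u + 1}) := ModuleCat.isZero_of_subsingleton _
    refine ⟨X, ModuleCat.of Λ PUnit.{u + 1}, 𝟙 X, 0, comp_zero, ?_, ⟨hX, hm⟩, ?_⟩
    · have : Epi (0 : X ⟶ ModuleCat.of Λ PUnit.{u + 1}) := ⟨fun _ _ _ => hz.eq_of_src _ _⟩
      exact ShortComplex.ShortExact.mk (ShortComplex.exact_of_f_is_kernel _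
        (KernelFork.IsLimit.ofId _ rfl))
    · have := hz.hasProjectiveDimensionLT_zero
      exact ⟨inferInstance, fun i _ =>
        HasProjectiveDimensionLT.subsingleton _ 0 i (Nat.zero_le _) V, 0, this⟩
  | succ m ih =>
    obtain ⟨I, f, _, hIf, _⟩ := h.enoughInjectives X hX
    have hE := shortExact_of_mono f
    obtain ⟨A₁, B₁, f₁, g₁, w₁, hE₁, hA₁, hB₁⟩ := ih (cokernel f)
      (finite_of_epi (cokernel.π f) hIf) fun i hi => subsingleton_ext_Y₃ hE
        (extOrth_of_injective V I i (by omega)) (hm _ (by omega))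
    obtain ⟨A', B', s, t, w, hE', hA', hB'⟩ := h.exists_right_approximation hE₁ hA₁ hB₁
    refine ⟨_, _, _, _, _, shortExact_pullback hE t, ?_, hB'⟩
    have hQ := shortExact_pullback hE' (cokernel.π f)
    exact rightPerp_of_retract (Retract.ofIso (pullbackSymmetry _ _))
      ⟨finite_X₂ hQ hA'.1 hIf, hA'.2.Y₂ hQ (extOrth_of_injective V I)⟩

lemma isCompletePair [IsNoetherianRing Λ] : IsCompletePair (leftPerpPD V) (rightPerp V) := by
  intro X hX
  obtain ⟨n, hn⟩ := h.pd
  obtain ⟨A, B, f, g, w, hE, hA, hB⟩ := h.exists_left_approximation n X hX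
    fun i hi => HasProjectiveDimensionLT.subsingleton V n i hi.le X
  refine ⟨⟨_, hE, rfl, hA, hB⟩, ?_⟩
  obtain ⟨A', B', f', g', w', hE', hA', hB'⟩ := h.exists_right_approximation hE hA hB
  exact ⟨_, hE', hA', hB', rfl⟩

lemma isCompleteHereditaryCotorsionPair [IsNoetherianRing Λ] :
    IsCompleteHereditaryCotorsionPair (leftPerpPD V) (rightPerp V) where
  isCotorsionPair := by
    refine ⟨fun X => ⟨fun hX => ⟨hX.1, fun Y hY => h.extOrth hX hY 1 one_pos⟩, fun hX => ?_⟩,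
      fun Y => ⟨fun hY => ⟨hY.1, fun X hX => h.extOrth hX hY 1 one_pos⟩, fun hY => ?_⟩⟩
    -- The orthogonality hypothesis splits the approximating sequence, so the module is a summand of
    -- one in the class.
    · obtain ⟨E, hE, hE1, hE2, rfl⟩ := (h.isCompletePair X hX.1).2
      obtain ⟨r⟩ := (exists_retracts hE (hX.2 _ hE1)).2
      exact leftPerpPD_of_retract r hE2
    · obtain ⟨E, hE, rfl, hE2, hE3⟩ := (h.isCompletePair Y hY.1).1
      obtain ⟨r⟩ := (exists_retracts hE (hY.2 _ hE3)).1
      exact rightPerp_of_retract r hE2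
  hereditary :=
    { finite := fun X hX => hX.1
      projective := fun X hX hp => by
        have : Projective X := (IsProjective.iff_projective X).1 hp
        exact ⟨hX, extOrth_of_projective X V, 1, inferInstance⟩
      extension := fun E hE h₁ h₃ => leftPerpPD_X₂ hE h₁ h₃
      kernel := fun E hE _ h₂ h₃ => leftPerpPD_X₁ hE h₂ h₃
      summand := fun X Y ⟨r⟩ hY => leftPerpPD_of_retract r hY }
  complete := h.isCompletePair

/-- Modules in the intersection of the two classes lie in `𝒯`. -/
lemma mem_of_leftPerpPD_of_rightPerp {X : ModuleCat.{u} Λ} (hB : leftPerpPD V X)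
    (hA : rightPerp V X) : 𝒯 X := by
  obtain ⟨E, hE, rfl, hE2, hE1⟩ := h.generates X hA
  exact h.retract _ _ (exists_retracts hE (h.extOrth hB hE1 1 one_pos)).2 hE2

/-- The middle term of the left approximation is an extension of modules in the left class, so it
lies in both classes and hence in `𝒯`. -/
lemma exists_cogenerator [IsNoetherianRing Λ] {B : ModuleCat.{u} Λ} (hB : leftPerpPD V B) :
    ∃ E : ShortComplex (ModuleCat.{u} Λ), E.ShortExact ∧ E.X₁ = B ∧ 𝒯 E.X₂ ∧
      leftPerpPD V E.X₃ := by
  obtain ⟨E, hE, rfl, hE2, hE3⟩ := (h.isCompletePair B hB.1).1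
  exact ⟨E, hE, rfl, h.mem_of_leftPerpPD_of_rightPerp (leftPerpPD_X₂ hE hB hE3) hE2, hE3⟩

end IsTiltingClass

namespace IsCotiltingClass

variable {W : ModuleCat.{u} Λ} {𝒯 : ObjectProperty (ModuleCat.{u} Λ)} (h : IsCotiltingClass W 𝒯)
include h

lemma leftPerp_of_mem {T : ModuleCat.{u} Λ} (hT : 𝒯 T) : leftPerp W T :=
  ⟨h.finite T hT, h.left T hT W h.self⟩

lemma rightPerpID_of_mem {T : ModuleCat.{u} Λ} (hT : 𝒯 T) : rightPerpID W T :=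
  ⟨h.finite T hT, h.right T hT W h.self, h.injd.imp fun n hn => h.injDim n hn T hT⟩

/-- Dual shift: cokernels of embeddings into `𝒯` raise the degree past the injective dimension of
`K`. -/
lemma extOrth {Y K : ModuleCat.{u} Λ} (hY : leftPerp W Y) (hK : rightPerpID W K) :
    ExtOrth.{u + 1, u} Y K := by
  obtain ⟨n, hn⟩ := hK.2.2
  suffices ∀ m Y, leftPerp W Y → ∀ i, 0 < i → n ≤ i + m → Subsingleton (Ext Y K i) from
    fun i hi => this n Y hY i hi (by omega)
  intro m
  induction m with
  | zero => exact fun Y _ i _ hi => HasInjectiveDimensionLT.subsingleton K n i hi Y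
  | succ m ih =>
    intro Y hY i hi him
    obtain ⟨E, hE, rfl, hE2, hE3⟩ := h.cogenerates Y hY
    exact subsingleton_ext_X₁ hE (h.left _ hE2 K hK.2.1 i hi) (ih _ hE3 _ (by omega) (by omega))

omit h in
lemma rightPerpID_X₃ {E : ShortComplex (ModuleCat.{u} Λ)}
    (hE : E.ShortExact) (h₁ : rightPerpID W E.X₁) (h₂ : rightPerpID W E.X₂) :
    rightPerpID W E.X₃ := by
  have := hE.epi_g
  obtain ⟨n, hn⟩ := h₁.2.2
  obtain ⟨m, hm⟩ := h₂.2.2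
  exact ⟨finite_of_epi E.g h₂.1, h₁.2.1.Y₃ hE h₂.2.1, max n m,
    hE.hasInjectiveDimensionLT_X₃ _ (hasInjectiveDimensionLT_of_ge _ m _ (by omega))
      (hasInjectiveDimensionLT_of_ge _ n _ (by omega))⟩

omit h in
lemma rightPerpID_of_retract {X Y : ModuleCat.{u} Λ} (r : Retract X Y) (hY : rightPerpID W Y) :
    rightPerpID W X := by
  obtain ⟨n, hn⟩ := hY.2.2
  exact ⟨finite_of_retract r hY.1, hY.2.1.of_retract (Retract.refl W) r, n,
    r.hasInjectiveDimensionLT n⟩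

omit h in
lemma leftPerp_of_retract {X Y : ModuleCat.{u} Λ} (r : Retract X Y) (hY : leftPerp W Y) :
    leftPerp W X :=
  ⟨finite_of_retract r hY.1, hY.2.of_retract r (Retract.refl W)⟩

lemma exists_cogenerator {Y : ModuleCat.{u} Λ} (hY : leftPerp W Y) :
    ∃ (T Y' : ModuleCat.{u} Λ) (f : Y ⟶ T) (g : T ⟶ Y') (w : f ≫ g = 0),
      (ShortComplex.mk f g w).ShortExact ∧ 𝒯 T ∧ leftPerp W Y' := by
  obtain ⟨E, hE, rfl, hE2, hE3⟩ := h.cogenerates Y hY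
  exact ⟨_, _, E.f, E.g, E.zero, hE, hE2, hE3⟩

lemma exists_left_approximation {E : ShortComplex (ModuleCat.{u} Λ)}
    (hE : E.ShortExact) (h₁ : rightPerpID W E.X₁) (h₂ : leftPerp W E.X₂) :
    ∃ (K Y : ModuleCat.{u} Λ) (f : E.X₃ ⟶ K) (g : K ⟶ Y) (w : f ≫ g = 0),
      (ShortComplex.mk f g w).ShortExact ∧ rightPerpID W K ∧ leftPerp W Y := by
  obtain ⟨T, Y', f, g, w, hE', hT, hY'⟩ := h.exists_cogenerator h₂
  have : Mono f := hE'.mono_f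
  refine ⟨_, _, _, _, _, shortExact_pushout hE' E.g, ?_, hY'⟩
  exact rightPerpID_of_retract (Retract.ofIso (pushoutSymmetry _ _))
    (rightPerpID_X₃ (shortExact_pushout_right hE f) h₁ (h.rightPerpID_of_mem hT))

/-- Induction on the last degree in which Ext from `Y` to `W` may survive, passing to the syzygy. A
left approximation of the syzygy is pushed out along its inclusion in a free module; the pushout is
an extension of a module in `leftPerp W` by the free one. -/
lemma exists_right_approximation [IsNoetherianRing Λ] (m : ℕ) (Y : ModuleCat.{u} Λ)
    (hY : Module.Finite Λ Y) (hm : ∀ i, m < i → Subsingleton (Ext Y W i)) :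
    ∃ (K G : ModuleCat.{u} Λ) (f : K ⟶ G) (g : G ⟶ Y) (w : f ≫ g = 0),
      (ShortComplex.mk f g w).ShortExact ∧ rightPerpID W K ∧ leftPerp W G := by
  induction m generalizing Y with
  | zero =>
    have hz : IsZero (ModuleCat.of Λ PUnit.{u + 1}) := ModuleCat.isZero_of_subsingleton _
    refine ⟨ModuleCat.of Λ PUnit.{u + 1}, Y, 0, 𝟙 Y, zero_comp, ?_, ?_, ⟨hY, hm⟩⟩
    · have : Mono (0 : ModuleCat.of Λ PUnit.{u + 1} ⟶ Y) := ⟨fun _ _ _ => hz.eq_of_tgt _ _⟩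
      exact ShortComplex.ShortExact.mk (ShortComplex.exact_of_g_is_cokernel _
        (CokernelCofork.IsColimit.ofId _ rfl))
    · have := hz.hasInjectiveDimensionLT_zero
      exact ⟨inferInstance, fun i _ =>
        HasInjectiveDimensionLT.subsingleton _ 0 i (Nat.zero_le _) W, 0, this⟩
  | succ m ih =>
    obtain ⟨n, f, _⟩ := exists_epi_of_finite hY
    have hE := shortExact_of_epi f
    have hP : Module.Finite Λ (ModuleCat.of Λ (Fin n → Λ)) :=
      inferInstanceAs (Module.Finite Λ (Fin n → Λ))
    obtain ⟨K₁, G₁, f₁, g₁, w₁, hE₁, hK₁, hG₁⟩ := ih (kernel f)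
      (finite_of_mono (kernel.ι f) hP) fun i hi => subsingleton_ext_X₁ hE
        (extOrth_of_projective _ W i (by omega)) (hm _ (by omega))
    obtain ⟨K', G', s, t, w, hE', hK', hG'⟩ := h.exists_left_approximation hE₁ hK₁ hG₁
    refine ⟨_, _, _, _, _, shortExact_pushout hE s, hK', ?_⟩
    have hQ := shortExact_pushout hE' (kernel.ι f)
    exact leftPerp_of_retract (Retract.ofIso (pushoutSymmetry _ _))
      ⟨finite_X₂ hQ hP hG'.1, (extOrth_of_projective _ W).X₂ hQ hG'.2⟩

lemma isCompletePair [IsNoetherianRing Λ] : IsCompletePair (leftPerp W) (rightPerpID W) := by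
  intro X hX
  obtain ⟨n, hn⟩ := h.injd
  obtain ⟨K, G, f, g, w, hE, hK, hG⟩ := h.exists_right_approximation n X hX
    fun i hi => HasInjectiveDimensionLT.subsingleton W n i hi.le X
  refine ⟨?_, ⟨_, hE, hK, hG, rfl⟩⟩
  obtain ⟨K', G', f', g', w', hE', hK', hG'⟩ := h.exists_left_approximation hE hK hG
  exact ⟨_, hE', rfl, hK', hG'⟩

lemma isCompleteHereditaryCotorsionPair [IsNoetherianRing Λ] :
    IsCompleteHereditaryCotorsionPair (leftPerp W) (rightPerpID W) where
  isCotorsionPair := by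
    refine ⟨fun X => ⟨fun hX => ⟨hX.1, fun Y hY => h.extOrth hX hY 1 one_pos⟩, fun hX => ?_⟩,
      fun Y => ⟨fun hY => ⟨hY.1, fun X hX => h.extOrth hX hY 1 one_pos⟩, fun hY => ?_⟩⟩
    · obtain ⟨E, hE, hE1, hE2, rfl⟩ := (h.isCompletePair X hX.1).2
      obtain ⟨r⟩ := (exists_retracts hE (hX.2 _ hE1)).2
      exact leftPerp_of_retract r hE2
    · obtain ⟨E, hE, rfl, hE2, hE3⟩ := (h.isCompletePair Y hY.1).1
      obtain ⟨r⟩ := (exists_retracts hE (hY.2 _ hE3)).1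
      exact rightPerpID_of_retract r hE2
  hereditary :=
    { finite := fun X hX => hX.1
      projective := fun X hX hp => by
        have : Projective X := (IsProjective.iff_projective X).1 hp
        exact ⟨hX, extOrth_of_projective X W⟩
      extension := fun E hE h₁ h₃ => ⟨finite_X₂ hE h₁.1 h₃.1, h₁.2.X₂ hE h₃.2⟩
      kernel := fun E hE h h₂ h₃ => ⟨h, h₂.2.X₁ hE h₃.2⟩
      summand := fun X Y ⟨r⟩ hY => leftPerp_of_retract r hY }
  complete := h.isCompletePair

/-- Modules in the intersection of the two classes lie in `𝒯`. -/
lemma mem_of_leftPerp_of_rightPerpID {X : ModuleCat.{u} Λ} (hG : leftPerp W X)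
    (hK : rightPerpID W X) : 𝒯 X := by
  obtain ⟨E, hE, rfl, hE2, hE3⟩ := h.cogenerates X hG
  exact h.retract _ _ (exists_retracts hE (h.extOrth hE3 hK 1 one_pos)).1 hE2

lemma exists_generator [IsNoetherianRing Λ] {K : ModuleCat.{u} Λ} (hK : rightPerpID W K) :
    ∃ E : ShortComplex (ModuleCat.{u} Λ), E.ShortExact ∧ E.X₃ = K ∧ 𝒯 E.X₂ ∧
      rightPerpID W E.X₁ := by
  obtain ⟨E, hE, hE1, hE2, rfl⟩ := (h.isCompletePair K hK.1).2
  refine ⟨E, hE, rfl, h.mem_of_leftPerp_of_rightPerpID hE2 ?_, hE1⟩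
  obtain ⟨n, hn⟩ := hE1.2.2
  obtain ⟨m, hm⟩ := hK.2.2
  exact ⟨hE2.1, hE1.2.1.Y₂ hE hK.2.1, max n m,
    hE.hasInjectiveDimensionLT_X₂ _ (hasInjectiveDimensionLT_of_ge _ n _ (by omega))
      (hasInjectiveDimensionLT_of_ge _ m _ (by omega))⟩

end IsCotiltingClass

end Tilting

end ExtVanishing

/-! ### Summands of powers and finite (co)resolutions. -/

namespace ExtVanishing

open Abelian Limits

universe w v

section Summand

variable {C : Type u} [Category.{v} C] [Preadditive C]

/-- `T` is a direct summand of a finite direct sum of copies of `V`. -/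
def IsSummand (V : C) : ObjectProperty C := fun T =>
  ∃ (n : ℕ) (f : Fin n → (T ⟶ V)) (g : Fin n → (V ⟶ T)), ∑ i, f i ≫ g i = 𝟙 T

lemma IsSummand.of_isZero {V T : C} (h : IsZero T) : IsSummand V T :=
  ⟨0, fun _ => 0, fun _ => 0, h.eq_of_src _ _⟩

lemma IsSummand.of_retract {V T X : C} (r : Retract X T) (h : IsSummand V T) : IsSummand V X := by
  obtain ⟨n, f, g, hfg⟩ := h
  refine ⟨n, fun i => r.i ≫ f i, fun i => g i ≫ r.r, ?_⟩
  calc ∑ i, (r.i ≫ f i) ≫ g i ≫ r.r = r.i ≫ (∑ i, f i ≫ g i) ≫ r.r := by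
        simp [Preadditive.comp_sum, Preadditive.sum_comp]
    _ = 𝟙 X := by rw [hfg]; simp

lemma IsSummand.of_iso {V V' T : C} (e : V ≅ V') (h : IsSummand V T) : IsSummand V' T := by
  obtain ⟨n, f, g, hfg⟩ := h
  exact ⟨n, fun i => f i ≫ e.hom, fun i => e.inv ≫ g i, by simpa using hfg⟩

lemma IsSummand.map {D : Type*} [Category D] [Preadditive D] (F : C ⥤ D) [F.Additive] {V T : C}
    (h : IsSummand V T) : IsSummand (F.obj V) (F.obj T) := by
  obtain ⟨n, f, g, hfg⟩ := h
  refine ⟨n, fun i => F.map (f i), fun i => F.map (g i), ?_⟩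
  simp only [← F.map_comp, ← F.map_sum, hfg, F.map_id]

/-- The inverse at `T` is the sum of copies of the inverse at `V`, conjugated by the components that
exhibit `T` as a summand; naturality moves them across. -/
lemma IsSummand.isIso_app {D : Type*} [Category D] [Preadditive D] {F G : C ⥤ D} [F.Additive]
    [G.Additive] (α : F ⟶ G) {V T : C} (h : IsSummand V T) (hV : IsIso (α.app V)) :
    IsIso (α.app T) := by
  obtain ⟨n, f, g, hfg⟩ := h
  refine ⟨∑ i, G.map (f i) ≫ inv (α.app V) ≫ F.map (g i), ?_, ?_⟩
  · simp only [Preadditive.comp_sum, ← α.naturality_assoc, IsIso.hom_inv_id_assoc, ← F.map_comp,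
      ← F.map_sum, hfg, F.map_id]
  · simp only [Preadditive.sum_comp, Category.assoc, α.naturality, IsIso.inv_hom_id_assoc,
      ← G.map_comp, ← G.map_sum, hfg, G.map_id]

lemma IsSummand.projective {V T : C} (h : IsSummand V T) [Projective V] : Projective T := by
  obtain ⟨n, f, g, hfg⟩ := h
  refine ⟨fun k e he => ⟨∑ i, f i ≫ Projective.factorThru (g i ≫ k) e, ?_⟩⟩
  simp only [Preadditive.sum_comp, Category.assoc, Projective.factorThru_comp]
  simp only [← Category.assoc, ← Preadditive.sum_comp, hfg, Category.id_comp]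

lemma IsSummand.injective {V T : C} (h : IsSummand V T) [Injective V] : Injective T := by
  obtain ⟨n, f, g, hfg⟩ := h
  refine ⟨fun k e he => ⟨∑ i, Injective.factorThru (k ≫ f i) e ≫ g i, ?_⟩⟩
  simp only [Preadditive.comp_sum, Injective.comp_factorThru_assoc, Category.assoc]
  simp only [← Preadditive.comp_sum, hfg, Category.comp_id]

end Summand

section SummandExt

variable {C : Type u} [Category.{v} C] [Abelian C] [HasExt.{w} C]

lemma IsSummand.subsingleton_right {V T X : C} (h : IsSummand V T) {i : ℕ}
    (hV : Subsingleton (Ext.{w} X V i)) : Subsingleton (Ext.{w} X T i) := by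
  obtain ⟨n, f, g, hfg⟩ := h
  refine subsingleton_of_forall_eq 0 fun x => ?_
  rw [← Ext.comp_mk₀_id x, ← hfg, Ext.mk₀_sum, Ext.comp_sum]
  refine Finset.sum_eq_zero fun j _ => ?_
  rw [← Ext.mk₀_comp_mk₀, ← Ext.comp_assoc_of_second_deg_zero,
    Subsingleton.elim (x.comp (Ext.mk₀ (f j)) (add_zero i)) 0, Ext.zero_comp]

lemma IsSummand.subsingleton_left {V T X : C} (h : IsSummand V T) {i : ℕ}
    (hV : Subsingleton (Ext.{w} V X i)) : Subsingleton (Ext.{w} T X i) := by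
  obtain ⟨n, f, g, hfg⟩ := h
  refine subsingleton_of_forall_eq 0 fun x => ?_
  rw [← Ext.mk₀_id_comp x, ← hfg, Ext.mk₀_sum, Ext.sum_comp]
  refine Finset.sum_eq_zero fun j _ => ?_
  rw [← Ext.mk₀_comp_mk₀, Ext.comp_assoc_of_second_deg_zero,
    Subsingleton.elim ((Ext.mk₀ (g j)).comp x (zero_add i)) 0, Ext.comp_zero]

end SummandExt

section Resolutions

variable {C : Type u} [Category.{v} C] [Abelian C]

/-- Objects with a finite coresolution by objects of `𝒯`. -/
inductive FiniteCoresolution (𝒯 : ObjectProperty C) : ObjectProperty C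
  | zero (X : C) (h : IsZero X) : FiniteCoresolution 𝒯 X
  | step (E : ShortComplex C) (hE : E.ShortExact) (h₂ : 𝒯 E.X₂)
      (h₃ : FiniteCoresolution 𝒯 E.X₃) : FiniteCoresolution 𝒯 E.X₁

/-- Objects with a finite resolution by objects of `𝒯`. -/
inductive FiniteResolution (𝒯 : ObjectProperty C) : ObjectProperty C
  | zero (X : C) (h : IsZero X) : FiniteResolution 𝒯 X
  | step (E : ShortComplex C) (hE : E.ShortExact) (h₂ : 𝒯 E.X₂)
      (h₁ : FiniteResolution 𝒯 E.X₁) : FiniteResolution 𝒯 E.X₃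

lemma FiniteCoresolution.of_iso {𝒯 : ObjectProperty C} {X Y : C} (e : Y ≅ X)
    (h : FiniteCoresolution 𝒯 X) : FiniteCoresolution 𝒯 Y := by
  cases h with
  | zero X h => exact .zero _ (h.of_iso e)
  | step E hE h₂ h₃ =>
    refine .step (ShortComplex.mk (e.hom ≫ E.f) E.g (by simp)) ?_ h₂ h₃
    exact ShortComplex.shortExact_of_iso
      (ShortComplex.isoMk e.symm (Iso.refl _) (Iso.refl _) (by simp) (by simp)) hE

open scoped ZeroObject in
lemma FiniteCoresolution.of_mem {𝒯 : ObjectProperty C} {X : C} (h : 𝒯 X) :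
    FiniteCoresolution 𝒯 X :=
  .step (ShortComplex.mk (𝟙 X) (0 : X ⟶ 0) comp_zero)
    (ShortComplex.ShortExact.mk (ShortComplex.exact_of_f_is_kernel _
      (KernelFork.IsLimit.ofId _ rfl))) h (.zero _ (isZero_zero C))

lemma mono_of_isCoseparator {I X Y : C} (hI : IsCoseparator I) {f : X ⟶ Y}
    (h : ∀ φ : X ⟶ I, ∃ ψ : Y ⟶ I, f ≫ ψ = φ) : Mono f := by
  refine Preadditive.mono_of_cancel_zero _ fun k hk => hI.def _ _ fun φ => ?_
  obtain ⟨ψ, rfl⟩ := h φ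
  rw [reassoc_of% hk, zero_comp, zero_comp]

end Resolutions

section Modules

variable {Λ : Type u} [Ring Λ]

lemma epi_of_generator {X Y : ModuleCat.{u} Λ} {f : X ⟶ Y}
    (h : ∀ φ : ModuleCat.of Λ Λ ⟶ Y, ∃ ψ : ModuleCat.of Λ Λ ⟶ X, ψ ≫ f = φ) : Epi f := by
  refine (ModuleCat.epi_iff_surjective f).2 fun y => ?_
  obtain ⟨ψ, hψ⟩ := h (ModuleCat.ofHom (LinearMap.toSpanSingleton Λ Y y))
  exact ⟨ψ.hom 1, by simpa using congr($hψ (1 : Λ))⟩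

lemma isSummand_pi (V : ModuleCat.{u} Λ) (n : ℕ) :
    IsSummand V (ModuleCat.of Λ (Fin n → V)) := by
  refine ⟨n, fun i => ModuleCat.ofHom (LinearMap.proj i),
    fun i => ModuleCat.ofHom (LinearMap.single Λ (fun _ => V) i), ?_⟩
  ext x
  simp

lemma isSummand_iff {V T : ModuleCat.{u} Λ} : IsSummand V T ↔ IsInAdd V T := by
  constructor
  · rintro ⟨n, f, g, hfg⟩
    refine ⟨n, LinearMap.pi fun i => (f i).hom,
      ∑ i, (g i).hom ∘ₗ LinearMap.proj i, LinearMap.ext fun x => ?_⟩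
    simpa using congr($hfg x)
  · rintro ⟨n, i, p, h⟩
    refine (isSummand_pi V n).of_retract ⟨ModuleCat.ofHom i, ModuleCat.ofHom p, ?_⟩
    rw [← ModuleCat.ofHom_comp, h]
    rfl

lemma IsSummand.finite {V T : ModuleCat.{u} Λ} (h : IsSummand V T) (hV : Module.Finite Λ V) :
    Module.Finite Λ T := by
  obtain ⟨n, i, p, h⟩ := isSummand_iff.1 h
  exact Module.Finite.of_surjective p fun x => ⟨i x, LinearMap.congr_fun h x⟩

lemma isAdditiveClosure {V : ModuleCat.{u} Λ} (hV : Module.Finite Λ V)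
    (h : ExtOrth.{u + 1, u} V V) : IsAdditiveClosure V (IsSummand V) where
  self := h
  finite _ hT := hT.finite hV
  right _ hT _ hX i hi := hT.subsingleton_right (hX i hi)
  left _ hT _ hX i hi := hT.subsingleton_left (hX i hi)
  projDim n _ _ hT := (hasProjectiveDimensionLT_iff _ _).2 fun i hi Y _ =>
    (hT.subsingleton_left (HasProjectiveDimensionLT.subsingleton V n i hi Y)).elim _ _
  injDim n _ _ hT := (hasInjectiveDimensionLT_iff _ _).2 fun i hi Y _ =>
    (hT.subsingleton_right (HasInjectiveDimensionLT.subsingleton V n i hi Y)).elim _ _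
  retract _ _ := fun ⟨r⟩ hT => hT.of_retract r

end Modules

end ExtVanishing

/-! ### Tilting theory for a dual pair of bimodules. -/

namespace ExtVanishing

open Abelian Limits

/-- Two module categories linked by two adjoint pairs `F ⊣ J` and `G ⊣ H`, where `H` and `J` are
the functors `Hom(V, -)` and `Hom(W, -)` for dual bimodules `V` and `W`; `IC` and `ID` are the
duals of the regular modules. -/
structure BimoduleContext (Λ Γ : Type u) [Ring Λ] [Ring Γ] where
  F : ModuleCat.{u} Λ ⥤ ModuleCat.{u} Γ
  J : ModuleCat.{u} Γ ⥤ ModuleCat.{u} Λ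
  G : ModuleCat.{u} Γ ⥤ ModuleCat.{u} Λ
  H : ModuleCat.{u} Λ ⥤ ModuleCat.{u} Γ
  V : ModuleCat.{u} Λ
  W : ModuleCat.{u} Γ
  IC : ModuleCat.{u} Λ
  ID : ModuleCat.{u} Γ
  adjF : F ⊣ J
  adjG : G ⊣ H
  additive_F : F.Additive
  additive_J : J.Additive
  additive_G : G.Additive
  additive_H : H.Additive
  isoGV : G.obj (ModuleCat.of Γ Γ) ≅ V
  isoJV : J.obj ID ≅ V
  isoFW : F.obj (ModuleCat.of Λ Λ) ≅ W
  isoHW : H.obj IC ≅ W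
  finite_V : Module.Finite Λ V
  finite_W : Module.Finite Γ W
  finite_IC : Module.Finite Λ IC
  finite_ID : Module.Finite Γ ID
  finite_H : ∀ X : ModuleCat.{u} Λ, Module.Finite Λ X → Module.Finite Γ (H.obj X)
  finite_J : ∀ Y : ModuleCat.{u} Γ, Module.Finite Γ Y → Module.Finite Λ (J.obj Y)
  finite_F : ∀ X : ModuleCat.{u} Λ, Module.Finite Λ X → Module.Finite Γ (F.obj X)
  finite_G : ∀ Y : ModuleCat.{u} Γ, Module.Finite Γ Y → Module.Finite Λ (G.obj Y)
  injective_IC : Injective IC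
  injective_ID : Injective ID
  coseparator_IC : IsCoseparator IC
  coseparator_ID : IsCoseparator ID
  embedding_IC : ∀ X : ModuleCat.{u} Λ, Module.Finite Λ X →
    ∃ (n : ℕ) (f : X ⟶ ModuleCat.of Λ (Fin n → IC)), Mono f
  embedding_ID : ∀ Y : ModuleCat.{u} Γ, Module.Finite Γ Y →
    ∃ (n : ℕ) (f : Y ⟶ ModuleCat.of Γ (Fin n → ID)), Mono f
  approx_V : ∀ X : ModuleCat.{u} Λ, Module.Finite Λ X →
    ∃ (n : ℕ) (f : ModuleCat.of Λ (Fin n → V) ⟶ X),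
    ∀ g : V ⟶ X, ∃ h, h ≫ f = g
  approx_W : ∀ Y : ModuleCat.{u} Γ, Module.Finite Γ Y →
    ∃ (n : ℕ) (f : Y ⟶ ModuleCat.of Γ (Fin n → W)),
    ∀ g : Y ⟶ W, ∃ h, f ≫ h = g
  approx_W' : ∀ X : ModuleCat.{u} Γ, Module.Finite Γ X →
    ∃ (n : ℕ) (f : ModuleCat.of Γ (Fin n → W) ⟶ X),
    ∀ g : W ⟶ X, ∃ h, h ≫ f = g
  approx_V' : ∀ Y : ModuleCat.{u} Λ, Module.Finite Λ Y →
    ∃ (n : ℕ) (f : Y ⟶ ModuleCat.of Λ (Fin n → V)),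
    ∀ g : Y ⟶ V, ∃ h, f ≫ h = g
  unit_iff : IsIso (adjG.unit.app (ModuleCat.of Γ Γ)) ↔ IsIso (adjF.counit.app ID)
  unit_iff' : IsIso (adjF.unit.app (ModuleCat.of Λ Λ)) ↔ IsIso (adjG.counit.app IC)

namespace BimoduleContext

attribute [instance] additive_F additive_J additive_G additive_H finite_V finite_W finite_IC finite_ID injective_IC injective_ID

variable {Λ Γ : Type u} [Ring Λ] [Ring Γ] (c : BimoduleContext Λ Γ)

/-- Interchange the roles of the two rings. -/
def swap : BimoduleContext Γ Λ where
  F := c.G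
  J := c.H
  G := c.F
  H := c.J
  V := c.W
  W := c.V
  IC := c.ID
  ID := c.IC
  adjF := c.adjG
  adjG := c.adjF
  additive_F := c.additive_G
  additive_J := c.additive_H
  additive_G := c.additive_F
  additive_H := c.additive_J
  isoGV := c.isoFW
  isoJV := c.isoHW
  isoFW := c.isoGV
  isoHW := c.isoJV
  finite_V := c.finite_W
  finite_W := c.finite_V
  finite_IC := c.finite_ID
  finite_ID := c.finite_IC
  finite_H := c.finite_J
  finite_J := c.finite_H
  finite_F := c.finite_G
  finite_G := c.finite_F
  injective_IC := c.injective_ID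
  injective_ID := c.injective_IC
  coseparator_IC := c.coseparator_ID
  coseparator_ID := c.coseparator_IC
  embedding_IC := c.embedding_ID
  embedding_ID := c.embedding_IC
  approx_V := c.approx_W'
  approx_W := c.approx_V'
  approx_W' := c.approx_V
  approx_V' := c.approx_W
  unit_iff := c.unit_iff'
  unit_iff' := c.unit_iff

/-- The module `V` is tilting and `Γ` is its endomorphism ring. -/
structure IsTilting : Prop where
  unit : IsIso (c.adjG.unit.app (ModuleCat.of Γ Γ))
  self : ExtOrth.{u + 1, u} c.V c.V
  pd : ∃ n, HasProjectiveDimensionLT c.V n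
  coresolution : FiniteCoresolution (IsSummand c.V) (ModuleCat.of Λ Λ)

/-- The module `V` is cotilting and `Γ` is its endomorphism ring. -/
structure IsCotilting : Prop where
  unit : IsIso (c.adjG.unit.app (ModuleCat.of Γ Γ))
  self : ExtOrth.{u + 1, u} c.V c.V
  injd : ∃ n, HasInjectiveDimensionLT c.V n
  resolution : FiniteResolution (IsSummand c.V) c.IC

instance (n : ℕ) : Injective (ModuleCat.of Λ (Fin n → c.IC)) := (isSummand_pi c.IC n).injective

instance (n : ℕ) : Injective (ModuleCat.of Γ (Fin n → c.ID)) := (isSummand_pi c.ID n).injective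

lemma projective_of_generator (Λ : Type u) [Ring Λ] : Projective (ModuleCat.of Λ Λ) :=
  (IsProjective.iff_projective _).1 inferInstance

attribute [local instance] projective_of_generator

/-- The first term of the functor `F` is exact when the cokernel is orthogonal to `V`. -/
lemma mono_map_F {E : ShortComplex (ModuleCat.{u} Λ)} (hE : E.ShortExact)
    (h : Subsingleton (Ext E.X₃ c.V 1)) : Mono (c.F.map E.f) := by
  -- By adjunction, maps from the image of `F` to the injective cogenerator are maps to `J ID ≅ V`,
  -- and these extend by the Ext hypothesis.
  refine mono_of_isCoseparator c.coseparator_ID fun φ => ?_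
  obtain ⟨g, hg⟩ := exists_extension hE h (c.adjF.homEquiv _ _ φ ≫ c.isoJV.hom)
  refine ⟨(c.adjF.homEquiv _ _).symm (g ≫ c.isoJV.inv), ?_⟩
  rw [← Adjunction.homEquiv_naturality_left_symm, ← Category.assoc, hg]
  simp

lemma mono_map_G {E : ShortComplex (ModuleCat.{u} Γ)} (hE : E.ShortExact)
    (h : Subsingleton (Ext E.X₃ c.W 1)) : Mono (c.G.map E.f) := c.swap.mono_map_F hE h

/-- Elements of the target are maps from `Γ`, which by adjunction are maps from `V`; these lift when
the Ext group vanishes. -/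
lemma epi_map_H {E : ShortComplex (ModuleCat.{u} Λ)} (hE : E.ShortExact)
    (h : Subsingleton (Ext c.V E.X₁ 1)) : Epi (c.H.map E.g) := by
  refine epi_of_generator fun φ => ?_
  obtain ⟨g, hg⟩ := exists_lifting hE h (c.isoGV.inv ≫ (c.adjG.homEquiv _ _).symm φ)
  refine ⟨c.adjG.homEquiv _ _ (c.isoGV.hom ≫ g), ?_⟩
  rw [← Adjunction.homEquiv_naturality_right, Category.assoc, hg]
  simp

lemma epi_map_J {E : ShortComplex (ModuleCat.{u} Γ)} (hE : E.ShortExact)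
    (h : Subsingleton (Ext c.W E.X₁ 1)) : Epi (c.J.map E.g) := c.swap.epi_map_H hE h

lemma preservesFiniteColimits_F : PreservesFiniteColimits c.F :=
  preservesFiniteColimits_of_adj c.adjF

lemma preservesFiniteLimits_H : PreservesFiniteLimits c.H := preservesFiniteLimits_of_adj c.adjG

lemma preservesFiniteLimits_J : PreservesFiniteLimits c.J := preservesFiniteLimits_of_adj c.adjF

lemma shortExact_F {E : ShortComplex (ModuleCat.{u} Λ)} (hE : E.ShortExact)
    (h : Subsingleton (Ext E.X₃ c.V 1)) : (E.map c.F).ShortExact :=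
  have := c.preservesFiniteColimits_F
  ShortExact.map_left hE (c.mono_map_F hE h)

lemma shortExact_H {E : ShortComplex (ModuleCat.{u} Λ)} (hE : E.ShortExact)
    (h : Subsingleton (Ext c.V E.X₁ 1)) : (E.map c.H).ShortExact :=
  have := c.preservesFiniteLimits_H
  ShortExact.map_right hE (c.epi_map_H hE h)

lemma shortExact_J {E : ShortComplex (ModuleCat.{u} Γ)} (hE : E.ShortExact)
    (h : Subsingleton (Ext c.W E.X₁ 1)) : (E.map c.J).ShortExact := c.swap.shortExact_H hE h

include c in
lemma exists_injective (X : ModuleCat.{u} Λ) (hX : Module.Finite Λ X) :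
    ∃ (I : ModuleCat.{u} Λ) (f : X ⟶ I), Mono f ∧ Module.Finite Λ I ∧ Injective I := by
  obtain ⟨n, f, hf⟩ := c.embedding_IC X hX
  exact ⟨_, f, hf, (isSummand_pi c.IC n).finite c.finite_IC, inferInstance⟩

omit [Ring Γ] in
lemma isSummand_of_projective {X : ModuleCat.{u} Λ} (hX : Module.Finite Λ X) (h : Projective X) :
    IsSummand (ModuleCat.of Λ Λ) X := by
  obtain ⟨n, f, hf⟩ := exists_epi_of_finite hX
  exact (isSummand_pi (ModuleCat.of Λ Λ) n).of_retract
    ⟨Projective.factorThru (𝟙 X) f, f, Projective.factorThru_comp _ _⟩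

lemma isSummand_of_injective {X : ModuleCat.{u} Λ} (hX : Module.Finite Λ X) (h : Injective X) :
    IsSummand c.IC X := by
  obtain ⟨n, f, hf⟩ := c.embedding_IC X hX
  exact (isSummand_pi c.IC n).of_retract
    ⟨f, Injective.factorThru (𝟙 X) f, Injective.comp_factorThru _ _⟩

/-- `V` is the image of the regular module under `G`, and the triangle identity makes the counit
there a one-sided inverse of the image of an invertible unit. -/
lemma counit_V (h : IsIso (c.adjG.unit.app (ModuleCat.of Γ Γ))) : IsIso (c.adjG.counit.app c.V) := by
  rw [← NatTrans.isIso_app_iff_of_iso c.adjG.counit c.isoGV]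
  exact IsIso.of_isIso_fac_left (c.adjG.left_triangle_components (ModuleCat.of Γ Γ))

lemma unit_W (h : IsIso (c.adjG.counit.app c.IC)) : IsIso (c.adjG.unit.app c.W) := by
  rw [← NatTrans.isIso_app_iff_of_iso c.adjG.unit c.isoHW]
  exact IsIso.of_isIso_fac_right (c.adjG.right_triangle_components c.IC)

lemma extOrth_of_finiteCoresolution {X A : ModuleCat.{u} Λ}
    (hX : FiniteCoresolution (IsSummand c.V) X) (hA : ExtOrth.{u + 1, u} c.V A) :
    ExtOrth.{u + 1, u} X A := by
  induction hX with
  | zero X h =>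
    have := h.projective
    exact extOrth_of_projective X A
  | step E hE h₂ h₃ ih => exact ExtOrth.X₁ hE (fun i hi => h₂.subsingleton_left (hA i hi)) ih

/-- The first term of the coresolution works: the next cosyzygy again has a finite coresolution by
summands of powers of `V`, so the obstruction to extending a map vanishes. -/
lemma exists_summand_envelope (X : ModuleCat.{u} Λ) (hX : FiniteCoresolution (IsSummand c.V) X) :
    ∃ (T : ModuleCat.{u} Λ) (j : X ⟶ T), IsSummand c.V T ∧
      ∀ A, ExtOrth.{u + 1, u} c.V A → ∀ φ : X ⟶ A, ∃ ψ, j ≫ ψ = φ := by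
  cases hX with
  | zero X h => exact ⟨X, 𝟙 X, .of_isZero h, fun A _ φ => ⟨φ, Category.id_comp φ⟩⟩
  | step E hE h₂ h₃ => exact ⟨E.X₂, E.f, h₂, fun A hA φ =>
      exists_extension hE (c.extOrth_of_finiteCoresolution h₃ hA 1 one_pos) φ⟩

/-- A finitely generated module right orthogonal to `V` is generated by `V`. -/
lemma exists_generator [IsNoetherianRing Λ] (hS : ExtOrth.{u + 1, u} c.V c.V)
    (hc : FiniteCoresolution (IsSummand c.V) (ModuleCat.of Λ Λ)) (A : ModuleCat.{u} Λ)
    (hA : rightPerp c.V A) : ∃ E : ShortComplex (ModuleCat.{u} Λ),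
      E.ShortExact ∧ E.X₃ = A ∧ IsSummand c.V E.X₂ ∧ rightPerp c.V E.X₁ := by
  obtain ⟨n, f, hf⟩ := c.approx_V A hA.1
  -- A map from the regular module to `A` factors through a summand of a power of `V` by the
  -- envelope, and each component then factors through the approximation `f`.
  have : Epi f := by
    obtain ⟨T, j, ⟨m, a, b, hab⟩, hj⟩ := c.exists_summand_envelope _ hc
    refine epi_of_generator fun φ => ?_
    obtain ⟨ψ, rfl⟩ := hj A hA.2 φ
    choose t ht using fun i => hf (b i ≫ ψ)
    refine ⟨j ≫ ∑ i, a i ≫ t i, ?_⟩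
    have : (∑ i, a i ≫ t i) ≫ f = ψ := by
      simp only [Preadditive.sum_comp, Category.assoc, ht]
      simp only [← Category.assoc, ← Preadditive.sum_comp, hab, Category.id_comp]
    rw [Category.assoc, this]
  have hE := shortExact_of_epi f
  have hVn := isSummand_pi c.V n
  -- For the kernel, degree one vanishes because every map from `V` lifts along `f`; higher degrees
  -- shift.
  exact ⟨_, hE, rfl, hVn, finite_of_mono (kernel.ι f) (hVn.finite c.finite_V),
    ExtOrth.Y₁ hE (fun i hi => hVn.subsingleton_right (hS i hi)) hA.2 hf⟩

namespace IsTilting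

variable {c} (h : c.IsTilting)
include h

lemma isTiltingClass [IsNoetherianRing Λ] : IsTiltingClass c.V (IsSummand c.V) where
  toIsAdditiveClosure := isAdditiveClosure c.finite_V h.self
  pd := h.pd
  generates := c.exists_generator h.self h.coresolution
  enoughInjectives := c.exists_injective

lemma counit_ID : IsIso (c.adjF.counit.app c.ID) := c.unit_iff.1 h.unit

lemma unit_V : IsIso (c.adjF.unit.app c.V) := c.swap.unit_W h.counit_ID

/-- `V` is `J ID`, and the counit at `ID` is invertible since `Γ` is the endomorphism ring of `V`;
so the image is `ID` itself. -/
lemma injective_FV : Injective (c.F.obj c.V) := by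
  have := h.counit_ID
  exact Injective.of_iso ((asIso (c.adjF.counit.app c.ID)).symm.trans (c.F.mapIso c.isoJV))
    c.injective_ID

lemma isCogeneratedBy_F [IsNoetherianRing Λ] :
    IsCogeneratedBy c.F (leftPerpPD c.V) (IsSummand c.V) := by
  intro B hB
  obtain ⟨E, hE, hE1, hE2, hE3⟩ := h.isTiltingClass.exists_cogenerator hB
  exact ⟨E, hE, hE1, hE2, hE3, c.mono_map_F hE (hE3.2.1 1 one_pos)⟩

lemma unit_leftPerpPD [IsNoetherianRing Λ] {B : ModuleCat.{u} Λ} (hB : leftPerpPD c.V B) :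
    IsIso (c.adjF.unit.app B) :=
  isIso_unit_of_isCogeneratedBy c.adjF h.isCogeneratedBy_F
    (fun _ hT => hT.isIso_app c.adjF.unit h.unit_V) B hB

/-- `W` is the image of the projective `Λ`, and `F` sends the cogenerating summands of powers of `V`
to injectives, so `extOrth_map_left` applies. -/
lemma extOrth_F [IsNoetherianRing Λ] {B : ModuleCat.{u} Λ} (hB : leftPerpPD c.V B) :
    ExtOrth.{u + 1, u} c.W (c.F.obj B) := by
  refine ExtOrth.of_iso ?_ c.isoFW.symm (Iso.refl _)
  refine extOrth_map_left c.adjF h.isCogeneratedBy_F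
    (fun _ hT => hT.isIso_app c.adjF.unit h.unit_V) _ (fun T hT => ?_) B hB
  have := h.injective_FV
  have := (hT.map c.F).injective
  exact extOrth_of_injective _ _

omit h [Ring Γ] in
lemma leftPerpPD_generator (V : ModuleCat.{u} Λ) : leftPerpPD V (ModuleCat.of Λ Λ) :=
  ⟨inferInstanceAs (Module.Finite Λ Λ), extOrth_of_projective _ _, 1, inferInstance⟩

/-- The regular module is projective, hence in the class on which the unit is already known to be
invertible. In the bimodule setting this says that `Λ` is the full endomorphism ring of `W`. -/
lemma balanced [IsNoetherianRing Λ] : IsIso (c.adjF.unit.app (ModuleCat.of Λ Λ)) :=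
  h.unit_leftPerpPD (leftPerpPD_generator _)

lemma self_W [IsNoetherianRing Λ] : ExtOrth.{u + 1, u} c.W c.W :=
  (h.extOrth_F (leftPerpPD_generator _)).of_iso (Iso.refl _) c.isoFW.symm

lemma counit_IC [IsNoetherianRing Λ] : IsIso (c.adjG.counit.app c.IC) := c.unit_iff'.1 h.balanced

/-- All cosyzygies are left orthogonal to `V`, so `F` keeps the coresolution exact, and its terms
become injective. -/
lemma injectiveDimension_F_of_finiteCoresolution {X : ModuleCat.{u} Λ}
    (hX : FiniteCoresolution (IsSummand c.V) X) :
    ExtOrth.{u + 1, u} X c.V ∧ ∃ n, HasInjectiveDimensionLT (c.F.obj X) n := by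
  refine ⟨c.extOrth_of_finiteCoresolution hX h.self, ?_⟩
  induction hX with
  | zero X hX => exact ⟨0, (c.F.map_isZero hX).hasInjectiveDimensionLT_zero⟩
  | step E hE h₂ h₃ ih =>
    obtain ⟨n, hn⟩ := ih
    have hF := c.shortExact_F hE (c.extOrth_of_finiteCoresolution h₃ h.self 1 one_pos)
    have := h.injective_FV
    have := (h₂.map c.F).injective
    have h₂ : HasInjectiveDimensionLT (E.map c.F).X₂ (n + 1) :=
      hasInjectiveDimensionLT_of_ge (c.F.obj E.X₂) 1 (n + 1) (by omega)
    exact ⟨n + 1, hF.hasInjectiveDimensionLT_X₁ n hn h₂⟩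

lemma injd_W : ∃ n, HasInjectiveDimensionLT c.W n := by
  obtain ⟨n, hn⟩ := (h.injectiveDimension_F_of_finiteCoresolution h.coresolution).2
  exact ⟨n, hasInjectiveDimensionLT_of_iso c.isoFW n⟩

omit h in
/-- Induction on the projective dimension in `leftPerpPD V`. -/
lemma leftPerpPD_induction [IsNoetherianRing Λ] {P : ModuleCat.{u} Λ → Prop}
    (h₀ : ∀ X, IsSummand (ModuleCat.of Λ Λ) X → P X)
    (h₁ : ∀ E : ShortComplex (ModuleCat.{u} Λ), (E.map c.F).ShortExact →
      IsSummand (ModuleCat.of Λ Λ) E.X₂ → P E.X₁ → P E.X₃)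
    {B : ModuleCat.{u} Λ} (hB : leftPerpPD c.V B) : P B := by
  obtain ⟨n, hn⟩ := hB.2.2
  have hn' : HasProjectiveDimensionLT B (n + 1) := hasProjectiveDimensionLT_of_ge B n _ (by omega)
  clear hn
  induction n generalizing B with
  | zero =>
    have : Projective B := projective_iff_hasProjectiveDimensionLT_one.2 hn'
    exact h₀ B (isSummand_of_projective hB.1 this)
  | succ n ih =>
    obtain ⟨m, f, _⟩ := exists_epi_of_finite hB.1
    have hE := shortExact_of_epi f
    have hP : leftPerpPD c.V (ModuleCat.of Λ (Fin m → Λ)) :=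
      ⟨inferInstanceAs (Module.Finite Λ (Fin m → Λ)), extOrth_of_projective _ _, 1, inferInstance⟩
    have hpd : HasProjectiveDimensionLT (kernel f) (n + 1) :=
      hE.hasProjectiveDimensionLT_X₁ (n + 1)
        (hasProjectiveDimensionLT_of_ge (ModuleCat.of Λ (Fin m → Λ)) 1 _ (by omega)) hn'
    exact h₁ _ (c.shortExact_F hE (hB.2.1 1 one_pos)) (isSummand_pi (ModuleCat.of Λ Λ) m)
      (ih (IsTiltingClass.leftPerpPD_X₁ hE hP hB) hpd)

-- A module in `leftPerpPD V` has a finite free resolution that `F` keeps exact, so its image is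
-- resolved by summands of powers of `W`.
omit h in
lemma extOrth_leftPerp_F [IsNoetherianRing Λ] {Y : ModuleCat.{u} Γ} (hY : leftPerp c.W Y)
    {B : ModuleCat.{u} Λ} (hB : leftPerpPD c.V B) : ExtOrth.{u + 1, u} Y (c.F.obj B) := by
  refine leftPerpPD_induction (c := c) (P := fun B => ExtOrth.{u + 1, u} Y (c.F.obj B))
    (fun X hX i hi => ((hX.map c.F).of_iso c.isoFW).subsingleton_right (hY.2 i hi))
    (fun E hE hE2 hE1 => ?_) hB
  exact ExtOrth.Y₃ hE hE1 fun i hi =>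
    ((hE2.map c.F).of_iso c.isoFW).subsingleton_right (hY.2 i hi)

lemma rightPerpID_F [IsNoetherianRing Λ] {B : ModuleCat.{u} Λ} (hB : leftPerpPD c.V B) :
    rightPerpID c.W (c.F.obj B) := by
  refine ⟨c.finite_F B hB.1, h.extOrth_F hB, ?_⟩
  obtain ⟨n, hn⟩ := h.injd_W
  have hs : ∀ X, IsSummand (ModuleCat.of Λ Λ) X → HasInjectiveDimensionLT (c.F.obj X) n :=
    fun X hX => (hasInjectiveDimensionLT_iff _ _).2 fun i hi Y e =>
      (((hX.map c.F).of_iso c.isoFW).subsingleton_right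
        (HasInjectiveDimensionLT.subsingleton c.W n i hi Y)).elim _ _
  refine leftPerpPD_induction (c := c) (P := fun B => ∃ n, HasInjectiveDimensionLT (c.F.obj B) n)
    (fun X hX => ⟨n, hs X hX⟩) (fun E hE hE2 ⟨m, hm⟩ => ?_) hB
  have h₂ : HasInjectiveDimensionLT (E.map c.F).X₂ (max m n) :=
    have := hs _ hE2
    hasInjectiveDimensionLT_of_ge (c.F.obj E.X₂) n _ (by omega)
  have h₁ : HasInjectiveDimensionLT (E.map c.F).X₁ (max m n + 1) :=
    hasInjectiveDimensionLT_of_ge (c.F.obj E.X₁) m _ (by omega)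
  exact ⟨_, hE.hasInjectiveDimensionLT_X₃ (max m n) h₂ h₁⟩

lemma exists_cogenerator [IsNoetherianRing Λ] (Y : ModuleCat.{u} Γ) (hY : leftPerp c.W Y) :
    ∃ E : ShortComplex (ModuleCat.{u} Γ), E.ShortExact ∧ E.X₁ = Y ∧ IsSummand c.W E.X₂ ∧
      leftPerp c.W E.X₃ := by
  obtain ⟨n, f, hf⟩ := c.approx_W Y hY.1
  have := h.counit_ID
  let eV : c.F.obj c.V ≅ c.ID := (c.F.mapIso c.isoJV).symm.trans (asIso (c.adjF.counit.app c.ID))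
  have hV : leftPerpPD c.V c.V := ⟨c.finite_V, h.self, h.pd⟩
  -- Maps to the cogenerator are maps to `F V`. Such a map lifts to the image of a free cover of
  -- `V`, because the image of the kernel is orthogonal to `Y`; the image of the free cover is a
  -- summand of a power of `W`, so the lift factors through `f`.
  have : Mono f := by
    refine mono_of_isCoseparator c.coseparator_ID fun φ => ?_
    obtain ⟨m, p, _⟩ := exists_epi_of_finite c.finite_V
    have hE := shortExact_of_epi p
    have hP : leftPerpPD c.V (ModuleCat.of Λ (Fin m → Λ)) :=
      ⟨inferInstanceAs (Module.Finite Λ (Fin m → Λ)), extOrth_of_projective _ _, 1, inferInstance⟩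
    have hK := IsTiltingClass.leftPerpPD_X₁ hE hP hV
    obtain ⟨t, ht⟩ : ∃ t : Y ⟶ c.F.obj (ModuleCat.of Λ (Fin m → Λ)),
        t ≫ c.F.map p = φ ≫ eV.inv :=
      exists_lifting (c.shortExact_F hE (h.self 1 one_pos))
        (extOrth_leftPerp_F hY hK 1 one_pos) (φ ≫ eV.inv)
    have hFP : IsSummand c.W (c.F.obj (ModuleCat.of Λ (Fin m → Λ))) :=
      ((isSummand_pi (ModuleCat.of Λ Λ) m).map c.F).of_iso c.isoFW
    obtain ⟨k, a, b, hab⟩ := hFP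
    choose s hs using fun i => hf (t ≫ a i)
    refine ⟨(∑ i, s i ≫ b i) ≫ c.F.map p ≫ eV.hom, ?_⟩
    have h1 : f ≫ ∑ i, s i ≫ b i = t := by
      simp only [Preadditive.comp_sum, ← Category.assoc, hs]
      simp only [Category.assoc, ← Preadditive.comp_sum, hab, Category.comp_id]
    rw [reassoc_of% h1, reassoc_of% ht, eV.inv_hom_id, Category.comp_id]
  have hE := shortExact_of_mono f
  have hWn := isSummand_pi c.W n
  exact ⟨_, hE, rfl, hWn, finite_of_epi (cokernel.π f) (hWn.finite c.finite_W),
    ExtOrth.X₃ hE hY.2 (fun i hi => hWn.subsingleton_left (h.self_W i hi)) hf⟩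

lemma isCotiltingClass [IsNoetherianRing Λ] : IsCotiltingClass c.W (IsSummand c.W) where
  toIsAdditiveClosure := isAdditiveClosure c.finite_W h.self_W
  injd := h.injd_W
  cogenerates := h.exists_cogenerator

lemma isGeneratedBy_H [IsNoetherianRing Λ] :
    IsGeneratedBy c.H (rightPerp c.V) (IsSummand c.V) := by
  intro A hA
  obtain ⟨E, hE, hE3, hE2, hE1⟩ := h.isTiltingClass.generates A hA
  exact ⟨E, hE, hE3, hE2, hE1, c.epi_map_H hE (hE1.2 1 one_pos)⟩

lemma counit_rightPerp [IsNoetherianRing Λ] {A : ModuleCat.{u} Λ} (hA : rightPerp c.V A) :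
    IsIso (c.adjG.counit.app A) :=
  isIso_counit_of_isGeneratedBy c.adjG h.isGeneratedBy_H
    (fun _ hT => hT.isIso_app c.adjG.counit (c.counit_V h.unit)) A hA

lemma projective_HV : Projective (c.H.obj c.V) := by
  have := h.unit
  exact Projective.of_iso ((asIso (c.adjG.unit.app (ModuleCat.of Γ Γ))).trans
    (c.H.mapIso c.isoGV)) (projective_of_generator Γ)

/-- `W` is `H IC` with `IC` injective, and `H` sends summands of powers of `V` to projectives, so
Ext vanishing passes through the generating sequences of `A`. -/
lemma leftPerp_H [IsNoetherianRing Λ] {A : ModuleCat.{u} Λ} (hA : rightPerp c.V A) :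
    leftPerp c.W (c.H.obj A) := by
  refine ⟨c.finite_H A hA.1, ExtOrth.of_iso ?_ (Iso.refl _) c.isoHW.symm⟩
  refine extOrth_map_right c.adjG h.isGeneratedBy_H
    (fun _ hT => hT.isIso_app c.adjG.counit (c.counit_V h.unit)) _ (fun T hT => ?_) A hA
  have := h.projective_HV
  have := (hT.map c.H).projective
  exact extOrth_of_projective _ _

lemma isCogeneratedBy_G [IsNoetherianRing Λ] :
    IsCogeneratedBy c.G (leftPerp c.W) (IsSummand c.W) := by
  intro Y hY
  obtain ⟨E, hE, hE1, hE2, hE3⟩ := h.exists_cogenerator Y hY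
  exact ⟨E, hE, hE1, hE2, hE3, c.mono_map_G hE (hE3.2 1 one_pos)⟩

lemma unit_leftPerp [IsNoetherianRing Λ] {Y : ModuleCat.{u} Γ} (hY : leftPerp c.W Y) :
    IsIso (c.adjG.unit.app Y) :=
  isIso_unit_of_isCogeneratedBy c.adjG h.isCogeneratedBy_G
    (fun _ hT => hT.isIso_app c.adjG.unit (c.unit_W h.counit_IC)) Y hY

lemma rightPerp_G [IsNoetherianRing Λ] {Y : ModuleCat.{u} Γ} (hY : leftPerp c.W Y) :
    rightPerp c.V (c.G.obj Y) := by
  refine ⟨c.finite_G Y hY.1, ExtOrth.of_iso ?_ c.isoGV.symm (Iso.refl _)⟩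
  refine extOrth_map_left c.adjG h.isCogeneratedBy_G
    (fun _ hT => hT.isIso_app c.adjG.unit (c.unit_W h.counit_IC)) _ (fun T hT => ?_) Y hY
  have := h.counit_IC
  have : Injective (c.G.obj c.W) := Injective.of_iso
    ((asIso (c.adjG.counit.app c.IC)).symm.trans (c.G.mapIso c.isoHW)) c.injective_IC
  have := (hT.map c.G).injective
  exact extOrth_of_injective _ _

lemma isGeneratedBy_J [IsNoetherianRing Λ] [IsNoetherianRing Γ] :
    IsGeneratedBy c.J (rightPerpID c.W) (IsSummand c.W) := by
  intro K hK
  obtain ⟨E, hE, hE3, hE2, hE1⟩ := h.isCotiltingClass.exists_generator hK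
  exact ⟨E, hE, hE3, hE2, hE1, c.epi_map_J hE (hE1.2.1 1 one_pos)⟩

lemma counit_W [IsNoetherianRing Λ] : IsIso (c.adjF.counit.app c.W) := c.swap.counit_V h.balanced

lemma counit_rightPerpID [IsNoetherianRing Λ] [IsNoetherianRing Γ] {K : ModuleCat.{u} Γ}
    (hK : rightPerpID c.W K) : IsIso (c.adjF.counit.app K) :=
  isIso_counit_of_isGeneratedBy c.adjF h.isGeneratedBy_J
    (fun _ hT => hT.isIso_app c.adjF.counit h.counit_W) K hK

lemma extOrth_J [IsNoetherianRing Λ] [IsNoetherianRing Γ] {K : ModuleCat.{u} Γ}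
    (hK : rightPerpID c.W K) : ExtOrth.{u + 1, u} (c.J.obj K) c.V := by
  refine ExtOrth.of_iso ?_ (Iso.refl _) c.isoJV.symm
  refine extOrth_map_right c.adjF h.isGeneratedBy_J
    (fun _ hT => hT.isIso_app c.adjF.counit h.counit_W) _ (fun T hT => ?_) K hK
  have := h.balanced
  have : Projective (c.J.obj c.W) := Projective.of_iso
    ((asIso (c.adjF.unit.app (ModuleCat.of Λ Λ))).trans (c.J.mapIso c.isoFW))
    (projective_of_generator Λ)
  have := (hT.map c.J).projective
  exact extOrth_of_projective _ _

omit h in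
lemma exists_embedding_rightPerpID {K : ModuleCat.{u} Γ}
    (hK : rightPerpID c.W K) : ∃ (n : ℕ) (f : K ⟶ ModuleCat.of Γ (Fin n → c.ID)), Mono f ∧
      rightPerpID c.W (cokernel f) := by
  obtain ⟨n, f, hf⟩ := c.embedding_ID K hK.1
  exact ⟨n, f, hf, IsCotiltingClass.rightPerpID_X₃ (shortExact_of_mono f) hK
    ⟨(isSummand_pi c.ID n).finite c.finite_ID, extOrth_of_injective _ _, 1, inferInstance⟩⟩

/-- The projective dimension is bounded by induction on the injective dimension of `K`: `J` keeps
the embedding in a power of `ID` exact, and `J ID` is `V`, which has finite projective dimension. -/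
lemma leftPerpPD_J [IsNoetherianRing Λ] [IsNoetherianRing Γ] {K : ModuleCat.{u} Γ}
    (hK : rightPerpID c.W K) : leftPerpPD c.V (c.J.obj K) := by
  refine ⟨c.finite_J K hK.1, h.extOrth_J hK, ?_⟩
  obtain ⟨r, hr⟩ := h.pd
  have hs : ∀ Y, IsSummand c.ID Y → HasProjectiveDimensionLT (c.J.obj Y) r :=
    fun Y hY => (hasProjectiveDimensionLT_iff _ _).2 fun i hi X e =>
      (((hY.map c.J).of_iso c.isoJV).subsingleton_left
        (HasProjectiveDimensionLT.subsingleton c.V r i hi X)).elim _ _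
  obtain ⟨n, hn⟩ := hK.2.2
  have hn' : HasInjectiveDimensionLT K (n + 1) := hasInjectiveDimensionLT_of_ge K n _ (by omega)
  clear hn
  induction n generalizing K with
  | zero =>
    have : Injective K := injective_iff_hasInjectiveDimensionLT_one.2 hn'
    exact ⟨r, hs K (c.swap.isSummand_of_injective hK.1 this)⟩
  | succ n ih =>
    obtain ⟨m, f, hf, hc⟩ := exists_embedding_rightPerpID hK
    have hE := shortExact_of_mono f
    have hid : HasInjectiveDimensionLT (cokernel f) (n + 1) :=
      hE.hasInjectiveDimensionLT_X₃ (n + 1)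
        (hasInjectiveDimensionLT_of_ge (ModuleCat.of Γ (Fin m → c.ID)) 1 _ (by omega)) hn'
    obtain ⟨q, hq⟩ := ih hc hid
    have hJ := c.shortExact_J hE (hK.2.1 1 one_pos)
    have h₂ : HasProjectiveDimensionLT
        ((ShortComplex.mk f (cokernel.π f) (cokernel.condition f)).map c.J).X₂ (max q r) :=
      have := hs _ (isSummand_pi c.ID m)
      hasProjectiveDimensionLT_of_ge (c.J.obj (ModuleCat.of Γ (Fin m → c.ID))) r _ (by omega)
    have h₃ : HasProjectiveDimensionLT
        ((ShortComplex.mk f (cokernel.π f) (cokernel.condition f)).map c.J).X₃ (max q r + 1) :=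
      hasProjectiveDimensionLT_of_ge (c.J.obj (cokernel f)) q _ (by omega)
    exact ⟨_, hJ.hasProjectiveDimensionLT_X₁ (max q r) h₂ h₃⟩

end IsTilting

/-! ### Reduction of the cotilting case to the tilting case. -/

namespace IsCotilting

variable {c} (h : c.IsCotilting)
include h

lemma extOrth_of_finiteResolution {A : ModuleCat.{u} Λ}
    (hA : FiniteResolution (IsSummand c.V) A) : ExtOrth.{u + 1, u} c.V A := by
  induction hA with
  | zero X hX =>
    have := hX.injective
    exact extOrth_of_injective c.V X
  | step E hE h₂ h₁ ih => exact ExtOrth.Y₃ hE ih fun i hi => h₂.subsingleton_right (h.self i hi)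

/-- The class of modules with a finite resolution is used in place of the full orthogonal class
because it contains `IC` by hypothesis and generates itself one step at a time. -/
lemma isGeneratedBy_H :
    IsGeneratedBy c.H (FiniteResolution (IsSummand c.V)) (IsSummand c.V) := by
  intro X hX
  cases hX with
  | zero X hX =>
    refine ⟨ShortComplex.mk (𝟙 X) (𝟙 X) (hX.eq_of_src _ _), ?_, rfl, .of_isZero hX, .zero X hX, ?_⟩
    · exact ShortComplex.ShortExact.mk (ShortComplex.exact_of_isZero_X₂ _ hX)
    · rw [c.H.map_id]
      infer_instance
  | step E hE h₂ h₁ => exact ⟨E, hE, rfl, h₂, h₁, c.epi_map_H hE (h.extOrth_of_finiteResolution h₁ 1 one_pos)⟩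

lemma isIso_counit (T : ModuleCat.{u} Λ) (hT : IsSummand c.V T) : IsIso (c.adjG.counit.app T) :=
  hT.isIso_app c.adjG.counit (c.counit_V h.unit)

lemma projective_HV : Projective (c.H.obj c.V) := by
  have := h.unit
  exact Projective.of_iso ((asIso (c.adjG.unit.app (ModuleCat.of Γ Γ))).trans
    (c.H.mapIso c.isoGV)) (projective_of_generator Γ)

/-- `W` is `H IC`, and `IC` is both injective and finitely resolved by summands of powers of `V`;
these become projective under `H`. -/
lemma self_W : ExtOrth.{u + 1, u} c.W c.W := by
  refine ExtOrth.of_iso ?_ c.isoHW.symm c.isoHW.symm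
  refine extOrth_map_right c.adjG h.isGeneratedBy_H h.isIso_counit _ (fun T hT => ?_) _
    h.resolution
  have := h.projective_HV
  have := (hT.map c.H).projective
  exact extOrth_of_projective _ _

lemma projectiveDimension_H {A : ModuleCat.{u} Λ} (hA : FiniteResolution (IsSummand c.V) A) :
    ∃ n, HasProjectiveDimensionLT (c.H.obj A) n := by
  induction hA with
  | zero X hX => exact ⟨0, (c.H.map_isZero hX).hasProjectiveDimensionLT_zero⟩
  | step E hE h₂ h₁ ih =>
    obtain ⟨n, hn⟩ := ih
    have hH := c.shortExact_H hE (h.extOrth_of_finiteResolution h₁ 1 one_pos)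
    have := h.projective_HV
    have := (h₂.map c.H).projective
    have h₂ : HasProjectiveDimensionLT (E.map c.H).X₂ (n + 1) :=
      hasProjectiveDimensionLT_of_ge (c.H.obj E.X₂) 1 (n + 1) (by omega)
    exact ⟨n + 1, hH.hasProjectiveDimensionLT_X₃ n hn h₂⟩

-- Orthogonality to `V` passes to cosyzygies, so `H` preserves exactness of a finite injective
-- coresolution and turns its terms into summands of powers of `W`.
omit h in
lemma finiteCoresolution_H {M : ModuleCat.{u} Λ} (hM : Module.Finite Λ M)
    (hV : ExtOrth.{u + 1, u} c.V M) (n : ℕ) (hn : HasInjectiveDimensionLT M (n + 1)) :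
    FiniteCoresolution (IsSummand c.W) (c.H.obj M) := by
  induction n generalizing M with
  | zero =>
    have : Injective M := injective_iff_hasInjectiveDimensionLT_one.2 hn
    exact .of_mem (((c.isSummand_of_injective hM this).map c.H).of_iso c.isoHW)
  | succ n ih =>
    obtain ⟨m, f, _⟩ := c.embedding_IC M hM
    have hE := shortExact_of_mono f
    have hI := isSummand_pi c.IC m
    refine .step _ (c.shortExact_H hE (hV 1 one_pos)) ((hI.map c.H).of_iso c.isoHW)
      (ih (finite_of_epi (cokernel.π f) (hI.finite c.finite_IC))
        (hV.Y₃ hE (extOrth_of_injective _ _)) ?_)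
    exact hE.hasInjectiveDimensionLT_X₃ (n + 1)
      (hasInjectiveDimensionLT_of_ge (ModuleCat.of Λ (Fin m → c.IC)) 1 _ (by omega)) hn

/-- Cotilting modules become tilting when the roles of the rings are interchanged. -/
lemma isTilting_swap : c.swap.IsTilting where
  unit := c.unit_iff'.2 (isIso_counit_of_isGeneratedBy c.adjG h.isGeneratedBy_H h.isIso_counit _
    h.resolution)
  self := h.self_W
  pd := by
    obtain ⟨n, hn⟩ := h.projectiveDimension_H h.resolution
    exact ⟨n, hasProjectiveDimensionLT_of_iso c.isoHW n⟩
  coresolution := by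
    obtain ⟨n, hn⟩ := h.injd
    have := h.unit
    -- Applied to `V` itself, whose image under `H` is the regular module of `Γ`.
    exact (finiteCoresolution_H c.finite_V h.self n
      (hasInjectiveDimensionLT_of_ge c.V n _ (by omega))).of_iso
        ((asIso (c.adjG.unit.app (ModuleCat.of Γ Γ))).trans (c.H.mapIso c.isoGV))

end IsCotilting

end BimoduleContext

end ExtVanishing

/-! ### Stable categories and sequences over the repetitive algebra. -/

namespace ExtVanishing

open Limits

section StablyZero

variable {C : Type*} [Category C] [Preadditive C]

/-- A morphism is stably zero if it factors through a projective object. -/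
def IsStablyZero {X Y : C} (f : X ⟶ Y) : Prop :=
  ∃ (P : C) (_ : Projective P) (a : X ⟶ P) (b : P ⟶ Y), a ≫ b = f

omit [Preadditive C] in
lemma isStablyZero_of_projective {X P Y : C} [Projective P] (a : X ⟶ P) (b : P ⟶ Y) :
    IsStablyZero (a ≫ b) := ⟨P, ‹_›, a, b, rfl⟩

omit [Preadditive C] in
lemma IsStablyZero.comp {X Y Z : C} {f : X ⟶ Y} (hf : IsStablyZero f) (g : Y ⟶ Z) :
    IsStablyZero (f ≫ g) := by
  obtain ⟨P, hP, a, b, rfl⟩ := hf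
  exact ⟨P, hP, a, b ≫ g, by simp⟩

omit [Preadditive C] in
lemma IsStablyZero.precomp {X Y Z : C} {g : Y ⟶ Z} (hg : IsStablyZero g) (f : X ⟶ Y) :
    IsStablyZero (f ≫ g) := by
  obtain ⟨P, hP, a, b, rfl⟩ := hg
  exact ⟨P, hP, f ≫ a, b, by simp⟩

lemma IsStablyZero.neg {X Y : C} {f : X ⟶ Y} (hf : IsStablyZero f) : IsStablyZero (-f) := by
  obtain ⟨P, hP, a, b, rfl⟩ := hf
  exact ⟨P, hP, a, -b, by simp⟩

lemma IsStablyZero.add [HasBinaryBiproducts C] {X Y : C} {f g : X ⟶ Y} (hf : IsStablyZero f)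
    (hg : IsStablyZero g) : IsStablyZero (f + g) := by
  obtain ⟨P, hP, a, b, rfl⟩ := hf
  obtain ⟨Q, hQ, a', b', rfl⟩ := hg
  exact ⟨P ⊞ Q, inferInstance, biprod.lift a a', biprod.desc b b', by simp⟩

variable (C) in
/-- The relation defining the stable category. -/
def stableRel : HomRel C := fun _ _ f g => IsStablyZero (f - g)

instance [HasBinaryBiproducts C] [HasZeroObject C] : Congruence (stableRel C) where
  equivalence :=
    { refl := fun f => by
        obtain ⟨Z, hZ⟩ := HasZeroObject.zero (C := C)
        refine ⟨Z, ⟨fun f g _ => ⟨0, hZ.eq_of_src _ _⟩⟩, 0, 0, by simp⟩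
      symm := fun {f g} h => by simpa [stableRel] using IsStablyZero.neg h
      trans := fun {f g h} h₁ h₂ => by simpa [stableRel] using IsStablyZero.add h₁ h₂ }
  comp_left f _ _ h := by
    simpa [stableRel, Preadditive.comp_sub] using IsStablyZero.precomp h f
  comp_right g h := by
    simpa [stableRel, Preadditive.sub_comp] using IsStablyZero.comp h g

end StablyZero

section Shift

/-- Structure maps start at index `i + 1`, so terms and maps are naturally defined at successors.
Every integer is one, but only up to a propositional equality, which this lemma absorbs once and for
all. -/
lemma exists_shift {β : ℤ → Sort*} (f : ∀ i, β (i + 1)) : ∃ g : ∀ i, β i, ∀ i, g (i + 1) = f i :=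
  ⟨Equiv.piCongrLeft β (Equiv.addRight (1 : ℤ)) f,
    fun i => Equiv.piCongrLeft_apply_apply β (Equiv.addRight (1 : ℤ)) f i⟩

lemma forall_of_forall_succ {p : ℤ → Prop} (h : ∀ i, p (i + 1)) (i : ℤ) : p i := by
  simpa using h (i - 1)

lemma eventually_succ {p : ℤ → Prop} (h : ∀ᶠ i in Filter.cofinite, p i) :
    ∀ᶠ i in Filter.cofinite, p (i + 1) :=
  (add_left_injective (1 : ℤ)).tendsto_cofinite.eventually h

lemma eventually_pred {p : ℤ → Prop} (h : ∀ᶠ i in Filter.cofinite, p i) :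
    ∀ᶠ i in Filter.cofinite, p (i - 1) :=
  (sub_left_injective (b := (1 : ℤ))).tendsto_cofinite.eventually h

end Shift

/-- Bounded sequences of finitely generated modules with maps `X (i + 1) ⟶ N (X i)` such that
consecutive ones compose to zero. -/
structure RepetitiveModule {Λ : Type u} [Ring Λ] (N : ModuleCat.{u} Λ ⥤ ModuleCat.{u} Λ) where
  X : ℤ → ModuleCat.{u} Λ
  δ : ∀ i, X (i + 1) ⟶ N.obj (X i)
  finite : ∀ i, Module.Finite Λ (X i)
  bounded : ∀ᶠ i in Filter.cofinite, IsZero (X i)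
  δ_comp_δ : ∀ i, δ (i + 1) ≫ N.map (δ i) = 0

namespace RepetitiveModule

variable {Λ : Type u} [Ring Λ] {N : ModuleCat.{u} Λ ⥤ ModuleCat.{u} Λ}

/-- Morphisms are families of maps that commute with the structure maps. -/
@[ext]
structure Hom (X Y : RepetitiveModule N) where
  f : ∀ i, X.X i ⟶ Y.X i
  comm : ∀ i, X.δ i ≫ N.map (f i) = f (i + 1) ≫ Y.δ i

instance : Category (RepetitiveModule N) where
  Hom := Hom
  id X := ⟨fun i => 𝟙 (X.X i), fun i => by simp⟩
  comp f g := ⟨fun i => f.f i ≫ g.f i, fun i => by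
    rw [Functor.map_comp, reassoc_of% f.comm, g.comm, Category.assoc]⟩

@[ext]
lemma hom_ext {X Y : RepetitiveModule N} {f g : X ⟶ Y} (h : ∀ i, Hom.f f i = Hom.f g i) : f = g :=
  Hom.ext (funext h)

@[simp]
lemma id_f (X : RepetitiveModule N) (i : ℤ) : Hom.f (𝟙 X) i = 𝟙 (X.X i) := rfl

@[simp]
lemma comp_f {X Y Z : RepetitiveModule N} (f : X ⟶ Y) (g : Y ⟶ Z) (i : ℤ) :
    Hom.f (f ≫ g) i = Hom.f f i ≫ Hom.f g i := rfl

lemma comm {X Y : RepetitiveModule N} (f : X ⟶ Y) (i : ℤ) :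
    X.δ i ≫ N.map (Hom.f f i) = Hom.f f (i + 1) ≫ Y.δ i := Hom.comm f i

variable [N.Additive]

section Preadditive

variable {X Y : RepetitiveModule N}

instance : Zero (X ⟶ Y) := ⟨⟨fun _ => 0, by simp⟩⟩

instance : Add (X ⟶ Y) := ⟨fun f g => ⟨fun i => Hom.f f i + Hom.f g i, fun i => by
  rw [Functor.map_add, Preadditive.comp_add, Preadditive.add_comp, comm, comm]⟩⟩

instance : Neg (X ⟶ Y) := ⟨fun f => ⟨fun i => -Hom.f f i, fun i => by
  rw [Functor.map_neg, Preadditive.comp_neg, Preadditive.neg_comp, comm]⟩⟩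

instance : Sub (X ⟶ Y) := ⟨fun f g => ⟨fun i => Hom.f f i - Hom.f g i, fun i => by
  rw [Functor.map_sub, Preadditive.comp_sub, Preadditive.sub_comp, comm, comm]⟩⟩

@[simp] lemma zero_f (i : ℤ) : Hom.f (0 : X ⟶ Y) i = 0 := rfl

@[simp] lemma add_f (f g : X ⟶ Y) (i : ℤ) : Hom.f (f + g) i = Hom.f f i + Hom.f g i := rfl

@[simp] lemma neg_f (f : X ⟶ Y) (i : ℤ) : Hom.f (-f) i = -Hom.f f i := rfl

@[simp] lemma sub_f (f g : X ⟶ Y) (i : ℤ) : Hom.f (f - g) i = Hom.f f i - Hom.f g i := rfl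

instance : AddCommGroup (X ⟶ Y) where
  add_assoc _ _ _ := by ext i : 1; simp [add_assoc]
  zero_add _ := by ext i : 1; simp
  add_zero _ := by ext i : 1; simp
  add_comm _ _ := by ext i : 1; simp [add_comm]
  neg_add_cancel _ := by ext i : 1; simp
  sub_eq_add_neg _ _ := by ext i : 1; simp [sub_eq_add_neg]
  nsmul := nsmulRec
  zsmul := zsmulRec

instance : Preadditive (RepetitiveModule N) where
  add_comp _ _ _ _ _ _ := by ext i : 1; simp
  comp_add _ _ _ _ _ _ := by ext i : 1; simp

end Preadditive

/-- The zero sequence. -/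
def zero (N : ModuleCat.{u} Λ ⥤ ModuleCat.{u} Λ) : RepetitiveModule N where
  X _ := ModuleCat.of Λ PUnit
  δ _ := 0
  finite _ := inferInstance
  bounded := .of_forall fun _ => ModuleCat.isZero_of_subsingleton _
  δ_comp_δ _ := by simp

omit [N.Additive] in
lemma isZero_zero_X (i : ℤ) : IsZero ((zero N).X i) :=
  ModuleCat.isZero_of_subsingleton (ModuleCat.of Λ PUnit)

instance : HasZeroObject (RepetitiveModule N) where
  zero := ⟨zero N, (IsZero.iff_id_eq_zero _).2 (by
    ext i : 1
    exact (isZero_zero_X i).eq_of_src _ _)⟩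

/-- The direct sum of two sequences. -/
noncomputable def sum (X Y : RepetitiveModule N) : RepetitiveModule N where
  X i := X.X i ⊞ Y.X i
  δ i := biprod.desc (X.δ i ≫ N.map biprod.inl) (Y.δ i ≫ N.map biprod.inr)
  finite i :=
    have := X.finite i
    have := Y.finite i
    Module.Finite.equiv (ModuleCat.biprodIsoProd (X.X i) (Y.X i)).toLinearEquiv.symm
  bounded := by
    filter_upwards [X.bounded, Y.bounded] with i hX hY
    rw [biprod_isZero_iff]
    exact ⟨hX, hY⟩
  δ_comp_δ i := by
    refine biprod.hom_ext' _ _ ?_ ?_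
    · rw [biprod.inl_desc_assoc, Category.assoc, ← N.map_comp, biprod.inl_desc, N.map_comp,
        reassoc_of% X.δ_comp_δ, zero_comp, comp_zero]
    · rw [biprod.inr_desc_assoc, Category.assoc, ← N.map_comp, biprod.inr_desc, N.map_comp,
        reassoc_of% Y.δ_comp_δ, zero_comp, comp_zero]

/-- The direct sum with its injections and projections. -/
noncomputable def bicone (X Y : RepetitiveModule N) : BinaryBicone X Y where
  pt := sum X Y
  fst := ⟨fun i => (biprod.fst : X.X i ⊞ Y.X i ⟶ X.X i), fun i => biprod.hom_ext' _ _
    (by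
      simp only [sum, biprod.inl_desc_assoc, Category.assoc, ← N.map_comp, biprod.inl_fst,
        biprod.inl_fst_assoc, N.map_id, Category.comp_id])
    (by
      simp only [sum, biprod.inr_desc_assoc, Category.assoc, ← N.map_comp, biprod.inr_fst,
        biprod.inr_fst_assoc, N.map_zero, comp_zero, zero_comp])⟩
  snd := ⟨fun i => (biprod.snd : X.X i ⊞ Y.X i ⟶ Y.X i), fun i => biprod.hom_ext' _ _
    (by
      simp only [sum, biprod.inl_desc_assoc, Category.assoc, ← N.map_comp, biprod.inl_snd,
        biprod.inl_snd_assoc, N.map_zero, comp_zero, zero_comp])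
    (by
      simp only [sum, biprod.inr_desc_assoc, Category.assoc, ← N.map_comp, biprod.inr_snd,
        biprod.inr_snd_assoc, N.map_id, Category.comp_id])⟩
  inl := ⟨fun i => (biprod.inl : X.X i ⟶ X.X i ⊞ Y.X i), fun i => (biprod.inl_desc _ _).symm⟩
  inr := ⟨fun i => (biprod.inr : Y.X i ⟶ X.X i ⊞ Y.X i), fun i => (biprod.inr_desc _ _).symm⟩
  inl_fst := hom_ext fun _ => biprod.inl_fst
  inl_snd := hom_ext fun _ => biprod.inl_snd
  inr_fst := hom_ext fun _ => biprod.inr_fst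
  inr_snd := hom_ext fun _ => biprod.inr_snd

instance : HasBinaryBiproducts (RepetitiveModule N) where
  has_binary_biproduct X Y := HasBinaryBiproduct.mk
    ⟨bicone X Y, isBinaryBilimitOfTotal _ (hom_ext fun _ => biprod.total)⟩

omit [N.Additive] in
lemma epi_of_forall {X Y : RepetitiveModule N} (f : X ⟶ Y) (h : ∀ i, Epi (Hom.f f i)) : Epi f :=
  ⟨fun g g' hg => by
    ext i : 1
    rw [← cancel_epi (Hom.f f i)]
    exact congrArg (fun φ => Hom.f φ i) hg⟩

/-- The componentwise cokernels inherit structure maps and form a sequence. The projection to it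
vanishes after `f`, hence is zero, so each cokernel is zero. -/
lemma epi_f {X Y : RepetitiveModule N} (f : X ⟶ Y) [Epi f] (i : ℤ) : Epi (Hom.f f i) := by
  let Z : RepetitiveModule N :=
    { X := fun i => cokernel (Hom.f f i)
      δ := fun i => cokernel.desc _ (Y.δ i ≫ N.map (cokernel.π (Hom.f f i))) (by
        rw [← Category.assoc, ← comm, Category.assoc, ← N.map_comp, cokernel.condition]
        simp)
      finite := fun i => finite_of_epi (cokernel.π (Hom.f f i)) (Y.finite i)
      bounded := Y.bounded.mono fun i hi => IsZero.of_epi (cokernel.π (Hom.f f i)) hi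
      δ_comp_δ := fun i => by
        rw [← cancel_epi (cokernel.π _)]
        simp only [cokernel.π_desc_assoc, Category.assoc, ← N.map_comp, cokernel.π_desc, comp_zero]
        simp [N.map_comp, reassoc_of% Y.δ_comp_δ] }
  let p : Y ⟶ Z := ⟨fun i => cokernel.π (Hom.f f i), fun i => by simp [Z]⟩
  have hp : p = 0 := by
    rw [← cancel_epi f, comp_zero]
    ext i : 1
    exact cokernel.condition _
  refine Preadditive.epi_of_cokernel_zero ?_
  exact congrArg (fun φ => Hom.f φ i) hp

end RepetitiveModule

end ExtVanishing

/-! ### Coinduced sequences: enough projectives. -/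

namespace ExtVanishing

open Limits

namespace RepetitiveModule

variable {Λ : Type u} [Ring Λ] {N : ModuleCat.{u} Λ ⥤ ModuleCat.{u} Λ}

/-- A class of finitely generated modules on which `N` is fully faithful with projective values
that generate all finitely generated modules. -/
structure IsInducing (N : ModuleCat.{u} Λ ⥤ ModuleCat.{u} Λ)
    (𝓘 : ObjectProperty (ModuleCat.{u} Λ)) : Prop where
  finite : ∀ I, 𝓘 I → Module.Finite Λ I
  finite_map : ∀ I, 𝓘 I → Module.Finite Λ (N.obj I)
  projective : ∀ I, 𝓘 I → Projective (N.obj I)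
  bijective : ∀ I, 𝓘 I → ∀ M, Function.Bijective (N.map : (I ⟶ M) → (N.obj I ⟶ N.obj M))
  of_isZero : ∀ I, IsZero I → 𝓘 I
  cover : ∀ X : ModuleCat.{u} Λ, Module.Finite Λ X → ∃ I, 𝓘 I ∧ ∃ f : N.obj I ⟶ X, Epi f

/-- Zero modules are covered by zero, so that families chosen termwise stay bounded. -/
lemma IsInducing.exists_cover {𝓘 : ObjectProperty (ModuleCat.{u} Λ)} (h : IsInducing N 𝓘)
    (X : ModuleCat.{u} Λ) (hX : Module.Finite Λ X) :
    ∃ I, 𝓘 I ∧ (IsZero X → IsZero I) ∧ ∃ f : N.obj I ⟶ X, Epi f := by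
  by_cases h0 : IsZero X
  · exact ⟨X, h.of_isZero X h0, id, 0, ⟨fun _ _ _ => h0.eq_of_src _ _⟩⟩
  · obtain ⟨I, hI, f⟩ := h.cover X hX
    exact ⟨I, hI, fun h => (h0 h).elim, f⟩

/-- Families from which coinduced sequences are built. -/
structure Family (N : ModuleCat.{u} Λ ⥤ ModuleCat.{u} Λ)
    (𝓘 : ObjectProperty (ModuleCat.{u} Λ)) where
  I : ℤ → ModuleCat.{u} Λ
  mem : ∀ i, 𝓘 (I i)
  bounded : ∀ᶠ i in Filter.cofinite, IsZero (I i)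

/-- The identification of the reindexed terms of a family. -/
def shiftIso (I : ℤ → ModuleCat.{u} Λ) (i : ℤ) : I (i + 1 - 1) ≅ I i :=
  eqToIso (congrArg I (by ring))

variable [N.Additive] {𝓘 : ObjectProperty (ModuleCat.{u} Λ)} (h : IsInducing N 𝓘) (F : Family N 𝓘)

namespace Family

/-- The coinduced sequence with terms `I i ⊞ N (I (i - 1))`. -/
noncomputable def coind : RepetitiveModule N where
  X i := F.I i ⊞ N.obj (F.I (i - 1))
  δ i := (biprod.snd : F.I (i + 1) ⊞ N.obj (F.I (i + 1 - 1)) ⟶ _) ≫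
    N.map ((shiftIso F.I i).hom ≫ biprod.inl)
  finite i :=
    have := h.finite _ (F.mem i)
    have := h.finite_map _ (F.mem (i - 1))
    Module.Finite.equiv
      (ModuleCat.biprodIsoProd (F.I i) (N.obj (F.I (i - 1)))).toLinearEquiv.symm
  bounded := by
    filter_upwards [F.bounded, eventually_pred F.bounded] with i h₁ h₂
    rw [biprod_isZero_iff]
    exact ⟨h₁, N.map_isZero h₂⟩
  δ_comp_δ i := by
    rw [Category.assoc, ← N.map_comp, Category.assoc, biprod.inl_snd_assoc, zero_comp,
      comp_zero, N.map_zero, comp_zero]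

/-- Projection to the first summand. -/
noncomputable def fst (i : ℤ) : (F.coind h).X i ⟶ F.I i :=
  (biprod.fst : F.I i ⊞ N.obj (F.I (i - 1)) ⟶ F.I i)

/-- Inclusion of the first summand. -/
noncomputable def inl (i : ℤ) : F.I i ⟶ (F.coind h).X i :=
  (biprod.inl : F.I i ⟶ F.I i ⊞ N.obj (F.I (i - 1)))

/-- Projection to the second summand, after reindexing. -/
noncomputable def snd (i : ℤ) : (F.coind h).X (i + 1) ⟶ N.obj (F.I i) :=
  (biprod.snd : F.I (i + 1) ⊞ N.obj (F.I (i + 1 - 1)) ⟶ _) ≫ N.map (shiftIso F.I i).hom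

/-- Inclusion of the second summand, after reindexing. -/
noncomputable def inr (i : ℤ) : N.obj (F.I i) ⟶ (F.coind h).X (i + 1) :=
  N.map (shiftIso F.I i).inv ≫ (biprod.inr : N.obj (F.I (i + 1 - 1)) ⟶ F.I (i + 1) ⊞ _)

lemma δ_eq (i : ℤ) : (F.coind h).δ i = F.snd h i ≫ N.map (F.inl h i) := by
  simp [coind, snd, inl]

@[simp] lemma inl_fst (i : ℤ) : F.inl h i ≫ F.fst h i = 𝟙 _ := biprod.inl_fst

@[simp] lemma inr_fst (i : ℤ) : F.inr h i ≫ F.fst h (i + 1) = 0 :=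
  (Category.assoc _ _ _).trans ((congrArg (_ ≫ ·) biprod.inr_fst).trans comp_zero)

@[simp] lemma inl_snd (i : ℤ) : F.inl h (i + 1) ≫ F.snd h i = 0 :=
  (biprod.inl_snd_assoc _).trans zero_comp

@[simp] lemma inr_snd (i : ℤ) : F.inr h i ≫ F.snd h i = 𝟙 _ :=
  (Category.assoc _ _ _).trans ((congrArg (_ ≫ ·) (biprod.inr_snd_assoc _)).trans
    (N.mapIso (shiftIso F.I i)).inv_hom_id)

lemma total (i : ℤ) :
    F.fst h (i + 1) ≫ F.inl h (i + 1) + F.snd h i ≫ F.inr h i = 𝟙 ((F.coind h).X (i + 1)) := by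
  have h₁ {A B B' : ModuleCat.{u} Λ} (e : B ≅ B') : (biprod.fst : A ⊞ B ⟶ A) ≫ biprod.inl +
      (biprod.snd ≫ e.hom) ≫ e.inv ≫ biprod.inr = 𝟙 (A ⊞ B) := by simp
  exact h₁ (N.mapIso (shiftIso F.I i))

lemma hom_ext_from {i : ℤ} {M : ModuleCat.{u} Λ} {a b : (F.coind h).X (i + 1) ⟶ M}
    (h₁ : F.inl h (i + 1) ≫ a = F.inl h (i + 1) ≫ b) (h₂ : F.inr h i ≫ a = F.inr h i ≫ b) :
    a = b := by
  rw [← Category.id_comp a, ← Category.id_comp b, ← F.total h, Preadditive.add_comp,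
    Preadditive.add_comp]
  simp only [Category.assoc, h₁, h₂]

variable {X : RepetitiveModule N}

/-- The second component of a map to a coinduced sequence is forced by the first, through
compatibility with the structure maps. -/
lemma comp_snd (φ : X ⟶ F.coind h) (i : ℤ) :
    Hom.f φ (i + 1) ≫ F.snd h i = X.δ i ≫ N.map (Hom.f φ i ≫ F.fst h i) := by
  have := comm φ i =≫ N.map (F.fst h i)
  rw [δ_eq, Category.assoc, Category.assoc, Category.assoc, ← N.map_comp, ← N.map_comp, inl_fst,
    N.map_id, Category.comp_id] at this
  exact this.symm

/-- Morphisms to a coinduced sequence. -/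
lemma exists_lift (x : ∀ i, X.X i ⟶ F.I i) :
    ∃ φ : X ⟶ F.coind h, ∀ i, Hom.f φ i ≫ F.fst h i = x i := by
  obtain ⟨f, hf⟩ := exists_shift (β := fun i => X.X i ⟶ (F.coind h).X i)
    fun i => x (i + 1) ≫ F.inl h (i + 1) + X.δ i ≫ N.map (x i) ≫ F.inr h i
  have h1 : ∀ i, f i ≫ F.fst h i = x i := forall_of_forall_succ fun i => by
    rw [hf, Preadditive.add_comp]
    simp
  refine ⟨⟨f, fun i => ?_⟩, h1⟩
  rw [hf, δ_eq, Preadditive.add_comp]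
  have h2 : X.δ i ≫ N.map (f i) = X.δ i ≫ N.map (x i ≫ F.inl h i) := by
    -- The second summand of `f` at index `i` involves the structure map ending there, and it dies
    -- because consecutive structure maps compose to zero. Stating this for an arbitrary map `a`
    -- allows `i` to be replaced by a successor.
    suffices ∀ i, ∀ (M : ModuleCat.{u} Λ) (a : M ⟶ N.obj (X.X i)),
        (∀ j (e : i = j + 1), (a ≫ N.map (eqToHom (congrArg X.X e))) ≫ N.map (X.δ j) = 0) →
        a ≫ N.map (f i) = a ≫ N.map (x i ≫ F.inl h i) by
      refine this i _ _ fun j e => ?_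
      subst e
      simp [X.δ_comp_δ]
    refine forall_of_forall_succ fun i M a ha => ?_
    have := ha i rfl
    rw [eqToHom_refl, N.map_id, Category.comp_id] at this
    rw [hf, N.map_add, Preadditive.comp_add, N.map_comp (X.δ i), reassoc_of% this, zero_comp,
      add_zero]
  rw [h2]
  simp [N.map_comp, reassoc_of% F.inl_snd h i, reassoc_of% F.inr_snd h i]

/-- Morphisms from a coinduced sequence. -/
lemma exists_desc (s : ∀ i, F.I i ⟶ X.X i) (r : ∀ i, N.obj (F.I i) ⟶ X.X (i + 1))
    (hs : ∀ i, s (i + 1) ≫ X.δ i = 0) (hr : ∀ i, r i ≫ X.δ i = N.map (s i)) :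
    ∃ ψ : F.coind h ⟶ X, (∀ i, F.inl h i ≫ Hom.f ψ i = s i) ∧
      ∀ i, F.inr h i ≫ Hom.f ψ (i + 1) = r i := by
  obtain ⟨f, hf⟩ := exists_shift (β := fun i => (F.coind h).X i ⟶ X.X i)
    fun i => F.fst h (i + 1) ≫ s (i + 1) + F.snd h i ≫ r i
  have h1 : ∀ i, F.inl h i ≫ f i = s i := forall_of_forall_succ fun i => by
    rw [hf, Preadditive.comp_add]
    simp [reassoc_of% F.inl_fst h (i + 1), reassoc_of% F.inl_snd h i]
  refine ⟨⟨f, fun i => ?_⟩, h1, fun i => ?_⟩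
  · rw [δ_eq, Category.assoc, ← N.map_comp, h1, hf, Preadditive.add_comp, Category.assoc,
      Category.assoc, hs, hr, comp_zero, zero_add]
  · change _ ≫ f (i + 1) = _
    rw [hf, Preadditive.comp_add]
    simp [reassoc_of% F.inr_fst h i, reassoc_of% F.inr_snd h i]

lemma lift_desc {Y : RepetitiveModule N} (φ : X ⟶ F.coind h) (ψ : F.coind h ⟶ Y) (i : ℤ) :
    Hom.f (φ ≫ ψ) (i + 1) =
      (Hom.f φ (i + 1) ≫ F.fst h (i + 1)) ≫ F.inl h (i + 1) ≫ Hom.f ψ (i + 1) +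
      X.δ i ≫ N.map (Hom.f φ i ≫ F.fst h i) ≫ F.inr h i ≫ Hom.f ψ (i + 1) := by
  have := F.total h i
  rw [comp_f, ← reassoc_of% F.comp_snd h φ i]
  conv_lhs => rw [← Category.id_comp (Hom.f ψ (i + 1)), ← this]
  simp

lemma inr_δ (ψ : F.coind h ⟶ X) (i : ℤ) :
    (F.inr h i ≫ Hom.f ψ (i + 1)) ≫ X.δ i = N.map (F.inl h i ≫ Hom.f ψ i) := by
  rw [Category.assoc, ← comm, δ_eq, Category.assoc, reassoc_of% F.inr_snd h i, N.map_comp]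

/-- The restriction to `F.I i` becomes, under `N`, the restriction to the second summand followed by
a structure map; `N` is faithful on such maps. -/
lemma hom_ext_inr {ψ ψ' : F.coind h ⟶ X}
    (hψ : ∀ i, F.inr h i ≫ Hom.f ψ (i + 1) = F.inr h i ≫ Hom.f ψ' (i + 1)) : ψ = ψ' := by
  refine hom_ext (forall_of_forall_succ fun i => F.hom_ext_from h ?_ (hψ i))
  apply (h.bijective _ (F.mem (i + 1)) _).1
  rw [← inr_δ, ← inr_δ, hψ]

/-- By fullness of `N` the composite with the structure map comes from a map on `F.I i`, and by
faithfulness the compatibility of these maps can be checked after `N`. Coinduced sequences are thus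
also induced, which makes them projective. -/
lemma exists_desc_inr (r : ∀ i, N.obj (F.I i) ⟶ X.X (i + 1)) :
    ∃ ψ : F.coind h ⟶ X, ∀ i, F.inr h i ≫ Hom.f ψ (i + 1) = r i := by
  choose s hs using fun i => (h.bijective _ (F.mem i) _).2 (r i ≫ X.δ i)
  obtain ⟨ψ, -, hψ⟩ := F.exists_desc h s r (fun i => by
    apply (h.bijective _ (F.mem (i + 1)) _).1
    rw [N.map_comp, hs, Category.assoc, X.δ_comp_δ, comp_zero, N.map_zero]) fun i => (hs i).symm
  exact ⟨ψ, hψ⟩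

lemma projective_coind : Projective (F.coind h) where
  factors {E X} f e _ := by
    have := fun i => h.projective _ (F.mem i)
    have := epi_f e
    obtain ⟨ψ, hψ⟩ := F.exists_desc_inr h (X := E) fun i =>
      Projective.factorThru (F.inr h i ≫ Hom.f f (i + 1)) (Hom.f e (i + 1))
    refine ⟨ψ, F.hom_ext_inr h fun i => ?_⟩
    rw [comp_f, reassoc_of% hψ i, Projective.factorThru_comp]

end Family

include h in
lemma exists_epi_coind (X : RepetitiveModule N) :
    ∃ (F : Family N 𝓘) (f : F.coind h ⟶ X), Epi f := by
  choose I hI h0 f hf using fun i => h.exists_cover (X.X (i + 1)) (X.finite (i + 1))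
  let F : Family N 𝓘 := ⟨I, hI, (eventually_succ X.bounded).mono h0⟩
  obtain ⟨ψ, hψ⟩ := F.exists_desc_inr h f
  refine ⟨F, ψ, epi_of_forall ψ (forall_of_forall_succ fun i => ?_)⟩
  have : Epi (F.inr h i ≫ Hom.f ψ (i + 1)) := by
    rw [hψ]
    exact hf i
  exact epi_of_epi (F.inr h i) _

-- A projective object is a retract of a coinduced sequence covering it, so coinduced sequences
-- suffice to detect stably zero maps.
include h in
lemma exists_factor_coind {X Y : RepetitiveModule N} {f : X ⟶ Y} (hf : IsStablyZero f) :
    ∃ (F : Family N 𝓘) (a : X ⟶ F.coind h) (b : F.coind h ⟶ Y), a ≫ b = f := by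
  obtain ⟨P, hP, a, b, rfl⟩ := hf
  obtain ⟨F, e, _⟩ := exists_epi_coind h P
  exact ⟨F, a ≫ Projective.factorThru (𝟙 P) e, e ≫ b, by
    rw [Category.assoc, ← Category.assoc _ e, Projective.factorThru_comp, Category.id_comp]⟩

end RepetitiveModule

end ExtVanishing

/-! ### Approximations used to link sequences over the two rings. -/

namespace ExtVanishing

open Abelian Limits RepetitiveModule

section

variable {C D : Type*} [Category C] [Preadditive C] [Category D] [Preadditive D]

/-- Summands of powers of `N V` are retracts of values of `N`. -/
lemma IsSummand.exists_retract {Λ : Type u} [Ring Λ] {V : ModuleCat.{u} Λ}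
    (N : ModuleCat.{u} Λ ⥤ D) [N.Additive] {X : D} (h : IsSummand (N.obj V) X) :
    ∃ n : ℕ, Nonempty (Retract X (N.obj (ModuleCat.of Λ (Fin n → V)))) := by
  obtain ⟨n, a, b, hab⟩ := h
  let i (j : Fin n) : V ⟶ ModuleCat.of Λ (Fin n → V) :=
    ModuleCat.ofHom (LinearMap.single Λ (fun _ => (V : Type u)) j)
  let p (j : Fin n) : ModuleCat.of Λ (Fin n → V) ⟶ V := ModuleCat.ofHom (LinearMap.proj j)
  have hip (j l : Fin n) : i j ≫ p l = if j = l then 𝟙 _ else 0 := by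
    ext v
    by_cases h : j = l
    · subst h
      simp [i, p]
    · simp [i, p, h, Ne.symm h]
  refine ⟨n, ⟨∑ j, a j ≫ N.map (i j), ∑ l, N.map (p l) ≫ b l, ?_⟩⟩
  simp only [Preadditive.sum_comp, Preadditive.comp_sum, Category.assoc]
  rw [← hab]
  refine Finset.sum_congr rfl fun j _ => ?_
  rw [Finset.sum_eq_single j]
  · rw [← N.map_comp_assoc, hip, if_pos rfl, N.map_id, Category.id_comp]
  · intro l _ hl
    rw [← N.map_comp_assoc, hip, if_neg hl, N.map_zero, zero_comp, comp_zero]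
  · simp

end

namespace BimoduleContext.IsTilting

variable {Λ Γ : Type u} [Ring Λ] [Ring Γ] [IsNoetherianRing Λ] [IsNoetherianRing Γ]
  {c : BimoduleContext Λ Γ} (h : c.IsTilting)
include h

omit [IsNoetherianRing Γ] in
lemma H_bijective {A : ModuleCat.{u} Λ} (hA : rightPerp c.V A) (M : ModuleCat.{u} Λ) :
    Function.Bijective (c.H.map : (A ⟶ M) → (c.H.obj A ⟶ c.H.obj M)) :=
  map_bijective_of_isIso_counit c.adjG (h.counit_rightPerp hA) M

lemma J_bijective {K : ModuleCat.{u} Γ} (hK : rightPerpID c.W K) (Z : ModuleCat.{u} Γ) :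
    Function.Bijective (c.J.map : (K ⟶ Z) → (c.J.obj K ⟶ c.J.obj Z)) :=
  map_bijective_of_isIso_counit c.adjF (h.counit_rightPerpID hK) Z

lemma exists_extend {E : ShortComplex (ModuleCat.{u} Λ)} (hE : E.ShortExact)
    {K : ModuleCat.{u} Γ} (hK : rightPerpID c.W K) (e : E.X₃ ≅ c.J.obj K) {A : ModuleCat.{u} Λ}
    (hA : rightPerp c.V A) (f : E.X₁ ⟶ A) : ∃ g, E.f ≫ g = f :=
  exists_extension hE ((h.isTiltingClass.extOrth (h.leftPerpPD_J hK) hA).of_iso e (Iso.refl _)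
    1 one_pos) f

omit [IsNoetherianRing Γ] in
lemma exists_lift {E : ShortComplex (ModuleCat.{u} Γ)} (hE : E.ShortExact)
    (hK : rightPerpID c.W E.X₁) {A : ModuleCat.{u} Λ} (hA : rightPerp c.V A)
    (f : c.H.obj A ⟶ E.X₃) : ∃ g, g ≫ E.g = f :=
  exists_lifting hE (h.isCotiltingClass.extOrth (h.leftPerp_H hA) hK 1 one_pos) f

omit h [IsNoetherianRing Λ] [IsNoetherianRing Γ] in
lemma rightPerp_of_isZero {X : ModuleCat.{u} Λ} (hX : IsZero X) : rightPerp c.V X :=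
  ⟨(IsSummand.of_isZero (V := c.V) hX).finite c.finite_V, by
    have := (IsSummand.of_isZero (V := c.IC) hX).injective
    exact extOrth_of_injective _ _⟩

omit h [IsNoetherianRing Λ] [IsNoetherianRing Γ] in
lemma rightPerpID_of_isSummand {U : ModuleCat.{u} Γ} (hU : IsSummand c.ID U) :
    rightPerpID c.W U := by
  have := hU.injective
  exact ⟨hU.finite c.finite_ID, extOrth_of_injective _ _, 1, inferInstance⟩

omit h [IsNoetherianRing Λ] [IsNoetherianRing Γ] in
lemma rightPerp_of_isSummand {I : ModuleCat.{u} Λ} (hI : IsSummand c.IC I) :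
    rightPerp c.V I := by
  have := hI.injective
  exact ⟨hI.finite c.finite_IC, extOrth_of_injective _ _⟩

omit [IsNoetherianRing Γ] in
lemma rightPerpID_H {I : ModuleCat.{u} Λ} (hI : IsSummand c.IC I) :
    rightPerpID c.W (c.H.obj I) :=
  h.isCotiltingClass.rightPerpID_of_mem ((hI.map c.H).of_iso c.isoHW)

omit [IsNoetherianRing Γ] in
lemma rightPerp_J {U : ModuleCat.{u} Γ} (hU : IsSummand c.ID U) : rightPerp c.V (c.J.obj U) :=
  h.isTiltingClass.rightPerp_of_mem ((hU.map c.J).of_iso c.isoJV)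

omit [IsNoetherianRing Γ] in
lemma nonempty_iso_HJ : Nonempty (c.J.obj (c.H.obj c.IC) ≅ ModuleCat.of Λ Λ) := by
  have := h.balanced
  exact ⟨(c.J.mapIso c.isoHW).trans ((c.J.mapIso c.isoFW).symm.trans
    (asIso (c.adjF.unit.app (ModuleCat.of Λ Λ))).symm)⟩

omit [IsNoetherianRing Λ] [IsNoetherianRing Γ] in
lemma nonempty_iso_JH : Nonempty (c.H.obj (c.J.obj c.ID) ≅ ModuleCat.of Γ Γ) := by
  have := h.unit
  exact ⟨(c.H.mapIso c.isoJV).trans ((c.H.mapIso c.isoGV).symm.trans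
    (asIso (c.adjG.unit.app (ModuleCat.of Γ Γ))).symm)⟩

/-- Bijectivity composes two steps: `H` is full and faithful on maps out of `IC`, and its value
there is `W`, on which `J` is. The value `JH IC` is the regular module, so retracts of values
include all free modules and give the covers. -/
lemma isInducing_IC : IsInducing (c.H ⋙ c.J) (IsSummand c.IC) where
  finite I hI := hI.finite c.finite_IC
  finite_map I hI := c.finite_J _ (c.finite_H _ (hI.finite c.finite_IC))
  projective I hI := by
    obtain ⟨e⟩ := h.nonempty_iso_HJ
    have := projective_of_generator Λ
    exact ((hI.map (c.H ⋙ c.J)).of_iso e).projective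
  bijective I hI M := (h.J_bijective (h.rightPerpID_H hI) _).comp
    (h.H_bijective (rightPerp_of_isSummand hI) _)
  of_isZero I hI := .of_isZero hI
  cover X hX := by
    obtain ⟨n, f, hf⟩ := exists_epi_of_finite hX
    obtain ⟨e⟩ := h.nonempty_iso_HJ
    obtain ⟨m, ⟨r⟩⟩ := IsSummand.exists_retract (c.H ⋙ c.J)
      ((isSummand_pi (ModuleCat.of Λ Λ) n).of_iso e.symm)
    exact ⟨_, isSummand_pi c.IC m, r.r ≫ f, inferInstance⟩

lemma isInducing_ID : IsInducing (c.J ⋙ c.H) (IsSummand c.ID) where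
  finite I hI := hI.finite c.finite_ID
  finite_map I hI := c.finite_H _ (c.finite_J _ (hI.finite c.finite_ID))
  projective I hI := by
    obtain ⟨e⟩ := h.nonempty_iso_JH
    have := projective_of_generator Γ
    exact ((hI.map (c.J ⋙ c.H)).of_iso e).projective
  bijective I hI M := (h.H_bijective (h.rightPerp_J hI) _).comp
    (h.J_bijective (rightPerpID_of_isSummand hI) _)
  of_isZero I hI := .of_isZero hI
  cover X hX := by
    obtain ⟨n, f, hf⟩ := exists_epi_of_finite hX
    obtain ⟨e⟩ := h.nonempty_iso_JH
    obtain ⟨m, ⟨r⟩⟩ := IsSummand.exists_retract (c.J ⋙ c.H)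
      ((isSummand_pi (ModuleCat.of Γ Γ) n).of_iso e.symm)
    exact ⟨_, isSummand_pi c.ID m, r.r ≫ f, inferInstance⟩

omit [IsNoetherianRing Γ] in
/-- A short exact sequence with a given left term, middle term in `rightPerp V` and right term in
the image of `rightPerpID W`. -/
lemma exists_coresolution (X : ModuleCat.{u} Λ) (hX : Module.Finite Λ X) :
    ∃ (A : ModuleCat.{u} Λ) (K : ModuleCat.{u} Γ) (i : X ⟶ A) (q : A ⟶ c.J.obj K)
      (w : i ≫ q = 0), (ShortComplex.mk i q w).ShortExact ∧ rightPerp c.V A ∧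
      rightPerpID c.W K ∧ (IsZero X → IsZero A) := by
  -- The zero module is treated apart so that the chosen modules vanish wherever the sequence does.
  by_cases h0 : IsZero X
  · have hK : IsZero (ModuleCat.of Γ PUnit) := ModuleCat.isZero_of_subsingleton _
    exact ⟨X, _, 𝟙 X, 0, comp_zero, .mk' (ShortComplex.exact_of_isZero_X₂ _ h0) inferInstance
      ⟨fun _ _ _ => (c.J.map_isZero hK).eq_of_src _ _⟩, rightPerp_of_isZero h0,
      rightPerpID_of_isSummand (.of_isZero hK), id⟩
  · obtain ⟨⟨E, hE, rfl, hA, hB⟩, -⟩ := h.isTiltingClass.isCompletePair X hX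
    -- The cokernel of the left approximation is identified with a value of `J` through the unit.
    have := h.unit_leftPerpPD hB
    let e := asIso (c.adjF.unit.app E.X₃)
    have w : E.f ≫ E.g ≫ e.hom = 0 := by rw [E.zero_assoc, zero_comp]
    exact ⟨E.X₂, c.F.obj E.X₃, E.f, E.g ≫ e.hom, w, ShortComplex.shortExact_of_iso
      (ShortComplex.isoMk (S₁ := E) (S₂ := .mk E.f (E.g ≫ e.hom) w) (Iso.refl _) (Iso.refl _) e)
      hE, hA, h.rightPerpID_F hB, fun h => (h0 h).elim⟩

/-- A short exact sequence with a given right term, middle term in the image of `rightPerp V` and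
left term in `rightPerpID W`. -/
lemma exists_resolution (Y : ModuleCat.{u} Γ) (hY : Module.Finite Γ Y) :
    ∃ (A : ModuleCat.{u} Λ) (K : ModuleCat.{u} Γ) (i : K ⟶ c.H.obj A) (p : c.H.obj A ⟶ Y)
      (w : i ≫ p = 0), (ShortComplex.mk i p w).ShortExact ∧ rightPerp c.V A ∧
      rightPerpID c.W K ∧ (IsZero Y → IsZero A) := by
  by_cases h0 : IsZero Y
  · have hA : IsZero (ModuleCat.of Λ PUnit) := ModuleCat.isZero_of_subsingleton _
    have hHA := c.H.map_isZero hA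
    exact ⟨_, Y, 0, 0, comp_zero, .mk' (ShortComplex.exact_of_isZero_X₂ _ hHA)
      ⟨fun _ _ _ => h0.eq_of_tgt _ _⟩ ⟨fun _ _ _ => h0.eq_of_src _ _⟩, rightPerp_of_isZero hA,
      rightPerpID_of_isSummand (.of_isZero h0), fun _ => hA⟩
  · obtain ⟨-, E, hE, hA, hB, rfl⟩ := h.isCotiltingClass.isCompletePair Y hY
    have := h.unit_leftPerp hB
    let e := asIso (c.adjG.unit.app E.X₂)
    have w : (E.f ≫ e.hom) ≫ e.inv ≫ E.g = 0 := by simp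
    exact ⟨c.G.obj E.X₂, E.X₁, E.f ≫ e.hom, e.inv ≫ E.g, w, ShortComplex.shortExact_of_iso
      (ShortComplex.isoMk (S₁ := E) (S₂ := .mk (E.f ≫ e.hom) (e.inv ≫ E.g) w) (Iso.refl _) e
        (Iso.refl _)) hE, h.rightPerp_G hB, hA, fun h => (h0 h).elim⟩

omit h [IsNoetherianRing Λ] [IsNoetherianRing Γ] in
lemma exists_mono_injective {K : ModuleCat.{u} Γ} (hK : rightPerpID c.W K) :
    ∃ U, IsSummand c.ID U ∧ (IsZero K → IsZero U) ∧ ∃ f : K ⟶ U, Mono f ∧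
      rightPerpID c.W (cokernel f) := by
  by_cases h0 : IsZero K
  · exact ⟨K, .of_isZero h0, id, 𝟙 K, inferInstance,
      rightPerpID_of_isSummand (.of_isZero (IsZero.of_epi (cokernel.π (𝟙 K)) h0))⟩
  · obtain ⟨n, f, hf, hf'⟩ := exists_embedding_rightPerpID hK
    exact ⟨_, isSummand_pi c.ID n, fun h => (h0 h).elim, f, hf, hf'⟩

/-- A generator of `K` is a summand of a power of `W`, hence `H` of its image under `G`, and that
image is a summand of a power of `IC` because `G W ≅ IC`. -/
lemma exists_epi_injective {K : ModuleCat.{u} Γ} (hK : rightPerpID c.W K) :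
    ∃ I, IsSummand c.IC I ∧ (IsZero K → IsZero I) ∧ ∃ f : c.H.obj I ⟶ K, Epi f ∧
      rightPerpID c.W (kernel f) := by
  by_cases h0 : IsZero K
  · have hI : IsZero (ModuleCat.of Λ PUnit) := ModuleCat.isZero_of_subsingleton _
    exact ⟨_, .of_isZero hI, fun _ => hI, 0, ⟨fun _ _ _ => h0.eq_of_src _ _⟩,
      rightPerpID_of_isSummand (.of_isZero (IsZero.of_mono (kernel.ι _) (c.H.map_isZero hI)))⟩
  · obtain ⟨E, hE, rfl, hT, hK'⟩ := h.isCotiltingClass.exists_generator hK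
    have := h.unit_leftPerp (h.isCotiltingClass.leftPerp_of_mem hT)
    have := h.counit_IC
    have := hE.epi_g
    let e := asIso (c.adjG.unit.app E.X₂)
    refine ⟨c.G.obj E.X₂, (hT.map c.G).of_iso ((c.G.mapIso c.isoHW).symm.trans
      (asIso (c.adjG.counit.app c.IC))), fun h => (h0 h).elim, e.inv ≫ E.g, inferInstance, ?_⟩
    have := hE.mono_f
    let i : kernel (e.inv ≫ E.g) ≅ E.X₁ := (kernelIsIsoComp e.inv E.g).trans
      (hE.exact.fIsKernel.conePointUniqueUpToIso (kernelIsKernel E.g)).symm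
    exact IsCotiltingClass.rightPerpID_of_retract ⟨i.hom, i.inv, i.hom_inv_id⟩ hK'

end BimoduleContext.IsTilting

end ExtVanishing

/-! ### Triples linking the two kinds of sequences, and extending or lifting maps to them. -/

namespace ExtVanishing

open Abelian Limits RepetitiveModule

namespace RepetitiveModule

variable {Λ Γ : Type u} [Ring Λ] [Ring Γ] {F : ModuleCat.{u} Λ ⥤ ModuleCat.{u} Γ}
  {G : ModuleCat.{u} Γ ⥤ ModuleCat.{u} Λ} (X : RepetitiveModule (F ⋙ G))

/-- The structure maps over a composite functor. -/
def d (i : ℤ) : X.X (i + 1) ⟶ G.obj (F.obj (X.X i)) := X.δ i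

variable {X}

lemma d_d [F.Additive] [G.Additive] (i : ℤ) : X.d (i + 1) ≫ G.map (F.map (X.d i)) = 0 :=
  X.δ_comp_δ i

lemma d_comm {X' : RepetitiveModule (F ⋙ G)} (f : X ⟶ X') (i : ℤ) :
    X.d i ≫ G.map (F.map (Hom.f f i)) = Hom.f f (i + 1) ≫ X'.d i := comm f i

end RepetitiveModule

variable {Λ Γ : Type u} [Ring Λ] [Ring Γ]

/-- A correspondence between sequences over the two rings: a sequence of modules in
`rightPerp V` with compatible maps from the first and to the second. -/
structure Triple (c : BimoduleContext Λ Γ) (X : RepetitiveModule (c.H ⋙ c.J))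
    (Y : RepetitiveModule (c.J ⋙ c.H)) where
  A : ℤ → ModuleCat.{u} Λ
  mem : ∀ i, rightPerp c.V (A i)
  bounded : ∀ᶠ i in Filter.cofinite, IsZero (A i)
  ι : ∀ i, X.X i ⟶ A i
  p : ∀ i, c.H.obj (A i) ⟶ Y.X i
  q : ∀ i, A (i + 1) ⟶ c.J.obj (Y.X i)
  ι_q : ∀ i, ι (i + 1) ≫ q i = X.d i ≫ c.J.map (c.H.map (ι i)) ≫ c.J.map (p i)
  p_d : ∀ i, p (i + 1) ≫ Y.d i = c.H.map (q i)

namespace Triple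

variable {c : BimoduleContext Λ Γ} {X X' X'' : RepetitiveModule (c.H ⋙ c.J)}
    {Y Y' Y'' : RepetitiveModule (c.J ⋙ c.H)} (D : Triple c X Y) (D' : Triple c X' Y')
    (D'' : Triple c X'' Y'')

/-- Triples in which `X` embeds in `A` and `Y` is the pushout determined by `X` and `A`. -/
structure TypeI where
  K : ℤ → ModuleCat.{u} Γ
  mem : ∀ i, rightPerpID c.W (K i)
  π : ∀ i, Y.X i ⟶ K i
  p_π : ∀ i, D.p i ≫ π i = 0
  ι_q_π : ∀ i, D.ι (i + 1) ≫ D.q i ≫ c.J.map (π i) = 0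
  shortExact_p : ∀ i, (ShortComplex.mk _ _ (p_π i)).ShortExact
  shortExact_ι : ∀ i, (ShortComplex.mk _ _ (ι_q_π i)).ShortExact
  exists_desc : ∀ i (Z : ModuleCat.{u} Γ) (u : c.H.obj (D.A i) ⟶ Z) (v : D.A (i + 1) ⟶ c.J.obj Z),
    X.d i ≫ c.J.map (c.H.map (D.ι i)) ≫ c.J.map u = D.ι (i + 1) ≫ v →
    ∃ w : Y.X i ⟶ Z, D.p i ≫ w = u ∧ D.q i ≫ c.J.map w = v

/-- Triples in which `Y` is a quotient of `A` and `X` is the pullback determined by `A` and `Y`. -/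
structure TypeII where
  K : ℤ → ModuleCat.{u} Γ
  mem : ∀ i, rightPerpID c.W (K i)
  k : ∀ i, K i ⟶ c.H.obj (D.A i)
  k_p : ∀ i, k i ≫ D.p i = 0
  shortExact_p : ∀ i, (ShortComplex.mk _ _ (k_p i)).ShortExact
  isPullback : ∀ i, IsPullback (D.ι (i + 1)) (X.d i ≫ c.J.map (c.H.map (D.ι i))) (D.q i)
    (c.J.map (D.p i))

/-- Morphisms of triples. -/
structure IsHom (f : X ⟶ X') (a : ∀ i, D.A i ⟶ D'.A i) (g : Y ⟶ Y') : Prop where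
  ι : ∀ i, D.ι i ≫ a i = Hom.f f i ≫ D'.ι i
  p : ∀ i, D.p i ≫ Hom.f g i = c.H.map (a i) ≫ D'.p i

variable {D D' D''}

lemma IsHom.comp {f : X ⟶ X'} {a : ∀ i, D.A i ⟶ D'.A i} {g : Y ⟶ Y'} (h : IsHom D D' f a g)
    {f' : X' ⟶ X''} {a' : ∀ i, D'.A i ⟶ D''.A i} {g' : Y' ⟶ Y''} (h' : IsHom D' D'' f' a' g') :
    IsHom D D'' (f ≫ f') (fun i => a i ≫ a' i) (g ≫ g') where
  ι i := by rw [reassoc_of% h.ι, h'.ι, comp_f, Category.assoc]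
  p i := by rw [comp_f, reassoc_of% h.p, h'.p, c.H.map_comp, Category.assoc]

lemma IsHom.sub {f f' : X ⟶ X'} {a a' : ∀ i, D.A i ⟶ D'.A i} {g g' : Y ⟶ Y'}
    (h : IsHom D D' f a g) (h' : IsHom D D' f' a' g') :
    IsHom D D' (f - f') (fun i => a i - a' i) (g - g') where
  ι i := by rw [Preadditive.comp_sub, sub_f, Preadditive.sub_comp, h.ι, h'.ι]
  p i := by rw [sub_f, Preadditive.comp_sub, c.H.map_sub, Preadditive.sub_comp, h.p, h'.p]

lemma IsHom.id (D : Triple c X Y) : IsHom D D (𝟙 X) (fun i => 𝟙 (D.A i)) (𝟙 Y) where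
  ι i := by simp
  p i := by simp

variable [IsNoetherianRing Λ] [IsNoetherianRing Γ] (h : c.IsTilting)
include h

-- `H` is faithful on maps out of `D.A`, and there `q` becomes `p` followed by a structure map of
-- `Y`.
omit [IsNoetherianRing Γ] in
lemma q_d (D : Triple c X Y) (i : ℤ) : D.q (i + 1) ≫ c.J.map (Y.d i) = 0 := by
  apply (h.H_bijective (D.mem _) _).1
  rw [c.H.map_comp, ← D.p_d, Category.assoc, Y.d_d, comp_zero, c.H.map_zero]

omit [IsNoetherianRing Γ] in
lemma IsHom.q {f : X ⟶ X'} {a : ∀ i, D.A i ⟶ D'.A i} {g : Y ⟶ Y'} (hf : IsHom D D' f a g) (i : ℤ) :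
    D.q i ≫ c.J.map (Hom.f g i) = a (i + 1) ≫ D'.q i := by
  apply (h.H_bijective (D.mem _) _).1
  rw [c.H.map_comp, ← D.p_d, Category.assoc, Y.d_comm, reassoc_of% hf.p, D'.p_d, c.H.map_comp]

/-- A difference killed by `p` factors through the cokernel `t.K i`. After `J` it is killed by the
epimorphism from `D.A (i + 1)`, and `J` is faithful on maps out of `t.K i`. -/
lemma TypeI.hom_ext (t : D.TypeI) {i : ℤ} {Z : ModuleCat.{u} Γ} {w w' : Y.X i ⟶ Z}
    (hp : D.p i ≫ w = D.p i ≫ w') (hq : D.q i ≫ c.J.map w = D.q i ≫ c.J.map w') : w = w' := by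
  rw [← sub_eq_zero]
  have hE := t.shortExact_p i
  have := (t.shortExact_ι i).epi_g
  have hw : D.p i ≫ (w - w') = 0 := by rw [Preadditive.comp_sub, hp, sub_self]
  have := hE.epi_g
  obtain ⟨z, hz⟩ : ∃ z, t.π i ≫ z = w - w' := ⟨hE.exact.desc _ hw, hE.exact.g_desc _ _⟩
  have : z = 0 := by
    apply (h.J_bijective (t.mem i) Z).1
    rw [c.J.map_zero, ← cancel_epi (D.q i ≫ c.J.map (t.π i)), comp_zero, Category.assoc,
      ← c.J.map_comp, hz, c.J.map_sub, Preadditive.comp_sub, hq, sub_self]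
  rw [← hz, this, comp_zero]

lemma TypeI.exists_extend (t : D.TypeI) {i : ℤ} {A : ModuleCat.{u} Λ} (hA : rightPerp c.V A)
    (f : X.X i ⟶ A) : ∃ g, D.ι i ≫ g = f := by
  suffices ∀ i, ∀ f : X.X i ⟶ A, ∃ g, D.ι i ≫ g = f from this i f
  refine forall_of_forall_succ fun i f => ?_
  exact h.exists_extend (t.shortExact_ι i) (t.mem i) (Iso.refl _) hA f

/-- Morphisms of sequences extend to triples if the source has type I. -/
lemma TypeI.exists_isHom (t : D.TypeI) (D' : Triple c X' Y') (f : X ⟶ X') :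
    ∃ a g, IsHom D D' f a g := by
  -- The cokernel of `ι` is a value of `J`, left orthogonal to the targets, so the middle components
  -- extend; the pushout property then gives the components on `Y`.
  choose a ha using fun i => t.exists_extend h (D'.mem i) (Hom.f f i ≫ D'.ι i)
  choose g hg hg' using fun i => t.exists_desc i _ (c.H.map (a i) ≫ D'.p i) (a (i + 1) ≫ D'.q i) (by
    rw [reassoc_of% ha, D'.ι_q, ← reassoc_of% X.d_comm f i, c.J.map_comp]
    simp only [← Category.assoc, ← c.J.map_comp, ← c.H.map_comp, ha])
  refine ⟨a, ⟨g, fun i => ?_⟩, ha, hg⟩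
  change Y.d i ≫ c.H.map (c.J.map (g i)) = g (i + 1) ≫ Y'.d i
  apply t.hom_ext h
  · rw [reassoc_of% D.p_d i, ← c.H.map_comp, hg', reassoc_of% hg, D'.p_d, c.H.map_comp]
  · rw [c.J.map_comp, reassoc_of% D.q_d h i, zero_comp, c.J.map_comp, reassoc_of% hg', D'.q_d h,
      comp_zero]

omit [IsNoetherianRing Γ] in
/-- Morphisms of sequences lift to triples if the target has type II. -/
lemma TypeII.exists_isHom (D : Triple c X Y) (t : D'.TypeII) (g : Y ⟶ Y') :
    ∃ f a, IsHom D D' f a g := by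
  -- Lifting through `p` is unobstructed because its kernel lies in `rightPerpID W`; full
  -- faithfulness of `H` then produces the middle components.
  choose a' ha' using fun i => h.exists_lift (t.shortExact_p i) (t.mem i) (D.mem i)
    (D.p i ≫ Hom.f g i)
  choose a ha using fun i => (h.H_bijective (D.mem i) (D'.A i)).2 (a' i)
  have hap (i) : D.p i ≫ Hom.f g i = c.H.map (a i) ≫ D'.p i := by
    rw [ha]
    exact (ha' i).symm
  have haq (i) : D.q i ≫ c.J.map (Hom.f g i) = a (i + 1) ≫ D'.q i := by
    apply (h.H_bijective (D.mem _) _).1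
    rw [c.H.map_comp, ← D.p_d, Category.assoc, Y.d_comm, reassoc_of% hap, D'.p_d, c.H.map_comp]
  -- The components on `X` are forced by the pullback in the target triple.
  obtain ⟨f, hf⟩ := exists_shift (β := fun i => X.X i ⟶ X'.X i) fun i =>
    (t.isPullback i).lift (D.ι (i + 1) ≫ a (i + 1)) (X.d i ≫ c.J.map (c.H.map (D.ι i ≫ a i))) (by
      rw [Category.assoc, ← haq, reassoc_of% D.ι_q i, Category.assoc, ← c.J.map_comp,
        ← c.J.map_comp, ← c.J.map_comp, c.H.map_comp, Category.assoc, hap])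
  have hf₁ : ∀ i, D.ι i ≫ a i = f i ≫ D'.ι i := forall_of_forall_succ fun i => by
    rw [hf, IsPullback.lift_fst]
  have hf₂ (i) : f (i + 1) ≫ X'.d i ≫ c.J.map (c.H.map (D'.ι i)) =
      X.d i ≫ c.J.map (c.H.map (D.ι i ≫ a i)) := by
    rw [hf, IsPullback.lift_snd]
  refine ⟨⟨f, forall_of_forall_succ fun i => ?_⟩, a, hf₁, hap⟩
  change X.d (i + 1) ≫ c.J.map (c.H.map (f (i + 1))) = f (i + 1 + 1) ≫ X'.d (i + 1)
  have := c.preservesFiniteLimits_H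
  have := c.preservesFiniteLimits_J
  apply (((t.isPullback i).map c.H).map c.J).hom_ext
  · rw [Category.assoc, Category.assoc, hf₂, hf₁, c.H.map_comp, c.J.map_comp]
  · rw [Category.assoc, ← c.J.map_comp, ← c.H.map_comp, hf₂, c.H.map_comp, c.J.map_comp,
      reassoc_of% X.d_d i, zero_comp, Category.assoc, c.H.map_comp, c.J.map_comp,
      reassoc_of% X'.d_d i, zero_comp, comp_zero]

end Triple
end ExtVanishing

/-! ### Maps of triples that vanish on one side. -/

namespace ExtVanishing

open Abelian Limits RepetitiveModule

namespace Triple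

variable {Λ Γ : Type u} [Ring Λ] [Ring Γ] {c : BimoduleContext Λ Γ}
  {X X' : RepetitiveModule (c.H ⋙ c.J)} {Y Y' : RepetitiveModule (c.J ⋙ c.H)}
  {D : Triple c X Y} {D' : Triple c X' Y'}
  [IsNoetherianRing Λ] [IsNoetherianRing Γ] (h : c.IsTilting)
include h

/-- The second component of a morphism of triples with trivial first component is stably zero if
the source has type I. -/
lemma TypeI.isStablyZero_of_eq_zero (t : D.TypeI) {a : ∀ i, D.A i ⟶ D'.A i} {g : Y ⟶ Y'}
    (hg : IsHom D D' 0 a g) : IsStablyZero g := by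
  choose U hU h0 u hu hc using fun i => BimoduleContext.IsTilting.exists_mono_injective (t.mem i)
  -- Since the component on `X` vanishes, the middle map factors through the cokernel of `ι`, which
  -- is `J` of `t.K i`.
  have hb (i) : ∃ b, (D.q i ≫ c.J.map (t.π i)) ≫ b = a (i + 1) := by
    have hE := t.shortExact_ι i
    have := hE.epi_g
    have h0 : D.ι (i + 1) ≫ a (i + 1) = 0 := by rw [hg.ι, zero_f, zero_comp]
    exact ⟨hE.exact.desc _ h0, hE.exact.g_desc _ _⟩
  choose b hb using hb
  -- With `t.K i` embedded in an injective whose cokernel stays in the class, that factorization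
  -- extends to `J` of the injective. These injectives form the coinduced sequence through which `g`
  -- factors.
  have he (i) : ∃ e : c.J.obj (U i) ⟶ D'.A (i + 1), c.J.map (u i) ≫ e = b i := h.exists_extend
    (c.shortExact_J (shortExact_of_mono (u i)) ((t.mem i).2.1 1 one_pos)) (hc i) (Iso.refl _)
    (D'.mem (i + 1)) (b i)
  choose e he using he
  choose s hs using fun i => (h.J_bijective
    (BimoduleContext.IsTilting.rightPerpID_of_isSummand (hU i)) _).2 (e i ≫ D'.q i)
  let F : Family (c.J ⋙ c.H) (IsSummand c.ID) := ⟨U, hU, Y.bounded.mono fun i hi => h0 i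
    (have := (t.shortExact_p i).epi_g; IsZero.of_epi (t.π i) hi)⟩
  obtain ⟨y, hy⟩ := F.exists_lift h.isInducing_ID (X := Y) fun i => t.π i ≫ u i
  obtain ⟨z, hz₁, hz₂⟩ := F.exists_desc h.isInducing_ID (X := Y') s
    (fun i => c.H.map (e i) ≫ D'.p (i + 1))
    (fun i => by
      apply (h.J_bijective (BimoduleContext.IsTilting.rightPerpID_of_isSummand (hU (i + 1))) _).1
      change c.J.map (s (i + 1) ≫ Y'.d i) = _
      rw [c.J.map_comp, hs, Category.assoc, D'.q_d h, comp_zero, c.J.map_zero])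
    (fun i => by
      change (_ ≫ _) ≫ Y'.d i = c.H.map (c.J.map (s i))
      rw [hs, c.H.map_comp, Category.assoc, D'.p_d])
  have hqa (i) : D.q i ≫ c.J.map (t.π i) ≫ c.J.map (u i) ≫ e i = a (i + 1) := by
    rw [he, ← Category.assoc, hb]
  have := F.projective_coind h.isInducing_ID
  have key : y ≫ z = g := by
    refine RepetitiveModule.hom_ext (forall_of_forall_succ fun i => ?_)
    rw [F.lift_desc, hz₁, hz₂, hy, hy]
    change _ + Y.d i ≫ c.H.map (c.J.map (t.π i ≫ u i)) ≫ _ = _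
    apply t.hom_ext h
    · rw [Preadditive.comp_add, Category.assoc, reassoc_of% t.p_π, zero_comp, zero_add,
        reassoc_of% D.p_d i, ← c.H.map_comp_assoc, ← c.H.map_comp_assoc, c.J.map_comp,
        Category.assoc, Category.assoc, hqa, hg.p]
    · rw [hg.q h, c.J.map_add, Preadditive.comp_add, c.J.map_comp (Y.d i),
        reassoc_of% D.q_d h i, zero_comp, add_zero, c.J.map_comp, hs, c.J.map_comp,
        Category.assoc, reassoc_of% hqa (i + 1)]
  rw [← key]
  exact isStablyZero_of_projective y z

/-- The first component of a morphism of triples with trivial second component is stably zero if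
the target has type II. -/
lemma TypeII.isStablyZero_of_eq_zero (t : D'.TypeII) {a : ∀ i, D.A i ⟶ D'.A i} {f : X ⟶ X'}
    (hf : IsHom D D' f a 0) : IsStablyZero f := by
  choose I hI h0 e he hc using fun i => h.exists_epi_injective (t.mem i)
  -- Since the component on `Y` vanishes, the image of the middle map under `H` lands in the kernel
  -- of `p`. Covering that kernel by `H` of injectives factors the middle map itself through
  -- injectives, by full faithfulness of `H`.
  have hm (i) : ∃ m, m ≫ t.k i = c.H.map (a i) := by
    have hE := t.shortExact_p i
    have := hE.mono_f
    have h0 : c.H.map (a i) ≫ D'.p i = 0 := by rw [← hf.p, zero_f, comp_zero]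
    exact ⟨hE.exact.lift _ h0, hE.exact.lift_f _ _⟩
  choose m' hm' using hm
  have hn (i) : ∃ n : c.H.obj (D.A i) ⟶ c.H.obj (I i), n ≫ e i = m' i :=
    h.exists_lift (shortExact_of_epi (e i)) (hc i) (D.mem i) (m' i)
  choose n hn using hn
  choose m hm using fun i => (h.H_bijective (D.mem i) (I i)).2 (n i)
  have hI' (i) := BimoduleContext.IsTilting.rightPerp_of_isSummand (hI i)
  choose l hl using fun i => (h.H_bijective (hI' i) (D'.A i)).2 (e i ≫ t.k i)
  have hml (i) : m i ≫ l i = a i := by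
    apply (h.H_bijective (D.mem i) _).1
    rw [c.H.map_comp, hm, hl, reassoc_of% hn, hm']
  have hlp (i) : c.H.map (l i) ≫ D'.p i = 0 := by
    rw [hl, Category.assoc, t.k_p, comp_zero]
  have hlq (i) : l (i + 1) ≫ D'.q i = 0 := by
    apply (h.H_bijective (hI' _) _).1
    rw [c.H.map_comp, ← D'.p_d, reassoc_of% hlp (i + 1), zero_comp, c.H.map_zero]
  let F : Family (c.H ⋙ c.J) (IsSummand c.IC) := ⟨I, hI, D'.bounded.mono fun i hi => h0 i
    (have := (t.shortExact_p i).mono_f; IsZero.of_mono (t.k i) (c.H.map_isZero hi))⟩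
  obtain ⟨x, hx⟩ := F.exists_lift h.isInducing_IC (X := X) fun i => D.ι i ≫ m i
  -- The two summands of the coinduced sequence map to the pullback by using one leg and zero on the
  -- other: `l` into `D'.A` for the first, its image under `JH` for the second.
  obtain ⟨s, hs⟩ := exists_shift (β := fun i => I i ⟶ X'.X i) fun i =>
    (t.isPullback i).lift (l (i + 1)) 0 (by rw [hlq, zero_comp])
  let r (i) : c.J.obj (c.H.obj (I i)) ⟶ X'.X (i + 1) :=
    (t.isPullback i).lift 0 (c.J.map (c.H.map (l i))) (by
      rw [zero_comp, ← c.J.map_comp, hlp, c.J.map_zero])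
  have hs₁ : ∀ i, s i ≫ D'.ι i = l i := forall_of_forall_succ fun i => by
    rw [hs, IsPullback.lift_fst]
  have hs₂ (i) : s (i + 1) ≫ X'.d i ≫ c.J.map (c.H.map (D'.ι i)) = 0 := by
    rw [hs, IsPullback.lift_snd]
  have hr₁ (i) : r i ≫ D'.ι (i + 1) = 0 := IsPullback.lift_fst _ _ _ _
  have hr₂ (i) : r i ≫ X'.d i ≫ c.J.map (c.H.map (D'.ι i)) = c.J.map (c.H.map (l i)) :=
    IsPullback.lift_snd _ _ _ _
  have := c.preservesFiniteLimits_H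
  have := c.preservesFiniteLimits_J
  have hP (i) := ((t.isPullback i).map c.H).map c.J
  obtain ⟨y, hy₁, hy₂⟩ := F.exists_desc h.isInducing_IC (X := X') s r
    (forall_of_forall_succ fun i => by
      change s (i + 1 + 1) ≫ X'.d (i + 1) = 0
      apply (hP i).hom_ext
      · rw [Category.assoc, hs₂, zero_comp]
      · rw [Category.assoc, c.H.map_comp, c.J.map_comp, reassoc_of% X'.d_d i, zero_comp,
          comp_zero, zero_comp])
    (forall_of_forall_succ fun i => by
      change r (i + 1) ≫ X'.d (i + 1) = c.J.map (c.H.map (s (i + 1)))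
      apply (hP i).hom_ext
      · rw [Category.assoc, hr₂, ← c.J.map_comp, ← c.H.map_comp, hs₁]
      · rw [← c.J.map_comp, ← c.H.map_comp, hs₂, Category.assoc, c.H.map_comp, c.J.map_comp,
          reassoc_of% X'.d_d i, zero_comp, comp_zero, c.H.map_zero, c.J.map_zero])
  have := F.projective_coind h.isInducing_IC
  have key : x ≫ y = f := by
    refine RepetitiveModule.hom_ext (forall_of_forall_succ fun i => ?_)
    rw [F.lift_desc, hy₁, hy₂, hx, hx]
    change _ + X.d i ≫ c.J.map (c.H.map (D.ι i ≫ m i)) ≫ _ = _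
    apply (t.isPullback i).hom_ext
    · rw [Preadditive.add_comp, Category.assoc, Category.assoc, Category.assoc, Category.assoc,
        hs₁, hr₁, comp_zero, comp_zero, add_zero, hml, hf.ι]
    · rw [Preadditive.add_comp, Category.assoc, Category.assoc, Category.assoc, Category.assoc,
        hs₂, hr₂, comp_zero, comp_zero, zero_add, ← c.J.map_comp, ← c.H.map_comp, Category.assoc,
        hml, hf.ι, c.H.map_comp, c.J.map_comp, reassoc_of% X.d_comm f]
  rw [← key]
  exact isStablyZero_of_projective x y

end Triple
end ExtVanishing

/-! ### Every sequence belongs to a triple. -/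

namespace ExtVanishing

open Abelian Limits RepetitiveModule

lemma ShortExact.of_iso_right {C : Type*} [Category C] [Abelian C] {X Y Z Z' : C} {f f' : X ⟶ Y}
    {g : Y ⟶ Z} {w : f ≫ g = 0} (h : (ShortComplex.mk f g w).ShortExact) (e : Z ≅ Z')
    {g' : Y ⟶ Z'} {w' : f' ≫ g' = 0} (hf : f = f') (hg : g ≫ e.hom = g') :
    (ShortComplex.mk f' g' w').ShortExact := by
  subst hf hg
  exact ShortComplex.shortExact_of_iso (ShortComplex.isoMk (S₁ := .mk f g w)
    (S₂ := .mk f (g ≫ e.hom) w') (Iso.refl _) (Iso.refl _) e (by simp) (by simp)) h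

namespace Triple

variable {Λ Γ : Type u} [Ring Λ] [Ring Γ] {c : BimoduleContext Λ Γ}
  [IsNoetherianRing Λ] [IsNoetherianRing Γ] (h : c.IsTilting)
include h

/-- Every sequence over the first ring is part of a triple of type I. -/
lemma exists_typeI (X : RepetitiveModule (c.H ⋙ c.J)) :
    ∃ (Y : RepetitiveModule (c.J ⋙ c.H)) (D : Triple c X Y), Nonempty D.TypeI := by
  choose A K ι ρ w hE hA hK h0 using fun i => h.exists_coresolution (X.X i) (X.finite i)
  -- The map `X (i + 1) ⟶ J (H (A i))` is transposed to a map out of `F`. The pushout of it with `F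
  -- (ι (i + 1))` classifies exactly the pairs of maps asked for in `exists_desc` of a type I
  -- triple.
  let α (i) : c.F.obj (X.X (i + 1)) ⟶ c.H.obj (A i) :=
    (c.adjF.homEquiv _ _).symm (X.d i ≫ c.J.map (c.H.map (ι i)))
  let p (i) : c.H.obj (A i) ⟶ pushout (c.F.map (ι (i + 1))) (α i) := pushout.inr _ _
  let q (i) : A (i + 1) ⟶ c.J.obj (pushout (c.F.map (ι (i + 1))) (α i)) :=
    c.adjF.homEquiv _ _ (pushout.inl _ _)
  have hq (i) {Z} (z : pushout (c.F.map (ι (i + 1))) (α i) ⟶ Z) :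
      q i ≫ c.J.map z = c.adjF.homEquiv _ _ (pushout.inl _ _ ≫ z) :=
    (c.adjF.homEquiv_naturality_right _ _).symm
  have exd (i) (Z : ModuleCat.{u} Γ) (u : c.H.obj (A i) ⟶ Z) (v : A (i + 1) ⟶ c.J.obj Z)
      (huv : X.d i ≫ c.J.map (c.H.map (ι i)) ≫ c.J.map u = ι (i + 1) ≫ v) :
      ∃ w : pushout (c.F.map (ι (i + 1))) (α i) ⟶ Z, p i ≫ w = u ∧ q i ≫ c.J.map w = v := by
    refine ⟨pushout.desc ((c.adjF.homEquiv _ _).symm v) u ?_, pushout.inr_desc _ _ _, ?_⟩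
    · rw [← c.adjF.homEquiv_naturality_left_symm, ← huv, ← c.adjF.homEquiv_naturality_right_symm,
        Category.assoc]
    · rw [hq, pushout.inl_desc, Equiv.apply_symm_apply]
  have ext (i) {Z : ModuleCat.{u} Γ} {z z' : pushout (c.F.map (ι (i + 1))) (α i) ⟶ Z}
      (h₁ : p i ≫ z = p i ≫ z') (h₂ : q i ≫ c.J.map z = q i ≫ c.J.map z') : z = z' := by
    rw [hq, hq] at h₂
    exact pushout.hom_ext ((c.adjF.homEquiv _ _).injective h₂) h₁
  have ιq (i) : ι (i + 1) ≫ q i = X.d i ≫ c.J.map (c.H.map (ι i)) ≫ c.J.map (p i) := by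
    have : ι (i + 1) ≫ q i = c.adjF.homEquiv _ _ (α i ≫ p i) := by
      rw [← pushout.condition, c.adjF.homEquiv_naturality_left]
    rw [this, c.adjF.homEquiv_naturality_right, Equiv.apply_symm_apply, Category.assoc]
  -- The structure map of `Y` is `H q` on one leg and zero on the other; the two agree because
  -- consecutive structure maps of `X` compose to zero.
  choose ε hε hε' using fun i => exd (i + 1) _ (c.H.map (q i)) 0 (by
    rw [comp_zero, ← c.J.map_comp, ← c.H.map_comp, ιq, c.H.map_comp, c.J.map_comp,
      reassoc_of% X.d_d i, zero_comp])
  choose π hπ hπ' using fun i => exd i (K (i + 1)) 0 (ρ (i + 1)) (by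
    rw [c.J.map_zero, comp_zero, comp_zero, w])
  -- `F` is exact here because the cokernel is left orthogonal to `V`, and the counit identifies `F
  -- (J K)` with `K`. Pushing out then shows that `p` has cokernel `K`.
  have hFE (i) : (ShortComplex.mk (c.F.map (ι (i + 1)))
      ((c.adjF.homEquiv _ _).symm (ρ (i + 1))) (by
        rw [← c.adjF.homEquiv_naturality_left_symm, w]
        simp [Adjunction.homEquiv_counit])).ShortExact := by
    have := h.counit_rightPerpID (hK (i + 1))
    have hF := c.shortExact_F (hE (i + 1)) ((h.leftPerpPD_J (hK (i + 1))).2.1 1 one_pos)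
    exact ShortExact.of_iso_right hF
      (@asIso _ _ _ _ (c.adjF.counit.app (K (i + 1))) this) rfl
      (c.adjF.homEquiv_counit _ _ _).symm
  have hp (i) : (ShortComplex.mk (p i) (π i) (hπ i)).ShortExact := by
    refine ShortExact.of_iso_right (shortExact_pushout (hFE i) (α i)) (Iso.refl _) rfl ?_
    refine (Category.comp_id _).trans (pushout.hom_ext ?_ ?_)
    · rw [pushout.inl_desc]
      apply (c.adjF.homEquiv _ _).injective
      rw [← hq, hπ', Equiv.apply_symm_apply]
    · rw [pushout.inr_desc]
      exact (hπ i).symm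
  let Y : RepetitiveModule (c.J ⋙ c.H) :=
    { X := fun i => pushout (c.F.map (ι (i + 1))) (α i)
      δ := ε
      finite := fun i => finite_X₂ (hp i) (c.finite_H _ (hA i).1) (hK (i + 1)).1
      bounded := by
        filter_upwards [X.bounded, eventually_succ X.bounded] with i h₁ h₂
        rw [IsZero.iff_id_eq_zero]
        exact pushout.hom_ext ((c.F.map_isZero (h0 _ h₂)).eq_of_src _ _)
          ((c.H.map_isZero (h0 _ h₁)).eq_of_src _ _)
      δ_comp_δ := fun i => by
        change ε (i + 1) ≫ c.H.map (c.J.map (ε i)) = 0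
        apply ext
        · rw [reassoc_of% hε, ← c.H.map_comp, hε', c.H.map_zero, comp_zero]
        · rw [c.J.map_comp, reassoc_of% hε', zero_comp, c.J.map_zero, comp_zero] }
  let D : Triple c X Y := ⟨A, hA, X.bounded.mono h0, ι, p, q, ιq, hε⟩
  exact ⟨Y, D, ⟨⟨fun i => K (i + 1), fun i => hK (i + 1), π, hπ, fun i => by
    change ι (i + 1) ≫ q i ≫ c.J.map (π i) = 0
    rw [hπ', w], hp, fun i => ShortExact.of_iso_right (hE (i + 1)) (Iso.refl _) rfl
      ((Category.comp_id _).trans (hπ' i).symm), exd⟩⟩⟩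

/-- Every sequence over the second ring is part of a triple of type II. -/
lemma exists_typeII (Y : RepetitiveModule (c.J ⋙ c.H)) :
    ∃ (X : RepetitiveModule (c.H ⋙ c.J)) (D : Triple c X Y), Nonempty D.TypeII := by
  choose A K k p w hE hA hK h0 using fun i => h.exists_resolution (Y.X i) (Y.finite i)
  choose q hq using fun i => (h.H_bijective (hA (i + 1)) (c.J.obj (Y.X i))).2 (p (i + 1) ≫ Y.d i)
  have hqd (i) : q (i + 1) ≫ c.J.map (Y.d i) = 0 := by
    apply (h.H_bijective (hA _) _).1
    rw [c.H.map_comp, hq, Category.assoc, Y.d_d, comp_zero, c.H.map_zero]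
  -- The pullback of `q` and `J p` gives the term at index `i + 1`; reindexing defines the sequence
  -- everywhere.
  obtain ⟨X, hX⟩ := exists_shift (β := fun _ => ModuleCat.{u} Λ)
    fun i => pullback (q i) (c.J.map (p i))
  let e (i) : X (i + 1) ≅ pullback (q i) (c.J.map (p i)) := eqToIso (hX i)
  obtain ⟨ι, hι⟩ := exists_shift (β := fun i => X i ⟶ A i) fun i => (e i).hom ≫ pullback.fst _ _
  let b (i) : X (i + 1) ⟶ c.J.obj (c.H.obj (A i)) := (e i).hom ≫ pullback.snd _ _
  have hP (i) : IsPullback (ι (i + 1)) (b i) (q i) (c.J.map (p i)) := by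
    refine IsPullback.of_iso_pullback ⟨?_⟩ (e i) (hι i).symm rfl
    rw [hι, Category.assoc, Category.assoc, pullback.condition]
  have := c.preservesFiniteLimits_H
  have := c.preservesFiniteLimits_J
  have hP' (i) := ((hP i).map c.H).map c.J
  have hbq (i) : b (i + 1) ≫ c.J.map (c.H.map (q i)) = 0 := by
    rw [hq, c.J.map_comp, ← reassoc_of% (hP (i + 1)).w, hqd, comp_zero]
  -- `H` and `J` preserve the pullback square, so a structure map is a pair of legs. The second leg
  -- is zero, which is consistent because `q` followed by `J` of a structure map of `Y` vanishes.
  obtain ⟨d, hd⟩ := exists_shift (β := fun i => X (i + 1) ⟶ c.J.obj (c.H.obj (X i))) fun i =>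
    (hP' i).lift (b (i + 1)) 0 (by rw [hbq, zero_comp])
  have hd₁ : ∀ i, d i ≫ c.J.map (c.H.map (ι i)) = b i := forall_of_forall_succ fun i => by
    rw [hd, IsPullback.lift_fst]
  have hd₂ (i) : d (i + 1) ≫ c.J.map (c.H.map (b i)) = 0 := by
    rw [hd, IsPullback.lift_snd]
  let X' : RepetitiveModule (c.H ⋙ c.J) :=
    { X := X
      δ := d
      finite := forall_of_forall_succ fun i => by
        have : Mono (biprod.lift (ι (i + 1)) (b i)) := ⟨fun f g hfg => (hP i).hom_ext
          (by simpa using hfg =≫ biprod.fst) (by simpa using hfg =≫ biprod.snd)⟩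
        have := (hA (i + 1)).1
        have := c.finite_J _ (c.finite_H _ (hA i).1)
        exact finite_of_mono (biprod.lift (ι (i + 1)) (b i)) (Module.Finite.equiv
          (ModuleCat.biprodIsoProd (A (i + 1)) (c.J.obj (c.H.obj (A i)))).toLinearEquiv.symm)
      bounded := by
        have : ∀ᶠ i in Filter.cofinite, IsZero (X (i - 1 + 1)) := by
          refine eventually_pred (p := fun i => IsZero (X (i + 1))) ?_
          filter_upwards [Y.bounded, eventually_succ Y.bounded] with i h₁ h₂
          rw [IsZero.iff_id_eq_zero]
          exact (hP i).hom_ext ((h0 _ h₂).eq_of_tgt _ _)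
            ((c.J.map_isZero (c.H.map_isZero (h0 _ h₁))).eq_of_tgt _ _)
        simpa using this
      δ_comp_δ := forall_of_forall_succ fun i => by
        change d (i + 1 + 1) ≫ c.J.map (c.H.map (d (i + 1))) = 0
        apply (((hP' i).map c.H).map c.J).hom_ext
        · rw [Category.assoc, ← c.J.map_comp, ← c.H.map_comp, hd₁, hd₂, zero_comp]
        · rw [Category.assoc, ← c.J.map_comp, ← c.H.map_comp, hd₂, c.H.map_zero, c.J.map_zero,
            comp_zero, zero_comp] }
  refine ⟨X', ⟨A, hA, Y.bounded.mono h0, ι, p, q, fun i => ?_, fun i => (hq i).symm⟩,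
    ⟨⟨K, hK, k, w, hE, fun i => ?_⟩⟩⟩
  · change _ = d i ≫ _
    rw [reassoc_of% hd₁, (hP i).w]
  · change IsPullback (ι (i + 1)) (d i ≫ c.J.map (c.H.map (ι i))) _ _
    rw [hd₁]
    exact hP i

end Triple
end ExtVanishing

/-! ### Mapping cones and biproducts of sequences. -/

namespace ExtVanishing

open Abelian Limits RepetitiveModule

section ShortExact

variable {C : Type*} [Category C] [Abelian C]

lemma IsPullback.of_exists {P X Y Z : C} {fst : P ⟶ X} {snd : P ⟶ Y} {f : X ⟶ Z} {g : Y ⟶ Z}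
    (w : fst ≫ f = snd ≫ g)
    (hex : ∀ (T : C) (a : T ⟶ X) (b : T ⟶ Y), a ≫ f = b ≫ g → ∃ t, t ≫ fst = a ∧ t ≫ snd = b)
    (huniq : ∀ (T : C) (t : T ⟶ P), t ≫ fst = 0 → t ≫ snd = 0 → t = 0) :
    IsPullback fst snd f g := by
  choose l h₁ h₂ using fun s : PullbackCone f g => hex _ s.fst s.snd s.condition
  refine ⟨⟨w⟩, ⟨PullbackCone.IsLimit.mk w l h₁ h₂ fun s m hm₁ hm₂ => ?_⟩⟩
  rw [← sub_eq_zero]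
  apply huniq <;> rw [Preadditive.sub_comp, sub_eq_zero]
  · rw [hm₁, h₁]
  · rw [hm₂, h₂]

/-- The mapping cone of a map from a short exact sequence, restricted to its left term. -/
lemma shortExact_lift_desc {X₁ X₂ X₃ U : C} {k : X₁ ⟶ X₂} {p : X₂ ⟶ X₃} {w : k ≫ p = 0}
    (hE : (ShortComplex.mk k p w).ShortExact) (s : X₂ ⟶ U) [Mono (k ≫ s)] :
    ∃ (t : X₃ ⟶ cokernel (k ≫ s)) (w' : biprod.lift p s ≫ biprod.desc t (cokernel.π (k ≫ s)) = 0),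
      (ShortComplex.mk _ _ w').ShortExact := by
  have hp : Epi p := hE.epi_g
  have hk : Mono k := hE.mono_f
  have h0 : k ≫ (-(s ≫ cokernel.π (k ≫ s))) = 0 := by
    rw [Preadditive.comp_neg, ← Category.assoc, cokernel.condition, neg_zero]
  obtain ⟨t, ht⟩ : ∃ t, p ≫ t = -(s ≫ cokernel.π (k ≫ s)) :=
    ⟨hE.exact.desc _ h0, hE.exact.g_desc _ _⟩
  have w' : biprod.lift p s ≫ biprod.desc t (cokernel.π (k ≫ s)) = 0 := by simp [ht]
  refine ⟨t, w', ?_⟩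
  have : Mono (biprod.lift p s) := Preadditive.mono_of_cancel_zero _ fun f hf => by
    have h₁ : f ≫ p = 0 := by simpa using hf =≫ biprod.fst
    have h₂ : f ≫ s = 0 := by simpa using hf =≫ biprod.snd
    obtain ⟨m, rfl⟩ : ∃ m, m ≫ k = f := ⟨hE.exact.lift _ h₁, hE.exact.lift_f _ _⟩
    rw [(cancel_mono (k ≫ s)).1 (by simpa using h₂ : m ≫ k ≫ s = 0 ≫ k ≫ s), zero_comp]
  have : Epi (biprod.desc t (cokernel.π (k ≫ s))) := epi_of_epi_fac (biprod.inr_desc _ _)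
  refine .mk' (ShortComplex.exact_of_g_is_cokernel _ ?_) ‹_› this
  refine CokernelCofork.IsColimit.ofπ _ _
    (fun z hz => cokernel.desc _ (biprod.inr ≫ z) ?_) (fun z hz => ?_) (fun z hz m hm => ?_)
  · have : p ≫ biprod.inl ≫ z + s ≫ biprod.inr ≫ z = 0 := by
      simpa [biprod.lift_eq] using hz
    rw [Category.assoc, eq_neg_of_add_eq_zero_right this, Preadditive.comp_neg, reassoc_of% w,
      zero_comp, neg_zero]
  · apply biprod.hom_ext'
    · have : p ≫ biprod.inl ≫ z + s ≫ biprod.inr ≫ z = 0 := by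
        simpa [biprod.lift_eq] using hz
      rw [biprod.inl_desc_assoc, ← cancel_epi p, reassoc_of% ht, Preadditive.neg_comp,
        Category.assoc, cokernel.π_desc, eq_neg_of_add_eq_zero_left this]
    · rw [biprod.inr_desc_assoc, cokernel.π_desc]
  · rw [← cancel_epi (cokernel.π _), cokernel.π_desc, ← hm, biprod.inr_desc_assoc]

/-- The mapping cone of a map to a short exact sequence, restricted to its right term. -/
lemma shortExact_lift_desc' {X₁ X₂ X₃ U : C} {p : X₁ ⟶ X₂} {π : X₂ ⟶ X₃} {w : p ≫ π = 0}
    (hE : (ShortComplex.mk p π w).ShortExact) (s : U ⟶ X₂) [Epi (s ≫ π)] :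
    ∃ (t : kernel (s ≫ π) ⟶ X₁) (w' : biprod.lift t (kernel.ι (s ≫ π)) ≫ biprod.desc p s = 0),
      (ShortComplex.mk _ _ w').ShortExact := by
  have hπ : Epi π := hE.epi_g
  have hp : Mono p := hE.mono_f
  have h0 : (-(kernel.ι (s ≫ π) ≫ s)) ≫ π = 0 := by
    rw [Preadditive.neg_comp, Category.assoc, kernel.condition, neg_zero]
  obtain ⟨t, ht⟩ : ∃ t, t ≫ p = -(kernel.ι (s ≫ π) ≫ s) :=
    ⟨hE.exact.lift _ h0, hE.exact.lift_f _ _⟩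
  have w' : biprod.lift t (kernel.ι (s ≫ π)) ≫ biprod.desc p s = 0 := by simp [ht]
  refine ⟨t, w', ?_⟩
  have : Epi (biprod.desc p s) := Preadditive.epi_of_cancel_zero _ fun f hf => by
    have h₁ : p ≫ f = 0 := by simpa using biprod.inl ≫= hf
    have h₂ : s ≫ f = 0 := by simpa using biprod.inr ≫= hf
    obtain ⟨m, rfl⟩ : ∃ m, π ≫ m = f := ⟨hE.exact.desc _ h₁, hE.exact.g_desc _ _⟩
    rw [(cancel_epi (s ≫ π)).1 (by simpa using h₂ : (s ≫ π) ≫ m = (s ≫ π) ≫ 0), comp_zero]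
  have : Mono (biprod.lift t (kernel.ι (s ≫ π))) := mono_of_mono_fac (biprod.lift_snd _ _)
  refine .mk' (ShortComplex.exact_of_f_is_kernel _ ?_) this ‹_›
  refine KernelFork.IsLimit.ofι _ _
    (fun z hz => kernel.lift _ (z ≫ biprod.snd) ?_) (fun z hz => ?_) (fun z hz m hm => ?_)
  · have : (z ≫ biprod.fst) ≫ p + (z ≫ biprod.snd) ≫ s = 0 := by
      simpa [biprod.desc_eq] using hz
    rw [← Category.assoc, eq_neg_of_add_eq_zero_right this, Preadditive.neg_comp, Category.assoc, w,
      comp_zero, neg_zero]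
  · apply biprod.hom_ext
    · have : (z ≫ biprod.fst) ≫ p + (z ≫ biprod.snd) ≫ s = 0 := by
        simpa [biprod.desc_eq] using hz
      rw [Category.assoc, biprod.lift_fst, ← cancel_mono p, Category.assoc, ht,
        Preadditive.comp_neg, kernel.lift_ι_assoc, eq_neg_of_add_eq_zero_left this]
    · rw [Category.assoc, biprod.lift_snd, kernel.lift_ι]
  · rw [← cancel_mono (kernel.ι _), kernel.lift_ι, ← hm, Category.assoc, biprod.lift_snd]

end ShortExact

namespace RepetitiveModule

variable {Λ : Type u} [Ring Λ] {N : ModuleCat.{u} Λ ⥤ ModuleCat.{u} Λ} [N.Additive]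

section Biprod

variable (X Y : RepetitiveModule N) (i : ℤ)

@[simp] lemma biprod_inl_fst_f :
    Hom.f (biprod.inl : X ⟶ X ⊞ Y) i ≫ Hom.f (biprod.fst : X ⊞ Y ⟶ X) i = 𝟙 _ := by
  rw [← comp_f, biprod.inl_fst, id_f]

@[simp] lemma biprod_inr_snd_f :
    Hom.f (biprod.inr : Y ⟶ X ⊞ Y) i ≫ Hom.f (biprod.snd : X ⊞ Y ⟶ Y) i = 𝟙 _ := by
  rw [← comp_f, biprod.inr_snd, id_f]

@[simp] lemma biprod_inl_snd_f :
    Hom.f (biprod.inl : X ⟶ X ⊞ Y) i ≫ Hom.f (biprod.snd : X ⊞ Y ⟶ Y) i = 0 := by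
  rw [← comp_f, biprod.inl_snd, zero_f]

@[simp] lemma biprod_inr_fst_f :
    Hom.f (biprod.inr : Y ⟶ X ⊞ Y) i ≫ Hom.f (biprod.fst : X ⊞ Y ⟶ X) i = 0 := by
  rw [← comp_f, biprod.inr_fst, zero_f]

lemma biprod_total_f :
    Hom.f (biprod.fst : X ⊞ Y ⟶ X) i ≫ Hom.f (biprod.inl : X ⟶ X ⊞ Y) i +
      Hom.f (biprod.snd : X ⊞ Y ⟶ Y) i ≫ Hom.f (biprod.inr : Y ⟶ X ⊞ Y) i = 𝟙 _ := by
  rw [← comp_f, ← comp_f, ← add_f, biprod.total, id_f]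

end Biprod

namespace Family

variable {𝓘 : ObjectProperty (ModuleCat.{u} Λ)} (h : IsInducing N 𝓘) (F : Family N 𝓘) (i : ℤ)

/-- Inclusion of the second summand. -/
noncomputable def tail : N.obj (F.I (i - 1)) ⟶ (F.coind h).X i :=
  (biprod.inr : N.obj (F.I (i - 1)) ⟶ F.I i ⊞ N.obj (F.I (i - 1)))

/-- Projection to the second summand. -/
noncomputable def toTail : (F.coind h).X i ⟶ N.obj (F.I (i - 1)) :=
  (biprod.snd : F.I i ⊞ N.obj (F.I (i - 1)) ⟶ _)

@[simp] lemma tail_toTail : F.tail h i ≫ F.toTail h i = 𝟙 _ := biprod.inr_snd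

@[simp] lemma tail_fst : F.tail h i ≫ F.fst h i = 0 := biprod.inr_fst

@[simp] lemma inl_toTail : F.inl h i ≫ F.toTail h i = 0 := biprod.inl_snd

lemma fst_inl_add_toTail_tail :
    F.fst h i ≫ F.inl h i + F.toTail h i ≫ F.tail h i = 𝟙 _ := biprod.total

lemma tail_δ :
    F.tail h (i + 1) ≫ (F.coind h).δ i = N.map ((shiftIso F.I i).hom ≫ F.inl h i) := by
  refine (biprod.inr_snd_assoc _)

lemma inl_δ : F.inl h (i + 1) ≫ (F.coind h).δ i = 0 :=
  (biprod.inl_snd_assoc _).trans zero_comp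

lemma δ_eq_toTail : (F.coind h).δ i =
    F.toTail h (i + 1) ≫ N.map ((shiftIso F.I i).hom ≫ F.inl h i) := rfl

end Family
end RepetitiveModule
end ExtVanishing

/-! ### From type II to type I by adding a coinduced summand. -/

namespace ExtVanishing

open Abelian Limits RepetitiveModule

namespace Triple

variable {Λ Γ : Type u} [Ring Λ] [Ring Γ] {c : BimoduleContext Λ Γ}
  [IsNoetherianRing Λ] [IsNoetherianRing Γ] (h : c.IsTilting)
  {X : RepetitiveModule (c.H ⋙ c.J)} {Y : RepetitiveModule (c.J ⋙ c.H)} {D : Triple c X Y}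
include h

omit [IsNoetherianRing Γ] [IsNoetherianRing Λ] h in
lemma rightPerp_biprod {A B : ModuleCat.{u} Λ} (hA : rightPerp c.V A) (hB : rightPerp c.V B) :
    rightPerp c.V (A ⊞ B) := by
  have := hA.1
  have := hB.1
  refine ⟨Module.Finite.equiv (ModuleCat.biprodIsoProd A B).toLinearEquiv.symm, ?_⟩
  have hE : (ShortComplex.mk (biprod.inl : A ⟶ A ⊞ B) biprod.snd (by simp)).ShortExact :=
    (ShortComplex.Splitting.ofHasBinaryBiproduct A B).shortExact
  exact ExtOrth.Y₂ hE hA.2 hB.2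

/-- Add a coinduced sequence to the second component of a triple of type II to turn it into a
triple of type I. -/
lemma TypeII.exists_typeI (t : D.TypeII) (F : Family (c.J ⋙ c.H) (IsSummand c.ID))
    (s : ∀ i, c.H.obj (D.A i) ⟶ F.I i) (hs : ∀ i, Mono (t.k i ≫ s i))
    (hc : ∀ i, rightPerpID c.W (cokernel (t.k i ≫ s i))) :
    ∃ D' : Triple c X (Y ⊞ F.coind h.isInducing_ID), Nonempty D'.TypeI := by
  set hI := h.isInducing_ID
  set Z := F.coind hI
  -- The middle term grows by `J (F.I (i - 1))`, whose image under `H` is exactly the second summand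
  -- of the coinduced sequence. That part of `p` is split, so the new cokernels come only from `F.I
  -- i`.
  let Q (i) : ModuleCat.{u} Λ := c.J.obj (F.I (i - 1))
  let e (i) : Q (i + 1) ≅ c.J.obj (F.I i) := c.J.mapIso (shiftIso F.I i)
  let τ (i) : c.H.obj (Q i) ⟶ Z.X i := F.tail hI i
  let ρ (i) : Z.X i ⟶ c.H.obj (Q i) := F.toTail hI i
  let in₁ (i) : Y.X i ⟶ (Y ⊞ Z).X i := Hom.f (biprod.inl : Y ⟶ Y ⊞ Z) i
  let in₂ (i) : Z.X i ⟶ (Y ⊞ Z).X i := Hom.f (biprod.inr : Z ⟶ Y ⊞ Z) i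
  let pr₁ (i) : (Y ⊞ Z).X i ⟶ Y.X i := Hom.f (biprod.fst : Y ⊞ Z ⟶ Y) i
  let pr₂ (i) : (Y ⊞ Z).X i ⟶ Z.X i := Hom.f (biprod.snd : Y ⊞ Z ⟶ Z) i
  have total (i) : pr₁ i ≫ in₁ i + pr₂ i ≫ in₂ i = 𝟙 _ := biprod_total_f Y Z i
  have hin₁₁ (i) : in₁ i ≫ pr₁ i = 𝟙 _ := biprod_inl_fst_f Y Z i
  have hin₁₂ (i) : in₁ i ≫ pr₂ i = 0 := biprod_inl_snd_f Y Z i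
  have hin₂₁ (i) : in₂ i ≫ pr₁ i = 0 := biprod_inr_fst_f Y Z i
  have hin₂₂ (i) : in₂ i ≫ pr₂ i = 𝟙 _ := biprod_inr_snd_f Y Z i
  have τρ (i) : τ i ≫ ρ i = 𝟙 _ := F.tail_toTail hI i
  have τf (i) : τ i ≫ F.fst hI i = 0 := F.tail_fst hI i
  have lρ (i) : F.inl hI i ≫ ρ i = 0 := F.inl_toTail hI i
  have lf (i) : F.inl hI i ≫ F.fst hI i = 𝟙 _ := F.inl_fst hI i
  have total' (i) : F.fst hI i ≫ F.inl hI i + ρ i ≫ τ i = 𝟙 _ := F.fst_inl_add_toTail_tail hI i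
  have ext (i) {M} {f g : (Y ⊞ Z).X i ⟶ M} (h₁ : in₁ i ≫ f = in₁ i ≫ g)
      (h₂ : F.inl hI i ≫ in₂ i ≫ f = F.inl hI i ≫ in₂ i ≫ g)
      (h₃ : τ i ≫ in₂ i ≫ f = τ i ≫ in₂ i ≫ g) : f = g := by
    have h₄ : in₂ i ≫ f = in₂ i ≫ g := by
      rw [← Category.id_comp (in₂ i ≫ f), ← Category.id_comp (in₂ i ≫ g), ← total',
        Preadditive.add_comp, Preadditive.add_comp, Category.assoc, Category.assoc, Category.assoc,
        Category.assoc, h₂, h₃]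
    rw [← Category.id_comp f, ← Category.id_comp g, ← total, Preadditive.add_comp,
      Preadditive.add_comp, Category.assoc, Category.assoc, Category.assoc, Category.assoc, h₁, h₄]
  have τd (i) : τ (i + 1) ≫ Z.d i = c.H.map ((e i).hom ≫ c.J.map (F.inl hI i)) := by
    refine (F.tail_δ hI i).trans ?_
    simp [e]
  have ld (i) : F.inl hI (i + 1) ≫ Z.d i = 0 := F.inl_δ hI i
  let b (i) := X.d i ≫ c.J.map (c.H.map (D.ι i))
  -- The new component of `ι` records the second leg of the pullback through `s`; it is what makes
  -- the enlarged `ι` a monomorphism.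
  obtain ⟨r, hr⟩ := exists_shift (β := fun i => X.X i ⟶ Q i) fun i =>
    b i ≫ c.J.map (s i) ≫ (e i).inv
  have hre (i) : r (i + 1) ≫ (e i).hom = b i ≫ c.J.map (s i) := by simp [hr]
  have hdr : ∀ i, X.d i ≫ c.J.map (c.H.map (r i)) = 0 := forall_of_forall_succ fun i => by
    simp only [hr, b, c.H.map_comp, c.J.map_comp, Category.assoc, reassoc_of% X.d_d i, zero_comp]
  let σ (i) : c.H.obj (D.A i) ⟶ (Y ⊞ Z).X i := D.p i ≫ in₁ i + s i ≫ F.inl hI i ≫ in₂ i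
  let p (i) : c.H.obj (D.A i ⊞ Q i) ⟶ (Y ⊞ Z).X i :=
    c.H.map biprod.fst ≫ σ i + c.H.map biprod.snd ≫ τ i ≫ in₂ i
  have p_inl (i) : c.H.map biprod.inl ≫ p i = σ i := by
    simp [p, ← c.H.map_comp_assoc]
  have p_inr (i) : c.H.map biprod.inr ≫ p i = τ i ≫ in₂ i := by
    simp [p, ← c.H.map_comp_assoc]
  let q (i) : D.A (i + 1) ⊞ Q (i + 1) ⟶ c.J.obj ((Y ⊞ Z).X i) :=
    biprod.desc (D.q i ≫ c.J.map (in₁ i)) ((e i).hom ≫ c.J.map (F.inl hI i ≫ in₂ i))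
  let ι (i) : X.X i ⟶ D.A i ⊞ Q i := biprod.lift (D.ι i) (r i)
  have ι_eq (i) : ι i = D.ι i ≫ biprod.inl + r i ≫ biprod.inr := by simp [ι, biprod.lift_eq]
  have hι (i) {M : ModuleCat.{u} Γ} (u : c.H.obj (D.A i ⊞ Q i) ⟶ M) :
      X.d i ≫ c.J.map (c.H.map (ι i)) ≫ c.J.map u = b i ≫ c.J.map (c.H.map biprod.inl ≫ u) := by
    rw [ι_eq, c.H.map_add, c.J.map_add, Preadditive.add_comp, Preadditive.comp_add, c.H.map_comp,
      c.H.map_comp, c.J.map_comp, c.J.map_comp, Category.assoc, Category.assoc,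
      reassoc_of% hdr i, zero_comp, add_zero, c.J.map_comp, Category.assoc]
  -- The old `p` has kernel `t.k`; together with `s`, which is mono on that kernel, it becomes mono
  -- into `Y ⊞ F.I`, with cokernel that of `t.k ≫ s`.
  choose v w' hv using fun i => shortExact_lift_desc (t.shortExact_p i) (s i)
  let D' : Triple c X (Y ⊞ Z) :=
    { A := fun i => D.A i ⊞ Q i
      mem := fun i => rightPerp_biprod (D.mem i) (h.rightPerp_J (F.mem (i - 1)))
      bounded := by
        filter_upwards [D.bounded, eventually_pred F.bounded] with i h₁ h₂
        rw [biprod_isZero_iff]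
        exact ⟨h₁, c.J.map_isZero h₂⟩
      ι := ι
      p := p
      q := q
      ι_q := fun i => by
        rw [hι, p_inl, biprod.lift_desc, reassoc_of% hre, reassoc_of% D.ι_q]
        simp only [b, σ, Category.assoc, c.J.map_add, Preadditive.comp_add, c.J.map_comp]
      p_d := fun i => by
        have h₁ : in₁ (i + 1) ≫ (Y ⊞ Z).d i = Y.d i ≫ c.H.map (c.J.map (in₁ i)) :=
          (d_comm (biprod.inl : Y ⟶ Y ⊞ Z) i).symm
        have h₂ : in₂ (i + 1) ≫ (Y ⊞ Z).d i = Z.d i ≫ c.H.map (c.J.map (in₂ i)) :=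
          (d_comm (biprod.inr : Z ⟶ Y ⊞ Z) i).symm
        simp only [p, σ, q, Preadditive.add_comp, Category.assoc, h₁, h₂, biprod.desc_eq,
          reassoc_of% D.p_d i, reassoc_of% ld i, reassoc_of% τd i, zero_comp, comp_zero, add_zero,
          c.H.map_add, c.H.map_comp, c.J.map_comp] }
  let π (i) : (Y ⊞ Z).X i ⟶ cokernel (t.k i ≫ s i) :=
    pr₁ i ≫ v i + pr₂ i ≫ F.fst hI i ≫ cokernel.π _
  have in₁π (i) : in₁ i ≫ π i = v i := by
    simp only [π, Preadditive.comp_add, reassoc_of% hin₁₁ i, reassoc_of% hin₁₂ i, zero_comp,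
      add_zero]
  have in₂π (i) : in₂ i ≫ π i = F.fst hI i ≫ cokernel.π _ := by
    simp only [π, Preadditive.comp_add, reassoc_of% hin₂₁ i, reassoc_of% hin₂₂ i, zero_comp,
      zero_add]
  have hw (i) : D.p i ≫ v i + s i ≫ cokernel.π (t.k i ≫ s i) = 0 := by
    simpa using w' i
  have pπ (i) : p i ≫ π i = 0 := by
    simp only [p, σ, Preadditive.add_comp, Category.assoc, in₁π, in₂π, reassoc_of% lf i,
      reassoc_of% τf i, hw, zero_comp, comp_zero, add_zero]
  have qπ (i) : q i ≫ c.J.map (π i) =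
      biprod.desc (D.q i ≫ c.J.map (v i)) ((e i).hom ≫ c.J.map (cokernel.π _)) := by
    apply biprod.hom_ext'
    · simp only [q, biprod.inl_desc_assoc, biprod.inl_desc, Category.assoc, ← c.J.map_comp, in₁π]
    · simp only [q, biprod.inr_desc_assoc, biprod.inr_desc, Category.assoc, ← c.J.map_comp, in₂π,
        reassoc_of% lf i]
  have Htot (i) : c.H.map (biprod.fst : D.A i ⊞ Q i ⟶ _) ≫ c.H.map biprod.inl +
      c.H.map (biprod.snd : D.A i ⊞ Q i ⟶ _) ≫ c.H.map biprod.inr = 𝟙 _ := by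
    rw [← c.H.map_comp, ← c.H.map_comp, ← c.H.map_add, biprod.total, c.H.map_id]
  have hπ (i) : Epi (π i) := by
    refine epi_of_epi_fac (f := F.inl hI i ≫ in₂ i) (h := cokernel.π (t.k i ≫ s i)) ?_
    rw [Category.assoc, in₂π, reassoc_of% lf i]
  have hp (i) : Mono (p i) := Preadditive.mono_of_cancel_zero _ fun f hf => by
    have h₁ : f ≫ c.H.map biprod.snd = 0 := by
      simpa only [p, σ, Category.assoc, Preadditive.add_comp, Preadditive.comp_add, hin₁₂,
        reassoc_of% hin₁₂ i, reassoc_of% hin₂₂ i, lρ, τρ, zero_comp, comp_zero, zero_add,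
        Category.comp_id] using hf =≫ (pr₂ i ≫ ρ i)
    have h₂ : f ≫ c.H.map biprod.fst ≫ D.p i = 0 := by
      simpa only [p, σ, Category.assoc, Preadditive.add_comp, Preadditive.comp_add, hin₁₁, hin₂₁,
        zero_comp, comp_zero, add_zero, Category.comp_id] using hf =≫ pr₁ i
    have h₃ : f ≫ c.H.map biprod.fst ≫ s i = 0 := by
      simpa only [p, σ, Category.assoc, Preadditive.add_comp, Preadditive.comp_add,
        reassoc_of% hin₁₂ i, reassoc_of% hin₂₂ i, lf, τf, zero_comp, comp_zero, zero_add, add_zero,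
        Category.comp_id] using hf =≫ (pr₂ i ≫ F.fst hI i)
    have := (hv i).mono_f
    have h₄ : f ≫ c.H.map biprod.fst = 0 := by
      apply (cancel_mono (biprod.lift (D.p i) (s i))).1
      simp only [biprod.lift_eq, Preadditive.comp_add, Category.assoc, zero_comp, reassoc_of% h₂,
        reassoc_of% h₃, add_zero]
    rw [← Category.comp_id f, ← Htot, Preadditive.comp_add, reassoc_of% h₄, reassoc_of% h₁,
      zero_comp, zero_comp, add_zero]
  have sp (i) : (ShortComplex.mk (p i) (π i) (pπ i)).ShortExact := by
    refine .mk' (ShortComplex.exact_of_g_is_cokernel _ ?_) (hp i) (hπ i)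
    have hz' {T : ModuleCat.{u} Γ} (z : (Y ⊞ Z).X i ⟶ T) (hz : p i ≫ z = 0) :
        biprod.lift (D.p i) (s i) ≫ biprod.desc (in₁ i ≫ z) (F.inl hI i ≫ in₂ i ≫ z) = 0 := by
      rw [biprod.lift_desc]
      have := c.H.map biprod.inl ≫= hz
      rw [comp_zero, reassoc_of% p_inl] at this
      simpa only [σ, Preadditive.add_comp, Category.assoc] using this
    have hd {T : ModuleCat.{u} Γ} (z : (Y ⊞ Z).X i ⟶ T) (hz : p i ≫ z = 0) :
        biprod.desc (v i) (cokernel.π _) ≫ (hv i).exact.desc _ (hz' z hz) =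
          biprod.desc (in₁ i ≫ z) (F.inl hI i ≫ in₂ i ≫ z) := (hv i).exact.g_desc _ _
    refine CokernelCofork.IsColimit.ofπ _ _ (fun z hz => (hv i).exact.desc _ (hz' z hz))
      (fun z hz => ?_) (fun z hz m hm => ?_)
    · apply ext
      · rw [reassoc_of% in₁π]
        simpa using biprod.inl ≫= hd z hz
      · rw [reassoc_of% in₂π, reassoc_of% lf]
        simpa using biprod.inr ≫= hd z hz
      · rw [reassoc_of% in₂π, reassoc_of% τf, zero_comp]
        have := c.H.map biprod.inr ≫= hz
        rw [comp_zero, reassoc_of% p_inr] at this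
        exact this.symm
    · have := hπ i
      rw [← cancel_epi (π i), hm]
      apply ext
      · rw [reassoc_of% in₁π]
        simpa using (biprod.inl ≫= hd z hz).symm
      · rw [reassoc_of% in₂π, reassoc_of% lf]
        simpa using (biprod.inr ≫= hd z hz).symm
      · rw [reassoc_of% in₂π, reassoc_of% τf, zero_comp]
        have := c.H.map biprod.inr ≫= hz
        rw [comp_zero, reassoc_of% p_inr] at this
        exact this
  have := c.preservesFiniteLimits_J
  have wι (i) : ι (i + 1) ≫ q i ≫ c.J.map (π i) = 0 := by
    rw [reassoc_of% D'.ι_q i, ← c.J.map_comp, pπ, c.J.map_zero, comp_zero, comp_zero]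
  have Jl (i) : c.J.map (biprod.lift (D.p i) (s i)) =
      c.J.map (D.p i) ≫ c.J.map biprod.inl + c.J.map (s i) ≫ c.J.map biprod.inr := by
    rw [biprod.lift_eq, c.J.map_add, c.J.map_comp, c.J.map_comp]
  have hJl (i) : Mono (c.J.map (biprod.lift (D.p i) (s i))) :=
    have : Mono (biprod.lift (D.p i) (s i)) := (hv i).mono_f
    inferInstance
  have hbw (i) : b i ≫ c.J.map (D.p i) = D.ι (i + 1) ≫ D.q i := ((t.isPullback i).w).symm
  have hιm (i) : Mono (ι (i + 1)) := Preadditive.mono_of_cancel_zero _ fun f hf => by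
    have h₁ : f ≫ D.ι (i + 1) = 0 := by simpa [ι] using hf =≫ biprod.fst
    have h₂ : f ≫ r (i + 1) = 0 := by simpa [ι] using hf =≫ biprod.snd
    apply (t.isPullback i).hom_ext
    · rw [h₁, zero_comp]
    · change f ≫ b i = 0 ≫ b i
      apply (cancel_mono (c.J.map (biprod.lift (D.p i) (s i)))).1
      rw [Jl, zero_comp, zero_comp, Preadditive.comp_add, Category.assoc f (b i),
        Category.assoc f (b i), reassoc_of% hbw i, reassoc_of% h₁, zero_comp, ← reassoc_of% hre i, reassoc_of% h₂,
        zero_comp, zero_add]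
  have hιe (i) : Epi (q i ≫ c.J.map (π i)) := by
    rw [qπ]
    have : Epi (c.J.map (cokernel.π (t.k i ≫ s i))) :=
      (c.shortExact_J (shortExact_of_mono (t.k i ≫ s i)) ((t.mem i).2.1 1 one_pos)).epi_g
    exact epi_of_epi_fac (biprod.inr_desc _ _)
  have sι (i) : (ShortComplex.mk _ _ (wι i)).ShortExact := by
    refine .mk' (ShortComplex.exact_of_f_is_kernel _ ?_) (hιm i) (hιe i)
    have hz' {T : ModuleCat.{u} Λ} (z : T ⟶ D.A (i + 1) ⊞ Q (i + 1))
        (hz : z ≫ q i ≫ c.J.map (π i) = 0) : ∃ x, x ≫ ι (i + 1) = z := by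
      have h₁ : (z ≫ biprod.fst) ≫ D.q i ≫ c.J.map (v i) +
          (z ≫ biprod.snd) ≫ (e i).hom ≫ c.J.map (cokernel.π _) = 0 := by
        simpa [qπ, biprod.desc_eq] using hz
      have hJ : ((ShortComplex.mk _ _ (w' i)).map c.J).Exact :=
        have := (hv i).mono_f
        (hv i).exact.map_of_mono_of_preservesKernel c.J this inferInstance
      let φ : T ⟶ c.J.obj (Y.X i ⊞ F.I i) := (z ≫ biprod.fst) ≫ D.q i ≫ c.J.map biprod.inl +
        (z ≫ biprod.snd) ≫ (e i).hom ≫ c.J.map biprod.inr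
      have hφ : φ ≫ c.J.map (biprod.desc (v i) (cokernel.π _)) = 0 := by
        simp only [φ, Preadditive.add_comp, Category.assoc, ← c.J.map_comp, biprod.inl_desc,
          biprod.inr_desc]
        simpa only [Category.assoc] using h₁
      -- Left exactness of `J` on the cone sequence recovers the second leg of the pullback from the
      -- two components of `z`.
      obtain ⟨β, hβ⟩ : ∃ β, β ≫ c.J.map (biprod.lift (D.p i) (s i)) = φ :=
        have : Mono ((ShortComplex.mk _ _ (w' i)).map c.J).f := hJl i
        ⟨hJ.lift φ hφ, hJ.lift_f _ _⟩
      have hβ₁ : β ≫ c.J.map (D.p i) = (z ≫ biprod.fst) ≫ D.q i := by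
        have := hβ =≫ c.J.map biprod.fst
        simpa only [φ, Category.assoc, Preadditive.add_comp, ← c.J.map_comp, biprod.lift_fst,
          biprod.inl_fst, biprod.inr_fst, c.J.map_id, c.J.map_zero, comp_zero, add_zero,
          Category.comp_id] using this
      have hβ₂ : β ≫ c.J.map (s i) = (z ≫ biprod.snd) ≫ (e i).hom := by
        have := hβ =≫ c.J.map biprod.snd
        simpa only [φ, Category.assoc, Preadditive.add_comp, ← c.J.map_comp, biprod.lift_snd,
          biprod.inl_snd, biprod.inr_snd, c.J.map_id, c.J.map_zero, comp_zero, zero_add,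
          Category.comp_id] using this
      refine ⟨(t.isPullback i).lift (z ≫ biprod.fst) β hβ₁.symm, ?_⟩
      have hx₂ : (t.isPullback i).lift (z ≫ biprod.fst) β hβ₁.symm ≫ b i = β :=
        (t.isPullback i).lift_snd _ _ _
      apply biprod.hom_ext
      · rw [Category.assoc, biprod.lift_fst, IsPullback.lift_fst]
      · rw [Category.assoc, biprod.lift_snd, ← cancel_mono (e i).hom, Category.assoc, hre,
          reassoc_of% hx₂, hβ₂]
    choose x hx using @hz'
    exact KernelFork.IsLimit.ofι _ _ (fun z hz => x z hz) (fun z hz => hx z hz)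
      (fun z hz m hm => by
        have := hιm i
        rw [← cancel_mono (ι (i + 1)), hm, hx])
  refine ⟨D', ⟨⟨fun i => cokernel (t.k i ≫ s i), hc, π, pπ, wι, sp, sι, fun i M u w huw => ?_⟩⟩⟩
  change X.d i ≫ c.J.map (c.H.map (ι i)) ≫ c.J.map u = ι (i + 1) ≫ w at huw
  change ∃ z, p i ≫ z = u ∧ q i ≫ c.J.map z = w
  rw [hι] at huw
  have hU := BimoduleContext.IsTilting.rightPerpID_of_isSummand (F.mem i)
  -- The value on `F.I i` is dictated by the restriction of `w` to the new summand, by fullness of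
  -- `J`.
  obtain ⟨wU, hwU⟩ := (h.J_bijective hU M).2 ((e i).inv ≫ biprod.inr ≫ w)
  have hx : c.J.map (t.k i) ≫ c.J.map (D.p i) = 0 := by
    rw [← c.J.map_comp, t.k_p, c.J.map_zero]
  -- This map into the pullback tests the equation on the kernel of `p`: it is zero on the first leg
  -- and `J` of the kernel inclusion on the second, so compatibility of `u` and `w` yields the
  -- vanishing needed to descend to `Y`.
  let x : c.J.obj (t.K i) ⟶ X.X (i + 1) :=
    (t.isPullback i).lift 0 (c.J.map (t.k i)) (by rw [hx, zero_comp])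
  have hx₁ : x ≫ D.ι (i + 1) = 0 := (t.isPullback i).lift_fst _ _ _
  have hx₂ : x ≫ b i = c.J.map (t.k i) := (t.isPullback i).lift_snd _ _ _
  have h0 : t.k i ≫ (c.H.map biprod.inl ≫ u - s i ≫ wU) = 0 := by
    apply (h.J_bijective (t.mem i) M).1
    have h₁ := x ≫= huw
    rw [reassoc_of% hx₂] at h₁
    have h₂ : x ≫ ι (i + 1) ≫ w = x ≫ b i ≫ c.J.map (s i) ≫ c.J.map wU := by
      rw [hwU, ← reassoc_of% hre, Iso.hom_inv_id_assoc, ι_eq, Preadditive.add_comp,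
        Preadditive.comp_add, Category.assoc, Category.assoc, reassoc_of% hx₁, zero_comp, zero_add]
    rw [h₂, reassoc_of% hx₂] at h₁
    rw [c.J.map_comp, c.J.map_sub, Preadditive.comp_sub, h₁, c.J.map_comp (s i), sub_self,
      c.J.map_zero]
  have := (t.shortExact_p i).epi_g
  obtain ⟨wY, hwY⟩ : ∃ wY, D.p i ≫ wY = c.H.map biprod.inl ≫ u - s i ≫ wU :=
    ⟨(t.shortExact_p i).exact.desc _ h0, (t.shortExact_p i).exact.g_desc _ _⟩
  let z : (Y ⊞ Z).X i ⟶ M :=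
    pr₁ i ≫ wY + pr₂ i ≫ (F.fst hI i ≫ wU + ρ i ≫ c.H.map biprod.inr ≫ u)
  have z₁ : in₁ i ≫ z = wY := by
    simp only [z, Preadditive.comp_add, reassoc_of% hin₁₁ i, reassoc_of% hin₁₂ i, zero_comp,
      add_zero]
  have z₂ : in₂ i ≫ z = F.fst hI i ≫ wU + ρ i ≫ c.H.map biprod.inr ≫ u := by
    simp only [z, Preadditive.comp_add, reassoc_of% hin₂₁ i, reassoc_of% hin₂₂ i, zero_comp,
      zero_add]
  refine ⟨z, ?_, ?_⟩
  · have h₁ : σ i ≫ z = c.H.map biprod.inl ≫ u := by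
      simp only [σ, Preadditive.add_comp, Category.assoc, z₁, z₂, hwY, Preadditive.comp_add,
        reassoc_of% lf i, reassoc_of% lρ i, zero_comp, add_zero, sub_add_cancel]
    simp only [p, Preadditive.add_comp, Category.assoc, h₁, z₂, Preadditive.comp_add,
      reassoc_of% τf i, reassoc_of% τρ i, zero_comp, zero_add]
    simp only [← Category.assoc, ← Preadditive.add_comp, Htot, Category.id_comp]
  · apply biprod.hom_ext'
    · rw [biprod.inl_desc_assoc, Category.assoc, ← c.J.map_comp, z₁]
      -- In a type II triple `ι` is a pullback of `J p`, which is epi because the kernel of `p` is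
      -- right orthogonal to `W`. Equality can therefore be tested on `X`.
      have : Epi (D.ι (i + 1)) := by
        have : Epi (c.J.map (D.p i)) :=
          (c.shortExact_J (t.shortExact_p i) ((t.mem i).2.1 1 one_pos)).epi_g
        exact (MorphismProperty.epimorphisms _).of_isPullback (t.isPullback i).flip
          (MorphismProperty.epimorphisms.infer_property _)
      rw [← cancel_epi (D.ι (i + 1)), ← reassoc_of% hbw, ← c.J.map_comp, hwY, c.J.map_sub,
        Preadditive.comp_sub, huw, c.J.map_comp, ← reassoc_of% hre, hwU, Iso.hom_inv_id_assoc,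
        ι_eq, Preadditive.add_comp, Category.assoc, Category.assoc, add_sub_cancel_right]
    · rw [biprod.inr_desc_assoc, Category.assoc, ← c.J.map_comp, Category.assoc, z₂,
        Preadditive.comp_add, reassoc_of% lf i, reassoc_of% lρ i, zero_comp, add_zero, hwU,
        Iso.hom_inv_id_assoc]

end Triple
end ExtVanishing

/-! ### From type I to type II by adding a coinduced summand. -/

namespace ExtVanishing

open Abelian Limits RepetitiveModule

namespace Triple

variable {Λ Γ : Type u} [Ring Λ] [Ring Γ] {c : BimoduleContext Λ Γ}
  [IsNoetherianRing Λ] [IsNoetherianRing Γ] (h : c.IsTilting)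
  {X : RepetitiveModule (c.H ⋙ c.J)} {Y : RepetitiveModule (c.J ⋙ c.H)} {D : Triple c X Y}
include h

-- A pair agreeing in `J Y` is killed by the projection of `A` to the cokernel of `ι`, so its first
-- entry lifts to `X`; the second leg then agrees because `J p` is mono.
omit [IsNoetherianRing Λ] [IsNoetherianRing Γ] h in
lemma TypeI.isPullback (t : D.TypeI) (i : ℤ) :
    IsPullback (D.ι (i + 1)) (X.d i ≫ c.J.map (c.H.map (D.ι i))) (D.q i) (c.J.map (D.p i)) := by
  have w : D.ι (i + 1) ≫ D.q i = (X.d i ≫ c.J.map (c.H.map (D.ι i))) ≫ c.J.map (D.p i) := by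
    rw [D.ι_q, Category.assoc]
  have hE := t.shortExact_ι i
  have : Mono (D.ι (i + 1)) := hE.mono_f
  have := c.preservesFiniteLimits_J
  have : Mono (D.p i) := (t.shortExact_p i).mono_f
  refine IsPullback.of_exists w (fun T a b hab => ?_) fun T x hx _ => ?_
  · have h0 : a ≫ D.q i ≫ c.J.map (t.π i) = 0 := by
      rw [reassoc_of% hab, ← c.J.map_comp, t.p_π, c.J.map_zero, comp_zero]
    refine ⟨hE.exact.lift a h0, hE.exact.lift_f _ _, ?_⟩
    rw [← cancel_mono (c.J.map (D.p i)), Category.assoc, ← w, ← hab]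
    exact (Category.assoc _ _ _).symm.trans (congrArg (· ≫ D.q i) (hE.exact.lift_f a h0))
  · rw [← cancel_mono (D.ι (i + 1)), hx, zero_comp]

/-- Add a coinduced sequence to the first component of a triple of type I to turn it into a
triple of type II. -/
lemma TypeI.exists_typeII (t : D.TypeI) (F : Family (c.H ⋙ c.J) (IsSummand c.IC))
    (s : ∀ i, c.J.obj (c.H.obj (F.I i)) ⟶ D.A (i + 1)) (m : ∀ i, c.H.obj (F.I i) ⟶ Y.X i)
    (hsm : ∀ i, c.J.map (m i) = s i ≫ D.q i) (hm : ∀ i, Epi (m i ≫ t.π i))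
    (hk : ∀ i, rightPerpID c.W (kernel (m i ≫ t.π i))) :
    ∃ D' : Triple c (X ⊞ F.coind h.isInducing_IC) Y, Nonempty D'.TypeII ∧
      ∃ a, IsHom D D' biprod.inl a (𝟙 Y) := by
  set hI := h.isInducing_IC
  set Z := F.coind hI
  let Q (i) : ModuleCat.{u} Λ := c.J.obj (c.H.obj (F.I (i - 1)))
  let e (i) : Q (i + 1) ≅ c.J.obj (c.H.obj (F.I i)) :=
    c.J.mapIso (c.H.mapIso (shiftIso F.I i))
  let τ (i) : Q i ⟶ Z.X i := F.tail hI i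
  let ρ (i) : Z.X i ⟶ Q i := F.toTail hI i
  let in₁ (i) : X.X i ⟶ (X ⊞ Z).X i := Hom.f (biprod.inl : X ⟶ X ⊞ Z) i
  let in₂ (i) : Z.X i ⟶ (X ⊞ Z).X i := Hom.f (biprod.inr : Z ⟶ X ⊞ Z) i
  let pr₁ (i) : (X ⊞ Z).X i ⟶ X.X i := Hom.f (biprod.fst : X ⊞ Z ⟶ X) i
  let pr₂ (i) : (X ⊞ Z).X i ⟶ Z.X i := Hom.f (biprod.snd : X ⊞ Z ⟶ Z) i
  have total (i) : pr₁ i ≫ in₁ i + pr₂ i ≫ in₂ i = 𝟙 _ := biprod_total_f X Z i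
  have hin₁₁ (i) : in₁ i ≫ pr₁ i = 𝟙 _ := biprod_inl_fst_f X Z i
  have hin₁₂ (i) : in₁ i ≫ pr₂ i = 0 := biprod_inl_snd_f X Z i
  have hin₂₁ (i) : in₂ i ≫ pr₁ i = 0 := biprod_inr_fst_f X Z i
  have hin₂₂ (i) : in₂ i ≫ pr₂ i = 𝟙 _ := biprod_inr_snd_f X Z i
  have τρ (i) : τ i ≫ ρ i = 𝟙 _ := F.tail_toTail hI i
  have τf (i) : τ i ≫ F.fst hI i = 0 := F.tail_fst hI i
  have lρ (i) : F.inl hI i ≫ ρ i = 0 := F.inl_toTail hI i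
  have lf (i) : F.inl hI i ≫ F.fst hI i = 𝟙 _ := F.inl_fst hI i
  have total' (i) : F.fst hI i ≫ F.inl hI i + ρ i ≫ τ i = 𝟙 _ := F.fst_inl_add_toTail_tail hI i
  have dZ (i) : Z.d i = ρ (i + 1) ≫ (e i).hom ≫ c.J.map (c.H.map (F.inl hI i)) := by
    refine (F.δ_eq_toTail hI i).trans ?_
    simp [e, ρ]
  have hpr₁ (i) : (X ⊞ Z).d i ≫ c.J.map (c.H.map (pr₁ i)) = pr₁ (i + 1) ≫ X.d i :=
    d_comm (biprod.fst : X ⊞ Z ⟶ X) i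
  have hpr₂ (i) : (X ⊞ Z).d i ≫ c.J.map (c.H.map (pr₂ i)) = pr₂ (i + 1) ≫ Z.d i :=
    d_comm (biprod.snd : X ⊞ Z ⟶ Z) i
  -- The summand `J (H (F.I i))` of the coinduced sequence reaches `D.A` through `s`, while its
  -- first summand is added to the middle term unchanged.
  obtain ⟨r, hr⟩ := exists_shift (β := fun i => Q i ⟶ D.A i) fun i => (e i).hom ≫ s i
  let ι (i) : (X ⊞ Z).X i ⟶ D.A i ⊞ F.I i :=
    pr₁ i ≫ D.ι i ≫ biprod.inl + pr₂ i ≫ (F.fst hI i ≫ biprod.inr + ρ i ≫ r i ≫ biprod.inl)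
  let p (i) : c.H.obj (D.A i ⊞ F.I i) ⟶ Y.X i :=
    c.H.map biprod.fst ≫ D.p i + c.H.map biprod.snd ≫ m i
  have p_inl (i) : c.H.map biprod.inl ≫ p i = D.p i := by simp [p, ← c.H.map_comp_assoc]
  have p_inr (i) : c.H.map biprod.inr ≫ p i = m i := by simp [p, ← c.H.map_comp_assoc]
  let q (i) : D.A (i + 1) ⊞ F.I (i + 1) ⟶ c.J.obj (Y.X i) := biprod.desc (D.q i) 0
  obtain ⟨b, hb⟩ : ∃ b : ∀ i, (X ⊞ Z).X (i + 1) ⟶ c.J.obj (c.H.obj (D.A i ⊞ F.I i)),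
      ∀ i, b i = (X ⊞ Z).d i ≫ c.J.map (c.H.map (ι i)) := ⟨_, fun _ => rfl⟩
  have b_eq (i) : b i = pr₁ (i + 1) ≫ X.d i ≫ c.J.map (c.H.map (D.ι i)) ≫
      c.J.map (c.H.map biprod.inl) +
      pr₂ (i + 1) ≫ ρ (i + 1) ≫ (e i).hom ≫ c.J.map (c.H.map biprod.inr) := by
    have h₁ : F.inl hI i ≫ (F.fst hI i ≫ biprod.inr + ρ i ≫ r i ≫ biprod.inl) =
        (biprod.inr : _ ⟶ D.A i ⊞ F.I i) := by
      rw [Preadditive.comp_add, reassoc_of% lf i, reassoc_of% lρ i, zero_comp, add_zero]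
    rw [hb]
    dsimp only [ι]
    rw [c.H.map_add, c.J.map_add, Preadditive.comp_add, c.H.map_comp (pr₁ i), c.H.map_comp (pr₂ i), c.J.map_comp, c.J.map_comp,
      reassoc_of% hpr₁ i, reassoc_of% hpr₂ i, dZ, c.H.map_comp, c.J.map_comp]
    simp only [Category.assoc]
    rw [← c.J.map_comp (c.H.map (F.inl hI i)), ← c.H.map_comp, h₁]
  have b_fst (i) : b i ≫ c.J.map (c.H.map biprod.fst) =
      pr₁ (i + 1) ≫ X.d i ≫ c.J.map (c.H.map (D.ι i)) := by
    simp only [b_eq, Preadditive.add_comp, Category.assoc, ← c.J.map_comp, ← c.H.map_comp,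
      biprod.inl_fst, biprod.inr_fst, c.H.map_zero, c.J.map_zero, comp_zero, add_zero,
      Category.comp_id]
  have b_snd (i) : b i ≫ c.J.map (c.H.map biprod.snd) = pr₂ (i + 1) ≫ ρ (i + 1) ≫ (e i).hom := by
    simp only [b_eq, Preadditive.add_comp, Category.assoc, ← c.J.map_comp, ← c.H.map_comp,
      biprod.inl_snd, biprod.inr_snd, c.H.map_zero, c.J.map_zero, comp_zero, zero_add, c.H.map_id,
      c.J.map_id, Category.comp_id]
  have ι_fst (i) : ι i ≫ biprod.fst = pr₁ i ≫ D.ι i + pr₂ i ≫ ρ i ≫ r i := by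
    simp [ι]
  have ι_snd (i) : ι i ≫ biprod.snd = pr₂ i ≫ F.fst hI i := by
    simp [ι]
  have q_eq (i) : q i = biprod.fst ≫ D.q i := by simp [q, biprod.desc_eq]
  have Jp (i) : c.J.map (p i) = c.J.map (c.H.map biprod.fst) ≫ c.J.map (D.p i) +
      c.J.map (c.H.map biprod.snd) ≫ s i ≫ D.q i := by
    simp only [p, c.J.map_add, c.J.map_comp, hsm]
  have w (i) : ι (i + 1) ≫ q i = b i ≫ c.J.map (p i) := by
    rw [q_eq, reassoc_of% ι_fst, Jp, Preadditive.comp_add, reassoc_of% b_fst, reassoc_of% b_snd,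
      Preadditive.add_comp, Category.assoc, D.ι_q, hr]
    simp only [Category.assoc]
  -- Tested after `J`, which is faithful here: `m` becomes `s ≫ q`, and `q` followed by `J` of a
  -- structure map is zero.
  have hmd (i) : m (i + 1) ≫ Y.d i = 0 := by
    apply (h.J_bijective (h.rightPerpID_H (F.mem _)) _).1
    rw [c.J.map_comp, hsm, Category.assoc, D.q_d h, comp_zero, c.J.map_zero]
  let D' : Triple c (X ⊞ Z) Y :=
    { A := fun i => D.A i ⊞ F.I i
      mem := fun i => rightPerp_biprod (D.mem i)
        (BimoduleContext.IsTilting.rightPerp_of_isSummand (F.mem i))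
      bounded := by
        filter_upwards [D.bounded, F.bounded] with i h₁ h₂
        rw [biprod_isZero_iff]
        exact ⟨h₁, h₂⟩
      ι := ι
      p := p
      q := q
      ι_q := fun i => by rw [w, hb, Category.assoc]
      p_d := fun i => by
        simp only [p, Preadditive.add_comp, Category.assoc, D.p_d, hmd, comp_zero, add_zero, q_eq,
          c.H.map_comp] }
  have := preservesBinaryBiproducts_of_preservesBiproducts c.H
  -- The added map `m` covers the cokernel of `p`, so together they are epi, with kernel that of `m
  -- ≫ t.π`.
  choose v w' hv using fun i => shortExact_lift_desc' (t.shortExact_p i) (m i)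
  let k (i) : kernel (m i ≫ t.π i) ⟶ c.H.obj (D.A i ⊞ F.I i) :=
    biprod.lift (v i) (kernel.ι _) ≫ (c.H.mapBiprod _ _).inv
  have hp (i) : (c.H.mapBiprod (D.A i) (F.I i)).inv ≫ p i = biprod.desc (D.p i) (m i) := by
    apply biprod.hom_ext'
    · rw [Functor.mapBiprod_inv, biprod.inl_desc_assoc, biprod.inl_desc, p_inl]
    · rw [Functor.mapBiprod_inv, biprod.inr_desc_assoc, biprod.inr_desc, p_inr]
  have wk (i) : k i ≫ p i = 0 := by
    rw [Category.assoc, hp, w']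
  have hPD := t.isPullback
  refine ⟨D', ⟨fun i => kernel (m i ≫ t.π i), hk, k, wk, fun i => ?_, fun i => ?_⟩, fun i => biprod.inl,
    ⟨fun i => ?_, fun i => ?_⟩⟩
  · exact ShortComplex.shortExact_of_iso (ShortComplex.isoMk (S₁ := .mk _ _ (w' i))
      (S₂ := .mk (k i) (p i) (wk i)) (Iso.refl _) (c.H.mapBiprod _ _).symm (Iso.refl _) (by simp [k])
        (by
          dsimp
          rw [hp, Category.comp_id])) (hv i)
  · change IsPullback (ι (i + 1)) ((X ⊞ Z).d i ≫ c.J.map (c.H.map (ι i))) (q i) (c.J.map (p i))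
    rw [← hb]
    refine IsPullback.of_exists (w i) (fun T a b' hab => ?_) fun T x hx hx' => ?_
    · have hx : (a ≫ biprod.fst - (b' ≫ c.J.map (c.H.map biprod.snd)) ≫ s i) ≫ D.q i =
          (b' ≫ c.J.map (c.H.map biprod.fst)) ≫ c.J.map (D.p i) := by
        rw [q_eq, Jp, Preadditive.comp_add] at hab
        rw [Preadditive.sub_comp, Category.assoc, hab]
        simp only [Category.assoc, add_sub_cancel_right]
      obtain ⟨x, hx₁, hx₂⟩ : ∃ x, x ≫ D.ι (i + 1) =
          a ≫ biprod.fst - (b' ≫ c.J.map (c.H.map biprod.snd)) ≫ s i ∧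
          x ≫ X.d i ≫ c.J.map (c.H.map (D.ι i)) = b' ≫ c.J.map (c.H.map biprod.fst) :=
        ⟨(hPD i).lift _ _ hx, (hPD i).lift_fst _ _ _, (hPD i).lift_snd _ _ _⟩
      let y : T ⟶ Z.X (i + 1) := (a ≫ biprod.snd) ≫ F.inl hI (i + 1) +
        (b' ≫ c.J.map (c.H.map biprod.snd)) ≫ (e i).inv ≫ τ (i + 1)
      have hy₁ : y ≫ F.fst hI (i + 1) = a ≫ biprod.snd := by
        simp only [y, Preadditive.add_comp, Category.assoc, lf, τf, comp_zero, add_zero,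
          Category.comp_id]
      have hy₂ : y ≫ ρ (i + 1) = (b' ≫ c.J.map (c.H.map biprod.snd)) ≫ (e i).inv := by
        simp only [y, Preadditive.add_comp, Category.assoc, lρ, τρ, comp_zero, zero_add,
          Category.comp_id]
      have h₁ : (x ≫ in₁ (i + 1) + y ≫ in₂ (i + 1)) ≫ pr₁ (i + 1) = x := by
        simp only [Preadditive.add_comp, Category.assoc, hin₁₁, hin₂₁, comp_zero, add_zero,
          Category.comp_id]
      have h₂ : (x ≫ in₁ (i + 1) + y ≫ in₂ (i + 1)) ≫ pr₂ (i + 1) = y := by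
        simp only [Preadditive.add_comp, Category.assoc, hin₁₂, hin₂₂, comp_zero, zero_add,
          Category.comp_id]
      refine ⟨x ≫ in₁ (i + 1) + y ≫ in₂ (i + 1), ?_, ?_⟩
      · apply biprod.hom_ext
        · rw [Category.assoc, ι_fst, Preadditive.comp_add, reassoc_of% h₁, reassoc_of% h₂, hx₁,
            reassoc_of% hy₂, hr, Iso.inv_hom_id_assoc]
          simp only [Category.assoc, sub_add_cancel]
        · rw [Category.assoc, ι_snd, reassoc_of% h₂, hy₁]
      · rw [b_eq, Preadditive.comp_add, reassoc_of% h₁, reassoc_of% h₂, reassoc_of% hx₂,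
          reassoc_of% hy₂, Iso.inv_hom_id_assoc]
        simp only [← Preadditive.comp_add, ← c.J.map_comp, ← c.H.map_comp, ← c.J.map_add,
          ← c.H.map_add, biprod.total, c.H.map_id, c.J.map_id, Category.comp_id]
    · have h₁ : (x ≫ pr₂ (i + 1)) ≫ ρ (i + 1) = 0 := by
        rw [← cancel_mono (e i).hom, zero_comp, Category.assoc, Category.assoc, ← b_snd,
          reassoc_of% hx', zero_comp]
      have h₂ : (x ≫ pr₂ (i + 1)) ≫ F.fst hI (i + 1) = 0 := by
        rw [Category.assoc, ← ι_snd, reassoc_of% hx, zero_comp]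
      have h₃ : x ≫ pr₂ (i + 1) = 0 := by
        rw [← Category.comp_id (x ≫ pr₂ (i + 1)), ← total', Preadditive.comp_add,
          ← Category.assoc (x ≫ _), h₂, ← Category.assoc (x ≫ _), h₁, zero_comp, zero_comp, add_zero]
      have h₄ : x ≫ pr₁ (i + 1) = 0 := by
        apply (hPD i).hom_ext
        · have := hx =≫ biprod.fst
          rw [Category.assoc, ι_fst, Preadditive.comp_add, reassoc_of% h₃, zero_comp, zero_comp,
            add_zero] at this
          rw [Category.assoc, this, zero_comp]
        · rw [Category.assoc, ← b_fst, reassoc_of% hx', zero_comp, zero_comp]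
      rw [← Category.comp_id x, ← total, Preadditive.comp_add, reassoc_of% h₃, reassoc_of% h₄,
        zero_comp, zero_comp, add_zero]
  · change D.ι i ≫ biprod.inl = in₁ i ≫ ι i
    simp only [ι, Preadditive.comp_add, reassoc_of% hin₁₁ i, reassoc_of% hin₁₂ i, zero_comp,
      add_zero]
  · rw [id_f, Category.comp_id]
    exact (p_inl i).symm

end Triple
end ExtVanishing

/-! ### The equivalence of stable categories. -/

namespace ExtVanishing

open Abelian Limits RepetitiveModule

namespace Triple

variable {Λ Γ : Type u} [Ring Λ] [Ring Γ] {c : BimoduleContext Λ Γ}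
  [IsNoetherianRing Λ] [IsNoetherianRing Γ] (h : c.IsTilting)
  {X X' : RepetitiveModule (c.H ⋙ c.J)} {Y Y' : RepetitiveModule (c.J ⋙ c.H)}
  {D : Triple c X Y} {D' : Triple c X' Y'}
include h

/-- The kernels of `p` embed in injectives with cokernels in the same class, and injectivity extends
these embeddings along `t.k` to give `s`. -/
lemma TypeII.exists_coind (t : D.TypeII) : ∃ (F : Family (c.J ⋙ c.H) (IsSummand c.ID))
    (D' : Triple c X (Y ⊞ F.coind h.isInducing_ID)), Nonempty D'.TypeI := by
  choose U hU h0 f hf hf' using fun i => BimoduleContext.IsTilting.exists_mono_injective (t.mem i)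
  have hk (i) : Mono (t.k i) := (t.shortExact_p i).mono_f
  have hI (i) : Injective (U i) := (hU i).injective
  have hs (i) : t.k i ≫ Injective.factorThru (f i) (t.k i) = f i := Injective.comp_factorThru _ _
  refine ⟨⟨U, hU, D.bounded.mono fun i hi => h0 i (IsZero.of_mono (t.k i) (c.H.map_isZero hi))⟩,
    t.exists_typeI h _ (fun i => Injective.factorThru (f i) (t.k i)) (fun i => ?_) fun i => ?_⟩
  · rw [hs]
    exact hf i
  · rw [hs]
    exact hf' i

lemma TypeI.exists_coind (t : D.TypeI) : ∃ (F : Family (c.H ⋙ c.J) (IsSummand c.IC))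
    (D' : Triple c (X ⊞ F.coind h.isInducing_IC) Y), Nonempty D'.TypeII ∧
      ∃ a, IsHom D D' biprod.inl a (𝟙 Y) := by
  choose I hI h0 e he he' using fun i => h.exists_epi_injective (t.mem i)
  have hP (i) : Projective (c.J.obj (c.H.obj (I i))) := h.isInducing_IC.projective _ (hI i)
  have hE (i) : Epi (D.q i ≫ c.J.map (t.π i)) := (t.shortExact_ι i).epi_g
  -- `J (H (I i))` is projective, so `J` of the cover lifts to `D.A (i + 1)`; full faithfulness of
  -- `J` converts the lift followed by `q` into the map `m`.
  let s (i) : c.J.obj (c.H.obj (I i)) ⟶ D.A (i + 1) :=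
    Projective.factorThru (c.J.map (e i)) (D.q i ≫ c.J.map (t.π i))
  have hs (i) : s i ≫ D.q i ≫ c.J.map (t.π i) = c.J.map (e i) := Projective.factorThru_comp _ _
  choose m hm using fun i => (h.J_bijective (h.rightPerpID_H (hI i)) _).2 (s i ≫ D.q i)
  have hme (i) : m i ≫ t.π i = e i := by
    apply (h.J_bijective (h.rightPerpID_H (hI i)) _).1
    rw [c.J.map_comp, hm, Category.assoc, hs]
  refine ⟨⟨I, hI, Y.bounded.mono fun i hi => h0 i
    (have := (t.shortExact_p i).epi_g; IsZero.of_epi (t.π i) hi)⟩,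
    t.exists_typeII h _ s m hm (fun i => ?_) fun i => ?_⟩
  · rw [hme]
    exact he i
  · rw [hme]
    exact he' i

omit [IsNoetherianRing Λ] [IsNoetherianRing Γ] h in
variable (c) in
/-- The zero triple. -/
def zero : Triple c (RepetitiveModule.zero _) (RepetitiveModule.zero _) where
  A _ := ModuleCat.of Λ PUnit
  mem _ := BimoduleContext.IsTilting.rightPerp_of_isZero (ModuleCat.isZero_of_subsingleton _)
  bounded := .of_forall fun _ => ModuleCat.isZero_of_subsingleton _
  ι _ := 0
  p _ := 0
  q _ := 0
  ι_q _ := by simp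
  p_d _ := by simp

omit [IsNoetherianRing Λ] [IsNoetherianRing Γ] h in
lemma isZero_zero_A (i : ℤ) : IsZero ((zero c).A i) :=
  ModuleCat.isZero_of_subsingleton (ModuleCat.of Λ PUnit)

omit h [IsNoetherianRing Λ] [IsNoetherianRing Γ] in
variable (Λ) in
lemma isZero_punit : IsZero (ModuleCat.of Λ PUnit.{u + 1}) := ModuleCat.isZero_of_subsingleton _

omit h [IsNoetherianRing Λ] [IsNoetherianRing Γ] in
lemma shortExact_of_isZero {E : ShortComplex (ModuleCat.{u} Λ)} (h₁ : IsZero E.X₁)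
    (h₂ : IsZero E.X₂) (h₃ : IsZero E.X₃) : E.ShortExact :=
  .mk' (ShortComplex.exact_of_isZero_X₂ _ h₂) ⟨fun _ _ _ => h₁.eq_of_tgt _ _⟩
    ⟨fun _ _ _ => h₃.eq_of_src _ _⟩

omit h [IsNoetherianRing Λ] [IsNoetherianRing Γ] in
lemma rightPerpID_punit : rightPerpID c.W (ModuleCat.of Γ PUnit.{u + 1}) :=
  BimoduleContext.IsTilting.rightPerpID_of_isSummand (.of_isZero (isZero_punit Γ))

omit [IsNoetherianRing Λ] [IsNoetherianRing Γ] h in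
variable (c) in
/-- The zero triple has type I. -/
def zeroTypeI : (zero c).TypeI where
  K _ := ModuleCat.of Γ PUnit.{u + 1}
  mem _ := rightPerpID_punit
  π _ := 0
  p_π _ := comp_zero
  ι_q_π _ := by simp
  shortExact_p i := shortExact_of_isZero (c.H.map_isZero (isZero_zero_A i))
    (isZero_zero_X (N := c.J ⋙ c.H) i)
    (isZero_punit Γ)
  shortExact_ι i := shortExact_of_isZero (isZero_zero_X (N := c.H ⋙ c.J) (i + 1))
    (isZero_zero_A (c := c) (i + 1)) (c.J.map_isZero (isZero_punit Γ))
  exists_desc i _ _ _ _ := ⟨0, (c.H.map_isZero (isZero_zero_A i)).eq_of_src _ _,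
    (isZero_zero_A (i + 1)).eq_of_src _ _⟩

omit [IsNoetherianRing Λ] [IsNoetherianRing Γ] h in
variable (c) in
/-- The zero triple has type II. -/
def zeroTypeII : (zero c).TypeII where
  K _ := ModuleCat.of Γ PUnit.{u + 1}
  mem _ := rightPerpID_punit
  k _ := 0
  k_p _ := comp_zero
  shortExact_p i := shortExact_of_isZero (isZero_punit Γ) (c.H.map_isZero (isZero_zero_A i))
    (isZero_zero_X (N := c.J ⋙ c.H) i)
  isPullback i := IsPullback.of_exists ((isZero_zero_X _).eq_of_src _ _)
    (fun _ _ _ _ => ⟨0, (isZero_zero_A (i + 1)).eq_of_tgt _ _,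
      (c.J.map_isZero (c.H.map_isZero (isZero_zero_A i))).eq_of_tgt _ _⟩)
    fun _ _ _ _ => (isZero_zero_X _).eq_of_tgt _ _

/-- Coinduced sequences correspond to zero: apply the conversion to the zero triple, where the
cokernels are just the injectives of the family. -/
lemma exists_typeI_coind (F : Family (c.J ⋙ c.H) (IsSummand c.ID)) :
    ∃ D : Triple c (RepetitiveModule.zero _)
      (RepetitiveModule.zero _ ⊞ F.coind h.isInducing_ID), Nonempty D.TypeI := by
  refine (zeroTypeII c).exists_typeI h F 0 (fun i => ⟨fun _ _ _ => (isZero_punit Γ).eq_of_tgt _ _⟩)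
    fun i => ?_
  have h0 : (zeroTypeII c).k i ≫ (0 : ∀ i, c.H.obj ((zero c).A i) ⟶ F.I i) i = 0 := comp_zero
  rw [h0]
  exact IsCotiltingClass.rightPerpID_of_retract
    ⟨cokernel.desc 0 (𝟙 _) zero_comp, cokernel.π _, by rw [← cancel_epi (cokernel.π _)]; simp⟩
    (BimoduleContext.IsTilting.rightPerpID_of_isSummand (F.mem i))

lemma exists_typeII_coind (F : Family (c.H ⋙ c.J) (IsSummand c.IC)) :
    ∃ D : Triple c (RepetitiveModule.zero _ ⊞ F.coind h.isInducing_IC)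
      (RepetitiveModule.zero _), Nonempty D.TypeII := by
  obtain ⟨D, hD, -⟩ := (zeroTypeI c).exists_typeII h F 0 0
    (fun i => ((c.J.map_isZero (isZero_zero_X i))).eq_of_tgt _ _)
    (fun i => ⟨fun _ _ _ =>
      (show IsZero ((zeroTypeI c).K i) from isZero_punit Γ).eq_of_src _ _⟩) fun i => by
      have h0 : (0 : ∀ i, c.H.obj (F.I i) ⟶ (RepetitiveModule.zero (c.J ⋙ c.H)).X i) i ≫
        (zeroTypeI c).π i = 0 := zero_comp
      rw [h0]
      exact IsCotiltingClass.rightPerpID_of_retract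
        ⟨kernel.ι _, kernel.lift 0 (𝟙 _) comp_zero, by rw [← cancel_mono (kernel.ι _)]; simp⟩
        (h.rightPerpID_H (F.mem i))
  exact ⟨D, hD⟩

omit h [IsNoetherianRing Λ] [IsNoetherianRing Γ] in
lemma projective_zero (N : ModuleCat.{u} Λ ⥤ ModuleCat.{u} Λ) [N.Additive] :
    Projective (RepetitiveModule.zero N) where
  factors f e _ := ⟨0, by
    ext i : 1
    exact (isZero_zero_X i).eq_of_src _ _⟩

/-- The second component of a morphism of triples is stably zero if the first one is and the
source has type I. -/
lemma TypeI.isStablyZero (t : D.TypeI) {f : X ⟶ X'} {a : ∀ i, D.A i ⟶ D'.A i} {g : Y ⟶ Y'}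
    (hf : IsHom D D' f a g) (h0 : IsStablyZero f) : IsStablyZero g := by
  -- The factorization through a coinduced sequence is lifted to a composite of maps of triples
  -- whose middle triple has a projective `Y` as well. Subtracting it reduces to a map whose
  -- component on `X` is zero.
  obtain ⟨F, α, β, rfl⟩ := exists_factor_coind h.isInducing_IC h0
  obtain ⟨D₁, ⟨t₁⟩⟩ := exists_typeII_coind h F
  obtain ⟨F', D₂, ⟨t₂⟩⟩ := t₁.exists_coind h
  obtain ⟨a₁, γ₁, h₁⟩ := t.exists_isHom h D₂ (α ≫ biprod.inr)
  obtain ⟨a₂, γ₂, h₂⟩ := t₂.exists_isHom h D' (biprod.snd ≫ β)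
  have h₃ := hf.sub (h₁.comp h₂)
  have : α ≫ β - (α ≫ (biprod.inr : _ ⟶ RepetitiveModule.zero (c.H ⋙ c.J) ⊞ _)) ≫
    biprod.snd ≫ β = 0 := by simp
  rw [this] at h₃
  have := projective_zero (c.J ⋙ c.H)
  have := F'.projective_coind h.isInducing_ID
  simpa using (t.isStablyZero_of_eq_zero h h₃).add (isStablyZero_of_projective γ₁ γ₂)

/-- The first component of a morphism of triples is stably zero if the second one is and the
target has type II. -/
lemma TypeII.isStablyZero (t : D'.TypeII) {f : X ⟶ X'} {a : ∀ i, D.A i ⟶ D'.A i} {g : Y ⟶ Y'}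
    (hf : IsHom D D' f a g) (h0 : IsStablyZero g) : IsStablyZero f := by
  obtain ⟨F, α, β, rfl⟩ := exists_factor_coind h.isInducing_ID h0
  obtain ⟨D₁, ⟨t₁⟩⟩ := exists_typeI_coind h F
  obtain ⟨F', D₂, ⟨t₂⟩, -⟩ := t₁.exists_coind h
  obtain ⟨γ₁, a₁, h₁⟩ := t₂.exists_isHom h D (α ≫ biprod.inr)
  obtain ⟨γ₂, a₂, h₂⟩ := t.exists_isHom h D₂ (biprod.snd ≫ β)
  have h₃ := hf.sub (h₁.comp h₂)
  have : α ≫ β - (α ≫ (biprod.inr : _ ⟶ RepetitiveModule.zero (c.J ⋙ c.H) ⊞ _)) ≫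
    biprod.snd ≫ β = 0 := by simp
  rw [this] at h₃
  have := projective_zero (c.H ⋙ c.J)
  have := F'.projective_coind h.isInducing_IC
  simpa using (t.isStablyZero_of_eq_zero h h₃).add (isStablyZero_of_projective γ₁ γ₂)

/-- For the converse the target is enlarged to type II by a coinduced summand on the `X` side, which
is projected away afterwards. -/
lemma TypeI.isStablyZero_iff (t : D.TypeI) (t' : D'.TypeI) {f : X ⟶ X'}
    {a : ∀ i, D.A i ⟶ D'.A i} {g : Y ⟶ Y'} (hf : IsHom D D' f a g) :
    IsStablyZero f ↔ IsStablyZero g := by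
  refine ⟨t.isStablyZero h hf, fun h0 => ?_⟩
  obtain ⟨F, D'', ⟨t''⟩, b, hb⟩ := t'.exists_coind h
  have := (t''.isStablyZero h (hf.comp hb) (h0.comp _)).comp biprod.fst
  simpa using this

/-- This is fullness. The map lifts once the target is enlarged to type II; discarding the
projective summand changes the first component only by a stably zero map, so re-extending changes
the second only by a stably zero map. -/
lemma TypeI.exists_isHom_of_snd (t : D.TypeI) (t' : D'.TypeI) (g : Y ⟶ Y') :
    ∃ f a g', IsHom D D' f a g' ∧ IsStablyZero (g' - g) := by
  obtain ⟨F, D'', ⟨t''⟩, b, hb⟩ := t'.exists_coind h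
  obtain ⟨f, a, hf⟩ := t''.exists_isHom h D g
  obtain ⟨a', g', hf'⟩ := t.exists_isHom h D' (f ≫ biprod.fst)
  refine ⟨_, a', g', hf', ?_⟩
  have h₁ := (hf'.comp hb).sub hf
  rw [Category.comp_id] at h₁
  refine t.isStablyZero h h₁ ?_
  have h₂ : (f ≫ biprod.fst) ≫ biprod.inl - f =
      -((f ≫ biprod.snd) ≫ (biprod.inr : F.coind h.isInducing_IC ⟶ X' ⊞ _)) := by
    rw [← neg_sub, neg_inj, sub_eq_iff_eq_add']
    conv_lhs => rw [← Category.comp_id f, ← biprod.total]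
    simp only [Preadditive.comp_add, Category.assoc]
  rw [h₂]
  have := F.projective_coind h.isInducing_IC
  exact (isStablyZero_of_projective _ _).neg

end Triple

/-- The stable category. -/
abbrev StableCategory (C : Type*) [Category C] [Preadditive C] := CategoryTheory.Quotient (stableRel C)

section

variable {C : Type*} [Category C] [Preadditive C] [HasBinaryBiproducts C] [HasZeroObject C]

lemma quotient_map_eq_iff {X Y : C} (f g : X ⟶ Y) :
    (Quotient.functor (stableRel C)).map f = (Quotient.functor (stableRel C)).map g ↔
      IsStablyZero (f - g) := Quotient.functor_map_eq_iff _ f g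

lemma nonempty_iso_biprod (X P : C) [Projective P] :
    Nonempty ((Quotient.functor (stableRel C)).obj (X ⊞ P) ≅
      (Quotient.functor (stableRel C)).obj X) := by
  refine ⟨⟨(Quotient.functor _).map biprod.fst, (Quotient.functor _).map biprod.inl, ?_, ?_⟩⟩
  · rw [← CategoryTheory.Functor.map_comp, ← CategoryTheory.Functor.map_id, quotient_map_eq_iff, ← biprod.total, sub_add_cancel_left]
    exact (isStablyZero_of_projective _ _).neg
  · rw [← CategoryTheory.Functor.map_comp, biprod.inl_fst, CategoryTheory.Functor.map_id]

end

namespace BimoduleContext.IsTilting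

variable {Λ Γ : Type u} [Ring Λ] [Ring Γ] {c : BimoduleContext Λ Γ}
  [IsNoetherianRing Λ] [IsNoetherianRing Γ] (h : c.IsTilting)
include h

/-- The stable categories of sequences over the two rings are equivalent. -/
theorem nonempty_stableCategory_equivalence :
    Nonempty (StableCategory (RepetitiveModule (c.H ⋙ c.J)) ≌
      StableCategory (RepetitiveModule (c.J ⋙ c.H))) := by
  choose Y D t using Triple.exists_typeI h
  let t (X) : (D X).TypeI := (t X).some
  choose a g hg using fun (X X' : RepetitiveModule (c.H ⋙ c.J)) (f : X ⟶ X') =>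
    (t X).exists_isHom h (D X') f
  let Q := Quotient.functor (stableRel (RepetitiveModule (c.J ⋙ c.H)))
  -- Two extensions of stably equal maps induce the same stable map, and conversely; this gives
  -- functoriality and faithfulness together.
  have key {X X' : RepetitiveModule (c.H ⋙ c.J)} {f f' : X ⟶ X'} {a a'} {g g' : Y X ⟶ Y X'}
      (hf : Triple.IsHom (D X) (D X') f a g) (hf' : Triple.IsHom (D X) (D X') f' a' g') :
      Q.map g = Q.map g' ↔ IsStablyZero (f - f') := by
    rw [quotient_map_eq_iff, (t X).isStablyZero_iff h (t X') (hf.sub hf')]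
  have key' {X X' : RepetitiveModule (c.H ⋙ c.J)} {f : X ⟶ X'} {a a'} {g g' : Y X ⟶ Y X'}
      (hf : Triple.IsHom (D X) (D X') f a g) (hf' : Triple.IsHom (D X) (D X') f a' g') :
      Q.map g = Q.map g' := (key hf hf').2 (by
    rw [sub_self]
    exact ⟨_, Triple.projective_zero _, 0, 0, zero_comp⟩)
  let Φ : RepetitiveModule (c.H ⋙ c.J) ⥤ StableCategory (RepetitiveModule (c.J ⋙ c.H)) :=
    { obj := fun X => Q.obj (Y X)
      map := fun f => Q.map (g _ _ f)
      map_id := fun X => by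
        rw [← Q.map_id]
        exact key' (hg _ _ _) (Triple.IsHom.id (D X))
      map_comp := fun f f' => by
        rw [← Q.map_comp]
        exact key' (hg _ _ _) ((hg _ _ f).comp (hg _ _ f')) }
  have hΦ {X X' : RepetitiveModule (c.H ⋙ c.J)} (f f' : X ⟶ X') :
      Φ.map f = Φ.map f' ↔ IsStablyZero (f - f') := key (hg _ _ f) (hg _ _ f')
  let Ψ := CategoryTheory.Quotient.lift (stableRel (RepetitiveModule (c.H ⋙ c.J))) Φ
    fun X X' f f' hf => (hΦ f f').2 hf
  have hfaith : Ψ.Faithful := ⟨fun {X X'} f f' hff' => by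
    obtain ⟨f, rfl⟩ := (Quotient.functor _).map_surjective f
    obtain ⟨f', rfl⟩ := (Quotient.functor _).map_surjective f'
    exact (quotient_map_eq_iff _ _).2 ((hΦ f f').1 hff')⟩
  have hfull : Ψ.Full := ⟨fun {X X'} γ => by
    obtain ⟨γ, rfl⟩ := Q.map_surjective γ
    obtain ⟨f, a', g', hf, hγ⟩ := (t X.as).exists_isHom_of_snd h (t X'.as) γ
    exact ⟨(Quotient.functor _).map f,
      (key' (hg _ _ f) hf).trans ((quotient_map_eq_iff _ _).2 hγ)⟩⟩
  -- A type II triple over `Z` becomes type I after adding a projective to `Z`. Two type I triples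
  -- over the same sequence have stably isomorphic second components.
  have hess : Ψ.EssSurj := ⟨fun Z => by
    obtain ⟨X, D', ⟨t'⟩⟩ := Triple.exists_typeII h Z.as
    obtain ⟨F, D'', ⟨t''⟩⟩ := t'.exists_coind h
    obtain ⟨a₁, g₁, h₁⟩ := (t X).exists_isHom h D'' (𝟙 X)
    obtain ⟨a₂, g₂, h₂⟩ := t''.exists_isHom h (D X) (𝟙 X)
    have h₁₂ := (h₁.comp h₂).sub (Triple.IsHom.id _)
    have h₂₁ := (h₂.comp h₁).sub (Triple.IsHom.id _)
    rw [Category.comp_id, sub_self] at h₁₂ h₂₁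
    have h0 : IsStablyZero (0 : X ⟶ X) := ⟨_, Triple.projective_zero _, 0, 0, zero_comp⟩
    have := F.projective_coind h.isInducing_ID
    obtain ⟨e⟩ := nonempty_iso_biprod Z.as (F.coind h.isInducing_ID)
    refine ⟨(Quotient.functor _).obj X, ⟨Iso.trans ⟨Q.map g₁, Q.map g₂, ?_, ?_⟩ e⟩⟩
    · rw [← Q.map_comp]
      exact ((quotient_map_eq_iff _ _).2 ((t X).isStablyZero h h₁₂ h0)).trans (Q.map_id _)
    · rw [← Q.map_comp]
      exact ((quotient_map_eq_iff _ _).2 (t''.isStablyZero h h₂₁ h0)).trans (Q.map_id _)⟩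
  have : Ψ.IsEquivalence := {}
  exact ⟨Ψ.asEquivalence⟩

end BimoduleContext.IsTilting

end ExtVanishing

/-! ### The adjunction of Hom and tensor product. -/

namespace ExtVanishing

open MulOpposite TensorProduct

section Equivalence

variable {C D : Type*} [Category C] [Category D] {L : D ⥤ C} {G : C ⥤ D} (adj : L ⊣ G)

/-- An adjunction restricts to an equivalence between subcategories on which the unit and the
counit are isomorphisms. -/
lemma exists_equivalence_of_adjunction {𝒜 : ObjectProperty C} {𝒢 : ObjectProperty D}
    (hG : ∀ X, 𝒜 X → 𝒢 (G.obj X)) (hL : ∀ Y, 𝒢 Y → 𝒜 (L.obj Y))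
    (hε : ∀ X, 𝒜 X → IsIso (adj.counit.app X)) (hη : ∀ Y, 𝒢 Y → IsIso (adj.unit.app Y)) :
    ∃ e : 𝒜.FullSubcategory ≌ 𝒢.FullSubcategory,
      Nonempty (e.functor ⋙ 𝒢.ι ≅ 𝒜.ι ⋙ G) ∧ Nonempty (e.inverse ⋙ 𝒜.ι ≅ 𝒢.ι ⋙ L) := by
  have (X : 𝒜.FullSubcategory) := hε _ X.property
  have (Y : 𝒢.FullSubcategory) := hη _ Y.property
  let Φ := 𝒢.lift (𝒜.ι ⋙ G) fun X => hG _ X.property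
  let Ψ := 𝒜.lift (𝒢.ι ⋙ L) fun Y => hL _ Y.property
  let ε : Φ ⋙ Ψ ≅ 𝟭 _ := NatIso.ofComponents
    (fun X => 𝒜.fullyFaithfulι.preimageIso (asIso (adj.counit.app X.obj))) fun f => by
      apply 𝒜.ι.map_injective
      simp only [Functor.map_comp, Functor.FullyFaithful.preimageIso_hom]
      exact adj.counit.naturality (𝒜.ι.map f)
  let η : 𝟭 _ ≅ Ψ ⋙ Φ := NatIso.ofComponents
    (fun Y => 𝒢.fullyFaithfulι.preimageIso (asIso (adj.unit.app Y.obj))) fun f => by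
      apply 𝒢.ι.map_injective
      simp only [Functor.map_comp, Functor.FullyFaithful.preimageIso_hom]
      exact adj.unit.naturality (𝒢.ι.map f)
  exact ⟨CategoryTheory.Equivalence.mk Φ Ψ ε.symm η.symm, ⟨Iso.refl _⟩, ⟨Iso.refl _⟩⟩

end Equivalence

section Adjunction

variable {S R V : Type u} [Ring S] [Ring R] [AddCommGroup V] [Module S V] [Module Rᵐᵒᵖ V]
  [SMulCommClass S Rᵐᵒᵖ V] {X : Type u} [AddCommGroup X] [Module Sᵐᵒᵖ X]

/-- The map out of a tensor product given by a balanced biadditive map. -/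
noncomputable def BalancedTensor.lift {A : Type*} [AddCommGroup A] (f : X →+ V →+ A)
    (hf : ∀ x (s : S) v, f (op s • x) v = f x (s • v)) : BalancedTensor S V X →+ A :=
  QuotientAddGroup.lift _ (TensorProduct.liftAddHom f fun n x v => by simp) (by
    rw [balancedRelations, AddSubgroup.closure_le]
    rintro _ ⟨x, s, v, rfl⟩
    simp [hf])

lemma BalancedTensor.tmul_smul (s : S) (x : X) (v : V) :
    BalancedTensor.tmul (S := S) x (s • v) = BalancedTensor.tmul (op s • x) v := by
  have h : (op s • x) ⊗ₜ[ℤ] v - x ⊗ₜ[ℤ] (s • v) ∈ balancedRelations S V X :=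
    AddSubgroup.subset_closure ⟨x, s, v, rfl⟩
  exact (QuotientAddGroup.eq_iff_sub_mem.2 h).symm

lemma BalancedTensor.add_tmul (x y : X) (v : V) :
    BalancedTensor.tmul (S := S) (x + y) v = BalancedTensor.tmul x v + BalancedTensor.tmul y v := by
  rw [BalancedTensor.tmul, TensorProduct.add_tmul, map_add]
  rfl

variable (S R V)

/-- The map `x ↦ (v ↦ x ⊗ v)`. -/
noncomputable def balancedTensorUnit (X : ModuleCat.{u} Sᵐᵒᵖ) :
    X ⟶ (rightHomFunctor S R V).obj ((balancedTensorFunctor S R V).obj X) :=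
  ModuleCat.ofHom (Y := RightHom R V (BalancedTensor S V X))
    { toFun := fun x => (show V →ₗ[Rᵐᵒᵖ] BalancedTensor S V X from
        { toFun := fun v => BalancedTensor.tmul x v
          map_add' := fun _ _ => BalancedTensor.tmul_add _ _ _
          map_smul' := fun _ _ => rfl })
      map_add' := fun _ _ => LinearMap.ext fun _ => BalancedTensor.add_tmul _ _ _
      map_smul' := fun s _ => LinearMap.ext fun _ =>
        (BalancedTensor.tmul_smul s.unop _ _).symm }

/-- The map `f ⊗ v ↦ f v`. -/
noncomputable def balancedTensorCounit (Y : ModuleCat.{u} Rᵐᵒᵖ) :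
    (balancedTensorFunctor S R V).obj ((rightHomFunctor S R V).obj Y) ⟶ Y :=
  ModuleCat.ofHom (X := BalancedTensor S V (RightHom R V Y))
    { BalancedTensor.lift (X := RightHom R V Y)
        { toFun := fun f => (show V →ₗ[Rᵐᵒᵖ] Y from f).toAddMonoidHom
          map_zero' := rfl
          map_add' := fun _ _ => rfl } (fun _ _ _ => rfl) with
      map_smul' := fun r => DFunLike.congr_fun
        (f := (BalancedTensor.lift (X := RightHom R V Y)
          { toFun := fun f => (show V →ₗ[Rᵐᵒᵖ] Y from f).toAddMonoidHom
            map_zero' := rfl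
            map_add' := fun _ _ => rfl } (fun _ _ _ => rfl)).comp
          (DistribSMul.toAddMonoidHom (BalancedTensor S V (RightHom R V Y)) r))
        (g := (DistribSMul.toAddMonoidHom Y r).comp (BalancedTensor.lift (X := RightHom R V Y)
          { toFun := fun f => (show V →ₗ[Rᵐᵒᵖ] Y from f).toAddMonoidHom
            map_zero' := rfl
            map_add' := fun _ _ => rfl } (fun _ _ _ => rfl)))
        (BalancedTensor.hom_ext fun f v => (show V →ₗ[Rᵐᵒᵖ] Y from f).map_smul r v) }

lemma balancedTensorFunctor_hom_ext {X : ModuleCat.{u} Sᵐᵒᵖ} {Y : ModuleCat.{u} Rᵐᵒᵖ}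
    {f g : (balancedTensorFunctor S R V).obj X ⟶ Y}
    (h : ∀ (x : X) (v : V), f.hom (BalancedTensor.tmul x v) = g.hom (BalancedTensor.tmul x v)) :
    f = g :=
  ModuleCat.hom_ext (LinearMap.toAddMonoidHom_injective (BalancedTensor.hom_ext h))

/-- The functor `- ⊗_S V` is left adjoint to `Hom_R(V, -)`. -/
noncomputable def balancedTensorAdjunction :
    balancedTensorFunctor S R V ⊣ rightHomFunctor S R V :=
  Adjunction.mkOfUnitCounit
    { unit :=
        { app := balancedTensorUnit S R V
          naturality := fun _ _ _ => rfl }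
      counit :=
        { app := balancedTensorCounit S R V
          naturality := fun _ _ _ => balancedTensorFunctor_hom_ext S R V fun _ _ => rfl }
      left_triangle := by
        ext X : 2
        exact balancedTensorFunctor_hom_ext S R V fun _ _ => rfl
      right_triangle := rfl }

instance : (rightHomFunctor S R V).Additive where
  map_add := ModuleCat.hom_ext (LinearMap.ext fun _ => rfl)

instance : (balancedTensorFunctor S R V).Additive :=
  (balancedTensorAdjunction S R V).left_adjoint_additive

variable {S R V} in
lemma inducesEquivalence {𝒜 : ObjectProperty (ModuleCat.{u} Rᵐᵒᵖ)}
    {𝒢 : ObjectProperty (ModuleCat.{u} Sᵐᵒᵖ)}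
    (hG : ∀ X, 𝒜 X → 𝒢 ((rightHomFunctor S R V).obj X))
    (hL : ∀ Y, 𝒢 Y → 𝒜 ((balancedTensorFunctor S R V).obj Y))
    (hε : ∀ X, 𝒜 X → IsIso ((balancedTensorAdjunction S R V).counit.app X))
    (hη : ∀ Y, 𝒢 Y → IsIso ((balancedTensorAdjunction S R V).unit.app Y)) :
    InducesEquivalence S R V 𝒜 𝒢 :=
  exists_equivalence_of_adjunction (balancedTensorAdjunction S R V) hG hL hε hη

end Adjunction

end ExtVanishing

/-! ### Matlis duality over a commutative artinian ring. -/

namespace ExtVanishing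

section Matlis

variable {k : Type u} [CommRing k]

lemma exists_isInjectiveHull_dualizingModule :
    ∃ ι : (k ⧸ Ring.jacobson k) →ₗ[k] dualizingModule k, IsInjectiveHull ι :=
  Classical.choose_spec (exists_isInjectiveHull k (k ⧸ Ring.jacobson k))

instance : Module.Injective k (dualizingModule k) :=
  exists_isInjectiveHull_dualizingModule.choose_spec.injective_module

lemma exists_extension_dualizingModule {M N : Type u} [AddCommGroup M] [Module k M]
    [AddCommGroup N] [Module k N] (f : M →ₗ[k] N) (hf : Function.Injective f)
    (g : M →ₗ[k] dualizingModule k) : ∃ h : N →ₗ[k] dualizingModule k, h ∘ₗ f = g :=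
  Module.Injective.extension_property k _ _ _ f hf g

lemma mem_jacobson_iff {a : k} :
    a ∈ Ring.jacobson k ↔ ∀ m : Ideal k, m.IsMaximal → a ∈ m := by
  rw [Ring.jacobson_eq_sInf_isMaximal]
  simp

variable [IsArtinianRing k]

/-- There are finitely many maximal ideals, so some element is one modulo `m` and lies in all the
others; it spans the `m`-part of the quotient by the radical. -/
lemma exists_mul_mem_jacobson (m : Ideal k) [hm : m.IsMaximal] :
    ∃ f : k, 1 - f ∈ m ∧ ∀ a ∈ m, a * f ∈ Ring.jacobson k := by
  classical
  have := Fintype.ofFinite (MaximalSpectrum k)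
  let I : Ideal k := (Finset.univ.filter fun n : MaximalSpectrum k => n.asIdeal ≠ m).inf
    MaximalSpectrum.asIdeal
  have hI : ¬ I ≤ m := fun h => by
    obtain ⟨n, hn, hnm⟩ := (Ideal.IsPrime.inf_le' hm.isPrime).1 h
    exact (Finset.mem_filter.1 hn).2 (n.isMaximal.eq_of_le hm.ne_top hnm)
  obtain ⟨a, ha, ham⟩ := Set.not_subset.1 hI
  obtain ⟨b, hb⟩ := Ideal.Quotient.exists_inv
    (I := m) (a := Ideal.Quotient.mk m a) (fun h => ham (Ideal.Quotient.eq_zero_iff_mem.1 h))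
  obtain ⟨b, rfl⟩ := Ideal.Quotient.mk_surjective b
  refine ⟨a * b, ?_, fun c hc => mem_jacobson_iff.2 fun n hn => ?_⟩
  · rw [← Ideal.Quotient.eq_zero_iff_mem, map_sub, map_mul, hb, map_one, sub_self]
  · by_cases h : n = m
    · exact h ▸ m.mul_mem_right _ hc
    · have h1 : I ≤ n := Finset.inf_le (f := MaximalSpectrum.asIdeal) (b := ⟨n, hn⟩) (by simpa using h)
      exact n.mul_mem_left _ (n.mul_mem_right _ (h1 ha))

/-- The part of the dualizing module killed by a maximal ideal is simple. -/
lemma exists_socle (m : Ideal k) [hm : m.IsMaximal] : ∃ x : dualizingModule k, x ≠ 0 ∧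
    (∀ a ∈ m, a • x = 0) ∧
    ∀ y : dualizingModule k, (∀ a ∈ m, a • y = 0) → y ∈ Submodule.span k {x} := by
  obtain ⟨ι, hι⟩ := exists_isInjectiveHull_dualizingModule (k := k)
  obtain ⟨f, hf, hfm⟩ := exists_mul_mem_jacobson m
  let J := Ring.jacobson k
  have hx (a : k) (ha : a ∈ m) : a • ι (J.mkQ f) = 0 := by
    have h0 : J.mkQ (a • f) = 0 := (Submodule.Quotient.mk_eq_zero J).2 (hfm a ha)
    rw [← map_smul, ← map_smul, h0, map_zero]
  refine ⟨ι (J.mkQ f), fun h => ?_, hx, fun y hy => ?_⟩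
  · have h1 : J.mkQ f = 0 := hι.injective (h.trans (map_zero ι).symm)
    have h2 : f ∈ m := mem_jacobson_iff.1 ((Submodule.Quotient.mk_eq_zero J).1 h1) m hm
    exact hm.ne_top ((Ideal.eq_top_iff_one m).2 (by simpa using m.add_mem hf h2))
  · by_cases hy0 : y = 0
    · rw [hy0]
      exact zero_mem _
    -- Essentiality puts a nonzero multiple of `y` in the image of `ι`. The multiplier is invertible
    -- modulo `m`, so `y` itself lies in the image, and multiplication by `f` fixes it.
    have hU : Submodule.span k {y} ⊓ LinearMap.range ι ≠ ⊥ := fun h =>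
      hy0 (Submodule.span_singleton_eq_bot.1 (hι.essential _ h))
    obtain ⟨z, ⟨hz, q, rfl⟩, hz0⟩ := Submodule.exists_mem_ne_zero_of_ne_bot hU
    obtain ⟨c, hc⟩ := Submodule.mem_span_singleton.1 hz
    have hcm : c ∉ m := fun h => hz0 (hc ▸ hy c h)
    obtain ⟨d, hd⟩ := Ideal.Quotient.exists_inv
      (I := m) (a := Ideal.Quotient.mk m c) (fun h => hcm (Ideal.Quotient.eq_zero_iff_mem.1 h))
    obtain ⟨d, rfl⟩ := Ideal.Quotient.mk_surjective d
    have hd' : c * d - 1 ∈ m := by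
      rw [← Ideal.Quotient.eq_zero_iff_mem, map_sub, map_mul, hd, map_one, sub_self]
    have h1 : y = d • ι q := by
      rw [← hc, smul_smul, ← sub_eq_zero, ← neg_eq_zero, neg_sub, mul_comm]
      simpa [sub_smul] using hy _ hd'
    obtain ⟨b, rfl⟩ := J.mkQ_surjective q
    have h2 : (1 - f) • y = 0 := hy _ hf
    rw [sub_smul, one_smul, sub_eq_zero] at h2
    refine Submodule.mem_span_singleton.2 ⟨d * b, ?_⟩
    rw [h2, h1, ← map_smul, ← map_smul, ← map_smul, ← map_smul, ← map_smul, ← map_smul]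
    congr 2
    simp only [smul_eq_mul]
    ring

/-- The dualizing module is a cogenerator. -/
lemma exists_apply_ne_zero {Y : Type u} [AddCommGroup Y] [Module k Y] {y : Y} (hy : y ≠ 0) :
    ∃ g : Y →ₗ[k] dualizingModule k, g y ≠ 0 := by
  let p := LinearMap.ker (LinearMap.toSpanSingleton k Y y)
  obtain ⟨m, hm, hpm⟩ := Ideal.exists_le_maximal p fun h => hy <| by
    have : (1 : k) ∈ p := h ▸ Submodule.mem_top
    simpa [p] using this
  obtain ⟨x, hx0, hx, -⟩ := exists_socle m
  -- The cyclic submodule generated by `y` is the quotient by its annihilator, which sends its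
  -- generator to a socle element for a maximal ideal above; injectivity extends this map.
  obtain ⟨g, hg⟩ := exists_extension_dualizingModule
    (p.liftQ (LinearMap.toSpanSingleton k Y y) le_rfl)
    (LinearMap.ker_eq_bot.1 (Submodule.ker_liftQ_eq_bot _ _ _ le_rfl))
    (p.liftQ (LinearMap.toSpanSingleton k _ x) fun a ha => hx a (hpm ha))
  refine ⟨g, fun h => hx0 ?_⟩
  have h1 : g ((1 : k) • y) = (1 : k) • x := LinearMap.congr_fun hg (p.mkQ 1)
  rwa [one_smul, one_smul, h, eq_comm] at h1

lemma length_dual_le_of_isSimpleModule {N : Type u} [AddCommGroup N] [Module k N]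
    (h : IsSimpleModule k N) : Module.length k (N →ₗ[k] dualizingModule k) ≤ 1 := by
  obtain ⟨m, hm, ⟨e⟩⟩ := isSimpleModule_iff_quot_maximal.1 h
  obtain ⟨x, -, hx, hx'⟩ := exists_socle m
  have h1 : Module.length k (Submodule.span k {x}) ≤ 1 := by
    have : IsSimpleModule k (k ⧸ m) := isSimpleModule_iff_quot_maximal.2 ⟨m, hm, ⟨.refl _ _⟩⟩
    rw [← Module.length_eq_one k (k ⧸ m)]
    refine Module.length_le_of_surjective ((m.liftQ (LinearMap.toSpanSingleton k _ x)
      fun a ha => hx a ha).codRestrict (Submodule.span k {x}) fun a => ?_) ?_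
    · obtain ⟨a, rfl⟩ := m.mkQ_surjective a
      exact Submodule.mem_span_singleton.2 ⟨a, rfl⟩
    · rintro ⟨y, hy⟩
      obtain ⟨a, rfl⟩ := Submodule.mem_span_singleton.1 hy
      exact ⟨m.mkQ a, rfl⟩
  refine le_trans (Module.length_le_of_injective (LinearMap.codRestrict (Submodule.span k {x})
    (LinearMap.applyₗ (e.symm (m.mkQ 1))) fun f => hx' _ fun a ha => ?_) ?_) h1
  · rw [LinearMap.applyₗ_apply_apply, ← map_smul, ← map_smul, ← map_smul]
    have : m.mkQ (a • (1 : k)) = 0 := (Submodule.Quotient.mk_eq_zero m).2 (by simpa using ha)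
    rw [this, map_zero, map_zero]
  · intro f g hfg
    have h2 : f (e.symm (m.mkQ 1)) = g (e.symm (m.mkQ 1)) := congrArg Subtype.val hfg
    ext y
    obtain ⟨z, rfl⟩ := e.symm.surjective y
    obtain ⟨a, rfl⟩ := m.mkQ_surjective z
    have h3 : m.mkQ a = a • m.mkQ 1 := by rw [← map_smul, smul_eq_mul, mul_one]
    rw [h3, map_smul, map_smul, map_smul, h2]

/-- Along a composition series, restriction to a submodule with simple quotient has as kernel the
dual of that quotient, of length at most one. -/
lemma length_dual_le {M : Type u} [AddCommGroup M] [Module k M] (h : IsFiniteLength k M) :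
    Module.length k (M →ₗ[k] dualizingModule k) ≤ Module.length k M := by
  induction h with
  | of_subsingleton => simp
  | @of_simple_quotient M _ _ N hs _ ih =>
    let ρ : (M →ₗ[k] dualizingModule k) →ₗ[k] (N →ₗ[k] dualizingModule k) := N.subtype.lcomp k _
    have h1 : Module.length k (LinearMap.ker ρ) ≤ 1 := by
      refine le_trans (Module.length_le_of_surjective
        ((N.mkQ.lcomp k (dualizingModule k)).codRestrict (LinearMap.ker ρ) fun f => ?_) ?_)
        (length_dual_le_of_isSimpleModule hs)
      · ext x
        exact (congrArg f ((Submodule.Quotient.mk_eq_zero N).2 x.2)).trans (map_zero f)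
      · rintro ⟨f, hf⟩
        exact ⟨N.liftQ f fun x hx => LinearMap.congr_fun hf ⟨x, hx⟩, Subtype.ext (by ext; rfl)⟩
    have h2 := Module.length_eq_add_of_exact (LinearMap.ker ρ).subtype ρ.rangeRestrict
      Subtype.val_injective ρ.surjective_rangeRestrict
      (LinearMap.exact_iff.2 (by simp))
    rw [h2, Module.length_eq_add_of_exact N.subtype N.mkQ Subtype.val_injective N.mkQ_surjective
      (LinearMap.exact_subtype_mkQ N), Module.length_eq_one k (M ⧸ N), add_comm]
    exact add_le_add ((Module.length_le_of_injective (LinearMap.range ρ).subtype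
      Subtype.val_injective).trans ih) h1

instance finite_dual {M : Type u} [AddCommGroup M] [Module k M] [Module.Finite k M] :
    Module.Finite k (M →ₗ[k] dualizingModule k) := by
  have h : IsFiniteLength k M := isFiniteLength_iff_isNoetherian_isArtinian.2 ⟨inferInstance, inferInstance⟩
  have h1 : IsFiniteLength k (M →ₗ[k] dualizingModule k) := Module.length_ne_top_iff.1
    (ne_top_of_le_ne_top (Module.length_ne_top_iff.2 h) (length_dual_le h))
  have := (isFiniteLength_iff_isNoetherian_isArtinian.1 h1).1
  infer_instance

/-- Finitely generated modules are reflexive. -/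
lemma bijective_eval {M : Type u} [AddCommGroup M] [Module k M] [Module.Finite k M] :
    Function.Bijective
      (LinearMap.flip (LinearMap.id : (M →ₗ[k] dualizingModule k) →ₗ[k] _)) := by
  have hi : Function.Injective
      (LinearMap.flip (LinearMap.id : (M →ₗ[k] dualizingModule k) →ₗ[k] _)) := by
    rw [injective_iff_map_eq_zero]
    intro x hx
    by_contra h
    obtain ⟨g, hg⟩ := exists_apply_ne_zero (k := k) h
    exact hg (LinearMap.congr_fun hx g)
  have hl {N : Type u} [AddCommGroup N] [Module k N] [Module.Finite k N] :
      Module.length k (N →ₗ[k] dualizingModule k) ≤ Module.length k N :=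
    length_dual_le (isFiniteLength_iff_isNoetherian_isArtinian.2 ⟨inferInstance, inferInstance⟩)
  refine ⟨hi, ?_⟩
  rw [← LinearMap.range_eq_top]
  by_contra h
  -- The bidual is no longer than the module, so an injective evaluation cannot have a proper image.
  have h1 := Submodule.length_lt h
  rw [← (LinearEquiv.ofInjective _ hi).length_eq] at h1
  exact absurd (h1.trans_le (hl.trans hl)) (lt_irrefl _)

end Matlis

end ExtVanishing

/-! ### Approximations and regular duals over an artin algebra. -/

namespace ExtVanishing

open MulOpposite Limits

section Algebra

variable (k : Type u) {A : Type u} [CommRing k] [Ring A] [Algebra k A]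

variable (A) in
lemma exists_module (Y : Type u) [AddCommGroup Y] [Module A Y] :
    ∃ _ : Module k Y, IsScalarTower k A Y := by
  let := Module.compHom Y (algebraMap k A)
  exact ⟨inferInstance, ⟨fun c a y => by
    rw [Algebra.smul_def, mul_smul]
    rfl⟩⟩

variable [IsNoetherianRing k] [Module.Finite k A]

/-- Homomorphisms between finitely generated modules over a finite algebra are generated by
finitely many ones. -/
lemma exists_hom_generators (X Y : Type u) [AddCommGroup X] [Module A X] [AddCommGroup Y]
    [Module A Y] [Module.Finite A X] [Module.Finite A Y] [Module k X] [IsScalarTower k A X]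
    [Module k Y] [IsScalarTower k A Y] :
    ∃ (n : ℕ) (f : Fin n → (X →ₗ[A] Y)), ∀ g, ∃ c : Fin n → k, g = ∑ j, c j • f j := by
  have := Module.Finite.trans (R := k) A X
  have := Module.Finite.trans (R := k) A Y
  have : IsNoetherian k (X →ₗ[A] Y) := isNoetherian_of_injective
    (⟨⟨LinearMap.restrictScalars k, fun _ _ => rfl⟩, fun _ _ => rfl⟩ :
      (X →ₗ[A] Y) →ₗ[k] (X →ₗ[k] Y)) (LinearMap.restrictScalars_injective k)
  obtain ⟨n, f, hf⟩ := Module.Finite.exists_fin (R := k) (M := X →ₗ[A] Y)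
  exact ⟨n, f, fun g => by
    obtain ⟨c, hc⟩ := (Submodule.mem_span_range_iff_exists_fun k).1
      (hf ▸ Submodule.mem_top : g ∈ Submodule.span k (Set.range f))
    exact ⟨c, hc.symm⟩⟩

include k in
/-- Right approximations by powers of a module. -/
lemma exists_right_approximation_pi (V X : ModuleCat.{u} A) (hV : Module.Finite A V)
    (hX : Module.Finite A X) : ∃ (n : ℕ) (f : ModuleCat.of A (Fin n → V) ⟶ X),
      ∀ g : V ⟶ X, ∃ h, h ≫ f = g := by
  obtain ⟨_, _⟩ := exists_module k A V
  obtain ⟨_, _⟩ := exists_module k A X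
  obtain ⟨n, f, hf⟩ := exists_hom_generators k (A := A) V X
  refine ⟨n, ModuleCat.ofHom (LinearMap.lsum A _ ℕ f), fun g => ?_⟩
  obtain ⟨c, hc⟩ := hf g.hom
  refine ⟨ModuleCat.ofHom (LinearMap.pi fun j => c j • LinearMap.id), ?_⟩
  ext x
  rw [hc]
  simp [LinearMap.lsum_apply]

include k in
/-- Left approximations by powers of a module. -/
lemma exists_left_approximation_pi (Y W : ModuleCat.{u} A) (hW : Module.Finite A W)
    (hY : Module.Finite A Y) : ∃ (n : ℕ) (f : Y ⟶ ModuleCat.of A (Fin n → W)),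
      ∀ g : Y ⟶ W, ∃ h, f ≫ h = g := by
  obtain ⟨_, _⟩ := exists_module k A Y
  obtain ⟨_, _⟩ := exists_module k A W
  obtain ⟨n, f, hf⟩ := exists_hom_generators k (A := A) Y W
  refine ⟨n, ModuleCat.ofHom (LinearMap.pi f), fun g => ?_⟩
  obtain ⟨c, hc⟩ := hf g.hom
  refine ⟨ModuleCat.ofHom (LinearMap.lsum A (fun _ => W) ℕ fun j => c j • LinearMap.id), ?_⟩
  ext x
  rw [hc]
  simp [LinearMap.lsum_apply]

end Algebra

section Dual

variable {k : Type u} [CommRing k]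

noncomputable instance (M : Type u) [AddCommGroup M] [Module k M] : Module k (DualModule k M) :=
  inferInstanceAs (Module k (M →ₗ[k] dualizingModule k))

instance [IsArtinianRing k] (M : Type u) [AddCommGroup M] [Module k M] [Module.Finite k M] :
    Module.Finite k (DualModule k M) :=
  inferInstanceAs (Module.Finite k (M →ₗ[k] dualizingModule k))

instance (A M : Type u) [Ring A] [Algebra k A] [AddCommGroup M] [Module k M] [Module A M]
    [IsScalarTower k A M] : IsScalarTower k Aᵐᵒᵖ (DualModule k M) where
  smul_assoc c a := fun (f : M →ₗ[k] dualizingModule k) => LinearMap.ext fun m =>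
    (congrArg f (smul_assoc c a.unop m)).trans (f.map_smul c _)

instance (A M : Type u) [Ring A] [Algebra k A] [AddCommGroup M] [Module k M] [Module Aᵐᵒᵖ M]
    [IsScalarTower k Aᵐᵒᵖ M] : IsScalarTower k A (DualModule k M) where
  smul_assoc c a := fun (f : M →ₗ[k] dualizingModule k) => LinearMap.ext fun m =>
    (congrArg f (smul_assoc c (op a) m)).trans (f.map_smul c _)

variable {S : Type u} [Ring S] [Algebra k S]

section

variable {Y : Type u} [AddCommGroup Y] [Module Sᵐᵒᵖ Y] [Module k Y] [IsScalarTower k Sᵐᵒᵖ Y]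

/-- The homomorphism to the dual of the regular module that corresponds to a linear form. -/
noncomputable def homDual (g : Y →ₗ[k] dualizingModule k) : Y →ₗ[Sᵐᵒᵖ] DualModule k S where
  toFun y := g ∘ₗ (LinearMap.toSpanSingleton Sᵐᵒᵖ Y y).restrictScalars k ∘ₗ
    (opLinearEquiv k : S ≃ₗ[k] Sᵐᵒᵖ).toLinearMap
  map_add' x y := LinearMap.ext fun s => by
    change g (op s • (x + y)) = g (op s • x) + g (op s • y)
    rw [smul_add, map_add]
  map_smul' a y := LinearMap.ext fun s => congrArg g (mul_smul (op s) a y).symm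

/-- The linear form given by a homomorphism to the dual of the regular module. -/
noncomputable def formOfHom (f : Y →ₗ[Sᵐᵒᵖ] DualModule k S) : Y →ₗ[k] dualizingModule k where
  toFun y := (show S →ₗ[k] dualizingModule k from f y) 1
  map_add' x y := congrArg (fun φ : DualModule k S => (show S →ₗ[k] dualizingModule k from φ) 1)
    (f.map_add x y)
  map_smul' c y := congrArg (fun φ : DualModule k S => (show S →ₗ[k] dualizingModule k from φ) 1)
    (LinearMap.map_smul_of_tower f c y)

lemma homDual_formOfHom (f : Y →ₗ[Sᵐᵒᵖ] DualModule k S) : homDual (formOfHom f) = f := by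
  refine LinearMap.ext fun y => LinearMap.ext fun s => ?_
  change (show S →ₗ[k] dualizingModule k from f (op s • y)) 1 =
    (show S →ₗ[k] dualizingModule k from f y) s
  rw [f.map_smul]
  exact congrArg (show S →ₗ[k] dualizingModule k from f y) (mul_one s)

lemma formOfHom_homDual (g : Y →ₗ[k] dualizingModule k) : formOfHom (homDual (S := S) g) = g :=
  LinearMap.ext fun y => congrArg g (one_smul Sᵐᵒᵖ y)

end

variable (k S) in
/-- The dual of the regular module. -/
noncomputable abbrev regularDual : ModuleCat.{u} Sᵐᵒᵖ := ModuleCat.of Sᵐᵒᵖ (DualModule k S)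

instance : Injective (regularDual k S) where
  factors {X Y} f i hi := by
    obtain ⟨_, _⟩ := exists_module k Sᵐᵒᵖ X
    obtain ⟨_, _⟩ := exists_module k Sᵐᵒᵖ Y
    obtain ⟨g, hg⟩ := exists_extension_dualizingModule (k := k) (i.hom.restrictScalars k)
      ((ModuleCat.mono_iff_injective i).1 hi) (formOfHom f.hom)
    refine ⟨ModuleCat.ofHom (homDual g), ModuleCat.hom_ext ?_⟩
    rw [← homDual_formOfHom f.hom, ← hg]
    exact LinearMap.ext fun x => LinearMap.ext fun s => congrArg g (i.hom.map_smul (op s) x).symm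

variable [IsArtinianRing k]

lemma isCoseparator_regularDual : IsCoseparator (regularDual k S) := by
  rw [isCoseparator_def]
  intro X Y f g h
  obtain ⟨_, _⟩ := exists_module k Sᵐᵒᵖ Y
  ext x
  by_contra hx
  obtain ⟨φ, hφ⟩ := exists_apply_ne_zero (k := k) (sub_ne_zero.2 hx)
  refine hφ ?_
  have h1 := LinearMap.congr_fun (congrArg ModuleCat.Hom.hom (h (ModuleCat.ofHom (homDual φ)))) x
  have h2 : φ ((1 : Sᵐᵒᵖ) • f.hom x) = φ ((1 : Sᵐᵒᵖ) • g.hom x) :=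
    congrArg (fun ψ : DualModule k S => (show S →ₗ[k] dualizingModule k from ψ) 1) h1
  rw [map_sub, sub_eq_zero]
  simpa using h2

lemma exists_mono_pi_regularDual [Module.Finite k S] (Y : ModuleCat.{u} Sᵐᵒᵖ)
    (hY : Module.Finite Sᵐᵒᵖ Y) :
    ∃ (n : ℕ) (f : Y ⟶ ModuleCat.of Sᵐᵒᵖ (Fin n → regularDual k S)), Mono f := by
  obtain ⟨_, _⟩ := exists_module k Sᵐᵒᵖ Y
  have : Module.Finite k Sᵐᵒᵖ := inferInstance
  have := Module.Finite.trans (R := k) Sᵐᵒᵖ Y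
  obtain ⟨n, g, hg⟩ := Module.Finite.exists_fin (R := k) (M := Y →ₗ[k] dualizingModule k)
  refine ⟨n, ModuleCat.ofHom (LinearMap.pi fun j => homDual (g j)), ?_⟩
  rw [ModuleCat.mono_iff_injective, injective_iff_map_eq_zero]
  intro y hy
  by_contra h
  obtain ⟨φ, hφ⟩ := exists_apply_ne_zero (k := k) h
  obtain ⟨c, rfl⟩ := (Submodule.mem_span_range_iff_exists_fun k).1
    (hg ▸ Submodule.mem_top : φ ∈ Submodule.span k (Set.range g))
  refine hφ ?_
  rw [LinearMap.sum_apply]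
  refine Finset.sum_eq_zero fun j _ => ?_
  have h1 : homDual (S := S) (g j) y = 0 := congrFun hy j
  have h2 : g j y = 0 := by
    rw [← formOfHom_homDual (S := S) (g j)]
    exact congrArg (fun φ : DualModule k S => (show S →ₗ[k] dualizingModule k from φ) 1) h1
  rw [LinearMap.smul_apply, h2, smul_zero]

instance finite_regularDual [Module.Finite k S] : Module.Finite Sᵐᵒᵖ (DualModule k S) :=
  Module.Finite.of_restrictScalars_finite k Sᵐᵒᵖ _

end Dual

end ExtVanishing

/-! ### The bimodule context of a perfect pairing. -/

namespace ExtVanishing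

open MulOpposite Limits

section Abstract

variable {Λ Γ : Type u} [Ring Λ] [Ring Γ] {L : ModuleCat.{u} Γ ⥤ ModuleCat.{u} Λ}
  {G : ModuleCat.{u} Λ ⥤ ModuleCat.{u} Γ} (adj : L ⊣ G)

lemma isIso_iff_bijective_comp_generator {X Y : ModuleCat.{u} Γ} (f : X ⟶ Y) :
    IsIso f ↔ Function.Bijective fun a : ModuleCat.of Γ Γ ⟶ X => a ≫ f := by
  refine ⟨fun _ => ⟨fun a b h => (cancel_mono f).1 h, fun b => ⟨b ≫ inv f, by simp⟩⟩, fun h => ?_⟩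
  have : Epi f := epi_of_generator fun φ => h.2 φ
  have : Mono f := by
    rw [ModuleCat.mono_iff_injective]
    intro x y hxy
    have h1 : ModuleCat.ofHom (LinearMap.toSpanSingleton Γ X x) =
        ModuleCat.ofHom (LinearMap.toSpanSingleton Γ X y) := h.1 (by
      ext
      simpa using hxy)
    simpa using LinearMap.congr_fun (congrArg ModuleCat.Hom.hom h1) 1
  exact isIso_of_mono_of_epi f

lemma isIso_iff_bijective_comp_coseparator {I : ModuleCat.{u} Γ} [Injective I]
    (hI : IsCoseparator I) {X Y : ModuleCat.{u} Γ} (f : X ⟶ Y) :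
    IsIso f ↔ Function.Bijective fun a : Y ⟶ I => f ≫ a := by
  refine ⟨fun _ => ⟨fun a b h => (cancel_epi f).1 h, fun b => ⟨inv f ≫ b, by simp⟩⟩, fun h => ?_⟩
  have : Mono f := mono_of_isCoseparator hI fun φ => h.2 φ
  have : Epi f := by
    refine Preadditive.epi_of_cancel_zero f fun g hg => ?_
    rw [isCoseparator_def] at hI
    refine hI _ _ fun φ => ?_
    rw [zero_comp]
    exact h.1 (by simp [reassoc_of% hg])
  exact isIso_of_mono_of_epi f

/-- Maps out of the generator detect isomorphisms, and composition with the unit corresponds under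
the adjunction to applying `L`. -/
lemma isIso_unit_generator_iff : IsIso (adj.unit.app (ModuleCat.of Γ Γ)) ↔
    Function.Bijective (L.map : (ModuleCat.of Γ Γ ⟶ ModuleCat.of Γ Γ) → _) := by
  rw [isIso_iff_bijective_comp_generator, ← (adj.homEquiv _ _).bijective.of_comp_iff']
  refine iff_of_eq (congrArg _ (funext fun f => ?_))
  simp [Adjunction.homEquiv_unit]

lemma isIso_counit_coseparator_iff {I : ModuleCat.{u} Λ} [Injective I] (hI : IsCoseparator I) :
    IsIso (adj.counit.app I) ↔ Function.Bijective (G.map : (I ⟶ I) → _) := by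
  rw [isIso_iff_bijective_comp_coseparator hI, ← (adj.homEquiv _ _).symm.bijective.of_comp_iff']
  refine iff_of_eq (congrArg _ (funext fun f => ?_))
  simp [Adjunction.homEquiv_counit]

lemma bijective_map_iff {C D : Type*} [Category C] [Category D] {F : C ⥤ D} {X : C} {Y : D}
    (e : F.obj X ≅ Y) {S : Type*} {φ : S → (X ⟶ X)} (hφ : Function.Bijective φ) {l : S → (Y ⟶ Y)}
    (h : ∀ s, F.map (φ s) ≫ e.hom = e.hom ≫ l s) :
    Function.Bijective (F.map : (X ⟶ X) → _) ↔ Function.Bijective l := by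
  have h1 : l = (fun a => e.inv ≫ a ≫ e.hom) ∘ F.map ∘ φ := funext fun s => by simp [h s]
  rw [h1, Function.Bijective.of_comp_iff', Function.Bijective.of_comp_iff _ hφ]
  exact ⟨fun a b hab => by simpa using hab, fun b => ⟨e.hom ≫ b ≫ e.inv, by simp⟩⟩

end Abstract

section Bimodule

variable (S R V : Type u) [Ring S] [Ring R] [AddCommGroup V] [Module S V] [Module Rᵐᵒᵖ V]
  [SMulCommClass S Rᵐᵒᵖ V]

/-- Left multiplication on a bimodule. -/
def leftMul (s : S) : ModuleCat.of Rᵐᵒᵖ V ⟶ ModuleCat.of Rᵐᵒᵖ V :=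
  ModuleCat.ofHom (DistribSMul.toLinearMap Rᵐᵒᵖ V s)

lemma BalancedTensor.one_tmul_smul (a : Sᵐᵒᵖ) (v : V) :
    BalancedTensor.tmul (S := S) (1 : Sᵐᵒᵖ) (a.unop • v) = BalancedTensor.tmul a v := by
  rw [BalancedTensor.tmul_smul]
  simp

/-- The isomorphism `S ⊗_S V ≅ V`. -/
noncomputable def balancedTensorRegularIso :
    (balancedTensorFunctor S R V).obj (ModuleCat.of Sᵐᵒᵖ Sᵐᵒᵖ) ≅ ModuleCat.of Rᵐᵒᵖ V where
  hom := ((balancedTensorAdjunction S R V).homEquiv _ _).symm (ModuleCat.ofHom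
    (Y := RightHom R V V)
    { toFun := fun a => (show V →ₗ[Rᵐᵒᵖ] V from DistribSMul.toLinearMap Rᵐᵒᵖ V a.unop)
      map_add' := fun a b => LinearMap.ext fun v => add_smul a.unop b.unop v
      map_smul' := fun a b => LinearMap.ext fun v => mul_smul b.unop a.unop v })
  inv := ModuleCat.ofHom (Y := BalancedTensor S V Sᵐᵒᵖ)
    { toFun := fun v => BalancedTensor.tmul 1 v
      map_add' := fun _ _ => BalancedTensor.tmul_add _ _ _
      map_smul' := fun _ _ => rfl }
  hom_inv_id := balancedTensorFunctor_hom_ext S R V fun a v =>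
    BalancedTensor.one_tmul_smul S V a v
  inv_hom_id := ModuleCat.hom_ext (LinearMap.ext fun v => one_smul S v)

variable {V}

/-- A free cover of `Y` is carried to an epimorphism from a summand of a power of `V`. -/
lemma finite_balancedTensor (hV : Module.Finite Rᵐᵒᵖ V) (Y : ModuleCat.{u} Sᵐᵒᵖ)
    (hY : Module.Finite Sᵐᵒᵖ Y) : Module.Finite Rᵐᵒᵖ ((balancedTensorFunctor S R V).obj Y) := by
  obtain ⟨n, f, hf⟩ := exists_epi_of_finite hY
  have := (balancedTensorAdjunction S R V).isLeftAdjoint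
  exact finite_of_epi ((balancedTensorFunctor S R V).map f)
    ((((isSummand_pi (ModuleCat.of Sᵐᵒᵖ Sᵐᵒᵖ) n).map (balancedTensorFunctor S R V)).of_iso
      (balancedTensorRegularIso S R V)).finite hV)

/-- The Hom group is already finitely generated over `k`, which acts through `S`. -/
lemma finite_rightHom (k : Type u) [CommRing k] [IsNoetherianRing k] [Algebra k S] [Algebra k R]
    [Module.Finite k R] [Module k V] [IsScalarTower k S V] [IsScalarTower k Rᵐᵒᵖ V]
    (hV : Module.Finite Rᵐᵒᵖ V) (X : ModuleCat.{u} Rᵐᵒᵖ) (hX : Module.Finite Rᵐᵒᵖ X) :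
    Module.Finite Sᵐᵒᵖ ((rightHomFunctor S R V).obj X) := by
  classical
  obtain ⟨_, _⟩ := exists_module k Rᵐᵒᵖ X
  obtain ⟨n, f, hf⟩ := exists_hom_generators k (A := Rᵐᵒᵖ) V X
  refine ⟨⟨Finset.univ.image (fun j => (show RightHom R V X from f j)), top_le_iff.1 fun g _ => ?_⟩⟩
  obtain ⟨c, hc⟩ := hf g
  have h1 : g = ∑ j, op (algebraMap k S (c j)) • (show RightHom R V X from f j) := by
    refine hc.trans (Finset.sum_congr rfl fun j _ => LinearMap.ext fun v => ?_)
    change c j • f j v = f j (algebraMap k S (c j) • v)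
    rw [algebraMap_smul, LinearMap.map_smul_of_tower]
  rw [h1]
  exact Submodule.sum_mem _ fun j _ => Submodule.smul_mem _ _ (Submodule.subset_span
    (Finset.mem_image_of_mem _ (Finset.mem_univ j)))

end Bimodule

variable {k S R V W : Type u} [CommRing k] [Ring S] [Ring R]
  [Algebra k S] [Algebra k R] 
  [AddCommGroup V] [Module k V] [Module S V] [Module Rᵐᵒᵖ V] [SMulCommClass S Rᵐᵒᵖ V]
  [IsScalarTower k S V] [IsScalarTower k Rᵐᵒᵖ V]
  [AddCommGroup W] [Module k W] [Module R W] [Module Sᵐᵒᵖ W] [SMulCommClass R Sᵐᵒᵖ W]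
  [IsScalarTower k R W] [IsScalarTower k Sᵐᵒᵖ W]

variable (S R) in
/-- A perfect balanced pairing between bimodules with values in the dualizing module. -/
structure IsDualPairing (B : V →ₗ[k] W →ₗ[k] dualizingModule k) : Prop where
  smul_left : ∀ (s : S) v w, B (s • v) w = B v (op s • w)
  smul_right : ∀ (r : R) v w, B (op r • v) w = B v (r • w)
  bijective : Function.Bijective B
  bijective_flip : Function.Bijective B.flip

namespace IsDualPairing

variable {B : V →ₗ[k] W →ₗ[k] dualizingModule k} (h : IsDualPairing S R B)
include h

omit [Algebra k S] [Algebra k R] [IsScalarTower k S V] [IsScalarTower k Rᵐᵒᵖ V]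
  [SMulCommClass S Rᵐᵒᵖ V] [SMulCommClass R Sᵐᵒᵖ W] [IsScalarTower k R W]
  [IsScalarTower k Sᵐᵒᵖ W] in
lemma flip : IsDualPairing R S B.flip where
  smul_left r w v := (h.smul_right r v w).symm
  smul_right s w v := (h.smul_left s v w).symm
  bijective := h.bijective_flip
  bijective_flip := h.bijective

/-- The homomorphism `V → Hom_S(W, DS)` given by the pairing. -/
noncomputable def toRightHomDual : V →ₗ[Rᵐᵒᵖ] RightHom S W (DualModule k S) where
  toFun v := homDual (S := S) (B v)
  map_add' v v' := LinearMap.ext fun w => LinearMap.ext fun s =>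
    LinearMap.congr_fun (B.map_add v v') (op s • w)
  map_smul' r v := LinearMap.ext fun w => LinearMap.ext fun s =>
    (h.smul_right r.unop v (op s • w)).trans (congrArg (B v) (smul_comm _ _ _))

omit [Algebra k R] [SMulCommClass S Rᵐᵒᵖ V] [IsScalarTower k S V] [IsScalarTower k Rᵐᵒᵖ V]
  [IsScalarTower k R W] in
lemma bijective_toRightHomDual : Function.Bijective h.toRightHomDual := by
  have h1 : Function.Bijective (homDual (S := S) (k := k) (Y := W)) :=
    Function.bijective_iff_has_inverse.2 ⟨formOfHom, formOfHom_homDual, homDual_formOfHom⟩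
  exact h1.comp h.bijective

/-- The isomorphism `Hom_S(W, DS) ≅ V`. -/
noncomputable def rightHomDualIso :
    (rightHomFunctor R S W).obj (regularDual k S) ≅ ModuleCat.of Rᵐᵒᵖ V :=
  (LinearEquiv.toModuleIso (X₁ := V) (X₂ := RightHom S W (DualModule k S))
    (LinearEquiv.ofBijective h.toRightHomDual h.bijective_toRightHomDual)).symm

-- The regular module has endomorphism ring `S`, acting on its tensor product with `V` by left
-- multiplication.
omit h in
lemma isIso_unit_iff : IsIso ((balancedTensorAdjunction S R V).unit.app (ModuleCat.of Sᵐᵒᵖ Sᵐᵒᵖ)) ↔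
    Function.Bijective (leftMul S R V) := by
  rw [isIso_unit_generator_iff]
  refine bijective_map_iff (balancedTensorRegularIso S R V)
    (φ := fun s => ModuleCat.ofHom (LinearMap.toSpanSingleton Sᵐᵒᵖ Sᵐᵒᵖ (op s)))
    ⟨fun s t hst => ?_, fun f => ⟨(f.hom 1).unop, ?_⟩⟩ fun s => ?_
  · simpa using LinearMap.congr_fun (congrArg ModuleCat.Hom.hom hst) 1
  · ext
    simp
  · exact balancedTensorFunctor_hom_ext S R V fun a v => mul_smul s a.unop v

variable [IsArtinianRing k] [Module.Finite k S]

-- Reflexivity of `S` identifies it with the endomorphisms of its dual, and the pairing turns their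
-- effect on homomorphisms from `W` into left multiplication on `V`. So both this and the unit
-- condition say that `S` is the full endomorphism ring of `V`.
omit [Algebra k R] [IsScalarTower k S V] [IsScalarTower k Rᵐᵒᵖ V] [IsScalarTower k R W] in
lemma isIso_counit_iff : IsIso ((balancedTensorAdjunction R S W).counit.app (regularDual k S)) ↔
    Function.Bijective (leftMul S R V) := by
  rw [isIso_counit_coseparator_iff _ isCoseparator_regularDual]
  refine bijective_map_iff h.rightHomDualIso (φ := leftMul S S (DualModule k S)) ?_ fun s => ?_
  · have h1 : Function.Bijective (homDual (S := S) (k := k) (Y := DualModule k S)) :=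
      Function.bijective_iff_has_inverse.2 ⟨formOfHom, formOfHom_homDual, homDual_formOfHom⟩
    have h2 : Function.Bijective (ModuleCat.ofHom (R := Sᵐᵒᵖ) (X := DualModule k S)
        (Y := DualModule k S)) := ⟨fun _ _ h => congrArg ModuleCat.Hom.hom h, fun f => ⟨f.hom, rfl⟩⟩
    exact h2.comp (h1.comp (bijective_eval (k := k) (M := S)))
  · rw [← Iso.inv_comp_eq, ← Category.assoc, ← Iso.eq_comp_inv]
    refine ModuleCat.hom_ext (LinearMap.ext fun v => LinearMap.ext fun w => LinearMap.ext fun t =>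
      Eq.trans ?_ (h.smul_left s v (op t • w)).symm)
    exact congrArg (B v) (mul_smul (op s) (op t) w)


variable [Module.Finite k R] [Module.Finite k V] [Module.Finite k W]

/-- The two adjoint pairs given by a dual pair of bimodules. -/
noncomputable def bimoduleContext : BimoduleContext Rᵐᵒᵖ Sᵐᵒᵖ :=
  have hV : Module.Finite Rᵐᵒᵖ V := Module.Finite.of_restrictScalars_finite k Rᵐᵒᵖ V
  have hW : Module.Finite Sᵐᵒᵖ W := Module.Finite.of_restrictScalars_finite k Sᵐᵒᵖ W
  { F := balancedTensorFunctor R S W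
    J := rightHomFunctor R S W
    G := balancedTensorFunctor S R V
    H := rightHomFunctor S R V
    V := ModuleCat.of Rᵐᵒᵖ V
    W := ModuleCat.of Sᵐᵒᵖ W
    IC := regularDual k R
    ID := regularDual k S
    adjF := balancedTensorAdjunction R S W
    adjG := balancedTensorAdjunction S R V
    additive_F := inferInstance
    additive_J := inferInstance
    additive_G := inferInstance
    additive_H := inferInstance
    isoGV := balancedTensorRegularIso S R V
    isoJV := h.rightHomDualIso
    isoFW := balancedTensorRegularIso R S W
    isoHW := h.flip.rightHomDualIso
    finite_V := hV
    finite_W := hW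
    finite_IC := finite_regularDual
    finite_ID := finite_regularDual
    finite_H := finite_rightHom S R k hV
    finite_J := finite_rightHom R S k hW
    finite_F := finite_balancedTensor R S hW
    finite_G := finite_balancedTensor S R hV
    injective_IC := inferInstance
    injective_ID := inferInstance
    coseparator_IC := isCoseparator_regularDual
    coseparator_ID := isCoseparator_regularDual
    embedding_IC := exists_mono_pi_regularDual
    embedding_ID := exists_mono_pi_regularDual
    approx_V := fun _ => exists_right_approximation_pi k _ _ hV
    approx_W := fun _ => exists_left_approximation_pi k _ _ hW
    approx_W' := fun _ => exists_right_approximation_pi k _ _ hW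
    approx_V' := fun _ => exists_left_approximation_pi k _ _ hV
    unit_iff := isIso_unit_iff.trans h.isIso_counit_iff.symm
    unit_iff' := isIso_unit_iff.trans h.flip.isIso_counit_iff.symm }

end IsDualPairing

end ExtVanishing

/-! ### Comparing the two indexings of repetitive modules. -/

namespace ExtVanishing

open Limits

namespace RepeComplex

variable {k R : Type u} [CommRing k] [Ring R] [Algebra k R]
  {N : ModuleCat.{u} Rᵐᵒᵖ ⥤ ModuleCat.{u} Rᵐᵒᵖ}
  (θ : rightHomFunctor R R (DualModule k R) ≅ N)

lemma map_eqToHom_comp {C D : Type*} [Category C] [Category D] (F : C ⥤ D) {X Y : ℤ → C}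
    (f : ∀ i, X i ⟶ Y i) {i j : ℤ} (h : i = j) :
    F.map (eqToHom (congrArg X h)) ≫ F.map (f j) =
      F.map (f i) ≫ F.map (eqToHom (congrArg Y h)) := by
  subst h
  simp

/-- The structure maps, transported along an isomorphism of functors. -/
noncomputable def shiftδ (X : RepeComplex k R) (i : ℤ) : X.X (i + 1) ⟶ N.obj (X.X i) :=
  X.δ (i + 1) ≫ θ.hom.app _ ≫ N.map (eqToHom (congrArg X.X (add_sub_cancel_right i 1)))

lemma comm_shiftδ_iff {X Y : RepeComplex k R} (f : ∀ i, X.X i ⟶ Y.X i) (i : ℤ) :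
    shiftδ θ X i ≫ N.map (f i) = f (i + 1) ≫ shiftδ θ Y i ↔
      X.δ (i + 1) ≫ (rightHomFunctor R R (DualModule k R)).map (f (i + 1 - 1)) =
        f (i + 1) ≫ Y.δ (i + 1) := by
  have : Mono (θ.hom.app _ ≫ N.map (eqToHom (congrArg Y.X (add_sub_cancel_right i 1)))) :=
    IsIso.mono_of_iso _
  simp only [shiftδ, Category.assoc]
  rw [map_eqToHom_comp N f (add_sub_cancel_right i 1), ← θ.hom.naturality_assoc, ← Category.assoc, ← Category.assoc (f _),
    cancel_mono]

/-- The functor to sequences with structure maps `X (i + 1) ⟶ N (X i)`. -/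
noncomputable def toRepetitiveModule : RepeComplex k R ⥤ RepetitiveModule N where
  obj X :=
    { X := X.X
      δ := shiftδ θ X
      finite := X.finite
      bounded := X.bounded.subset fun i hi h => hi (@ModuleCat.isZero_of_subsingleton _ _ _ h)
      δ_comp_δ := fun i => by
        simp only [shiftδ, Category.assoc, Functor.map_comp]
        rw [← Category.assoc (N.map (eqToHom _)), map_eqToHom_comp N X.δ (add_sub_cancel_right (i + 1) 1), Category.assoc,
          ← θ.hom.naturality_assoc, ← Category.assoc, X.δ_comp_δ, zero_comp] }
  map f := ⟨f.f, fun i => (comm_shiftδ_iff θ f.f i).2 (f.comm _)⟩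

instance : (toRepetitiveModule θ).Faithful where
  map_injective h := _root_.RepeComplex.Hom.ext (congrArg RepetitiveModule.Hom.f h)

instance : (toRepetitiveModule θ).Full where
  map_surjective f := ⟨⟨f.f, forall_of_forall_succ fun i =>
    (comm_shiftδ_iff θ f.f i).1 (f.comm i)⟩, rfl⟩

/-- The structure maps `X i ⟶ Hom(DR, X (i - 1))` of a sequence. -/
noncomputable def unshiftδ (M : RepetitiveModule N) (i : ℤ) :
    M.X i ⟶ (rightHomFunctor R R (DualModule k R)).obj (M.X (i - 1)) :=
  eqToHom (congrArg M.X (sub_add_cancel i 1).symm) ≫ M.δ (i - 1) ≫ θ.inv.app _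

omit [Algebra k R] in
lemma δ_comp_map_eqToHom (M : RepetitiveModule N) {i j : ℤ} (h : i = j) :
    M.δ i ≫ N.map (eqToHom (congrArg M.X h)) =
      eqToHom (congrArg (fun i => M.X (i + 1)) h) ≫ M.δ j := by
  subst h
  simp

lemma unshiftδ_comp (M : RepetitiveModule N) (i : ℤ) :
    unshiftδ θ M (i + 1) ≫ θ.hom.app _ ≫
      N.map (eqToHom (congrArg M.X (add_sub_cancel_right i 1))) = M.δ i := by
  simp only [unshiftδ, Category.assoc, Iso.inv_hom_id_app_assoc]
  rw [δ_comp_map_eqToHom M (add_sub_cancel_right i 1), eqToHom_trans_assoc, eqToHom_refl, Category.id_comp]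

/-- The module over the repetitive algebra given by a sequence. -/
noncomputable def ofRepetitiveModule [N.Additive] (M : RepetitiveModule N) : RepeComplex k R where
  X := M.X
  δ := unshiftδ θ M
  finite := M.finite
  bounded := (M.bounded.filter_mono le_rfl : {i | ¬ IsZero (M.X i)}.Finite).subset fun i hi h =>
    hi (ModuleCat.subsingleton_of_isZero h)
  δ_comp_δ i := by
    rw [unshiftδ, Category.assoc, Category.assoc, ← θ.inv.naturality, unshiftδ, N.map_comp,
      Category.assoc, ← Category.assoc (M.δ _),
      δ_comp_map_eqToHom M (sub_add_cancel (i - 1) 1).symm, N.map_comp, Category.assoc,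
      Category.assoc, ← Category.assoc (M.δ _), M.δ_comp_δ, zero_comp, comp_zero, comp_zero]

instance [N.Additive] : (toRepetitiveModule θ).EssSurj where
  mem_essImage M := by
    have h : ((toRepetitiveModule θ).obj (ofRepetitiveModule θ M)) = M := by
      obtain ⟨X, δ, h₁, h₂, h₃⟩ := M
      refine (RepetitiveModule.mk.injEq _ _ _ _ _ _ _ _ _ _).mpr ⟨rfl, heq_of_eq ?_⟩
      exact funext fun i => unshiftδ_comp θ ⟨X, δ, h₁, h₂, h₃⟩ i
    exact ⟨_, ⟨eqToIso h⟩⟩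

/-- The reindexing functor is an equivalence, hence preserves and reflects projective objects, so
factorizations can be carried in both directions. -/
lemma stableRel_iff [N.Additive] {X Y : RepeComplex k R} (f g : X ⟶ Y) :
    RepeComplex.stableRel k R f g ↔
      IsStablyZero ((toRepetitiveModule θ).map f - (toRepetitiveModule θ).map g) := by
  have : (toRepetitiveModule θ).IsEquivalence := {}
  let e := (toRepetitiveModule θ).asEquivalence
  constructor
  · rintro ⟨P, hP, a, b, hab⟩
    exact ⟨_, (e.map_projective_iff P).2 hP, e.functor.map a, e.functor.map b,
      RepetitiveModule.hom_ext fun i => (hab i).symm⟩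
  · rintro ⟨P, hP, a, b, hab⟩
    let Q := (toRepetitiveModule θ).objPreimage P
    let j : (toRepetitiveModule θ).obj Q ≅ P := (toRepetitiveModule θ).objObjPreimageIso P
    obtain ⟨a', ha⟩ := (toRepetitiveModule θ).map_surjective (a ≫ j.inv)
    obtain ⟨b', hb⟩ := (toRepetitiveModule θ).map_surjective (j.hom ≫ b)
    refine ⟨Q, (e.map_projective_iff Q).1 (Projective.of_iso j.symm hP), a', b', fun i => ?_⟩
    have h1 : (toRepetitiveModule θ).map (a' ≫ b') =
        (toRepetitiveModule θ).map f - (toRepetitiveModule θ).map g := by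
      rw [Functor.map_comp, ha, hb, Category.assoc, Iso.inv_hom_id_assoc, hab]
    exact (congrArg (fun φ => RepetitiveModule.Hom.f φ i) h1).symm

include θ in
/-- The repetitive category in terms of sequences with structure maps `X (i + 1) ⟶ N (X i)`. -/
theorem nonempty_repetitiveCategory_equivalence [N.Additive] :
    Nonempty (RepetitiveCategory k R ≌ StableCategory (RepetitiveModule N)) := by
  let Q := Quotient.functor (ExtVanishing.stableRel (RepetitiveModule N))
  let Ψ := CategoryTheory.Quotient.lift (RepeComplex.stableRel k R) (toRepetitiveModule θ ⋙ Q)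
    fun X Y f g h => (quotient_map_eq_iff _ _).2 ((stableRel_iff θ f g).1 h)
  have hfaith : Ψ.Faithful := ⟨fun {X Y} f g hfg => by
    obtain ⟨f, rfl⟩ := (Quotient.functor _).map_surjective f
    obtain ⟨g, rfl⟩ := (Quotient.functor _).map_surjective g
    exact CategoryTheory.Quotient.sound _ ((stableRel_iff θ f g).2 ((quotient_map_eq_iff _ _).1 hfg))⟩
  have hfull : Ψ.Full := ⟨fun {X Y} γ => by
    obtain ⟨γ, rfl⟩ := Q.map_surjective γ
    obtain ⟨f, rfl⟩ := (toRepetitiveModule θ).map_surjective γ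
    exact ⟨(Quotient.functor _).map f, rfl⟩⟩
  have hess : Ψ.EssSurj := ⟨fun Z => by
    exact ⟨(Quotient.functor _).obj ((toRepetitiveModule θ).objPreimage Z.as),
      ⟨Q.mapIso ((toRepetitiveModule θ).objObjPreimageIso Z.as)⟩⟩⟩
  have : Ψ.IsEquivalence := {}
  exact ⟨Ψ.asEquivalence⟩

end RepeComplex

end ExtVanishing

/-! ### Factoring `Hom(DR, -)` through the two Hom functors; splitting long exact sequences. -/

namespace ExtVanishing

open MulOpposite Limits

namespace IsDualPairing

variable {k S R V W : Type u} [CommRing k] [Ring S] [Ring R] [Algebra k S] [Algebra k R]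
  [AddCommGroup V] [Module k V] [Module S V] [Module Rᵐᵒᵖ V] [SMulCommClass S Rᵐᵒᵖ V]
  [IsScalarTower k S V] [IsScalarTower k Rᵐᵒᵖ V]
  [AddCommGroup W] [Module k W] [Module R W] [Module Sᵐᵒᵖ W] [SMulCommClass R Sᵐᵒᵖ W]
  [IsScalarTower k R W] [IsScalarTower k Sᵐᵒᵖ W]
  {B : V →ₗ[k] W →ₗ[k] dualizingModule k} (h : IsDualPairing S R B)
include h

/-- The map `Hom_R(DR, X) → Hom_S(W, Hom_R(V, X))`. -/
noncomputable def rightHomDualMap (X : ModuleCat.{u} Rᵐᵒᵖ) :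
    RightHom R (DualModule k R) X →ₗ[Rᵐᵒᵖ] RightHom S W (RightHom R V X) where
  toFun g := LinearMap.comp (R₂ := Sᵐᵒᵖ)
    ((rightHomFunctor S R V).map (ModuleCat.ofHom (X := DualModule k R) g)).hom
    h.flip.toRightHomDual
  map_add' _ _ := rfl
  map_smul' r g := LinearMap.ext fun w => LinearMap.ext fun v =>
    congrArg (show DualModule k R →ₗ[Rᵐᵒᵖ] X from g) (LinearMap.ext fun r' =>
      (congrArg (fun z => B z w) (mul_smul (op r.unop) (op r') v)).trans
        (h.smul_right r.unop (op r' • v) w))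

-- The invertible counit makes `Hom_R(V, -)` full and faithful on maps out of the regular dual,
-- whose image is `W` by the pairing.
omit [Algebra k S] [IsScalarTower k S V] [IsScalarTower k R W] [IsScalarTower k Sᵐᵒᵖ W] in
lemma bijective_rightHomDualMap
    (hc : IsIso ((balancedTensorAdjunction S R V).counit.app (regularDual k R)))
    (X : ModuleCat.{u} Rᵐᵒᵖ) : Function.Bijective (h.rightHomDualMap X) := by
  have hb := map_bijective_of_isIso_counit _ hc X
  have ht := h.flip.bijective_toRightHomDual
  refine ⟨fun f g hfg => ?_, fun f => ?_⟩
  · refine congrArg ModuleCat.Hom.hom (@hb.1 (ModuleCat.ofHom f) (ModuleCat.ofHom g)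
      (ModuleCat.hom_ext (LinearMap.ext fun φ => ?_)))
    obtain ⟨w, rfl⟩ := ht.2 φ
    exact LinearMap.congr_fun hfg w
  · let e := LinearEquiv.ofBijective _ ht
    obtain ⟨g, hg⟩ := hb.2 (ModuleCat.ofHom (X := RightHom R V (DualModule k R))
      (Y := RightHom R V X) ((show W →ₗ[Sᵐᵒᵖ] RightHom R V X from f) ∘ₗ e.symm.toLinearMap))
    refine ⟨g.hom, LinearMap.ext fun w => ?_⟩
    have h1 := LinearMap.congr_fun (congrArg ModuleCat.Hom.hom hg) (e w)
    exact h1.trans (congrArg (show W →ₗ[Sᵐᵒᵖ] RightHom R V X from f) (e.symm_apply_apply w))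

/-- The isomorphism `Hom_R(DR, X) ≅ Hom_S(W, Hom_R(V, X))`. -/
noncomputable def rightHomRegularDualIso
    (hc : IsIso ((balancedTensorAdjunction S R V).counit.app (regularDual k R))) :
    rightHomFunctor R R (DualModule k R) ≅ rightHomFunctor S R V ⋙ rightHomFunctor R S W :=
  NatIso.ofComponents (fun X => (LinearEquiv.ofBijective _
    (h.bijective_rightHomDualMap hc X)).toModuleIso) fun _ => rfl

end IsDualPairing

section Resolution

variable {Λ : Type u} [Ring Λ]

lemma finiteCoresolution_of_vanishing {T : ModuleCat.{u} Λ} (n : ℕ) (X : ModuleCat.{u} Λ)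
    (C : ℕ → ModuleCat.{u} Λ) (ε : X →ₗ[Λ] C 0) (d : ∀ i, C i →ₗ[Λ] C (i + 1))
    (hε : Function.Injective ε) (h0 : Function.Exact ε (d 0))
    (hd : ∀ i, Function.Exact (d i) (d (i + 1))) (hT : ∀ i, IsInAdd T (C i))
    (hn : ∀ i, n ≤ i → Subsingleton (C i)) : FiniteCoresolution (IsSummand T) X := by
  induction n generalizing X C with
  | zero =>
    have := hn 0 le_rfl
    exact .zero X (@ModuleCat.isZero_of_subsingleton _ _ X hε.subsingleton)
  | succ n ih =>
    let p := LinearMap.range ε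
    have hp : p ≤ LinearMap.ker (d 0) := (LinearMap.exact_iff.1 h0).ge
    have h1 : FiniteCoresolution (IsSummand T) (ModuleCat.of Λ (C 0 ⧸ p)) := by
      refine ih _ (fun i => C (i + 1)) (p.liftQ (d 0) hp) (fun i => d (i + 1)) ?_ ?_
        (fun i => hd (i + 1)) (fun i => hT (i + 1)) fun i hi => hn (i + 1) (by omega)
      · exact LinearMap.ker_eq_bot.1 (Submodule.ker_liftQ_eq_bot _ _ _
          (LinearMap.exact_iff.1 h0).le)
      · rw [LinearMap.exact_iff, Submodule.range_liftQ]
        exact LinearMap.exact_iff.1 (hd 0)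
    refine .step (ShortComplex.mk (X₁ := X) (X₂ := C 0) (X₃ := ModuleCat.of Λ (C 0 ⧸ p))
      (ModuleCat.ofHom ε) (ModuleCat.ofHom p.mkQ) (by
        ext x
        exact (Submodule.Quotient.mk_eq_zero p).2 ⟨x, rfl⟩)) ?_ (isSummand_iff.2 (hT 0)) h1
    exact ShortComplex.ShortExact.mk' ((ShortComplex.ShortExact.moduleCat_exact_iff_function_exact _).2
      (LinearMap.exact_map_mkQ_range ε))
      ((ModuleCat.mono_iff_injective _).2 hε)
      ((ModuleCat.epi_iff_surjective _).2 p.mkQ_surjective)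

lemma finiteResolution_of_vanishing {T : ModuleCat.{u} Λ} (n : ℕ) (X : ModuleCat.{u} Λ)
    (C : ℕ → ModuleCat.{u} Λ) (π : C 0 →ₗ[Λ] X) (d : ∀ i, C (i + 1) →ₗ[Λ] C i)
    (hπ : Function.Surjective π) (h0 : Function.Exact (d 0) π)
    (hd : ∀ i, Function.Exact (d (i + 1)) (d i)) (hT : ∀ i, IsInAdd T (C i))
    (hn : ∀ i, n ≤ i → Subsingleton (C i)) : FiniteResolution (IsSummand T) X := by
  induction n generalizing X C with
  | zero =>
    have := hn 0 le_rfl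
    exact .zero X (@ModuleCat.isZero_of_subsingleton _ _ X hπ.subsingleton)
  | succ n ih =>
    let p := LinearMap.ker π
    have h1 : FiniteResolution (IsSummand T) (ModuleCat.of Λ p) := by
      refine ih _ (fun i => C (i + 1)) ((d 0).codRestrict p fun x => (h0 _).2 ⟨x, rfl⟩)
        (fun i => d (i + 1)) ?_ ?_
        (fun i => hd (i + 1)) (fun i => hT (i + 1)) fun i hi => hn (i + 1) (by omega)
      · rintro ⟨x, hx⟩
        obtain ⟨y, rfl⟩ := (h0 x).1 hx
        exact ⟨y, rfl⟩
      · exact fun x => Subtype.ext_iff.trans (hd 0 x)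
    refine .step (ShortComplex.mk (X₁ := ModuleCat.of Λ p) (X₂ := C 0) (X₃ := X)
      (ModuleCat.ofHom p.subtype) (ModuleCat.ofHom π) (by
        ext x
        exact x.2)) ?_ (isSummand_iff.2 (hT 0)) h1
    exact ShortComplex.ShortExact.mk' ((ShortComplex.ShortExact.moduleCat_exact_iff_function_exact _).2
      (LinearMap.exact_subtype_ker_map π))
      ((ModuleCat.mono_iff_injective _).2 p.injective_subtype)
      ((ModuleCat.epi_iff_surjective _).2 hπ)

lemma HasFiniteAddCoresolution.finiteCoresolution {T X : ModuleCat.{u} Λ}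
    (h : HasFiniteAddCoresolution T X) : FiniteCoresolution (IsSummand T) X := by
  obtain ⟨n, C, ε, d, hε, h0, hd, hT, hn⟩ := h
  -- The bound counts terms, and the terms of index `0` to `n` may be nonzero.
  exact finiteCoresolution_of_vanishing (n + 1) X C ε d hε h0 hd hT hn

lemma HasFiniteAddResolution.finiteResolution {T X : ModuleCat.{u} Λ}
    (h : HasFiniteAddResolution T X) : FiniteResolution (IsSummand T) X := by
  obtain ⟨n, C, π, d, hπ, h0, hd, hT, hn⟩ := h
  exact finiteResolution_of_vanishing (n + 1) X C π d hπ h0 hd hT hn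

end Resolution

end ExtVanishing

/-! ### Ext of left modules through duality. -/

namespace ExtVanishing

open MulOpposite Limits Abelian

section DualMap

variable {k S : Type u} [CommRing k] [Ring S] [Algebra k S]
  {X Y Z : Type u} [AddCommGroup X] [Module k X] [Module S X] [IsScalarTower k S X]
  [AddCommGroup Y] [Module k Y] [Module S Y] [IsScalarTower k S Y]
  [AddCommGroup Z] [Module k Z] [Module S Z] [IsScalarTower k S Z]

variable (k) in
/-- The dual of a homomorphism of left modules. -/
noncomputable def dualMap (f : X →ₗ[S] Y) : DualModule k Y →ₗ[Sᵐᵒᵖ] DualModule k X where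
  toFun φ := LinearMap.comp (R₂ := k) (show Y →ₗ[k] dualizingModule k from φ) (f.restrictScalars k)
  map_add' _ _ := rfl
  map_smul' s φ := LinearMap.ext fun x =>
    congrArg (show Y →ₗ[k] dualizingModule k from φ) (f.map_smul s.unop x).symm

/-- Evaluation of a linear form. -/
noncomputable def dualEval (x : X) (φ : DualModule k X) : dualizingModule k :=
  (show X →ₗ[k] dualizingModule k from φ) x

lemma injective_dualMap {f : X →ₗ[S] Y} (hf : Function.Surjective f) :
    Function.Injective (dualMap k f) := fun φ ψ h => LinearMap.ext fun y => by
  obtain ⟨x, rfl⟩ := hf y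
  exact congrArg (dualEval x) h

lemma surjective_dualMap {f : X →ₗ[S] Y} (hf : Function.Injective f) :
    Function.Surjective (dualMap k f) := fun φ =>
  exists_extension_dualizingModule (k := k) (f.restrictScalars k) hf φ

lemma exact_dualMap {f : X →ₗ[S] Y} {g : Y →ₗ[S] Z} (h : Function.Exact f g)
    (hg : Function.Surjective g) : Function.Exact (dualMap k g) (dualMap k f) := fun φ => by
  refine ⟨fun hφ => ?_, ?_⟩
  · let p := LinearMap.ker (g.restrictScalars k)
    have hp : p ≤ LinearMap.ker (show Y →ₗ[k] dualizingModule k from φ) := fun y hy => by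
      obtain ⟨x, rfl⟩ := (h y).1 hy
      exact congrArg (dualEval x) hφ
    refine ⟨p.liftQ (show Y →ₗ[k] dualizingModule k from φ) hp ∘ₗ
      ((g.restrictScalars k).quotKerEquivOfSurjective hg).symm.toLinearMap,
      LinearMap.ext fun y => ?_⟩
    have h1 : ((g.restrictScalars k).quotKerEquivOfSurjective hg).symm (g y) = p.mkQ y :=
      (LinearEquiv.symm_apply_eq _).2 rfl
    exact congrArg (p.liftQ (show Y →ₗ[k] dualizingModule k from φ) hp) h1
  · rintro ⟨ψ, rfl⟩
    exact LinearMap.ext fun x => (congrArg (show Z →ₗ[k] dualizingModule k from ψ)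
      (h.apply_apply_eq_zero x)).trans (map_zero (show Z →ₗ[k] dualizingModule k from ψ))

variable [IsArtinianRing k]

lemma eq_of_eval_eq {x y : X} (h : ∀ φ : DualModule k X, dualEval x φ = dualEval y φ) : x = y := by
  by_contra hxy
  obtain ⟨φ, hφ⟩ := exists_apply_ne_zero (k := k) (sub_ne_zero.2 hxy)
  exact hφ ((map_sub φ x y).trans (sub_eq_zero.2 (h φ)))

lemma dualMap_injective {f g : X →ₗ[S] Y} (h : dualMap k f = dualMap k g) : f = g :=
  LinearMap.ext fun x => eq_of_eval_eq (k := k) fun φ =>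
    congrArg (dualEval x) (LinearMap.congr_fun h φ)

lemma exists_dualMap_eq [Module.Finite k Y] (g : DualModule k Y →ₗ[Sᵐᵒᵖ] DualModule k X) :
    ∃ f : X →ₗ[S] Y, dualMap k f = g := by
  have h (x : X) : ∃ y : Y, ∀ φ : DualModule k Y, dualEval y φ = dualEval x (g φ) := by
    obtain ⟨y, hy⟩ := (bijective_eval (k := k) (M := Y)).2
      (LinearMap.applyₗ x ∘ₗ (g.restrictScalars k : DualModule k Y →ₗ[k] (X →ₗ[k] dualizingModule k)))
    exact ⟨y, fun φ => LinearMap.congr_fun hy φ⟩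
  choose f hf using h
  refine ⟨⟨⟨f, fun x y => eq_of_eval_eq (k := k) fun φ => ?_⟩, fun s x =>
    eq_of_eval_eq (k := k) fun φ => ?_⟩, LinearMap.ext fun φ => LinearMap.ext fun x => hf x φ⟩
  · refine (hf _ φ).trans (((g φ).map_add x y).trans ?_)
    exact (congrArg₂ (· + ·) (hf x φ) (hf y φ)).symm.trans
      (map_add (show Y →ₗ[k] dualizingModule k from φ) (f x) (f y)).symm
  · exact (hf _ φ).trans ((congrArg (dualEval x) (g.map_smul (op s) φ)).symm.trans
      (hf x (op s • φ)).symm)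

end DualMap

section LeftExt

variable {k S : Type u} [CommRing k] [IsArtinianRing k] [Ring S] [Algebra k S] 

instance injective_dual_pi (n : ℕ) : Injective (ModuleCat.of Sᵐᵒᵖ (DualModule k (Fin n → S))) := by
  have h : Function.Bijective (LinearMap.pi fun j =>
      dualMap k (LinearMap.single S (fun _ : Fin n => S) j)) := by
    refine ⟨fun φ ψ h => LinearMap.pi_ext' fun j => congrFun h j, fun φ =>
      ⟨LinearMap.lsum k (fun _ => S) ℕ φ, funext fun j => LinearMap.ext fun s => ?_⟩⟩
    exact LinearMap.lsum_piSingle (R := k) (φ := fun _ : Fin n => S) (M := dualizingModule k) ℕ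
      (f := φ) j s
  have : Injective (ModuleCat.of Sᵐᵒᵖ (Fin n → regularDual k S)) :=
    (isSummand_pi (regularDual k S) n).injective
  exact Injective.of_iso (LinearEquiv.ofBijective _ h).toModuleIso.symm this

variable [Module.Finite k S]
variable {Y : Type u} [AddCommGroup Y] [Module k Y] [Module S Y] [IsScalarTower k S Y]
  [Module.Finite k Y]

/-- The dual of a free cover of `X` is an injective embedding of the dual of `X`, so syzygies on the
left match cosyzygies on the right and the degree drops on both sides at once. -/
lemma subsingleton_ext_of_dual (i : ℕ) (X : Type u) [AddCommGroup X] [Module k X]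
    [Module S X] [IsScalarTower k S X] [Module.Finite k X]
    (h : Subsingleton (Ext (ModuleCat.of Sᵐᵒᵖ (DualModule k Y))
      (ModuleCat.of Sᵐᵒᵖ (DualModule k X)) (i + 1))) :
    Subsingleton (Ext (ModuleCat.of S X) (ModuleCat.of S Y) (i + 1)) := by
  have : IsNoetherianRing S := IsNoetherianRing.of_finite k S
  have hX : Module.Finite S X := Module.Finite.of_restrictScalars_finite k S X
  obtain ⟨n, π, hπ⟩ := Module.Finite.exists_fin' S X
  let p := LinearMap.ker π
  have hp : Module.Finite k p := Module.Finite.trans S p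
  let E : ShortComplex (ModuleCat.{u} S) := ShortComplex.mk (X₁ := ModuleCat.of S p)
    (X₂ := ModuleCat.of S (Fin n → S)) (X₃ := ModuleCat.of S X)
    (ModuleCat.ofHom p.subtype) (ModuleCat.ofHom π) (by
      ext x
      exact x.2)
  have hE : E.ShortExact := ShortComplex.ShortExact.mk'
    ((ShortComplex.ShortExact.moduleCat_exact_iff_function_exact _).2
      (LinearMap.exact_subtype_ker_map π))
    ((ModuleCat.mono_iff_injective _).2 p.injective_subtype)
    ((ModuleCat.epi_iff_surjective _).2 hπ)
  let E' : ShortComplex (ModuleCat.{u} Sᵐᵒᵖ) :=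
    ShortComplex.mk (X₁ := ModuleCat.of Sᵐᵒᵖ (DualModule k X))
      (X₂ := ModuleCat.of Sᵐᵒᵖ (DualModule k (Fin n → S)))
      (X₃ := ModuleCat.of Sᵐᵒᵖ (DualModule k p))
      (ModuleCat.ofHom (dualMap k π)) (ModuleCat.ofHom (dualMap k p.subtype)) (by
        ext φ
        exact (exact_dualMap (LinearMap.exact_subtype_ker_map π) hπ).apply_apply_eq_zero φ)
  have hE' : E'.ShortExact := ShortComplex.ShortExact.mk'
    ((ShortComplex.ShortExact.moduleCat_exact_iff_function_exact _).2
      (exact_dualMap (LinearMap.exact_subtype_ker_map π) hπ))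
    ((ModuleCat.mono_iff_injective _).2 (injective_dualMap hπ))
    ((ModuleCat.epi_iff_surjective _).2 (surjective_dualMap p.injective_subtype))
  have hP (j : ℕ) : Subsingleton (Ext E.X₂ (ModuleCat.of S Y) (j + 1)) :=
    extOrth_of_projective _ _ _ j.succ_pos
  cases i with
  | zero =>
    refine subsingleton_ext_one_X₃ hE (hP 0) fun f => ?_
    -- In degree one, extending a map from the syzygy amounts to lifting its dual, and reflexivity
    -- brings the lift back to left modules.
    obtain ⟨g, hg⟩ := exists_lifting hE' h (ModuleCat.ofHom (dualMap k f.hom))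
    obtain ⟨f', hf'⟩ := exists_dualMap_eq g.hom
    refine ⟨ModuleCat.ofHom f', ModuleCat.hom_ext (dualMap_injective (k := k) ?_)⟩
    exact (congrArg (dualMap k p.subtype ∘ₗ ·) hf').trans (congrArg ModuleCat.Hom.hom hg)
  | succ i =>
    exact subsingleton_ext_X₃ hE (subsingleton_ext_of_dual i p (subsingleton_ext_Y₃ hE'
      (extOrth_of_injective _ _ _ i.succ_pos) h)) (hP (i + 1))

end LeftExt

end ExtVanishing

/-! ### Conclusion for the pairing of a module with its dual. -/

namespace ExtVanishing

open MulOpposite Limits Abelian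

namespace IsDualPairing

variable {k S R V W : Type u} [CommRing k] [IsArtinianRing k] [Ring S] [Ring R]
  [Algebra k S] [Algebra k R] [Module.Finite k S] [Module.Finite k R]
  [AddCommGroup V] [Module k V] [Module S V] [Module Rᵐᵒᵖ V] [SMulCommClass S Rᵐᵒᵖ V]
  [IsScalarTower k S V] [IsScalarTower k Rᵐᵒᵖ V] [Module.Finite k V]
  [AddCommGroup W] [Module k W] [Module R W] [Module Sᵐᵒᵖ W] [SMulCommClass R Sᵐᵒᵖ W]
  [IsScalarTower k R W] [IsScalarTower k Sᵐᵒᵖ W] [Module.Finite k W]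
  {B : V →ₗ[k] W →ₗ[k] dualizingModule k} (h : IsDualPairing S R B)

section

variable (ht : h.bimoduleContext.IsTilting)
include ht

lemma representsCounterEquivalence : RepresentsCounterEquivalence S R V W
    (leftPerpPD (ModuleCat.of Rᵐᵒᵖ V)) (rightPerp (ModuleCat.of Rᵐᵒᵖ V))
    (leftPerp (ModuleCat.of Sᵐᵒᵖ W)) (rightPerpID (ModuleCat.of Sᵐᵒᵖ W)) := by
  have : IsNoetherianRing Rᵐᵒᵖ := .of_finite k _
  have : IsNoetherianRing Sᵐᵒᵖ := .of_finite k _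
  exact ⟨inducesEquivalence (fun _ hX => ht.leftPerp_H hX) (fun _ hX => ht.rightPerp_G hX)
      (fun _ hX => ht.counit_rightPerp hX) fun _ hX => ht.unit_leftPerp hX,
    inducesEquivalence (fun _ hX => ht.leftPerpPD_J hX) (fun _ hX => ht.rightPerpID_F hX)
      (fun _ hX => ht.counit_rightPerpID hX) fun _ hX => ht.unit_leftPerpPD hX⟩

lemma repetitiveEquivalent : RepetitiveEquivalent k R S := by
  have : IsNoetherianRing Rᵐᵒᵖ := .of_finite k _
  have : IsNoetherianRing Sᵐᵒᵖ := .of_finite k _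
  obtain ⟨e⟩ := RepeComplex.nonempty_repetitiveCategory_equivalence
    (h.rightHomRegularDualIso ht.counit_IC)
  obtain ⟨e'⟩ := RepeComplex.nonempty_repetitiveCategory_equivalence
    (h.flip.rightHomRegularDualIso ht.counit_ID)
  obtain ⟨e''⟩ := ht.nonempty_stableCategory_equivalence
  exact ⟨e.trans (e''.trans e'.symm)⟩

lemma bijective_leftMul_of_isTilting : Function.Bijective (leftMul R S W) :=
  have : IsNoetherianRing Rᵐᵒᵖ := .of_finite k _
  isIso_unit_iff.1 ht.balanced

lemma flip_isTilting_self : ExtOrth.{u + 1, u} (ModuleCat.of Sᵐᵒᵖ W) (ModuleCat.of Sᵐᵒᵖ W) :=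
  have : IsNoetherianRing Rᵐᵒᵖ := .of_finite k _
  ht.self_W

end

end IsDualPairing

section Dual

variable {k S R V : Type u} [CommRing k] [IsArtinianRing k] [Ring S] [Ring R]
  [Algebra k S] [Algebra k R]
  [AddCommGroup V] [Module k V] [Module S V] [Module Rᵐᵒᵖ V] [SMulCommClass S Rᵐᵒᵖ V]
  [IsScalarTower k S V] [IsScalarTower k Rᵐᵒᵖ V] [Module.Finite k V]

variable (k V) in
/-- The pairing between a module and its dual. -/
noncomputable def dualPairing : V →ₗ[k] DualModule k V →ₗ[k] dualizingModule k :=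
  LinearMap.flip (LinearMap.id : (V →ₗ[k] dualizingModule k) →ₗ[k] _)

omit [SMulCommClass S Rᵐᵒᵖ V] in
variable (k S R V) in
lemma isDualPairing_dualPairing : IsDualPairing S R (dualPairing k V) where
  smul_left _ _ _ := rfl
  smul_right _ _ _ := rfl
  bijective := bijective_eval
  bijective_flip := Function.bijective_id

-- Duality identifies endomorphisms of the left module `V` with those of its dual and sends right
-- multiplications to left multiplications.
omit [Algebra k R] [IsScalarTower k Rᵐᵒᵖ V] [Module.Finite k V] in
lemma bijective_rightMulHom [SMulCommClass Rᵐᵒᵖ k V]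
    (h : Function.Bijective (leftMul R S (DualModule k V))) :
    Function.Bijective (rightMulHom S R V) := by
  have hd (r : Rᵐᵒᵖ) : dualMap k (rightMulHom S R V r) =
    (leftMul R S (DualModule k V) r.unop).hom := rfl
  refine ⟨fun r r' hr => unop_injective (h.1 (ModuleCat.hom_ext ?_)), fun f => ?_⟩
  · rw [← hd, ← hd, hr]
  · obtain ⟨r, hr⟩ := h.2 (ModuleCat.ofHom (dualMap k f))
    refine ⟨op r, dualMap_injective (k := k) ?_⟩
    rw [hd]
    exact congrArg ModuleCat.Hom.hom hr

end Dual

/-- Tilting and cotilting modules are good Wakamatsu-tilting modules and give repetitive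
equivalences. -/
theorem isGoodWakamatsuTilting_and_repetitiveEquivalent {k R T : Type u} [CommRing k] [IsArtinianRing k]
    [Ring R] [Algebra k R] [Module.Finite k R]
    [AddCommGroup T] [Module k T] [Module Rᵐᵒᵖ T] [IsScalarTower k Rᵐᵒᵖ T]
    (hT : IsTiltingModule R T ∨ IsCotiltingModule k R T) :
    IsGoodWakamatsuTilting k R T ∧
      RepetitiveEquivalent k R (Module.End Rᵐᵒᵖ T) := by
  have hfin : Module.Finite Rᵐᵒᵖ T := hT.elim (·.finite) (·.finite)
  have hTT : ExtOrth.{u + 1, u} (ModuleCat.of Rᵐᵒᵖ T) (ModuleCat.of Rᵐᵒᵖ T) :=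
    hT.elim (·.ext_eq_zero) (·.ext_eq_zero)
  have : Module.Finite k T := Module.Finite.trans Rᵐᵒᵖ T
  have : Module.Finite k (Module.End Rᵐᵒᵖ T) := by
    have : IsNoetherian k (Module.End Rᵐᵒᵖ T) := isNoetherian_of_injective
      (⟨⟨LinearMap.restrictScalars k, fun _ _ => rfl⟩, fun _ _ => rfl⟩ :
        (T →ₗ[Rᵐᵒᵖ] T) →ₗ[k] (T →ₗ[k] T)) (LinearMap.restrictScalars_injective k)
    infer_instance
  have h := isDualPairing_dualPairing k (Module.End Rᵐᵒᵖ T) R T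
  have : IsNoetherianRing Rᵐᵒᵖ := .of_finite k _
  have : IsNoetherianRing (Module.End Rᵐᵒᵖ T)ᵐᵒᵖ := .of_finite k _
  -- The ring is the endomorphism ring by definition, so left multiplication is tautologically
  -- bijective.
  have hS : IsIso (h.bimoduleContext.adjG.unit.app
      (ModuleCat.of (Module.End Rᵐᵒᵖ T)ᵐᵒᵖ (Module.End Rᵐᵒᵖ T)ᵐᵒᵖ)) :=
    IsDualPairing.isIso_unit_iff.2 ⟨fun f g hfg => congrArg ModuleCat.Hom.hom hfg,
      fun f => ⟨f.hom, rfl⟩⟩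
  have hW (hb : Function.Bijective (leftMul R (Module.End Rᵐᵒᵖ T) (DualModule k T)))
      (hO : ExtOrth.{u + 1, u} (ModuleCat.of (Module.End Rᵐᵒᵖ T)ᵐᵒᵖ (DualModule k T))
        (ModuleCat.of (Module.End Rᵐᵒᵖ T)ᵐᵒᵖ (DualModule k T))) : IsWakamatsuTilting R T :=
    { finite := hfin
      balanced := bijective_rightMulHom hb
      ext_right_eq_zero := hTT
      ext_left_eq_zero := fun i hi => by
        obtain ⟨i, rfl⟩ := Nat.exists_eq_succ_of_ne_zero hi.ne'
        exact subsingleton_ext_of_dual (k := k) i T (hO _ i.succ_pos) }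
  rcases hT with hT | hT
  · have ht : h.bimoduleContext.IsTilting :=
      { unit := hS
        self := hTT
        -- Dimension at most `n` means dimension less than `n + 1`.
        pd := hT.projectiveDimension.imp' (· + 1) fun _ hn => hn
        coresolution := (HasFiniteAddCoresolution.finiteCoresolution hT.coresolution).of_iso
          (LinearEquiv.toModuleIso (X₁ := Rᵐᵒᵖ) (X₂ := R)
            { (MulOpposite.opAddEquiv (α := R)).symm with map_smul' := fun _ _ => rfl }) }
    exact ⟨⟨hW (h.bijective_leftMul_of_isTilting ht) (h.flip_isTilting_self ht),
      _, _, _, _, ht.isTiltingClass.isCompleteHereditaryCotorsionPair,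
      ht.isCotiltingClass.isCompleteHereditaryCotorsionPair, h.representsCounterEquivalence ht⟩,
      h.repetitiveEquivalent ht⟩
  · have hc : h.bimoduleContext.IsCotilting :=
      { unit := hS
        self := hTT
        injd := hT.injectiveDimension.imp' (· + 1) fun _ hn => hn
        resolution := HasFiniteAddResolution.finiteResolution hT.resolution }
    have hs := hc.isTilting_swap
    -- The flipped pairing yields the same data as the interchanged context, so the dual of `T` is
    -- tilting over the endomorphism ring, and the tilting results apply with the two rings
    -- exchanged.
    have ht : h.flip.bimoduleContext.IsTilting := ⟨hs.unit, hs.self, hs.pd, hs.coresolution⟩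
    exact ⟨⟨hW (IsDualPairing.isIso_unit_iff.1 hs.unit) hs.self,
      _, _, _, _, ht.isCotiltingClass.isCompleteHereditaryCotorsionPair,
      ht.isTiltingClass.isCompleteHereditaryCotorsionPair,
      (h.flip.representsCounterEquivalence ht).symm⟩,
      (h.flip.repetitiveEquivalent ht).map CategoryTheory.Equivalence.symm⟩

end ExtVanishing

theorem mainTheorem6 {k R T : Type u} [CommRing k] [IsArtinianRing k]
    [Ring R] [Algebra k R] [Module.Finite k R]
    [AddCommGroup T] [Module k T] [Module Rᵐᵒᵖ T] [IsScalarTower k Rᵐᵒᵖ T]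
    (hT : IsTiltingModule R T ∨ IsCotiltingModule k R T) :
    IsGoodWakamatsuTilting k R T ∧
      RepetitiveEquivalent k R (Module.End Rᵐᵒᵖ T) :=
  ExtVanishing.isGoodWakamatsuTilting_and_repetitiveEquivalent hT
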